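/- Let $n\ge 2$, $\beta\in C_c^\infty((1/2,2))$, and for a function $h$ on $(0,\infty)$, $\nu\ge 0$, $R>0$ put $$T_R^\nu h(t,r)=\chi_{[R,2R)}(r)\,r^{-\frac{n-2}{2}}\int_0^\infty e^{-it\varpi(\rho)}J_\nu(r\rho)\beta(\rho)h(\rho)\,d\rho ,\qquad t\in\mathbb R,\ r>0,$$ where $J_\nu$ is the Bessel function of the first kind of order $\nu$. For $A\ge 1$ and $0<\lambda_0\le A$, call a real function $\varpi\in C^4((1/2,2))$ $(A,\lambda_0)$-admissible if for all $1/2<\rho<2$ $$A^{-1}\le|\varpi'(\rho)|\le A,\qquad \lambda_0\le|\varpi''(\rho)|\le A,\qquad |\varpi^{(3)}(\rho)|+|\varpi^{(4)}(\rho)|\le A .$$ Let $2\le p,q\le\infty$ satisfy $\frac2q\ge\frac12-\frac1p$, where $\frac1\infty=0$. (a) For every $A\ge1$ there is a constant $C>0$, depending only on $n,p,q,\beta,A$, such that for all $0<\lambda_0\le A$, all $(A,\lambda_0)$-admissible $\varpi$, all $\nu\ge0$, all $R\ge A^{-1}$ and all $h\in L^2((0,\infty),d\rho)$ $$\|T_R^\nu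 h\|_{L^q_t(\mathbb R;\,L^p(r^{n-1}dr))}\le C\,\lambda_0^{-\frac12(\frac12-\frac1p)}(1+\nu)^{\frac45(\frac12-\frac1p)}R^{\frac1q-\frac{2n-1}{2}(\frac12-\frac1p)}\|h\|_{L^2(d\rho)} .$$ (b) The power of $R$ is sharp: if $\beta\not\equiv0$, then for every $A\ge1$, $0<\lambda_0\le A$, $\nu\ge0$ and every $(A,\lambda_0)$-admissible $\varpi$ there are $c>0$ and $R_0>0$ such that for every $R\ge R_0$ there is a nonzero $h\in L^2((0,\infty),d\rho)$ with $$\|T_R^\nu h\|_{L^q_t(\mathbb R;\,L^p(r^{n-1}dr))}\ge c\,R^{\frac1q-\frac{2n-1}{2}(\frac12-\frac1p)}\|h\|_{L^2(d\rho)} .$$ -/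

import Mathlib

open Set MeasureTheory
open scoped ENNReal ContDiff

noncomputable section

/-- The Bessel function of the first kind `J_ν(x)`, for real order `ν ≥ 0` and `x > 0`:
`J_ν(x) = (x/2)^ν ∑_{k ≥ 0} (-1)^k / (k! Γ(ν + k + 1)) (x/2)^{2k}`. -/
def besselJ (ν x : ℝ) : ℝ :=
  (x / 2) ^ ν *
    ∑' k : ℕ, (-1 : ℝ) ^ k / ((k.factorial : ℝ) * Real.Gamma (ν + k + 1)) * (x / 2) ^ (2 * k)

/-- The conditions on the phase `ϖ ∈ C⁴(1/2, 2)`: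
`|ϖ'| ∼ 1`, `lam ≤ |ϖ''| ≲ 1` and `|ϖ⁽³⁾| + |ϖ⁽⁴⁾| ≲ 1` on `(1/2, 2)`,
with all implied constants equal to `A`. -/
structure IsAdmissiblePhase (A lam : ℝ) (ϖ : ℝ → ℝ) : Prop where
  contDiffOn : ContDiffOn ℝ 4 ϖ (Ioo (1 / 2) 2)
  deriv_lower : ∀ ρ ∈ Ioo (1 / 2 : ℝ) 2, A⁻¹ ≤ |deriv ϖ ρ|
  deriv_upper : ∀ ρ ∈ Ioo (1 / 2 : ℝ) 2, |deriv ϖ ρ| ≤ A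
  deriv_two_lower : ∀ ρ ∈ Ioo (1 / 2 : ℝ) 2, lam ≤ |iteratedDeriv 2 ϖ ρ|
  deriv_two_upper : ∀ ρ ∈ Ioo (1 / 2 : ℝ) 2, |iteratedDeriv 2 ϖ ρ| ≤ A
  deriv_three_four : ∀ ρ ∈ Ioo (1 / 2 : ℝ) 2,
    |iteratedDeriv 3 ϖ ρ| + |iteratedDeriv 4 ϖ ρ| ≤ A

/-- The measure `dρ` on the half line `(0, ∞)`. -/
def halfLine : Measure ℝ := volume.restrict (Ioi 0)

/-- The radial measure `r^{n-1} dr` on `(0, ∞)`. -/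
def radialMeasure (n : ℕ) : Measure ℝ :=
  halfLine.withDensity fun r => ENNReal.ofReal (r ^ ((n : ℝ) - 1))

/-- The mixed norm `‖F‖` in `L^q_t(ℝ; L^p(r^{n-1} dr))`, with values in `[0, ∞]`. -/
def mixedNorm (n : ℕ) (q p : ℝ≥0∞) (F : ℝ → ℝ → ℂ) : ℝ≥0∞ :=
  eLpNorm (fun t : ℝ => eLpNorm (F t) p (radialMeasure n)) q volume

/-- The localized operator
`T_R^ν h(t, r) = χ_{[R, 2R)}(r) r^{-(n-2)/2} ∫ e^{-itϖ(ρ)} J_ν(rρ) β(ρ) h(ρ) dρ`. -/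
def localizedOp (n : ℕ) (β : ℝ → ℂ) (ϖ : ℝ → ℝ) (ν R : ℝ) (h : ℝ → ℂ) (t r : ℝ) : ℂ :=
  (Ico R (2 * R)).indicator
    (fun r : ℝ => ((r ^ (-(((n : ℝ) - 2) / 2)) : ℝ) : ℂ) *
      ∫ ρ, Complex.exp (-(Complex.I * t * ϖ ρ)) * (besselJ ν (r * ρ) : ℂ) * β ρ * h ρ ∂halfLine) r

/-- The gap `1/2 - 1/p`, where `1/∞ = 0`. -/
def gap (p : ℝ≥0∞) : ℝ := 1 / 2 - p⁻¹.toReal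

/-- The exponent `1/q - ((2n-1)/2) (1/2 - 1/p)` of `R`, where `1/∞ = 0`. -/
def expR (n : ℕ) (p q : ℝ≥0∞) : ℝ := q⁻¹.toReal - (2 * (n : ℝ) - 1) / 2 * gap p

end

/-! Put g = 1/2 - 1/p and u_ν(x) = √x J_ν(x), so that u'' + (1 - (ν² - 1/4)/x²) u = 0. Pulling √(rρ)
out of the Bessel function writes the operator as r^{-(n-1)/2} times `bandOp`, whose radial L² norm
is then taken with respect to dr. At each time let X(t) be the L² norm in r and Y(t) a majorant of
the supremum over the shell. Then the L^p norm in r is at most X^{1-2g} Y^{2g}, and Hölder in t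
reduces everything to bounds for X in L² and L^∞ and for Y in L² and L⁴. The hypothesis 2/q ≥ g says
exactly that Y enters to a power at most 4 (`mixedNorm_le`).

For X, Weber's integral of e^{-st²} J_ν(at) J_ν(bt) t is bounded by a Gaussian in a - b, uniformly
in ν (`weber_integral_bound`). With Schur's test this gives the fixed-time L² bound (`hankel_bound`)
and shell averages of u_ν² and u_ν'². Plancherel in time, available because |ϖ'| ≥ 1/A, gives the
space-time bound with R in place of 1 (`bandOp_shell_sq_le`).

For Y the method is TT*. An energy argument turns the averages into pointwise bounds for x ≥ 4(1+ν),
where u = Re(e^{ix} z) with z bounded and z', z'' of size (1+ν)²/x². The kernel of TT* between radii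
s, s' and times differing by τ is an oscillatory integral with phase -τϖ(ρ) + (s - s')ρ. Van der
Corput bounds it by L (lam |τ|)^{-1/2}, and two integrations by parts give decay τ^{-2} once |τ| ≥
2AR (`ttKernel_bound`). Neither bound depends on the radii, so the radius may be any measurable
function of t, which amounts to a bound for the supremum. Schur's test gives the L²_t bound, with an
extra √R, and the Hardy–Littlewood–Sobolev inequality gives the L⁴_t bound. This needs R ≥ 8L². For
smaller R a Sobolev inequality in r and a pointwise bound suffice (`exists_maximal`). The loss in
the order enters only through L = (1+ν)^{4/5}.

For sharpness, a frequency packet of width ε/√R around ρ0 stays coherent for times of order R in the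
tube |r - t ϖ'(ρ0)| ≤ ε√R. The outgoing part of u_ν contributes about R^{-1/2} there and the other
part only O(1/R). Comparing norms gives the stated power (`exists_packet_lower`,
`sharp_power_identity`). -/

noncomputable section

/-! ### Bessel functions: power series, recurrences and the normal form of Bessel's equation. -/

/-- The coefficients of the entire function `besselG ν`. -/
def besselCoeff (ν : ℝ) (k : ℕ) : ℝ :=
  (-1 : ℝ) ^ k / ((k.factorial : ℝ) * Real.Gamma (ν + k + 1))

/-- The entire function `G_ν` with `J_ν(x) = (x/2)^ν G_ν((x/2)^2)`. -/
def besselG (ν y : ℝ) : ℝ := ∑' k : ℕ, besselCoeff ν k * y ^ k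

theorem besselJ_eq (ν x : ℝ) : besselJ ν x = (x / 2) ^ ν * besselG ν ((x / 2) ^ 2) := by
  simp only [besselJ, besselG, besselCoeff, pow_mul]

theorem gamma_arg_pos {ν : ℝ} (hν : 0 ≤ ν) (k : ℕ) : 0 < ν + k + 1 := by positivity

theorem factorial_mul_gamma_le {ν : ℝ} (hν : 0 ≤ ν) (k : ℕ) :
    (k.factorial : ℝ) * Real.Gamma (ν + 1) ≤ Real.Gamma (ν + k + 1) := by
  induction k with
  | zero => simp
  | succ k ih =>
    have h1 : Real.Gamma (ν + (k + 1 : ℕ) + 1) = (ν + k + 1) * Real.Gamma (ν + k + 1) := by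
      rw [← Real.Gamma_add_one (gamma_arg_pos hν k).ne']
      push_cast; ring_nf
    rw [h1, Nat.factorial_succ]
    push_cast
    have h2 : 0 < Real.Gamma (ν + 1) := Real.Gamma_pos_of_pos (by linarith)
    calc ((k : ℝ) + 1) * k.factorial * Real.Gamma (ν + 1)
        = (k + 1) * (k.factorial * Real.Gamma (ν + 1)) := by ring
      _ ≤ (ν + k + 1) * Real.Gamma (ν + k + 1) := by
        apply mul_le_mul (by linarith) ih (by positivity) (by positivity)

theorem abs_besselCoeff_le {ν : ℝ} (hν : 0 ≤ ν) (k : ℕ) :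
    |besselCoeff ν k| ≤ (Real.Gamma (ν + 1))⁻¹ / (k.factorial : ℝ) := by
  have h2 : 0 < Real.Gamma (ν + 1) := Real.Gamma_pos_of_pos (by linarith)
  have h3 := factorial_mul_gamma_le hν k
  have h5 : (1 : ℝ) ≤ k.factorial := by exact_mod_cast Nat.one_le_iff_ne_zero.mpr k.factorial_ne_zero
  have h4 : Real.Gamma (ν + 1) ≤ Real.Gamma (ν + k + 1) := by nlinarith
  have h6 : 0 < Real.Gamma (ν + k + 1) := by linarith
  rw [besselCoeff, abs_div, abs_pow, abs_neg, abs_one, one_pow, abs_of_pos (by positivity),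
    one_div, mul_inv, mul_comm, ← div_eq_mul_inv]
  gcongr

theorem summable_besselG_abs {ν : ℝ} (hν : 0 ≤ ν) (y : ℝ) :
    Summable fun k : ℕ => |besselCoeff ν k| * |y| ^ k := by
  refine Summable.of_nonneg_of_le (fun k => by positivity) (fun k => ?_)
    ((Real.summable_pow_div_factorial |y|).mul_left (Real.Gamma (ν + 1))⁻¹)
  calc |besselCoeff ν k| * |y| ^ k ≤ (Real.Gamma (ν + 1))⁻¹ / (k.factorial : ℝ) * |y| ^ k := by
        gcongr; exact abs_besselCoeff_le hν k
    _ = _ := by ring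

theorem summable_besselG {ν : ℝ} (hν : 0 ≤ ν) (y : ℝ) :
    Summable fun k : ℕ => besselCoeff ν k * y ^ k := by
  refine Summable.of_norm ?_
  simpa [abs_mul, abs_pow] using summable_besselG_abs hν y

/-- The coefficient form of G_ν' = -G_{ν+1}. -/
theorem besselCoeff_succ {ν : ℝ} (k : ℕ) :
    besselCoeff ν (k + 1) * (k + 1) = -besselCoeff (ν + 1) k := by
  unfold besselCoeff
  have h1 : ν + (k + 1 : ℕ) + 1 = ν + 1 + k + 1 := by push_cast; ring
  have h2 : ((k : ℝ) + 1) ≠ 0 := by positivity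
  rw [h1, Nat.factorial_succ, pow_succ]
  push_cast
  field_simp

theorem hasDerivAt_besselG {ν : ℝ} (hν : 0 ≤ ν) (y : ℝ) :
    HasDerivAt (besselG ν) (-besselG (ν + 1) y) y := by
  have hsum : Summable fun k : ℕ => |besselCoeff (ν + 1) k| * |(|y| + 1)| ^ k :=
    summable_besselG_abs (by linarith) _
  rw [abs_of_pos (by positivity : 0 < |y| + 1)] at hsum
  have key : HasDerivAt (fun z => ∑' n : ℕ, besselCoeff ν n * z ^ n)
      (∑' n : ℕ, besselCoeff ν n * (n * y ^ (n - 1))) y := by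
    refine hasDerivAt_tsum_of_isPreconnected (t := Metric.ball 0 (|y| + 1))
      (u := fun n : ℕ => |besselCoeff ν n| * (n * (|y| + 1) ^ (n - 1))) ?_ Metric.isOpen_ball
      (convex_ball _ _).isPreconnected (fun n z _ => (hasDerivAt_pow n z).const_mul _)
      (fun n z hz => ?_) (y₀ := (0 : ℝ)) (by simpa using by positivity) (summable_besselG hν 0) (by simp)
    · rw [← summable_nat_add_iff 1]
      refine hsum.congr fun k => ?_
      have := besselCoeff_succ (ν := ν) k
      rw [← abs_neg, ← this, abs_mul, abs_of_pos (by positivity : (0 : ℝ) < k + 1)]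
      rw [Nat.add_sub_cancel]; push_cast; ring
    · have hz' : |z| ≤ |y| + 1 := by simpa using (mem_ball_zero_iff.mp hz).le
      rw [Real.norm_eq_abs, abs_mul, abs_mul, abs_pow, Nat.abs_cast]
      gcongr
  have e : (∑' n : ℕ, besselCoeff ν n * (n * y ^ (n - 1))) = -besselG (ν + 1) y := by
    have hs : Summable fun n : ℕ => besselCoeff ν n * (n * y ^ (n - 1)) := by
      rw [← summable_nat_add_iff 1]
      refine (summable_besselG (ν := ν + 1) (by linarith) y).neg.congr fun k => ?_
      rw [← neg_mul, ← besselCoeff_succ]; rw [Nat.add_sub_cancel]; push_cast; ring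
    rw [hs.tsum_eq_zero_add, besselG, ← tsum_neg]
    simp only [Nat.cast_zero, zero_mul, mul_zero, zero_add]
    refine tsum_congr fun k => ?_
    rw [← neg_mul, ← besselCoeff_succ]; rw [Nat.add_sub_cancel]; push_cast; ring
  rw [e] at key
  exact key

/-- Coefficientwise this is Γ(z + 1) = z Γ(z). It encodes J_ν + J_{ν+2} = (2(ν+1)/x) J_{ν+1}, and
serves to differentiate J_{ν+1} in terms of J_ν. -/
theorem besselG_recurrence {ν : ℝ} (hν : 0 ≤ ν) (y : ℝ) :
    besselG ν y = (ν + 1) * besselG (ν + 1) y - y * besselG (ν + 2) y := by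
  have s1 := (summable_besselG (ν := ν + 1) (by linarith) y)
  have s2 := (summable_besselG (ν := ν + 2) (by linarith) y)
  -- Multiplication by y shifts the index by one. The shifted coefficient at k carries a factor k,
  -- so the missing term at k = 0 is automatically zero.
  have e2 : y * besselG (ν + 2) y = ∑' k : ℕ, (-(k : ℝ) * besselCoeff (ν + 1) k) * y ^ k ∧
      Summable fun k : ℕ => (-(k : ℝ) * besselCoeff (ν + 1) k) * y ^ k := by
    have hterm : ∀ k : ℕ, (-((k + 1 : ℕ) : ℝ) * besselCoeff (ν + 1) (k + 1)) * y ^ (k + 1)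
        = y * (besselCoeff (ν + 2) k * y ^ k) := by
      intro k
      have := besselCoeff_succ (ν := ν + 1) k
      rw [show ν + 1 + 1 = ν + 2 by ring] at this
      push_cast
      linear_combination -(y ^ (k + 1)) * this
    have hs : Summable fun k : ℕ => (-(k : ℝ) * besselCoeff (ν + 1) k) * y ^ k := by
      rw [← summable_nat_add_iff 1]
      exact (s2.mul_left y).congr fun k => (hterm k).symm
    refine ⟨?_, hs⟩
    rw [hs.tsum_eq_zero_add, besselG, ← tsum_mul_left]
    simp only [hterm]; simp
  rw [e2.1]
  unfold besselG
  rw [← tsum_mul_left, ← (s1.mul_left _).tsum_sub e2.2]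
  refine tsum_congr fun k => ?_
  unfold besselCoeff
  have h1 : Real.Gamma (ν + 1 + k + 1) = (ν + k + 1) * Real.Gamma (ν + k + 1) := by
    rw [← Real.Gamma_add_one (gamma_arg_pos hν k).ne']; ring_nf
  have h3 := (gamma_arg_pos hν k).ne'
  have h4 : Real.Gamma (ν + k + 1) ≠ 0 := (Real.Gamma_pos_of_pos (gamma_arg_pos hν k)).ne'
  rw [h1]
  field_simp
  ring

theorem hasDerivAt_half_rpow {ν x : ℝ} (hx : 0 < x) :
    HasDerivAt (fun x : ℝ => (x / 2) ^ ν) (ν / x * (x / 2) ^ ν) x := by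
  have := ((hasDerivAt_id x).div_const 2).rpow_const (p := ν) (Or.inl (by simp; positivity))
  refine this.congr_deriv ?_
  simp only [id]
  rw [Real.rpow_sub_one (by positivity)]
  field_simp

theorem hasDerivAt_besselG_sq {ν : ℝ} (hν : 0 ≤ ν) (x : ℝ) :
    HasDerivAt (fun x : ℝ => besselG ν ((x / 2) ^ 2)) (-besselG (ν + 1) ((x / 2) ^ 2) * (x / 2)) x := by
  have h : HasDerivAt (fun x : ℝ => (x / 2) ^ 2) (x / 2) x := by
    refine (((hasDerivAt_id' x).div_const 2).fun_pow 2).congr_deriv ?_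
    norm_num
    ring
  exact (hasDerivAt_besselG hν ((x / 2) ^ 2)).comp x h

theorem hasDerivAt_besselJ {ν x : ℝ} (hν : 0 ≤ ν) (hx : 0 < x) :
    HasDerivAt (besselJ ν) (ν / x * besselJ ν x - besselJ (ν + 1) x) x := by
  have h := (hasDerivAt_half_rpow (ν := ν) hx).mul (hasDerivAt_besselG_sq hν x)
  refine (h.congr_of_eventuallyEq (.of_forall fun y => besselJ_eq ν y)).congr_deriv ?_
  rw [besselJ_eq, besselJ_eq, Real.rpow_add_one (by positivity)]
  ring

theorem hasDerivAt_besselJ_succ {ν x : ℝ} (hν : 0 ≤ ν) (hx : 0 < x) :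
    HasDerivAt (besselJ (ν + 1)) (besselJ ν x - (ν + 1) / x * besselJ (ν + 1) x) x := by
  refine (hasDerivAt_besselJ (by linarith : 0 ≤ ν + 1) hx).congr_deriv ?_
  simp only [besselJ_eq]
  have h0 : x / 2 ≠ 0 := by positivity
  rw [besselG_recurrence hν, Real.rpow_add_one h0 (ν + 1), Real.rpow_add_one h0 ν,
    show ν + 1 + 1 = ν + 2 by ring]
  field_simp
  ring

/-- The normalised Bessel function `u_ν(x) = √x J_ν(x)`. -/
def besselU (ν x : ℝ) : ℝ := √x * besselJ ν x

/-- The derivative of `besselU`. -/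
def besselDU (ν x : ℝ) : ℝ := (ν + 1 / 2) / x * besselU ν x - besselU (ν + 1) x

theorem besselJ_eq_besselU {ν x : ℝ} (hx : 0 < x) : besselJ ν x = (√x)⁻¹ * besselU ν x := by
  have : √x ≠ 0 := (Real.sqrt_pos.mpr hx).ne'
  rw [besselU]; field_simp

theorem hasDerivAt_sqrt' {x : ℝ} (hx : 0 < x) : HasDerivAt Real.sqrt (1 / 2 / x * √x) x := by
  refine (Real.hasDerivAt_sqrt hx.ne').congr_deriv ?_
  have : √x ≠ 0 := (Real.sqrt_pos.mpr hx).ne'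
  have h2 := Real.mul_self_sqrt hx.le
  field_simp
  nlinarith

theorem hasDerivAt_besselU {ν x : ℝ} (hν : 0 ≤ ν) (hx : 0 < x) :
    HasDerivAt (besselU ν) (besselDU ν x) x := by
  refine ((hasDerivAt_sqrt' hx).mul (hasDerivAt_besselJ hν hx)).congr_deriv ?_
  simp only [besselDU, besselU]; ring

theorem hasDerivAt_besselU_succ {ν x : ℝ} (hν : 0 ≤ ν) (hx : 0 < x) :
    HasDerivAt (besselU (ν + 1)) (besselU ν x - (ν + 1 / 2) / x * besselU (ν + 1) x) x := by
  refine ((hasDerivAt_sqrt' hx).mul (hasDerivAt_besselJ_succ hν hx)).congr_deriv ?_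
  simp only [besselU]; ring

/-- Bessel's equation in Liouville normal form, without a first-order term. The energy estimate and
the slowly varying amplitude both come from it. -/
theorem hasDerivAt_besselDU {ν x : ℝ} (hν : 0 ≤ ν) (hx : 0 < x) :
    HasDerivAt (besselDU ν) (((ν ^ 2 - 1 / 4) / x ^ 2 - 1) * besselU ν x) x := by
  have h1 : HasDerivAt (fun x : ℝ => (ν + 1 / 2) / x) (-(ν + 1 / 2) / x ^ 2) x := by
    refine ((hasDerivAt_inv hx.ne').const_mul (ν + 1 / 2)).congr_deriv ?_
    field_simp
  refine ((h1.mul (hasDerivAt_besselU hν hx)).sub (hasDerivAt_besselU_succ hν hx)).congr_deriv ?_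
  simp only [besselDU]
  field_simp
  ring

/-- The average of the two formulas for u_ν', through u_{ν+1} and through u_{ν-1}. The factors ν/x
cancel, which is what keeps the averages of u_ν'² free of any loss in ν. -/
theorem besselDU_eq_of_one_le {ν x : ℝ} (hν : 1 ≤ ν) (hx : 0 < x) :
    besselDU ν x = (1 / 2) / x * besselU ν x + (1 / 2) * (besselU (ν - 1) x - besselU (ν + 1) x) := by
  have h := hasDerivAt_besselU_succ (ν := ν - 1) (by linarith) hx
  rw [sub_add_cancel] at h
  have := (hasDerivAt_besselU (by linarith) hx).unique h
  have h2 : besselDU ν x = (ν + 1 / 2) / x * besselU ν x - besselU (ν + 1) x := rfl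
  have h3 : (ν - 1 + 1 / 2) / x = (ν + 1 / 2) / x - 1 / x := by ring
  rw [h3] at this
  linear_combination (1 / 2) * this + (1 / 2) * h2

theorem continuousOn_besselU {ν : ℝ} (hν : 0 ≤ ν) : ContinuousOn (besselU ν) (Ioi 0) :=
  fun _ hx => (hasDerivAt_besselU hν hx).continuousAt.continuousWithinAt

theorem continuousOn_besselDU {ν : ℝ} (hν : 0 ≤ ν) : ContinuousOn (besselDU ν) (Ioi 0) :=
  fun _ hx => (hasDerivAt_besselDU hν hx).continuousAt.continuousWithinAt

theorem measurable_besselU {ν : ℝ} (hν : 0 ≤ ν) : Measurable (besselU ν) := by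
  have h : Continuous (besselG ν) :=
    continuous_iff_continuousAt.mpr fun y => (hasDerivAt_besselG hν y).continuousAt
  have : besselU ν = fun x => √x * ((x / 2) ^ ν * besselG ν ((x / 2) ^ 2)) := by
    ext x; rw [besselU, besselJ_eq]
  rw [this]
  have h2 : Measurable (besselG ν) := h.measurable
  fun_prop

theorem measurable_besselDU {ν : ℝ} (hν : 0 ≤ ν) : Measurable (besselDU ν) := by
  have h1 := measurable_besselU hν
  have h2 := measurable_besselU (ν := ν + 1) (by linarith)
  unfold besselDU
  fun_prop

/-- The Bessel function does not vanish near the origin. -/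
theorem exists_besselU_ne_zero {ν : ℝ} (hν : 0 ≤ ν) : ∃ x > 0, besselU ν x ≠ 0 := by
  have hc : ContinuousAt (fun x : ℝ => besselG ν ((x / 2) ^ 2)) 0 :=
    (hasDerivAt_besselG_sq hν 0).continuousAt
  have h0 : besselG ν ((0 / 2) ^ 2) ≠ 0 := by
    have : besselG ν ((0 / 2) ^ 2) = besselCoeff ν 0 := by
      rw [besselG, tsum_eq_single 0]
      · simp
      · intro k hk; simp [hk]
    rw [this, besselCoeff]
    have : Real.Gamma (ν + 1) ≠ 0 := (Real.Gamma_pos_of_pos (by linarith)).ne'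
    simpa
  have h1 := (hc.eventually_ne h0).filter_mono (nhdsWithin_le_nhds (s := Ioi (0 : ℝ)))
  obtain ⟨x, hx, hx0⟩ := (h1.and self_mem_nhdsWithin).exists
  have hx0' : 0 < x := hx0
  refine ⟨x, hx0', ?_⟩
  rw [besselU, besselJ_eq]
  have := Real.rpow_pos_of_pos (half_pos hx0') ν
  have := Real.sqrt_pos.mpr hx0'
  positivity

/-! ### A bound for the modified Bessel function, uniform in the order. -/

theorem centralBinom_sq_mul_le (m : ℕ) :
    (m.centralBinom : ℝ) ^ 2 * (2 * m + 1) ≤ (4 ^ m) ^ 2 := by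
  induction m with
  | zero => simp
  | succ m ih =>
    have h : ((m : ℝ) + 1) * (m + 1).centralBinom = 2 * (2 * m + 1) * m.centralBinom := by
      exact_mod_cast Nat.succ_mul_centralBinom_succ m
    have h2 : ((m + 1).centralBinom : ℝ) = 2 * (2 * m + 1) * m.centralBinom / (m + 1) := by
      rw [eq_div_iff (by positivity)]; linarith
    rw [h2, div_pow, div_mul_eq_mul_div, div_le_iff₀ (by positivity)]
    push_cast
    calc (2 * (2 * (m : ℝ) + 1) * m.centralBinom) ^ 2 * (2 * ((m : ℝ) + 1) + 1)
        = (m.centralBinom ^ 2 * (2 * m + 1)) * (4 * (2 * m + 1) * (2 * m + 3)) := by ring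
      _ ≤ (4 ^ m) ^ 2 * (16 * ((m : ℝ) + 1) ^ 2) := by
        have : 4 * (2 * (m : ℝ) + 1) * (2 * m + 3) ≤ 16 * ((m : ℝ) + 1) ^ 2 := by nlinarith
        exact mul_le_mul ih this (by positivity) (by positivity)
      _ = _ := by ring

/-- The square equals (2y)^{2m}/(2m)! times binom(2m, m)/4^m, and the last factor is at most
(2m+1)^{-1/2}. The arithmetic-geometric mean with parameter √(2y) linearizes this root, losing only
a constant where the exponential series concentrates, near 2m = 2y. -/
theorem sq_pow_div_factorial_le {y : ℝ} (hy : 0 < y) (m : ℕ) :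
    (y ^ m / m.factorial) ^ 2 ≤ (2 * y) ^ (2 * m) / (2 * m).factorial *
      ((√(2 * y) / ((2 * m : ℕ) + 1) + (√(2 * y))⁻¹) / 2) := by
  have h1 : ((2 * m).factorial : ℝ) = m.centralBinom * m.factorial ^ 2 := by
    have := Nat.choose_mul_factorial_mul_factorial (show m ≤ 2 * m by omega)
    rw [show 2 * m - m = m by omega] at this
    rw [← this, Nat.centralBinom_eq_two_mul_choose]
    push_cast; ring
  have hc : (0 : ℝ) < m.centralBinom := by exact_mod_cast Nat.centralBinom_pos m
  have hf : (0 : ℝ) < m.factorial := by exact_mod_cast m.factorial_pos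
  have hs : 0 < √(2 * y) := by positivity
  set s := √(2 * y)
  set w : ℝ := 2 * m + 1 with hw
  have hw0 : 0 < w := by positivity
  have key : (m.centralBinom : ℝ) / 4 ^ m ≤ (s / w + s⁻¹) / 2 := by
    have h2 := centralBinom_sq_mul_le m
    have h3 : ((m.centralBinom : ℝ) / 4 ^ m) ^ 2 ≤ 1 / w := by
      rw [div_pow, div_le_div_iff₀ (by positivity) hw0]; linarith
    refine abs_le_of_sq_le_sq' (h3.trans ?_) (by positivity) |>.2
    have : 1 / w = (s / w) * s⁻¹ := by field_simp
    rw [this]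
    nlinarith [sq_nonneg (s / w - s⁻¹)]
  have h4 : (y ^ m / m.factorial) ^ 2 =
      (2 * y) ^ (2 * m) / (2 * m).factorial * (m.centralBinom / 4 ^ m) := by
    rw [h1, mul_pow, show (2 : ℝ) ^ (2 * m) = 4 ^ m by rw [pow_mul]; norm_num]
    field_simp
    ring
  rw [h4]
  push_cast
  gcongr

theorem hasSum_exp (x : ℝ) : HasSum (fun n : ℕ => x ^ n / n.factorial) (Real.exp x) := by
  rw [Real.exp_eq_exp_ℝ]
  exact NormedSpace.exp_series_hasSum_exp' (𝕂 := ℝ) x |>.congr_fun (fun n => by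
    simp [div_eq_inv_mul]) 

/-- The weight 1/(n+1) turns x^n/n! into x^{-1} x^{n+1}/(n+1)!, so each half of the sum is at most
e^x/(2√x). The factor 1/√x gained here is the true decay of e^{-x} I_ν(x). -/
theorem summable_weighted_exp {x : ℝ} (hx : 0 < x) :
    Summable (fun n : ℕ => x ^ n / n.factorial * ((√x / (n + 1) + (√x)⁻¹) / 2)) ∧
    ∑' n : ℕ, x ^ n / n.factorial * ((√x / (n + 1) + (√x)⁻¹) / 2) ≤ Real.exp x / √x := by
  have hs : 0 < √x := Real.sqrt_pos.mpr hx
  have hss := Real.mul_self_sqrt hx.le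
  have h1 := hasSum_exp x
  have h2 : HasSum (fun n : ℕ => x ^ (n + 1) / (n + 1).factorial) (Real.exp x - 1) := by
    have := (hasSum_nat_add_iff' 1).mpr h1
    simpa using this
  have h3 := (h2.mul_left ((√x)⁻¹ / 2)).add (h1.mul_left ((√x)⁻¹ / 2))
  have e : (fun n : ℕ => x ^ n / n.factorial * ((√x / (n + 1) + (√x)⁻¹) / 2)) =
      fun n : ℕ => (√x)⁻¹ / 2 * (x ^ (n + 1) / (n + 1).factorial) +
        (√x)⁻¹ / 2 * (x ^ n / n.factorial) := by
    ext n
    rw [Nat.factorial_succ, pow_succ]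
    push_cast
    have hf : (n.factorial : ℝ) ≠ 0 := by exact_mod_cast n.factorial_ne_zero
    field_simp
    rw [Real.sq_sqrt hx.le]
  rw [e]
  refine ⟨h3.summable, h3.tsum_eq.le.trans ?_⟩
  have : 0 < (√x)⁻¹ := by positivity
  rw [div_eq_mul_inv (Real.exp x)]
  linarith

theorem summable_sq_pow_div_factorial {y : ℝ} (hy : 0 < y) :
    Summable (fun m : ℕ => (y ^ m / m.factorial) ^ 2) ∧
    ∑' m : ℕ, (y ^ m / m.factorial) ^ 2 ≤ Real.exp (2 * y) / √(2 * y) := by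
  obtain ⟨hs, hle⟩ := summable_weighted_exp (x := 2 * y) (by positivity)
  have hinj : Function.Injective fun m : ℕ => 2 * m := fun a b h => by simpa using h
  have hs2 := hs.comp_injective hinj
  have hsum : Summable (fun m : ℕ => (y ^ m / m.factorial) ^ 2) :=
    Summable.of_nonneg_of_le (fun m => by positivity) (sq_pow_div_factorial_le hy) hs2
  refine ⟨hsum, (hsum.tsum_le_tsum (sq_pow_div_factorial_le hy) hs2).trans (le_trans ?_ hle)⟩
  exact tsum_comp_le_tsum_of_inj hs (fun n => by positivity) hinj

/-- Log-convexity of Γ at N + 2 = θ(N+θ+1) + (1-θ)(N+θ+2), followed by the functional equation. -/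
theorem gamma_add_lower {θ : ℝ} (h0 : 0 ≤ θ) (h1 : θ ≤ 1) (N : ℕ) :
    ((N + 1).factorial : ℝ) ≤ Real.Gamma (N + θ + 1) * (N + 2 : ℝ) ^ (1 - θ) := by
  have hN : (0 : ℝ) < N + θ + 1 := by positivity
  have hG : 0 < Real.Gamma (N + θ + 1) := Real.Gamma_pos_of_pos hN
  have h2 := Real.Gamma_add_one hN.ne'
  have key : Real.Gamma (N + 2) ≤ Real.Gamma (N + θ + 1) ^ θ * Real.Gamma (N + θ + 1 + 1) ^ (1 - θ) := by
    rcases eq_or_lt_of_le h0 with h | h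
    · subst h; simp; rw [show (N : ℝ) + 1 + 1 = N + 2 by ring]
    rcases eq_or_lt_of_le h1 with h' | h'
    · subst h'; simp; rw [show (N : ℝ) + 1 + 1 = N + 2 by ring]
    have := Real.Gamma_mul_add_mul_le_rpow_Gamma_mul_rpow_Gamma hN
      (by positivity : (0 : ℝ) < N + θ + 1 + 1) h (by linarith : 0 < 1 - θ) (by ring)
    rwa [show θ * (N + θ + 1) + (1 - θ) * (N + θ + 1 + 1) = N + 2 by ring] at this
  have h3 : ((N + 1).factorial : ℝ) = Real.Gamma (N + 2) := by
    rw [← Real.Gamma_nat_eq_factorial]; push_cast; ring_nf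
  rw [h3]
  refine key.trans ?_
  rw [h2, Real.mul_rpow hN.le hG.le, mul_left_comm, ← Real.rpow_add hG]
  rw [show θ + (1 - θ) = 1 by ring, Real.rpow_one, mul_comm]
  gcongr ?_ * ?_
  exact Real.rpow_le_rpow hN.le (by linarith) (by linarith)

/-- A term of fractional index is dominated by its two integer neighbours, which reduces real orders
to integer ones. The mixed power y^θ (N+2)^{1-θ} is at most y + N + 2 by the weighted mean
inequality. -/
theorem rpow_div_gamma_le {θ y : ℝ} (h0 : 0 ≤ θ) (h1 : θ ≤ 1) (hy : 0 < y) (N : ℕ) :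
    y ^ (N + θ) / Real.Gamma (N + θ + 1) ≤
      y ^ (N + 1) / (N + 1).factorial + 2 * (y ^ N / N.factorial) := by
  have hG : 0 < Real.Gamma (N + θ + 1) := Real.Gamma_pos_of_pos (by positivity)
  have hf : (0 : ℝ) < N.factorial := by exact_mod_cast N.factorial_pos
  have hf1 : (0 : ℝ) < (N + 1).factorial := by exact_mod_cast (N + 1).factorial_pos
  have hlow := gamma_add_lower h0 h1 N
  have hamgm : y ^ θ * (N + 2 : ℝ) ^ (1 - θ) ≤ y + (N + 2) := by
    have := Real.geom_mean_le_arith_mean2_weighted h0 (by linarith : 0 ≤ 1 - θ) hy.le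
      (by positivity : (0 : ℝ) ≤ N + 2) (by ring)
    nlinarith [mul_nonneg h0 (by positivity : (0 : ℝ) ≤ N + 2), mul_nonneg (sub_nonneg.mpr h1) hy.le]
  rw [Real.rpow_add hy, Real.rpow_natCast, div_le_iff₀ hG]
  have e : y ^ (N + 1) / ((N + 1).factorial : ℝ) + 2 * (y ^ N / N.factorial) =
      y ^ N * (y + 2 * (N + 1)) / (N + 1).factorial := by
    rw [Nat.factorial_succ]; push_cast; field_simp; ring
  rw [e, div_mul_eq_mul_div, le_div_iff₀ hf1]
  have hyθ : 0 < y ^ θ := Real.rpow_pos_of_pos hy θ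
  calc y ^ N * y ^ θ * ((N + 1).factorial : ℝ)
      ≤ y ^ N * y ^ θ * (Real.Gamma (N + θ + 1) * (N + 2 : ℝ) ^ (1 - θ)) := by gcongr
    _ = y ^ N * Real.Gamma (N + θ + 1) * (y ^ θ * (N + 2 : ℝ) ^ (1 - θ)) := by ring
    _ ≤ y ^ N * Real.Gamma (N + θ + 1) * (y + 2 * (N + 1)) := by
      gcongr
      have : (0 : ℝ) ≤ N := N.cast_nonneg
      linarith
    _ = _ := by ring

theorem tsum_shift_le {b : ℕ → ℝ} (hb : Summable b) (h0 : ∀ n, 0 ≤ b n) (k : ℕ) :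
    ∑' m, b (m + k) ≤ ∑' m, b m :=
  tsum_comp_le_tsum_of_inj (i := fun m => m + k) hb h0 (add_left_injective k)

theorem besselI_term_eq {ν y : ℝ} (hν : 0 ≤ ν) (hy : 0 < y) (m : ℕ) :
    y ^ ν * (|besselCoeff ν m| * (y ^ 2) ^ m) =
      y ^ m / m.factorial * (y ^ (ν + m) / Real.Gamma (ν + m + 1)) := by
  have hG : 0 < Real.Gamma (ν + m + 1) := Real.Gamma_pos_of_pos (by positivity)
  have hf : (0 : ℝ) < m.factorial := by exact_mod_cast m.factorial_pos
  rw [besselCoeff, abs_div, abs_pow, abs_neg, abs_one, one_pow, abs_of_pos (mul_pos hf hG),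
    Real.rpow_add hy, Real.rpow_natCast]
  field_simp
  ring

theorem besselI_term_le {ν θ y : ℝ} {k : ℕ} (hθ : θ = ν - k) (h0 : 0 ≤ θ) (h1 : θ ≤ 1)
    (hν : 0 ≤ ν) (hy : 0 < y) (m : ℕ) :
    y ^ ν * (|besselCoeff ν m| * (y ^ 2) ^ m) ≤
      (1 / 2) * (y ^ m / m.factorial) ^ 2 + (y ^ (m + (k + 1)) / (m + (k + 1)).factorial) ^ 2 +
        4 * (y ^ (m + k) / (m + k).factorial) ^ 2 := by
  have hb := rpow_div_gamma_le h0 h1 hy (m + k)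
  have e1 : ((m + k : ℕ) : ℝ) + θ = ν + m := by push_cast; rw [hθ]; ring
  rw [e1] at hb
  rw [besselI_term_eq hν hy, ← add_assoc m k 1]
  have ham : 0 ≤ y ^ m / (m.factorial : ℝ) := by positivity
  refine (mul_le_mul_of_nonneg_left hb ham).trans ?_
  generalize y ^ (m + k + 1) / ((m + k + 1).factorial : ℝ) = p
  generalize y ^ (m + k) / ((m + k).factorial : ℝ) = q
  generalize y ^ m / (m.factorial : ℝ) = a
  nlinarith [sq_nonneg (a - (p + 2 * q)), sq_nonneg (p - 2 * q)]

/-- A bound for the modified Bessel function `I_ν(2y)` that is uniform in the order. -/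
theorem besselI_series_le {ν y : ℝ} (hν : 0 ≤ ν) (hy : 0 < y) :
    y ^ ν * ∑' m : ℕ, |besselCoeff ν m| * (y ^ 2) ^ m ≤ 6 * (Real.exp (2 * y) / √(2 * y)) := by
  obtain ⟨hs, hle⟩ := summable_sq_pow_div_factorial hy
  -- The integer part k of the order only shifts the index of the integer series, and dropping
  -- initial terms decreases a sum of squares. This makes the bound uniform in ν.
  obtain ⟨k, θ, hθ, h0, h1⟩ : ∃ (k : ℕ) (θ : ℝ), θ = ν - k ∧ 0 ≤ θ ∧ θ ≤ 1 :=
    ⟨⌊ν⌋₊, _, rfl, sub_nonneg.mpr (Nat.floor_le hν), by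
      have := (Nat.lt_floor_add_one ν).le; linarith⟩
  have hterm := besselI_term_le hθ h0 h1 hν hy
  obtain ⟨b, hb⟩ : ∃ b : ℕ → ℝ, ∀ m, b m = (y ^ m / m.factorial) ^ 2 := ⟨_, fun _ => rfl⟩
  have hb0 : ∀ m, 0 ≤ b m := fun m => by rw [hb]; positivity
  simp only [← hb] at hs hle hterm
  have hs1 : Summable fun m => b (m + (k + 1)) := (summable_nat_add_iff (k + 1)).mpr hs
  have hs2 : Summable fun m => b (m + k) := (summable_nat_add_iff k).mpr hs
  have le1 := tsum_shift_le hs hb0 (k + 1)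
  have le2 := tsum_shift_le hs hb0 k
  have hsL : Summable fun m : ℕ => y ^ ν * (|besselCoeff ν m| * (y ^ 2) ^ m) := by
    have := (summable_besselG_abs hν (y ^ 2)).mul_left (y ^ ν)
    rwa [abs_of_pos (by positivity)] at this
  rw [← tsum_mul_left]
  -- The three sums of squares carry the weights 1/2, 1 and 4, in total at most 6.
  refine (hsL.tsum_le_tsum hterm (((hs.mul_left (1 / 2)).add hs1).add (hs2.mul_left 4))).trans ?_
  rw [((hs.mul_left (1 / 2)).add hs1).tsum_add (hs2.mul_left 4), (hs.mul_left (1 / 2)).tsum_add hs1,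
    tsum_mul_left, tsum_mul_left]
  have : 0 ≤ ∑' m, b m := tsum_nonneg hb0
  linarith

/-- Absolute values in the series turn J_ν into I_ν. The bound ignores oscillation and serves only
to justify absolute convergence. -/
theorem abs_besselJ_le {ν x : ℝ} (hν : 0 ≤ ν) (hx : 0 < x) :
    |besselJ ν x| ≤ 6 * (Real.exp x / √x) := by
  have h := besselI_series_le hν (half_pos hx)
  rw [mul_div_cancel₀ x two_ne_zero] at h
  refine le_trans ?_ h
  rw [besselJ_eq, abs_mul, abs_of_pos (Real.rpow_pos_of_pos (half_pos hx) ν)]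
  gcongr
  have hs := summable_besselG_abs hν ((x / 2) ^ 2)
  have e : ∀ m : ℕ, |besselCoeff ν m| * |(x / 2) ^ 2| ^ m = ‖besselCoeff ν m * ((x / 2) ^ 2) ^ m‖ := by
    intro m; rw [Real.norm_eq_abs, abs_mul, abs_pow _ m]
  have h2 : ‖besselG ν ((x / 2) ^ 2)‖ ≤ ∑' m, ‖besselCoeff ν m * ((x / 2) ^ 2) ^ m‖ :=
    norm_tsum_le_tsum_norm (hs.congr e)
  refine h2.trans (le_of_eq (tsum_congr fun m => ?_))
  rw [← e, abs_of_pos (by positivity : 0 < (x / 2) ^ 2)]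

theorem abs_besselU_le_exp {ν x : ℝ} (hν : 0 ≤ ν) (hx : 0 < x) :
    |besselU ν x| ≤ 6 * Real.exp x := by
  have hs : 0 < √x := Real.sqrt_pos.mpr hx
  rw [besselU, abs_mul, abs_of_pos hs]
  calc √x * |besselJ ν x| ≤ √x * (6 * (Real.exp x / √x)) := by gcongr; exact abs_besselJ_le hν hx
    _ = _ := by field_simp

/-! ### Weber's second exponential integral. -/

/-- The Chu--Vandermonde identity, in terms of the Gamma function. -/
theorem gamma_vandermonde (l : ℕ) : ∀ (k : ℕ) {ν : ℝ}, 0 ≤ ν →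
    ∑ m ∈ Finset.range (l + 1), (k.choose m : ℝ) * l.choose m * m.factorial / Real.Gamma (ν + m + 1) =
      Real.Gamma (ν + k + l + 1) / (Real.Gamma (ν + k + 1) * Real.Gamma (ν + l + 1)) := by
  induction l with
  | zero =>
    intro k ν hν
    have h1 : Real.Gamma (ν + k + 1) ≠ 0 := (Real.Gamma_pos_of_pos (by positivity)).ne'
    simp
    field_simp
  | succ l ih =>
    intro k ν hν
    -- Pascal's rule in l+1, together with (m+1) binom(k, m+1) = k binom(k-1, m), expresses the sum
    -- for l+1 through those for l at (k, ν) and at (k-1, ν+1).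
    have step : ∑ m ∈ Finset.range (l + 1 + 1),
          (k.choose m : ℝ) * (l + 1).choose m * m.factorial / Real.Gamma (ν + m + 1) =
        ∑ m ∈ Finset.range (l + 1), (k.choose m : ℝ) * l.choose m * m.factorial / Real.Gamma (ν + m + 1)
        + k * ∑ m ∈ Finset.range (l + 1), ((k - 1).choose m : ℝ) * l.choose m * m.factorial /
            Real.Gamma (ν + 1 + m + 1) := by
      rw [Finset.sum_range_succ']
      have e1 : ∑ m ∈ Finset.range (l + 1), (k.choose m : ℝ) * l.choose m * m.factorial /
            Real.Gamma (ν + m + 1) =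
          ∑ m ∈ Finset.range (l + 1), (k.choose (m + 1) : ℝ) * l.choose (m + 1) * (m + 1).factorial /
            Real.Gamma (ν + (m + 1 : ℕ) + 1) + 1 / Real.Gamma (ν + 1) := by
        have := Finset.sum_range_succ' (fun m : ℕ => (k.choose m : ℝ) * l.choose m * m.factorial /
            Real.Gamma (ν + m + 1)) (l + 1)
        rw [Finset.sum_range_succ, Nat.choose_succ_self] at this
        simpa using this
      rw [e1, Finset.mul_sum, add_right_comm (Finset.sum _ _) (1 / _), ← Finset.sum_add_distrib]
      congr 1
      · refine Finset.sum_congr rfl fun m _ => ?_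
        have h2 : (k.choose (m + 1) : ℝ) * (m + 1) = k * (k - 1).choose m := by
          rcases k with _ | k
          · simp
          · have := Nat.add_one_mul_choose_eq k m
            rw [Nat.add_sub_cancel]
            exact_mod_cast this.symm
        have h3 : ν + ((m + 1 : ℕ) : ℝ) + 1 = ν + 1 + m + 1 := by push_cast; ring
        rw [h3, Nat.choose_succ_succ, Nat.factorial_succ]
        push_cast
        rw [← mul_div_assoc, ← add_div]
        congr 1
        linear_combination (l.choose m : ℝ) * m.factorial * h2
      · simp
    have hk0 : (0 : ℝ) ≤ k := k.cast_nonneg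
    have g1 : Real.Gamma (ν + (l + 1 : ℕ) + 1) = (ν + l + 1) * Real.Gamma (ν + l + 1) := by
      rw [← Real.Gamma_add_one (by positivity)]; push_cast; ring_nf
    have g2 : Real.Gamma (ν + k + (l + 1 : ℕ) + 1) = (ν + k + l + 1) * Real.Gamma (ν + k + l + 1) := by
      rw [← Real.Gamma_add_one (by positivity)]; push_cast; ring_nf
    have p1 : Real.Gamma (ν + k + 1) ≠ 0 := (Real.Gamma_pos_of_pos (by positivity)).ne'
    have p2 : Real.Gamma (ν + l + 1) ≠ 0 := (Real.Gamma_pos_of_pos (by positivity)).ne'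
    have p3 : ν + l + 1 ≠ 0 := by positivity
    rw [step, ih k hν, g1, g2]
    -- For k = 0 the natural subtraction k - 1 is harmless, since the second sum is multiplied by k.
    rcases k with _ | k
    · simp only [Nat.cast_zero, zero_mul, add_zero] at p1 ⊢
      field_simp
    · rw [Nat.add_sub_cancel, ih k (by linarith : 0 ≤ ν + 1)]
      have e1 : ν + 1 + k + l + 1 = ν + ((k + 1 : ℕ) : ℝ) + l + 1 := by push_cast; ring
      have e2 : ν + 1 + k + 1 = ν + ((k + 1 : ℕ) : ℝ) + 1 := by push_cast; ring
      have e3 : ν + 1 + l + 1 = ν + (l + 1 : ℕ) + 1 := by push_cast; ring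
      rw [e1, e2, e3, g1]
      field_simp
      ring

/-- After division by k! l!, the summand of the Vandermonde sum is a product of one Bessel
coefficient and two exponential coefficients. It thus becomes a term of the triple series. -/
theorem vandermonde_term {ν : ℝ} (m k l : ℕ) (hk : m ≤ k) (hl : m ≤ l) :
    (k.choose m : ℝ) * l.choose m * m.factorial / Real.Gamma (ν + m + 1) / (k.factorial * l.factorial) =
      1 / (m.factorial * Real.Gamma (ν + m + 1)) * (1 / (k - m).factorial * (1 / (l - m).factorial)) := by
  have h1 : (k.choose m : ℝ) * m.factorial * (k - m).factorial = k.factorial := by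
    exact_mod_cast Nat.choose_mul_factorial_mul_factorial hk
  have h2 : (l.choose m : ℝ) * m.factorial * (l - m).factorial = l.factorial := by
    exact_mod_cast Nat.choose_mul_factorial_mul_factorial hl
  have f : ∀ n : ℕ, (n.factorial : ℝ) ≠ 0 := fun n => by exact_mod_cast n.factorial_ne_zero
  have c1 := f m; have c2 := f (k - m); have c3 := f (l - m)
  have c4 : (k.choose m : ℝ) ≠ 0 := by exact_mod_cast (Nat.choose_pos hk).ne'
  have c5 : (l.choose m : ℝ) ≠ 0 := by exact_mod_cast (Nat.choose_pos hl).ne'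
  rw [← h1, ← h2]
  rcases eq_or_ne (Real.Gamma (ν + m + 1)) 0 with h | h
  · simp [h]
  · field_simp

theorem hasSum_mul_of_summable_norm {ι κ : Type*} {f : ι → ℝ} {g : κ → ℝ} {a b : ℝ} (hf : HasSum f a)
    (hg : HasSum g b) (nf : Summable fun n => ‖f n‖) (ng : Summable fun n => ‖g n‖) :
    HasSum (fun p : ι × κ => f p.1 * g p.2) (a * b) :=
  hf.mul hg (summable_mul_of_summable_norm nf ng)

/-- The terms of the triple series behind Weber's integral. -/
def doubleSeriesTerm (ν X Y : ℝ) (p : ℕ × ℕ × ℕ) : ℝ :=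
  if p.1 ≤ p.2.1 ∧ p.1 ≤ p.2.2 then
    |besselCoeff ν p.1| * (X * Y) ^ p.1 * (X ^ (p.2.1 - p.1) / (p.2.1 - p.1).factorial *
      (Y ^ (p.2.2 - p.1) / (p.2.2 - p.1).factorial)) else 0

/-- The shift `(m, i, j) ↦ (m, i + m, j + m)`. -/
def doubleSeriesEmb (p : ℕ × ℕ × ℕ) : ℕ × ℕ × ℕ := (p.1, p.2.1 + p.1, p.2.2 + p.1)

/-- The right side is a product of three absolutely convergent series. The shift (m, i, j) to (m,
i+m, j+m) collects the powers X^k Y^l, and for fixed k, l the sum over m is finite and is evaluated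
by Chu–Vandermonde. -/
theorem hasSum_double_series {ν : ℝ} (hν : 0 ≤ ν) (X Y : ℝ) :
    HasSum (fun q : ℕ × ℕ => X ^ q.1 * Y ^ q.2 / (q.1.factorial * q.2.factorial) *
        (Real.Gamma (ν + q.1 + q.2 + 1) / (Real.Gamma (ν + q.1 + 1) * Real.Gamma (ν + q.2 + 1))))
      ((∑' m : ℕ, |besselCoeff ν m| * (X * Y) ^ m) * (Real.exp X * Real.exp Y)) := by
  have hG : ∀ m : ℕ, 0 < Real.Gamma (ν + m + 1) := fun m => Real.Gamma_pos_of_pos (by positivity)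
  have hc : ∀ m, |besselCoeff ν m| = 1 / (m.factorial * Real.Gamma (ν + m + 1)) := fun m => by
    have hf : (0 : ℝ) < m.factorial := by exact_mod_cast m.factorial_pos
    rw [besselCoeff, abs_div, abs_pow, abs_neg, abs_one, one_pow, abs_of_pos (mul_pos hf (hG m))]
  have nE : ∀ X : ℝ, Summable fun n : ℕ => ‖X ^ n / n.factorial‖ := fun X =>
    (Real.summable_pow_div_factorial X).norm
  have nM : Summable fun m : ℕ => ‖|besselCoeff ν m| * (X * Y) ^ m‖ :=
    (summable_besselG_abs hν (X * Y)).congr fun m => by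
      rw [norm_mul, Real.norm_eq_abs, abs_abs, norm_pow, Real.norm_eq_abs]
  have sXY := hasSum_mul_of_summable_norm (f := fun n : ℕ => X ^ n / n.factorial)
    (g := fun n : ℕ => Y ^ n / n.factorial) (hasSum_exp X) (hasSum_exp Y) (nE X) (nE Y)
  have nXY : Summable fun p : ℕ × ℕ => ‖X ^ p.1 / p.1.factorial * (Y ^ p.2 / p.2.factorial)‖ :=
    sXY.summable.norm
  have s3 := hasSum_mul_of_summable_norm (f := fun m : ℕ => |besselCoeff ν m| * (X * Y) ^ m)
    (g := fun p : ℕ × ℕ => X ^ p.1 / p.1.factorial * (Y ^ p.2 / p.2.factorial))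
    nM.of_norm.hasSum sXY nM nXY
  have hi : Function.Injective doubleSeriesEmb := by
    rintro ⟨a, b, c⟩ ⟨a', b', c'⟩ h
    simp only [doubleSeriesEmb, Prod.mk.injEq] at h ⊢
    omega
  have hF : HasSum (doubleSeriesTerm ν X Y) ((∑' m : ℕ, |besselCoeff ν m| * (X * Y) ^ m) * (Real.exp X * Real.exp Y)) := by
    rw [← hi.hasSum_iff]
    · refine s3.congr_fun fun p => ?_
      obtain ⟨m, k, l⟩ := p
      simp [doubleSeriesTerm, doubleSeriesEmb]
    · rintro ⟨m, k, l⟩ hx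
      simp only [doubleSeriesTerm]
      rw [if_neg]
      rintro ⟨h1, h2⟩
      refine hx ⟨(m, k - m, l - m), ?_⟩
      simp only [doubleSeriesEmb, Prod.mk.injEq, true_and] at h1 h2 ⊢
      omega
  -- The factors are exchanged so that m becomes the inner summation variable.
  have hF' := (Equiv.prodComm (ℕ × ℕ) ℕ).hasSum_iff.mpr hF
  refine hF'.prod_fiberwise fun q => ?_
  obtain ⟨k, l⟩ := q
  have hval : X ^ k * Y ^ l / (k.factorial * l.factorial) *
        (Real.Gamma (ν + k + l + 1) / (Real.Gamma (ν + k + 1) * Real.Gamma (ν + l + 1))) =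
      ∑ m ∈ Finset.range (l + 1), doubleSeriesTerm ν X Y (m, k, l) := by
    rw [← gamma_vandermonde l k hν, Finset.mul_sum]
    refine Finset.sum_congr rfl fun m hm => ?_
    have hml : m ≤ l := by simpa [Nat.lt_succ_iff] using hm
    by_cases hmk : m ≤ k
    · simp only [doubleSeriesTerm, hmk, hml, and_self, if_true, hc]
      have e := vandermonde_term (ν := ν) m k l hmk hml
      have eX : X ^ k = X ^ m * X ^ (k - m) := by rw [← pow_add]; congr 1; omega
      have eY : Y ^ l = Y ^ m * Y ^ (l - m) := by rw [← pow_add]; congr 1; omega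
      calc _ = X ^ k * Y ^ l * ((k.choose m : ℝ) * l.choose m * m.factorial / Real.Gamma (ν + m + 1) /
            (k.factorial * l.factorial)) := by ring
        _ = _ := by rw [e, eX, eY, mul_pow]; ring
    · simp [doubleSeriesTerm, hmk, Nat.choose_eq_zero_of_lt (not_le.mp hmk)]
  simp only
  rw [hval]
  refine hasSum_sum_of_ne_finset_zero fun m hm => ?_
  have : ¬ m ≤ l := by simpa [Nat.lt_succ_iff] using hm
  simp [doubleSeriesTerm, this]

theorem integral_gaussian_rpow {ν s : ℝ} (hν : 0 ≤ ν) (hs : 0 < s) (j : ℕ) :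
    IntegrableOn (fun t : ℝ => t ^ (2 * ν + 2 * j + 1) * Real.exp (-s * t ^ 2)) (Ioi 0) ∧
    ∫ t in Ioi (0 : ℝ), t ^ (2 * ν + 2 * j + 1) * Real.exp (-s * t ^ 2) =
      Real.Gamma (ν + j + 1) / (2 * s ^ (ν + j + 1)) := by
  constructor
  · exact integrableOn_rpow_mul_exp_neg_mul_sq hs (by have : (0 : ℝ) ≤ j := j.cast_nonneg; linarith)
  · have h := integral_rpow_mul_exp_neg_mul_rpow (p := 2) (q := 2 * ν + 2 * j + 1) two_pos
      (by have : (0 : ℝ) ≤ j := j.cast_nonneg; linarith) hs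
    simp only [Real.rpow_two] at h
    rw [h, show (2 * ν + 2 * j + 1 + 1) / 2 = ν + j + 1 by ring,
      show -(2 * ν + 2 * j + 1 + 1) / 2 = -(ν + j + 1) by ring, Real.rpow_neg hs.le]
    field_simp

theorem integrableOn_gaussian_besselJ {ν a b s : ℝ} (hν : 0 ≤ ν) (ha : 0 < a) (hb : 0 < b)
    (hs : 0 < s) :
    IntegrableOn (fun t : ℝ => Real.exp (-s * t ^ 2) * (besselJ ν (a * t) * besselJ ν (b * t)) * t)
      (Ioi 0) := by
  have hu := measurable_besselU hν
  have hmeas : Measurable fun t : ℝ => Real.exp (-s * t ^ 2) *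
      ((√(a * t))⁻¹ * besselU ν (a * t) * ((√(b * t))⁻¹ * besselU ν (b * t))) * t := by
    fun_prop
  have hdom : Integrable (fun t : ℝ => 36 / √(a * b) * Real.exp ((a + b) ^ 2 / (2 * s)) *
      Real.exp (-(s / 2) * t ^ 2)) (volume.restrict (Ioi 0)) :=
    ((integrable_exp_neg_mul_sq (half_pos hs)).const_mul _).restrict
  refine hdom.mono' (hmeas.aestronglyMeasurable.congr ?_) ?_
  · refine (ae_restrict_iff' measurableSet_Ioi).mpr (.of_forall fun t ht => ?_)
    have ht' : 0 < t := ht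
    simp only
    rw [besselJ_eq_besselU (by positivity : 0 < a * t), besselJ_eq_besselU (by positivity : 0 < b * t)]
  · refine (ae_restrict_iff' measurableSet_Ioi).mpr (.of_forall fun t ht => ?_)
    have ht' : 0 < t := ht
    have h1 := abs_besselJ_le hν (by positivity : 0 < a * t)
    have h2 := abs_besselJ_le hν (by positivity : 0 < b * t)
    rw [Real.norm_eq_abs, abs_mul, abs_mul, abs_mul, abs_of_pos ht', abs_of_pos (Real.exp_pos _)]
    have hsq : √(a * t) * √(b * t) = √(a * b) * t := by
      rw [← Real.sqrt_mul (by positivity), show a * t * (b * t) = (a * b) * t ^ 2 by ring,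
        Real.sqrt_mul (by positivity), Real.sqrt_sq ht'.le]
    have hab : 0 < √(a * b) := by positivity
    calc Real.exp (-s * t ^ 2) * (|besselJ ν (a * t)| * |besselJ ν (b * t)|) * t
        ≤ Real.exp (-s * t ^ 2) * (6 * (Real.exp (a * t) / √(a * t)) *
            (6 * (Real.exp (b * t) / √(b * t)))) * t := by gcongr
      _ = Real.exp (-s * t ^ 2) * (36 * (Real.exp (a * t) * Real.exp (b * t)) /
            (√(a * t) * √(b * t))) * t := by field_simp; norm_num
      _ = 36 / √(a * b) * (Real.exp (-s * t ^ 2) * (Real.exp (a * t) * Real.exp (b * t))) := by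
        rw [hsq]; field_simp
      _ ≤ _ := by
        rw [mul_assoc (36 / √(a * b)), ← Real.exp_add, ← Real.exp_add, ← Real.exp_add]
        refine mul_le_mul_of_nonneg_left (Real.exp_le_exp.mpr ?_) (by positivity)
        have h3 : (a + b) ^ 2 / (2 * s) - (a + b) * t + s / 2 * t ^ 2 =
            (a + b - s * t) ^ 2 / (2 * s) := by field_simp; ring
        have h4 : 0 ≤ (a + b - s * t) ^ 2 / (2 * s) := by positivity
        nlinarith

/-- Weber's second exponential integral, as a bound. -/
theorem weber_integral_bound {ν a b s : ℝ} (hν : 0 ≤ ν) (ha : 0 < a) (hb : 0 < b) (hs : 0 < s) :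
    |∫ t in Ioi (0 : ℝ), Real.exp (-s * t ^ 2) * (besselJ ν (a * t) * besselJ ν (b * t)) * t| ≤
      3 / s * (√(a * b / (2 * s)))⁻¹ * Real.exp (-(a - b) ^ 2 / (4 * s)) := by
  obtain ⟨x, hx⟩ : ∃ x, x = a ^ 2 / (4 * s) := ⟨_, rfl⟩
  obtain ⟨y, hy⟩ : ∃ y, y = b ^ 2 / (4 * s) := ⟨_, rfl⟩
  have hx0 : 0 < x := by rw [hx]; positivity
  have hy0 : 0 < y := by rw [hy]; positivity
  have hG : ∀ z : ℝ, 0 < z → 0 < Real.Gamma z := fun z hz => Real.Gamma_pos_of_pos hz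
  obtain ⟨K, hK⟩ : ∃ K, K = (a / 2) ^ ν * (b / 2) ^ ν / (2 * s ^ (ν + 1)) := ⟨_, rfl⟩
  have hK0 : 0 < K := by rw [hK]; positivity
  let F : ℕ × ℕ → ℝ → ℝ := fun q t => (besselCoeff ν q.1 * besselCoeff ν q.2 *
    ((a / 2) ^ ν * (b / 2) ^ ν * (a / 2) ^ (2 * q.1) * (b / 2) ^ (2 * q.2))) *
      (t ^ (2 * ν + 2 * (q.1 + q.2 : ℕ) + 1) * Real.exp (-s * t ^ 2))
  have hFint : ∀ q, Integrable (F q) (volume.restrict (Ioi 0)) := fun q =>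
    (integral_gaussian_rpow hν hs (q.1 + q.2)).1.const_mul _
  have hspow : ∀ j : ℕ, s ^ (ν + j + 1) = s ^ (ν + 1) * s ^ j := fun j => by
    rw [show ν + j + 1 = ν + 1 + j by ring, Real.rpow_add hs, Real.rpow_natCast]
  have hval : ∀ q, ∫ t in Ioi (0 : ℝ), F q t = K * ((-x) ^ q.1 * (-y) ^ q.2 /
      (q.1.factorial * q.2.factorial) * (Real.Gamma (ν + q.1 + q.2 + 1) /
        (Real.Gamma (ν + q.1 + 1) * Real.Gamma (ν + q.2 + 1)))) := by
    rintro ⟨k, l⟩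
    simp only [F]
    rw [integral_const_mul, (integral_gaussian_rpow hν hs (k + l)).2, hspow, besselCoeff, besselCoeff,
      hK, hx, hy]
    have := hG (ν + k + 1) (by positivity)
    have := hG (ν + l + 1) (by positivity)
    have := Real.rpow_pos_of_pos hs (ν + 1)
    push_cast
    rw [neg_pow (a ^ 2 / (4 * s)), neg_pow (b ^ 2 / (4 * s)), div_pow, div_pow, div_pow, div_pow,
      mul_pow, mul_pow, ← pow_mul a, ← pow_mul b, pow_add, ← add_assoc ν]
    have e4 : ∀ n : ℕ, (2 : ℝ) ^ (2 * n) = 4 ^ n := fun n => by rw [pow_mul]; norm_num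
    rw [e4, e4]
    field_simp
  -- Each term has constant sign on (0, ∞), so the integral of its modulus is the modulus of its
  -- integral. This replaces (-x, -y) by (x, y) in the series, whose convergence then licenses
  -- termwise integration.
  have hnorm : ∀ q, ∫ t in Ioi (0 : ℝ), ‖F q t‖ = K * (x ^ q.1 * y ^ q.2 /
      (q.1.factorial * q.2.factorial) * (Real.Gamma (ν + q.1 + q.2 + 1) /
        (Real.Gamma (ν + q.1 + 1) * Real.Gamma (ν + q.2 + 1)))) := by
    rintro ⟨k, l⟩
    have h1 : ∫ t in Ioi (0 : ℝ), ‖F (k, l) t‖ = |∫ t in Ioi (0 : ℝ), F (k, l) t| := by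
      have e : ∀ t ∈ Ioi (0 : ℝ), ‖F (k, l) t‖ = |(besselCoeff ν k * besselCoeff ν l *
          ((a / 2) ^ ν * (b / 2) ^ ν * (a / 2) ^ (2 * k) * (b / 2) ^ (2 * l)))| *
          (t ^ (2 * ν + 2 * (k + l : ℕ) + 1) * Real.exp (-s * t ^ 2)) := by
        intro t ht
        have ht' : 0 < t := ht
        simp only [F]
        rw [Real.norm_eq_abs, abs_mul]
        congr 1
        exact abs_of_pos (by positivity)
      rw [setIntegral_congr_fun measurableSet_Ioi e, integral_const_mul]
      simp only [F]
      rw [integral_const_mul, abs_mul (_ * _) (integral _ _)]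
      congr 1
      symm
      have hn : 0 ≤ ∫ t in Ioi (0 : ℝ), t ^ (2 * ν + 2 * (k + l : ℕ) + 1) * Real.exp (-s * t ^ 2) :=
        setIntegral_nonneg measurableSet_Ioi fun t ht => by
          have ht' : 0 < t := ht
          positivity
      exact abs_of_nonneg hn
    rw [h1, hval]
    have := hG (ν + k + 1) (by positivity)
    have := hG (ν + l + 1) (by positivity)
    have := hG (ν + k + l + 1) (by positivity)
    rw [abs_mul K, abs_mul (_ / _), abs_div (_ * _), abs_mul, abs_pow, abs_pow, abs_neg, abs_neg, abs_of_pos hK0,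
      abs_of_pos hx0, abs_of_pos hy0, abs_of_pos (by positivity : (0 : ℝ) < k.factorial * l.factorial),
      abs_of_pos (by positivity)]
  have hsumN : Summable fun q => ∫ t in Ioi (0 : ℝ), ‖F q t‖ := by
    simp only [hnorm]
    exact (hasSum_double_series hν x y).summable.mul_left K
  have hpt : ∀ t ∈ Ioi (0 : ℝ), HasSum (fun q => F q t)
      (Real.exp (-s * t ^ 2) * (besselJ ν (a * t) * besselJ ν (b * t)) * t) := by
    intro t ht
    have ht' : 0 < t := ht
    have s1 := summable_besselG hν ((a * t / 2) ^ 2)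
    have s2 := summable_besselG hν ((b * t / 2) ^ 2)
    have n1 : Summable fun k => ‖besselCoeff ν k * ((a * t / 2) ^ 2) ^ k‖ := s1.norm
    have n2 : Summable fun k => ‖besselCoeff ν k * ((b * t / 2) ^ 2) ^ k‖ := s2.norm
    have h := (s1.hasSum.mul s2.hasSum (summable_mul_of_summable_norm n1 n2)).mul_left
      (Real.exp (-s * t ^ 2) * ((a * t / 2) ^ ν * (b * t / 2) ^ ν) * t)
    have e0 : Real.exp (-s * t ^ 2) * (besselJ ν (a * t) * besselJ ν (b * t)) * t =
      Real.exp (-s * t ^ 2) * ((a * t / 2) ^ ν * (b * t / 2) ^ ν) * t *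
        ((∑' k, besselCoeff ν k * ((a * t / 2) ^ 2) ^ k) *
          ∑' k, besselCoeff ν k * ((b * t / 2) ^ 2) ^ k) := by
      rw [besselJ_eq, besselJ_eq, besselG, besselG]; ring
    rw [e0]
    refine h.congr_fun ?_
    rintro ⟨k, l⟩
    simp only [F]
    have e1 : t ^ (2 * ν + 2 * ((k + l : ℕ) : ℝ) + 1) = t ^ ν * t ^ ν * (t ^ (2 * k) * t ^ (2 * l)) * t := by
      rw [Real.rpow_add_one ht'.ne', two_mul, Real.rpow_add ht', Real.rpow_add ht']
      rw [show (2 : ℝ) * ((k + l : ℕ) : ℝ) = ((2 * k + 2 * l : ℕ) : ℝ) by push_cast; ring,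
        Real.rpow_natCast, pow_add]
    have e2 : (a * t / 2) ^ ν = (a / 2) ^ ν * t ^ ν := by
      rw [← Real.mul_rpow (by positivity) ht'.le]; congr 1; ring
    have e3 : (b * t / 2) ^ ν = (b / 2) ^ ν * t ^ ν := by
      rw [← Real.mul_rpow (by positivity) ht'.le]; congr 1; ring
    rw [e1, e2, e3, ← pow_mul, ← pow_mul, show a * t / 2 = a / 2 * t by ring,
      show b * t / 2 = b / 2 * t by ring, mul_pow, mul_pow]
    ring
  have hae : ∀ᵐ t ∂(volume.restrict (Ioi (0 : ℝ))), HasSum (fun q => F q t)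
      (Real.exp (-s * t ^ 2) * (besselJ ν (a * t) * besselJ ν (b * t)) * t) :=
    (ae_restrict_iff' measurableSet_Ioi).mpr (.of_forall hpt)
  have hmain := hasSum_integral_of_summable_integral_norm hFint hsumN
  have hcongr : (fun t => ∑' q, F q t) =ᵐ[volume.restrict (Ioi 0)]
      fun t => Real.exp (-s * t ^ 2) * (besselJ ν (a * t) * besselJ ν (b * t)) * t :=
    hae.mono fun t ht => ht.tsum_eq
  rw [← integral_congr_ae hcongr]
  simp only [hval] at hmain
  -- The integrated series is resummed at (-x, -y). Since (-x)(-y) = w² with w = ab/(4s), the value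
  -- is the closed form I_ν(2w) e^{-x-y}/(2s). Uniformity in ν enters only now, through the bound
  -- for I_ν, and 2w - x - y = -(a-b)²/(4s).
  rw [hmain.unique ((hasSum_double_series hν (-x) (-y)).mul_left K)]
  obtain ⟨w, hw⟩ : ∃ w, w = a * b / (4 * s) := ⟨_, rfl⟩
  have hw0 : 0 < w := by rw [hw]; positivity
  have hxy : -x * -y = w ^ 2 := by rw [hx, hy, hw]; field_simp
  have hb := besselI_series_le hν hw0
  have hKw : K = 1 / (2 * s) * w ^ ν := by
    rw [hK, hw, Real.rpow_add_one hs.ne', ← Real.mul_rpow (by positivity) (by positivity),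
      show a * b / (4 * s) = (a / 2 * (b / 2)) / s by field_simp; ring,
      Real.div_rpow (by positivity) hs.le]
    field_simp
  have hS : 0 ≤ ∑' m, |besselCoeff ν m| * (w ^ 2) ^ m := tsum_nonneg fun m => by positivity
  rw [hxy, hKw, abs_of_nonneg (by positivity)]
  calc 1 / (2 * s) * w ^ ν * ((∑' m, |besselCoeff ν m| * (w ^ 2) ^ m) * (Real.exp (-x) * Real.exp (-y)))
      = 1 / (2 * s) * (w ^ ν * (∑' m, |besselCoeff ν m| * (w ^ 2) ^ m)) *
          (Real.exp (-x) * Real.exp (-y)) := by ring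
    _ ≤ 1 / (2 * s) * (6 * (Real.exp (2 * w) / √(2 * w))) * (Real.exp (-x) * Real.exp (-y)) := by
      gcongr
    _ = 3 / s * (√(2 * w))⁻¹ * (Real.exp (2 * w) * Real.exp (-x) * Real.exp (-y)) := by
      field_simp; norm_num
    _ = _ := by
      rw [← Real.exp_add, ← Real.exp_add, hw, hx, hy]
      congr 2
      · congr 2; field_simp; ring
      · field_simp; ring

/-! ### The T*T method, Schur's test and Plancherel in time. -/

open scoped ComplexConjugate in
/-- The `L²` norm of an integral operator is controlled by the quadratic form of the kernel of
its `T*T`. -/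
theorem lintegral_sq_le_of_kernel {α γ : Type*} [MeasurableSpace α] [MeasurableSpace γ]
    {τ : Measure α} [SFinite τ] {μ : Measure γ} [SFinite μ] {a : α → γ → ℂ}
    (ha : Measurable (Function.uncurry a)) {f : γ → ℂ} (hf : Measurable f) {k : γ → γ → ℝ≥0∞}
    (hfin : ∫⁻ t, (∫⁻ ρ, ‖a t ρ * f ρ‖ₑ ∂μ) ^ 2 ∂τ ≠ ⊤)
    (hk : ∀ᵐ ρ ∂μ, ∀ᵐ ρ' ∂μ, ‖∫ t, a t ρ * conj (a t ρ') ∂τ‖ₑ ≤ k ρ ρ') :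
    ∫⁻ t, ‖∫ ρ, a t ρ * f ρ ∂μ‖ₑ ^ 2 ∂τ ≤ ∫⁻ ρ, ∫⁻ ρ', ‖f ρ‖ₑ * ‖f ρ'‖ₑ * k ρ ρ' ∂μ ∂μ := by
  have hb : Measurable fun p : α × γ => a p.1 p.2 * f p.2 := ha.mul (hf.comp measurable_snd)
  have hΦ : Measurable fun p : α × (γ × γ) => a p.1 p.2.1 * f p.2.1 * conj (a p.1 p.2.2 * f p.2.2) := by
    refine Measurable.mul (hb.comp (f := fun p : α × γ × γ => (p.1, p.2.1)) (by fun_prop)) ?_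
    exact Complex.continuous_conj.measurable.comp
      (hb.comp (f := fun p : α × γ × γ => (p.1, p.2.2)) (by fun_prop))
  have hnorm : ∀ t, ∫⁻ p : γ × γ, ‖a t p.1 * f p.1 * conj (a t p.2 * f p.2)‖ₑ ∂(μ.prod μ) =
      (∫⁻ ρ, ‖a t ρ * f ρ‖ₑ ∂μ) ^ 2 := by
    intro t
    have hbt : Measurable fun ρ => ‖a t ρ * f ρ‖ₑ :=
      (hb.comp (measurable_prodMk_left (x := t))).enorm
    rw [sq, ← lintegral_prod_mul hbt.aemeasurable hbt.aemeasurable]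
    refine lintegral_congr fun p => ?_
    rw [enorm_mul, RCLike.enorm_conj]
  have hint : Integrable (fun p : α × (γ × γ) => a p.1 p.2.1 * f p.2.1 * conj (a p.1 p.2.2 * f p.2.2))
      (τ.prod (μ.prod μ)) := by
    refine ⟨hΦ.aestronglyMeasurable, ?_⟩
    rw [HasFiniteIntegral, lintegral_prod _ hΦ.enorm.aemeasurable]
    simp only [hnorm]
    exact hfin.lt_top
  have hG : ∀ t, ∫ p : γ × γ, a t p.1 * f p.1 * conj (a t p.2 * f p.2) ∂(μ.prod μ) =
      ((‖∫ ρ, a t ρ * f ρ ∂μ‖ ^ 2 : ℝ) : ℂ) := by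
    intro t
    rw [integral_prod_mul (fun ρ => a t ρ * f ρ) (fun ρ => conj (a t ρ * f ρ)), integral_conj,
      Complex.mul_conj, Complex.normSq_eq_norm_sq]
  have hGint : Integrable (fun t => ((‖∫ ρ, a t ρ * f ρ ∂μ‖ ^ 2 : ℝ) : ℂ)) τ := by
    have := hint.integral_prod_left
    simpa only [hG] using this
  -- The squared modulus is a double integral in (ρ, ρ'). Fubini moves the t integral inside, where
  -- it produces the kernel.
  have hswap : ∫ t, ((‖∫ ρ, a t ρ * f ρ ∂μ‖ ^ 2 : ℝ) : ℂ) ∂τ =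
      ∫ p : γ × γ, ∫ t, a t p.1 * f p.1 * conj (a t p.2 * f p.2) ∂τ ∂(μ.prod μ) := by
    rw [← integral_integral_swap (f := fun t (p : γ × γ) => a t p.1 * f p.1 * conj (a t p.2 * f p.2)) hint]
    simp only [hG]
  have hlhs : ∫⁻ t, ‖∫ ρ, a t ρ * f ρ ∂μ‖ₑ ^ 2 ∂τ =
      ‖∫ t, ((‖∫ ρ, a t ρ * f ρ ∂μ‖ ^ 2 : ℝ) : ℂ) ∂τ‖ₑ := by
    have hr : Integrable (fun t => ‖∫ ρ, a t ρ * f ρ ∂μ‖ ^ 2) τ := hGint.re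
    rw [integral_complex_ofReal, ← ofReal_norm, Complex.norm_real, Real.norm_eq_abs,
      abs_of_nonneg (integral_nonneg fun t => by positivity),
      ofReal_integral_eq_lintegral_ofReal hr (.of_forall fun t => by positivity)]
    refine lintegral_congr fun t => ?_
    rw [ENNReal.ofReal_pow (norm_nonneg _), ofReal_norm]
  rw [hlhs, hswap]
  refine (enorm_integral_le_lintegral_enorm _).trans ?_
  have hmeas : AEMeasurable (fun p : γ × γ =>
      ‖∫ t, a t p.1 * f p.1 * conj (a t p.2 * f p.2) ∂τ‖ₑ) (μ.prod μ) :=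
    hint.integral_prod_right.aestronglyMeasurable.enorm
  rw [lintegral_prod _ hmeas]
  refine lintegral_mono_ae (hk.mono fun ρ h => lintegral_mono_ae (h.mono fun ρ' h' => ?_))
  have e : ∀ t, a t ρ * f ρ * conj (a t ρ' * f ρ') = (f ρ * conj (f ρ')) * (a t ρ * conj (a t ρ')) := by
    intro t; rw [map_mul]; ring
  simp only [e]
  rw [integral_const_mul, enorm_mul, enorm_mul, RCLike.enorm_conj]
  gcongr

theorem ENNReal.two_mul_le_add_sq' (x y : ℝ≥0∞) : x * y ≤ (x ^ 2 + y ^ 2) / 2 := by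
  rcases eq_or_ne x ⊤ with rfl | hx
  · simp [ENNReal.top_pow, ENNReal.top_div]
  rcases eq_or_ne y ⊤ with rfl | hy
  · simp [ENNReal.top_pow, ENNReal.top_div]
  rw [ENNReal.le_div_iff_mul_le (by simp) (by simp)]
  lift x to NNReal using hx
  lift y to NNReal using hy
  norm_cast
  have := two_mul_le_add_sq x y
  rw [mul_comm]
  linarith [this, mul_assoc 2 x y]

/-- The Schur test for a symmetric kernel. -/
theorem schur_test {γ : Type*} [MeasurableSpace γ] {μ : Measure γ} [SFinite μ] {F : γ → ℝ≥0∞}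
    (hF : Measurable F) {k : γ → γ → ℝ≥0∞} (hk : Measurable (Function.uncurry k))
    (hsymm : ∀ x y, k x y = k y x) {B : ℝ≥0∞} (hB : ∀ x, ∫⁻ y, k x y ∂μ ≤ B) :
    ∫⁻ x, ∫⁻ y, F x * F y * k x y ∂μ ∂μ ≤ B * ∫⁻ x, F x ^ 2 ∂μ := by
  have hkx : ∀ x, Measurable (k x) := fun x => hk.comp (measurable_prodMk_left (x := x))
  have h1 : ∫⁻ x, ∫⁻ y, F x ^ 2 * k x y ∂μ ∂μ ≤ B * ∫⁻ x, F x ^ 2 ∂μ := by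
    rw [← lintegral_const_mul _ (by fun_prop)]
    refine lintegral_mono fun x => ?_
    rw [lintegral_const_mul _ (hkx x), mul_comm]
    gcongr
    exact hB x
  have h2 : ∫⁻ x, ∫⁻ y, F y ^ 2 * k x y ∂μ ∂μ = ∫⁻ x, ∫⁻ y, F x ^ 2 * k x y ∂μ ∂μ := by
    rw [lintegral_lintegral_swap]
    · simp only [hsymm]
    · exact (((hF.comp measurable_snd).pow_const 2).mul hk).aemeasurable
  have hm1 : Measurable fun p : γ × γ => F p.1 ^ 2 * k p.1 p.2 :=
    ((hF.comp measurable_fst).pow_const 2).mul hk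
  have hle : ∀ x y, F x * F y * k x y ≤ (1 / 2) * (F x ^ 2 * k x y) + (1 / 2) * (F y ^ 2 * k x y) := by
    intro x y
    calc F x * F y * k x y ≤ ((F x ^ 2 + F y ^ 2) / 2) * k x y := by
          gcongr; exact ENNReal.two_mul_le_add_sq' _ _
      _ = _ := by rw [ENNReal.div_eq_inv_mul, one_div]; ring
  calc ∫⁻ x, ∫⁻ y, F x * F y * k x y ∂μ ∂μ
      ≤ ∫⁻ x, ∫⁻ y, ((1 / 2) * (F x ^ 2 * k x y) + (1 / 2) * (F y ^ 2 * k x y)) ∂μ ∂μ :=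
        lintegral_mono fun x => lintegral_mono fun y => hle x y
    _ = ∫⁻ x, ((1 / 2) * (∫⁻ y, F x ^ 2 * k x y ∂μ) + (1 / 2) * ∫⁻ y, F y ^ 2 * k x y ∂μ) ∂μ := by
        refine lintegral_congr fun x => ?_
        have hkx' := hkx x
        have m1 : Measurable fun y => F x ^ 2 * k x y := by fun_prop
        have m2 : Measurable fun y => F y ^ 2 * k x y := by fun_prop
        rw [lintegral_add_left (m1.const_mul _), lintegral_const_mul _ m1, lintegral_const_mul _ m2]
    _ = (1 / 2) * (∫⁻ x, ∫⁻ y, F x ^ 2 * k x y ∂μ ∂μ) + (1 / 2) * ∫⁻ x, ∫⁻ y, F y ^ 2 * k x y ∂μ ∂μ := by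
        have hm : Measurable fun x => ∫⁻ y, F x ^ 2 * k x y ∂μ := hm1.lintegral_prod_right'
        have hm' : Measurable fun x => ∫⁻ y, F y ^ 2 * k x y ∂μ :=
          Measurable.lintegral_prod_right' (f := fun p : γ × γ => F p.2 ^ 2 * k p.1 p.2)
            (((hF.comp measurable_snd).pow_const 2).mul hk)
        rw [lintegral_add_left (hm.const_mul _), lintegral_const_mul _ hm, lintegral_const_mul _ hm']
    _ ≤ (1 / 2) * (B * ∫⁻ x, F x ^ 2 ∂μ) + (1 / 2) * (B * ∫⁻ x, F x ^ 2 ∂μ) := by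
        rw [h2]; gcongr
    _ = B * ∫⁻ x, F x ^ 2 ∂μ := by
        rw [← add_mul, one_div, ENNReal.inv_two_add_inv_two, one_mul]

theorem lintegral_gaussian_shift {c : ℝ} (hc : 0 < c) (x : ℝ) :
    ∫⁻ y, ENNReal.ofReal (Real.exp (-c * (x - y) ^ 2)) = ENNReal.ofReal √(Real.pi / c) := by
  rw [lintegral_sub_left_eq_self (fun z => ENNReal.ofReal (Real.exp (-c * z ^ 2))) x,
    ← ofReal_integral_eq_lintegral_ofReal (integrable_exp_neg_mul_sq hc)
      (.of_forall fun z => (Real.exp_pos _).le), integral_gaussian]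

/-- A Gaussian kernel acts boundedly on `L²`. -/
theorem schur_gaussian {μ : Measure ℝ} [SFinite μ] (hμ : μ ≤ volume) {F : ℝ → ℝ≥0∞}
    (hF : Measurable F) {c : ℝ} (hc : 0 < c) (D : ℝ≥0∞) :
    ∫⁻ x, ∫⁻ y, F x * F y * (D * ENNReal.ofReal (Real.exp (-c * (x - y) ^ 2))) ∂μ ∂μ ≤
      D * ENNReal.ofReal √(Real.pi / c) * ∫⁻ x, F x ^ 2 ∂μ := by
  refine schur_test hF (k := fun x y => D * ENNReal.ofReal (Real.exp (-c * (x - y) ^ 2)))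
    (by unfold Function.uncurry; fun_prop) (fun x y => by
      rw [show (x - y) ^ 2 = (y - x) ^ 2 by ring]) fun x => ?_
  rw [lintegral_const_mul _ (by fun_prop)]
  gcongr
  exact (lintegral_mono' hμ le_rfl).trans (lintegral_gaussian_shift hc x).le

/-- Lebesgue measure on the frequency band `(1/2, 2)`. -/
def band : Measure ℝ := volume.restrict (Ioo (1 / 2) 2)

instance : IsFiniteMeasure band := ⟨by simp [band]⟩

theorem ae_band {P : ℝ → Prop} (h : ∀ ρ ∈ Ioo (1 / 2 : ℝ) 2, P ρ) : ∀ᵐ ρ ∂band, P ρ :=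
  (ae_restrict_iff' measurableSet_Ioo).mpr (.of_forall h)

theorem band_le : band ≤ volume := Measure.restrict_le_self

theorem lintegral_enorm_lt_top_of_sq {μ : Measure ℝ} [IsFiniteMeasure μ] {f : ℝ → ℂ}
    (h2 : ∫⁻ ρ, ‖f ρ‖ₑ ^ 2 ∂μ ≠ ⊤) : ∫⁻ ρ, ‖f ρ‖ₑ ∂μ ≠ ⊤ := by
  have h : ∫⁻ ρ, ‖f ρ‖ₑ ∂μ ≤ ∫⁻ ρ, (1 + ‖f ρ‖ₑ ^ 2) ∂μ := by
    refine lintegral_mono fun ρ => ?_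
    rcases le_total (‖f ρ‖ₑ) 1 with h1 | h1
    · exact h1.trans le_self_add
    · calc ‖f ρ‖ₑ = ‖f ρ‖ₑ * 1 := (mul_one _).symm
        _ ≤ ‖f ρ‖ₑ * ‖f ρ‖ₑ := by gcongr
        _ ≤ _ := by rw [← sq]; exact le_add_self
  refine ne_top_of_le_ne_top ?_ h
  rw [lintegral_add_left measurable_const]
  simp [h2]

theorem enorm_complex_ofReal (x : ℝ) : ‖(x : ℂ)‖ₑ = ENNReal.ofReal |x| := by
  rw [← ofReal_norm, Complex.norm_real, Real.norm_eq_abs]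

theorem enorm_cexp_neg_I_mul (t w : ℝ) : ‖Complex.exp (-(Complex.I * t * w))‖ₑ = 1 := by
  have : -(Complex.I * t * w) = ((-(t * w) : ℝ) : ℂ) * Complex.I := by push_cast; ring
  rw [← ofReal_norm, this, Complex.norm_exp_ofReal_mul_I, ENNReal.ofReal_one]

open scoped ComplexConjugate in
theorem conj_cexp_neg_I_mul (t w : ℝ) :
    conj (Complex.exp (-(Complex.I * t * w))) = Complex.exp (Complex.I * t * w) := by
  rw [← Complex.exp_conj]
  simp

-- With the weight e^{-εt²} the kernel is the explicit Gaussian √(π/ε) e^{-(ϖ(ρ)-ϖ(ρ'))²/(4ε)}, and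
-- the lower bound on differences of ϖ makes it a Gaussian in ρ - ρ'. Its Schur norm √(π/ε) √(4πεA²)
-- = 2πA is independent of ε, so the weight can be removed in the limit. No change of variables is
-- needed.
open scoped ComplexConjugate in
theorem time_plancherel_gaussian {A ε : ℝ} (hA : 0 < A) (hε : 0 < ε) {ϖ : ℝ → ℝ} (hϖ : Measurable ϖ)
    (hmono : ∀ x ∈ Ioo (1 / 2 : ℝ) 2, ∀ y ∈ Ioo (1 / 2 : ℝ) 2, A⁻¹ * |x - y| ≤ |ϖ x - ϖ y|)
    {f : ℝ → ℂ} (hf : Measurable f) (hf2 : ∫⁻ ρ, ‖f ρ‖ₑ ^ 2 ∂band ≠ ⊤) :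
    ∫⁻ t : ℝ, ENNReal.ofReal (Real.exp (-ε * t ^ 2)) *
        ‖∫ ρ, Complex.exp (-(Complex.I * t * ϖ ρ)) * f ρ ∂band‖ₑ ^ 2 ≤
      ENNReal.ofReal (2 * Real.pi * A) * ∫⁻ ρ, ‖f ρ‖ₑ ^ 2 ∂band := by
  let a : ℝ → ℝ → ℂ := fun t ρ =>
    (Real.exp (-(ε / 2) * t ^ 2) : ℂ) * Complex.exp (-(Complex.I * t * ϖ ρ))
  have ha : Measurable (Function.uncurry a) := by
    unfold Function.uncurry; simp only [a]; fun_prop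
  have hea : ∀ t ρ, ‖a t ρ‖ₑ = ENNReal.ofReal (Real.exp (-(ε / 2) * t ^ 2)) := by
    intro t ρ
    simp only [a]
    rw [enorm_mul, enorm_cexp_neg_I_mul, mul_one, enorm_complex_ofReal, abs_of_pos (Real.exp_pos _)]
  have hsq : ∀ t : ℝ, ENNReal.ofReal (Real.exp (-(ε / 2) * t ^ 2)) ^ 2 =
      ENNReal.ofReal (Real.exp (-ε * t ^ 2)) := by
    intro t
    rw [← ENNReal.ofReal_pow (Real.exp_pos _).le, ← Real.exp_nat_mul]
    congr 2; push_cast; ring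
  have hL : ∀ t : ℝ, ENNReal.ofReal (Real.exp (-ε * t ^ 2)) *
        ‖∫ ρ, Complex.exp (-(Complex.I * t * ϖ ρ)) * f ρ ∂band‖ₑ ^ 2 =
      ‖∫ ρ, a t ρ * f ρ ∂band‖ₑ ^ 2 := by
    intro t
    simp only [a, mul_assoc]
    rw [integral_const_mul, enorm_mul, mul_pow, ← hsq, enorm_complex_ofReal, abs_of_pos (Real.exp_pos _)]
  simp only [hL]
  have hK : ∀ ρ ∈ Ioo (1 / 2 : ℝ) 2, ∀ ρ' ∈ Ioo (1 / 2 : ℝ) 2, ‖∫ t, a t ρ * conj (a t ρ')‖ₑ ≤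
      ENNReal.ofReal √(Real.pi / ε) * ENNReal.ofReal (Real.exp (-(1 / (4 * ε * A ^ 2)) * (ρ - ρ') ^ 2)) := by
    intro ρ hρ ρ' hρ'
    have e : ∀ t : ℝ, a t ρ * conj (a t ρ') =
        Complex.exp (Complex.I * ((-(ϖ ρ - ϖ ρ') : ℝ) : ℂ) * t) * Complex.exp (-(ε : ℂ) * (t : ℂ) ^ 2) := by
      intro t
      simp only [a]
      rw [map_mul, conj_cexp_neg_I_mul, Complex.conj_ofReal, Complex.ofReal_exp, ← Complex.exp_add,
        ← Complex.exp_add, ← Complex.exp_add, ← Complex.exp_add]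
      congr 1; push_cast; ring
    simp only [e]
    rw [fourierIntegral_gaussian (by simpa using hε)]
    rw [enorm_mul, ← ofReal_norm, ← ofReal_norm, Complex.norm_exp]
    have n1 : ‖((Real.pi : ℂ) / ε) ^ (1 / 2 : ℂ)‖ = √(Real.pi / ε) := by
      rw [← Complex.ofReal_div, Complex.norm_cpow_eq_rpow_re_of_pos (by positivity), Real.sqrt_eq_rpow]
      norm_num
    rw [n1]
    gcongr
    have e2 : -((-(ϖ ρ - ϖ ρ') : ℝ) : ℂ) ^ 2 / (4 * (ε : ℂ)) =
        ((-(ϖ ρ - ϖ ρ') ^ 2 / (4 * ε) : ℝ) : ℂ) := by push_cast; ring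
    rw [e2, Complex.ofReal_re]
    have h1 := hmono ρ hρ ρ' hρ'
    have h2 : (A⁻¹ * |ρ - ρ'|) ^ 2 ≤ (ϖ ρ - ϖ ρ') ^ 2 := by
      rw [← sq_abs (ϖ ρ - ϖ ρ')]; gcongr
    rw [mul_pow, sq_abs] at h2
    calc -(ϖ ρ - ϖ ρ') ^ 2 / (4 * ε) ≤ -(A⁻¹ ^ 2 * (ρ - ρ') ^ 2) / (4 * ε) := by gcongr
      _ = _ := by field_simp
  refine (lintegral_sq_le_of_kernel ha hf ?_ (ae_band fun ρ hρ => ae_band fun ρ' hρ' => hK ρ hρ ρ' hρ')).trans ?_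
  · simp only [enorm_mul, hea]
    have : ∀ t : ℝ, (∫⁻ ρ, ENNReal.ofReal (Real.exp (-(ε / 2) * t ^ 2)) * ‖f ρ‖ₑ ∂band) ^ 2 =
        ENNReal.ofReal (Real.exp (-ε * t ^ 2)) * (∫⁻ ρ, ‖f ρ‖ₑ ∂band) ^ 2 := by
      intro t
      rw [lintegral_const_mul _ hf.enorm, mul_pow, hsq]
    simp only [this]
    rw [lintegral_mul_const _ (by fun_prop)]
    refine ENNReal.mul_ne_top ?_ (ENNReal.pow_ne_top (lintegral_enorm_lt_top_of_sq hf2))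
    exact (integrable_exp_neg_mul_sq hε).lintegral_lt_top.ne
  · refine (schur_gaussian band_le hf.enorm (by positivity) _).trans (le_of_eq ?_)
    congr 1
    rw [← ENNReal.ofReal_mul (by positivity), ← Real.sqrt_mul (by positivity)]
    congr 1
    rw [show Real.pi / ε * (Real.pi / (1 / (4 * ε * A ^ 2))) = (2 * Real.pi * A) ^ 2 by
      field_simp; ring, Real.sqrt_sq (by positivity)]

/-- The Plancherel inequality in time. -/
theorem time_plancherel {A : ℝ} (hA : 0 < A) {ϖ : ℝ → ℝ} (hϖ : Measurable ϖ)
    (hmono : ∀ x ∈ Ioo (1 / 2 : ℝ) 2, ∀ y ∈ Ioo (1 / 2 : ℝ) 2, A⁻¹ * |x - y| ≤ |ϖ x - ϖ y|)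
    {f : ℝ → ℂ} (hf : Measurable f) (hf2 : ∫⁻ ρ, ‖f ρ‖ₑ ^ 2 ∂band ≠ ⊤) :
    ∫⁻ t : ℝ, ‖∫ ρ, Complex.exp (-(Complex.I * t * ϖ ρ)) * f ρ ∂band‖ₑ ^ 2 ≤
      ENNReal.ofReal (2 * Real.pi * A) * ∫⁻ ρ, ‖f ρ‖ₑ ^ 2 ∂band := by
  have hGm : Measurable fun t : ℝ => ‖∫ ρ, Complex.exp (-(Complex.I * t * ϖ ρ)) * f ρ ∂band‖ₑ ^ 2 := by
    have h : Measurable (Function.uncurry fun (t ρ : ℝ) => Complex.exp (-(Complex.I * t * ϖ ρ)) * f ρ) := by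
      unfold Function.uncurry; fun_prop
    have := h.stronglyMeasurable.integral_prod_right (ν := band)
    exact this.measurable.enorm.pow_const 2
  -- The weights with ε = 1/(n+1) increase to 1, so monotone convergence applies.
  have hlim := lintegral_tendsto_of_tendsto_of_monotone (μ := (volume : Measure ℝ))
    (f := fun (n : ℕ) t => ENNReal.ofReal (Real.exp (-(1 / ((n : ℝ) + 1)) * t ^ 2)) *
        ‖∫ ρ, Complex.exp (-(Complex.I * t * ϖ ρ)) * f ρ ∂band‖ₑ ^ 2)
    (F := fun t => ‖∫ ρ, Complex.exp (-(Complex.I * t * ϖ ρ)) * f ρ ∂band‖ₑ ^ 2)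
    (fun n => (Measurable.mul (by fun_prop) hGm).aemeasurable)
    (.of_forall fun t n m hnm => by
      simp only
      gcongr ENNReal.ofReal (Real.exp ?_) * _
      have : 1 / ((m : ℝ) + 1) ≤ 1 / ((n : ℝ) + 1) := by gcongr
      nlinarith [sq_nonneg t])
    (.of_forall fun t => by
      have h1 : Filter.Tendsto (fun n : ℕ => -(1 / ((n : ℝ) + 1)) * t ^ 2) Filter.atTop (nhds (-0 * t ^ 2)) :=
        (tendsto_one_div_add_atTop_nhds_zero_nat.neg).mul_const _
      have h2 := ENNReal.tendsto_ofReal ((Real.continuous_exp.tendsto _).comp h1)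
      have h3 := ENNReal.Tendsto.mul_const (b := ‖∫ ρ, Complex.exp (-(Complex.I * t * ϖ ρ)) * f ρ ∂band‖ₑ ^ 2)
        h2 (Or.inl (by simp))
      simpa using h3)
  refine le_of_tendsto' hlim fun n => ?_
  exact time_plancherel_gaussian hA (by positivity) hϖ hmono hf hf2

/-! ### Shell averages of u_ν and u_ν', and the Hankel transform. -/

theorem besselU_mul_besselU {ν a b t : ℝ} (ha : 0 < a) (hb : 0 < b) (ht : 0 < t) :
    besselU ν (a * t) * besselU ν (b * t) = √(a * b) * (besselJ ν (a * t) * besselJ ν (b * t) * t) := by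
  have hsq : √(a * t) * √(b * t) = √(a * b) * t := by
    rw [← Real.sqrt_mul (by positivity), show a * t * (b * t) = (a * b) * t ^ 2 by ring,
      Real.sqrt_mul (by positivity), Real.sqrt_sq ht.le]
  calc _ = (√(a * t) * √(b * t)) * (besselJ ν (a * t) * besselJ ν (b * t)) := by
        rw [besselU, besselU]; ring
    _ = _ := by rw [hsq]; ring

/-- The factor √(ab) created by the normalization cancels the one in Weber's bound, so what remains
depends only on a - b. The constant 5 dominates 3√2. -/
theorem weber_besselU {ν a b s : ℝ} (hν : 0 ≤ ν) (ha : 0 < a) (hb : 0 < b) (hs : 0 < s) :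
    IntegrableOn (fun t : ℝ => Real.exp (-s * t ^ 2) * (besselU ν (a * t) * besselU ν (b * t))) (Ioi 0) ∧
    |∫ t in Ioi (0 : ℝ), Real.exp (-s * t ^ 2) * (besselU ν (a * t) * besselU ν (b * t))| ≤
      5 / √s * Real.exp (-(1 / (4 * s)) * (a - b) ^ 2) := by
  have e : ∀ t ∈ Ioi (0 : ℝ), Real.exp (-s * t ^ 2) * (besselU ν (a * t) * besselU ν (b * t)) =
      √(a * b) * (Real.exp (-s * t ^ 2) * (besselJ ν (a * t) * besselJ ν (b * t)) * t) := by
    intro t ht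
    rw [besselU_mul_besselU ha hb ht]; ring
  constructor
  · exact IntegrableOn.congr_fun ((integrableOn_gaussian_besselJ hν ha hb hs).const_mul _)
      (fun t ht => (e t ht).symm) measurableSet_Ioi
  · rw [setIntegral_congr_fun measurableSet_Ioi e, integral_const_mul, abs_mul,
      abs_of_nonneg (Real.sqrt_nonneg _)]
    have hab : 0 < √(a * b) := by positivity
    have hss : 0 < √s := by positivity
    have h2s : √(a * b / (2 * s)) = √(a * b) / (√2 * √s) := by
      rw [Real.sqrt_div (by positivity), Real.sqrt_mul zero_le_two]
    have h2 : √2 ≤ 5 / 3 := by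
      rw [Real.sqrt_le_left (by norm_num)]; norm_num
    have hsq : √s * √s = s := Real.mul_self_sqrt hs.le
    calc √(a * b) * |∫ t in Ioi (0 : ℝ), Real.exp (-s * t ^ 2) * (besselJ ν (a * t) * besselJ ν (b * t)) * t|
        ≤ √(a * b) * (3 / s * (√(a * b / (2 * s)))⁻¹ * Real.exp (-(a - b) ^ 2 / (4 * s))) := by
          gcongr; exact weber_integral_bound hν ha hb hs
      _ = 3 * √2 / √s * Real.exp (-(1 / (4 * s)) * (a - b) ^ 2) := by
          rw [h2s, show -(a - b) ^ 2 / (4 * s) = -(1 / (4 * s)) * (a - b) ^ 2 by field_simp]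
          rw [show 3 / s = 3 / (√s * √s) by rw [hsq]]
          field_simp
      _ ≤ _ := by
          gcongr
          linarith

/-- Weber's bound with a = b and s = 1/X², where the weight e^{-st²} is at least e^{-4} on (0, 2X].
The result depends neither on ν nor on a. -/
theorem lintegral_besselU_sq {ν a X : ℝ} (hν : 0 ≤ ν) (ha : 0 < a) (hX : 0 < X) :
    ∫⁻ t in Ioc 0 (2 * X), ENNReal.ofReal (besselU ν (a * t) ^ 2) ≤
      ENNReal.ofReal (5 * Real.exp 4 * X) := by
  have hs : 0 < 1 / X ^ 2 := by positivity
  obtain ⟨hint, hb⟩ := weber_besselU hν ha ha hs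
  have h1 : ∀ t ∈ Ioc 0 (2 * X), ENNReal.ofReal (besselU ν (a * t) ^ 2) ≤ ENNReal.ofReal (Real.exp 4) *
      ENNReal.ofReal (Real.exp (-(1 / X ^ 2) * t ^ 2) * (besselU ν (a * t) * besselU ν (a * t))) := by
    intro t ht
    rw [← ENNReal.ofReal_mul (Real.exp_pos _).le, ← mul_assoc, ← Real.exp_add, ← sq]
    refine ENNReal.ofReal_le_ofReal (le_mul_of_one_le_left (sq_nonneg _) (Real.one_le_exp ?_))
    have : 1 / X ^ 2 * t ^ 2 ≤ 4 := by
      rw [div_mul_eq_mul_div, div_le_iff₀ (by positivity)]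
      nlinarith [ht.1, ht.2]
    linarith
  calc ∫⁻ t in Ioc 0 (2 * X), ENNReal.ofReal (besselU ν (a * t) ^ 2)
      ≤ ∫⁻ t in Ioc 0 (2 * X), ENNReal.ofReal (Real.exp 4) *
          ENNReal.ofReal (Real.exp (-(1 / X ^ 2) * t ^ 2) * (besselU ν (a * t) * besselU ν (a * t))) :=
        setLIntegral_mono' measurableSet_Ioc h1
    _ ≤ ∫⁻ t in Ioi 0, ENNReal.ofReal (Real.exp 4) *
          ENNReal.ofReal (Real.exp (-(1 / X ^ 2) * t ^ 2) * (besselU ν (a * t) * besselU ν (a * t))) :=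
        lintegral_mono_set fun t ht => ht.1
    _ = ENNReal.ofReal (Real.exp 4) * ENNReal.ofReal (∫ t in Ioi (0 : ℝ),
          Real.exp (-(1 / X ^ 2) * t ^ 2) * (besselU ν (a * t) * besselU ν (a * t))) := by
        rw [lintegral_const_mul' _ _ ENNReal.ofReal_ne_top, ofReal_integral_eq_lintegral_ofReal hint]
        exact .of_forall fun t => mul_nonneg (Real.exp_pos _).le (mul_self_nonneg _)
    _ ≤ _ := by
        rw [← ENNReal.ofReal_mul (Real.exp_pos _).le]
        refine ENNReal.ofReal_le_ofReal ?_
        have h2 := (le_abs_self _).trans hb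
        rw [Real.sqrt_div zero_le_one, Real.sqrt_one, Real.sqrt_sq hX.le] at h2
        simp only [sub_self, ne_eq, OfNat.ofNat_ne_zero, not_false_eq_true, zero_pow, mul_zero,
          Real.exp_zero, mul_one] at h2
        rw [div_div_eq_mul_div, div_one] at h2
        calc _ ≤ Real.exp 4 * (5 * X) := by gcongr
          _ = _ := by ring

/-- For ν ≥ 1 the symmetric formula through ν - 1 and ν + 1 is used, and for ν ≤ 1 the definition of
u', whose factor ν + 1/2 is then at most 3/2. The order max(ν - 1, 0) keeps a single statement with
a nonnegative index. -/
theorem besselDU_sq_le {ν x : ℝ} (hν : 0 ≤ ν) (hx : 0 < x) :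
    besselDU ν x ^ 2 ≤ 9 / 2 / x ^ 2 * besselU ν x ^ 2 + 2 * besselU (ν + 1) x ^ 2 +
      besselU (max (ν - 1) 0) x ^ 2 := by
  rcases le_total 1 ν with h | h
  · rw [max_eq_left (by linarith), besselDU_eq_of_one_le h hx]
    have e : 9 / 2 / x ^ 2 * besselU ν x ^ 2 = 18 * (1 / 2 / x * besselU ν x) ^ 2 := by
      field_simp; ring
    rw [e]
    nlinarith [sq_nonneg (1 / 2 / x * besselU ν x - 1 / 2 * besselU (ν - 1) x),
      sq_nonneg (1 / 2 / x * besselU ν x + 1 / 2 * besselU (ν + 1) x),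
      sq_nonneg (besselU (ν - 1) x + besselU (ν + 1) x), sq_nonneg (1 / 2 / x * besselU ν x),
      sq_nonneg (besselU (ν - 1) x), sq_nonneg (besselU (ν + 1) x)]
  · have e : 9 / 2 / x ^ 2 * besselU ν x ^ 2 = 2 * ((3 / 2) / x * besselU ν x) ^ 2 := by
      field_simp; ring
    have e2 : ((ν + 1 / 2) / x * besselU ν x) ^ 2 ≤ ((3 / 2) / x * besselU ν x) ^ 2 := by
      rw [mul_pow, mul_pow]
      gcongr
      linarith
    rw [besselDU, e]
    nlinarith [sq_nonneg ((ν + 1 / 2) / x * besselU ν x + besselU (ν + 1) x),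
      sq_nonneg (besselU (max (ν - 1) 0) x)]

/-- The lower limit c/a keeps the argument above c, which controls the coefficient of size 1/x². The
three orders that occur all obey the same bound for the average of u². -/
theorem lintegral_besselDU_sq {ν a X c : ℝ} (hν : 0 ≤ ν) (ha : 0 < a) (hX : 0 < X) (hc : 0 < c) :
    ∫⁻ t in Ioc (c / a) (2 * X), ENNReal.ofReal (besselDU ν (a * t) ^ 2) ≤
      ENNReal.ofReal ((9 / 2 / c ^ 2 + 3) * (5 * Real.exp 4 * X)) := by
  have hca : 0 < c / a := by positivity
  have h1 : ∀ t ∈ Ioc (c / a) (2 * X), ENNReal.ofReal (besselDU ν (a * t) ^ 2) ≤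
      ENNReal.ofReal (9 / 2 / c ^ 2) * ENNReal.ofReal (besselU ν (a * t) ^ 2) +
      ENNReal.ofReal 2 * ENNReal.ofReal (besselU (ν + 1) (a * t) ^ 2) +
        ENNReal.ofReal (besselU (max (ν - 1) 0) (a * t) ^ 2) := by
    intro t ht
    have hat : c ≤ a * t := by
      have := ht.1.le
      rw [div_le_iff₀ ha] at this; linarith
    rw [← ENNReal.ofReal_mul (by positivity), ← ENNReal.ofReal_mul (by positivity),
      ← ENNReal.ofReal_add (by positivity) (by positivity),
      ← ENNReal.ofReal_add (by positivity) (by positivity)]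
    refine ENNReal.ofReal_le_ofReal ((besselDU_sq_le hν (by linarith)).trans ?_)
    gcongr
  have hsub : Ioc (c / a) (2 * X) ⊆ Ioc 0 (2 * X) := Ioc_subset_Ioc_left hca.le
  have m : ∀ {μ : ℝ}, 0 ≤ μ → Measurable fun t => ENNReal.ofReal (besselU μ (a * t) ^ 2) := fun hμ => by
    have := measurable_besselU hμ
    fun_prop
  have b : ∀ {μ : ℝ}, 0 ≤ μ → ∫⁻ t in Ioc (c / a) (2 * X), ENNReal.ofReal (besselU μ (a * t) ^ 2) ≤
      ENNReal.ofReal (5 * Real.exp 4 * X) := fun hμ =>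
    (lintegral_mono_set hsub).trans (lintegral_besselU_sq hμ ha hX)
  refine (setLIntegral_mono' measurableSet_Ioc h1).trans ?_
  have hν1 : 0 ≤ ν + 1 := by linarith
  have hν2 : 0 ≤ max (ν - 1) 0 := le_max_right _ _
  have m1 := (m hν).const_mul (ENNReal.ofReal (9 / 2 / c ^ 2))
  rw [lintegral_add_right _ (m hν2),
    lintegral_add_left m1, lintegral_const_mul _ (m hν), lintegral_const_mul _ (m hν1)]
  calc _ ≤ ENNReal.ofReal (9 / 2 / c ^ 2) * ENNReal.ofReal (5 * Real.exp 4 * X) +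
        ENNReal.ofReal 2 * ENNReal.ofReal (5 * Real.exp 4 * X) + ENNReal.ofReal (5 * Real.exp 4 * X) := by
        gcongr
        · exact b hν
        · exact b hν1
        · exact b hν2
    _ = _ := by
        rw [← ENNReal.ofReal_mul (by positivity), ← ENNReal.ofReal_mul (by positivity),
          ← ENNReal.ofReal_add (by positivity) (by positivity),
          ← ENNReal.ofReal_add (by positivity) (by positivity)]
        congr 1; ring

open scoped ComplexConjugate in
/-- `L²` boundedness of the Hankel transform on dyadic shells, uniformly in the order. -/
theorem hankel_bound {ν R : ℝ} (hν : 0 ≤ ν) (hR : 0 < R) {f : ℝ → ℂ} (hf : Measurable f)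
    (hf2 : ∫⁻ ρ, ‖f ρ‖ₑ ^ 2 ∂band ≠ ⊤) :
    ∫⁻ r in Ico R (2 * R), ‖∫ ρ, (besselU ν (r * ρ) : ℂ) * f ρ ∂band‖ₑ ^ 2 ≤
      ENNReal.ofReal (20 * Real.exp 4) * ∫⁻ ρ, ‖f ρ‖ₑ ^ 2 ∂band := by
  -- With s = 1/R² the weight e^{-sr²/2} is comparable to 1 on the shell. In Schur's test the kernel
  -- height 5/√s and its width proportional to √s cancel, leaving 10√π ≤ 20.
  obtain ⟨s, hs_def⟩ : ∃ s, s = 1 / R ^ 2 := ⟨_, rfl⟩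
  have hs : 0 < s := by rw [hs_def]; positivity
  let a : ℝ → ℝ → ℂ := fun r ρ => ((Real.exp (-(s / 2) * r ^ 2) * besselU ν (ρ * r) : ℝ) : ℂ)
  have hu := measurable_besselU hν
  have ha : Measurable (Function.uncurry a) := by
    unfold Function.uncurry; simp only [a]; fun_prop
  have hbd : ∫⁻ r in Ioi (0 : ℝ), ‖∫ ρ, a r ρ * f ρ ∂band‖ₑ ^ 2 ≤
      ENNReal.ofReal 20 * ∫⁻ ρ, ‖f ρ‖ₑ ^ 2 ∂band := by
    have hK : ∀ ρ ∈ Ioo (1 / 2 : ℝ) 2, ∀ ρ' ∈ Ioo (1 / 2 : ℝ) 2,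
        ‖∫ r in Ioi (0 : ℝ), a r ρ * conj (a r ρ')‖ₑ ≤
        ENNReal.ofReal (5 / √s) * ENNReal.ofReal (Real.exp (-(1 / (4 * s)) * (ρ - ρ') ^ 2)) := by
      intro ρ hρ ρ' hρ'
      have h1 : 0 < ρ := by linarith [hρ.1]
      have h2 : 0 < ρ' := by linarith [hρ'.1]
      have e : ∀ r : ℝ, a r ρ * conj (a r ρ') =
          ((Real.exp (-s * r ^ 2) * (besselU ν (ρ * r) * besselU ν (ρ' * r)) : ℝ) : ℂ) := by
        intro r
        simp only [a]
        rw [Complex.conj_ofReal, ← Complex.ofReal_mul]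
        congr 1
        rw [show -s * r ^ 2 = -(s / 2) * r ^ 2 + -(s / 2) * r ^ 2 by ring, Real.exp_add]; ring
      simp only [e]
      rw [integral_complex_ofReal, enorm_complex_ofReal, ← ENNReal.ofReal_mul (by positivity)]
      exact ENNReal.ofReal_le_ofReal (weber_besselU hν h1 h2 hs).2
    refine (lintegral_sq_le_of_kernel ha hf ?_ (ae_band fun ρ hρ => ae_band fun ρ' hρ' => hK ρ hρ ρ' hρ')).trans ?_
    -- A priori finiteness: the Gaussian weight beats the exponential bound for u_ν, by completing
    -- the square.
    · have hle : ∀ r ∈ Ioi (0 : ℝ), (∫⁻ ρ, ‖a r ρ * f ρ‖ₑ ∂band) ^ 2 ≤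
          ENNReal.ofReal (36 * Real.exp (8 / s) * Real.exp (-(s / 2) * r ^ 2)) *
            (∫⁻ ρ, ‖f ρ‖ₑ ∂band) ^ 2 := by
        intro r hr
        have hr' : 0 < r := hr
        have hpt : ∀ᵐ ρ ∂band, ‖a r ρ * f ρ‖ₑ ≤
            ENNReal.ofReal (Real.exp (-(s / 2) * r ^ 2) * (6 * Real.exp (2 * r))) * ‖f ρ‖ₑ := by
          refine ae_band fun ρ hρ => ?_
          have h1 : 0 < ρ := by linarith [hρ.1]
          rw [enorm_mul, enorm_complex_ofReal, abs_mul, abs_of_pos (Real.exp_pos _)]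
          gcongr
          refine (abs_besselU_le_exp hν (by positivity)).trans ?_
          gcongr
          exact hρ.2.le
        calc (∫⁻ ρ, ‖a r ρ * f ρ‖ₑ ∂band) ^ 2 ≤
            (∫⁻ ρ, ENNReal.ofReal (Real.exp (-(s / 2) * r ^ 2) * (6 * Real.exp (2 * r))) * ‖f ρ‖ₑ ∂band) ^ 2 := by
              gcongr ?_ ^ 2
              exact lintegral_mono_ae hpt
          _ ≤ _ := by
              rw [lintegral_const_mul _ hf.enorm, mul_pow, ← ENNReal.ofReal_pow (by positivity)]
              gcongr
              rw [mul_pow, mul_pow, ← Real.exp_nat_mul, ← Real.exp_nat_mul, mul_left_comm, ← Real.exp_add,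
                mul_assoc, ← Real.exp_add]
              norm_num
              have h4 : 8 / s - 4 * r + s / 2 * r ^ 2 = (4 - s * r) ^ 2 / (2 * s) := by
                field_simp; ring
              have h5 : 0 ≤ (4 - s * r) ^ 2 / (2 * s) := by positivity
              nlinarith
      refine ne_top_of_le_ne_top ?_ (setLIntegral_mono' measurableSet_Ioi hle)
      rw [lintegral_mul_const _ (by fun_prop)]
      refine ENNReal.mul_ne_top ?_ (ENNReal.pow_ne_top (lintegral_enorm_lt_top_of_sq hf2))
      exact ((integrable_exp_neg_mul_sq (half_pos hs)).const_mul _).restrict.lintegral_lt_top.ne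
    · refine (schur_gaussian band_le hf.enorm (by positivity) _).trans ?_
      gcongr
      rw [← ENNReal.ofReal_mul (by positivity)]
      refine ENNReal.ofReal_le_ofReal ?_
      have e1 : √(Real.pi / (1 / (4 * s))) = 2 * √Real.pi * √s := by
        rw [show Real.pi / (1 / (4 * s)) = 2 ^ 2 * Real.pi * s by field_simp; norm_num,
          Real.sqrt_mul (by positivity), Real.sqrt_mul (by positivity), Real.sqrt_sq (by norm_num)]
      have hss : 0 < √s := by positivity
      have hpi : √Real.pi ≤ 2 := by
        rw [Real.sqrt_le_left (by norm_num)]; linarith [Real.pi_lt_four]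
      rw [e1]
      field_simp
      linarith
  have hpt : ∀ r ∈ Ico R (2 * R), ‖∫ ρ, (besselU ν (r * ρ) : ℂ) * f ρ ∂band‖ₑ ^ 2 ≤
      ENNReal.ofReal (Real.exp 4) * ‖∫ ρ, a r ρ * f ρ ∂band‖ₑ ^ 2 := by
    intro r hr
    have e : ∀ ρ, a r ρ * f ρ = (Real.exp (-(s / 2) * r ^ 2) : ℂ) * ((besselU ν (r * ρ) : ℂ) * f ρ) := by
      intro ρ; simp only [a]; rw [mul_comm ρ r]; push_cast; ring
    simp only [e]
    rw [integral_const_mul, enorm_mul, enorm_complex_ofReal, abs_of_pos (Real.exp_pos _), mul_pow,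
      ← ENNReal.ofReal_pow (Real.exp_pos _).le, ← mul_assoc, ← ENNReal.ofReal_mul (Real.exp_pos _).le,
      ← Real.exp_nat_mul, ← Real.exp_add]
    refine le_mul_of_one_le_left zero_le ?_
    rw [ENNReal.one_le_ofReal]
    refine Real.one_le_exp ?_
    have : s * r ^ 2 ≤ 4 := by
      rw [hs_def, div_mul_eq_mul_div, div_le_iff₀ (by positivity)]
      nlinarith [hr.1, hr.2]
    push_cast
    linarith
  calc _ ≤ ∫⁻ r in Ico R (2 * R), ENNReal.ofReal (Real.exp 4) * ‖∫ ρ, a r ρ * f ρ ∂band‖ₑ ^ 2 :=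
        setLIntegral_mono' measurableSet_Ico hpt
    _ ≤ ∫⁻ r in Ioi (0 : ℝ), ENNReal.ofReal (Real.exp 4) * ‖∫ ρ, a r ρ * f ρ ∂band‖ₑ ^ 2 :=
        lintegral_mono_set fun r hr => hR.trans_le hr.1
    _ ≤ ENNReal.ofReal (Real.exp 4) * (ENNReal.ofReal 20 * ∫⁻ ρ, ‖f ρ‖ₑ ^ 2 ∂band) := by
        rw [lintegral_const_mul' _ _ ENNReal.ofReal_ne_top]
        gcongr
    _ = _ := by
        rw [← mul_assoc, ← ENNReal.ofReal_mul (Real.exp_pos _).le, mul_comm (Real.exp 4)]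

/-! ### Energy estimate: pointwise bounds for x ≥ 4(1+ν). -/

/-- The energy of the Bessel equation in normal form. -/
def besselEnergy (ν x : ℝ) : ℝ :=
  besselDU ν x ^ 2 + (1 - (ν ^ 2 - 1 / 4) / x ^ 2) * besselU ν x ^ 2

theorem hasDerivAt_potential (ν : ℝ) {x : ℝ} (hx : 0 < x) :
    HasDerivAt (fun x : ℝ => (ν ^ 2 - 1 / 4) / x ^ 2) (-2 * (ν ^ 2 - 1 / 4) / x ^ 3) x := by
  have h := ((hasDerivAt_pow 2 x).inv (by positivity)).const_mul (ν ^ 2 - 1 / 4)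
  refine (h.congr_of_eventuallyEq (.of_forall fun y => ?_)).congr_deriv ?_
  · simp [div_eq_mul_inv]
  · field_simp
    norm_num
    ring

theorem hasDerivAt_besselEnergy {ν x : ℝ} (hν : 0 ≤ ν) (hx : 0 < x) :
    HasDerivAt (besselEnergy ν) (2 * (ν ^ 2 - 1 / 4) / x ^ 3 * besselU ν x ^ 2) x := by
  have h := ((hasDerivAt_besselDU hν hx).fun_pow 2).add
    (((hasDerivAt_potential ν hx).const_sub 1).mul ((hasDerivAt_besselU hν hx).fun_pow 2))
  refine h.congr_deriv ?_
  push_cast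
  ring

theorem abs_potential_le {ν x : ℝ} (hν : 0 ≤ ν) (hx : 4 * (1 + ν) ≤ x) :
    |(ν ^ 2 - 1 / 4) / x ^ 2| ≤ 1 / 16 := by
  have hx0 : 0 < x := by linarith
  rw [abs_div, abs_of_pos (by positivity : 0 < x ^ 2), div_le_iff₀ (by positivity), abs_le]
  constructor <;> nlinarith

theorem le_besselEnergy {ν x : ℝ} (hν : 0 ≤ ν) (hx : 4 * (1 + ν) ≤ x) :
    besselDU ν x ^ 2 + 15 / 16 * besselU ν x ^ 2 ≤ besselEnergy ν x := by
  have := (abs_le.mp (abs_potential_le hν hx)).2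
  unfold besselEnergy
  gcongr
  linarith

theorem besselEnergy_le {ν x : ℝ} (hν : 0 ≤ ν) (hx : 4 * (1 + ν) ≤ x) :
    besselEnergy ν x ≤ besselDU ν x ^ 2 + 17 / 16 * besselU ν x ^ 2 := by
  have := (abs_le.mp (abs_potential_le hν hx)).1
  unfold besselEnergy
  gcongr
  linarith

/-- The derivative is the energy plus 2V u² with V = (ν² - 1/4)/x². For x ≥ 4(1+ν) one has |V| ≤
1/16, so the energy, at least (15/16) u², absorbs a possibly negative term of size u²/8. -/
theorem monotoneOn_mul_besselEnergy {ν : ℝ} (hν : 0 ≤ ν) :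
    MonotoneOn (fun x => x * besselEnergy ν x) (Ici (4 * (1 + ν))) := by
  have hd : ∀ x ∈ Ici (4 * (1 + ν)), HasDerivAt (fun x => x * besselEnergy ν x)
      (1 * besselEnergy ν x + x * (2 * (ν ^ 2 - 1 / 4) / x ^ 3 * besselU ν x ^ 2)) x := by
    intro x hx
    have hx' : 4 * (1 + ν) ≤ x := hx
    exact (hasDerivAt_id' x).mul (hasDerivAt_besselEnergy hν (by linarith))
  refine monotoneOn_of_deriv_nonneg (convex_Ici _)
    (fun x hx => (hd x hx).continuousAt.continuousWithinAt)
    (fun x hx => (hd x (interior_subset hx)).differentiableAt.differentiableWithinAt) fun x hx => ?_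
  have hx' : 4 * (1 + ν) ≤ x := interior_subset hx
  have hx0 : 0 < x := by linarith
  rw [(hd x hx').deriv]
  have h1 := (abs_le.mp (abs_potential_le hν hx')).1
  have h2 := le_besselEnergy hν hx'
  have e : x * (2 * (ν ^ 2 - 1 / 4) / x ^ 3 * besselU ν x ^ 2) =
      2 * ((ν ^ 2 - 1 / 4) / x ^ 2) * besselU ν x ^ 2 := by field_simp
  rw [e]
  nlinarith [sq_nonneg (besselU ν x), sq_nonneg (besselDU ν x)]

/-- Monotonicity of x times the energy bounds the energy at X by twice the energy at any point of
(X, 2X]. Averaging over that interval brings in the known L² averages of u and u', so the uniform L²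
information becomes pointwise. -/
theorem besselEnergy_bound {ν X : ℝ} (hν : 0 ≤ ν) (hX : 4 * (1 + ν) ≤ X) :
    besselEnergy ν X ≤ 45 * Real.exp 4 := by
  have hX0 : 0 < X := by linarith
  have hX4 : 4 ≤ X := by linarith
  have hpt : ∀ x ∈ Ioc X (2 * X), ENNReal.ofReal (besselEnergy ν X) ≤
      ENNReal.ofReal 2 * ENNReal.ofReal (besselDU ν (1 * x) ^ 2) +
        ENNReal.ofReal (17 / 8) * ENNReal.ofReal (besselU ν (1 * x) ^ 2) := by
    intro x hx
    have hx' : 4 * (1 + ν) ≤ x := hX.trans hx.1.le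
    rw [one_mul, ← ENNReal.ofReal_mul (by norm_num), ← ENNReal.ofReal_mul (by norm_num),
      ← ENNReal.ofReal_add (by positivity) (by positivity)]
    refine ENNReal.ofReal_le_ofReal ?_
    have h1 : X * besselEnergy ν X ≤ x * besselEnergy ν x :=
      monotoneOn_mul_besselEnergy hν hX hx' hx.1.le
    have h2 := besselEnergy_le hν hx'
    have h3 := le_besselEnergy hν hx'
    have h4 : 0 ≤ besselEnergy ν x := le_trans (by positivity) h3
    have h5 : X * besselEnergy ν X ≤ X * (2 * besselEnergy ν x) := by nlinarith [hx.2]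
    have h6 := le_of_mul_le_mul_left h5 hX0
    linarith
  have hu := measurable_besselU hν
  have hdu := measurable_besselDU hν
  have h1 := setLIntegral_mono' (μ := volume) measurableSet_Ioc hpt
  rw [setLIntegral_const, Real.volume_Ioc, lintegral_add_left (by fun_prop),
    lintegral_const_mul _ (by fun_prop), lintegral_const_mul _ (by fun_prop)] at h1
  have h2 : ∫⁻ x in Ioc X (2 * X), ENNReal.ofReal (besselDU ν (1 * x) ^ 2) ≤
      ENNReal.ofReal ((9 / 2 / 4 ^ 2 + 3) * (5 * Real.exp 4 * X)) :=
    (lintegral_mono_set (Ioc_subset_Ioc_left (by linarith))).trans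
      (lintegral_besselDU_sq hν one_pos hX0 (by norm_num : (0 : ℝ) < 4))
  have h3 : ∫⁻ x in Ioc X (2 * X), ENNReal.ofReal (besselU ν (1 * x) ^ 2) ≤
      ENNReal.ofReal (5 * Real.exp 4 * X) :=
    (lintegral_mono_set (Ioc_subset_Ioc_left hX0.le)).trans (lintegral_besselU_sq hν one_pos hX0)
  have h4 := h1.trans (add_le_add (mul_le_mul_right h2 _) (mul_le_mul_right h3 _))
  have hE : 0 ≤ besselEnergy ν X := le_trans (by positivity) (le_besselEnergy hν hX)
  rw [← ENNReal.ofReal_mul hE, ← ENNReal.ofReal_mul zero_le_two,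
    ← ENNReal.ofReal_mul (by norm_num : (0 : ℝ) ≤ 17 / 8),
    ← ENNReal.ofReal_add (by positivity) (by positivity),
    ENNReal.ofReal_le_ofReal_iff (by positivity)] at h4
  have h5 : besselEnergy ν X * X ≤ 45 * Real.exp 4 * X := by
    nlinarith [mul_pos (Real.exp_pos 4) hX0]
  exact le_of_mul_le_mul_right h5 hX0

/-- The uniform bound for the normalised Bessel functions away from the transition region. -/
def besselM : ℝ := 7 * Real.exp 2

theorem besselM_pos : 0 < besselM := by unfold besselM; positivity

theorem besselM_sq : besselM ^ 2 = 49 * Real.exp 4 := by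
  rw [besselM, mul_pow, ← Real.exp_nat_mul]; norm_num

theorem abs_besselU_le {ν x : ℝ} (hν : 0 ≤ ν) (hx : 4 * (1 + ν) ≤ x) : |besselU ν x| ≤ besselM := by
  refine abs_le_of_sq_le_sq ?_ besselM_pos.le
  rw [besselM_sq]
  nlinarith [le_besselEnergy hν hx, besselEnergy_bound hν hx, sq_nonneg (besselDU ν x), Real.exp_pos 4]

theorem abs_besselDU_le {ν x : ℝ} (hν : 0 ≤ ν) (hx : 4 * (1 + ν) ≤ x) : |besselDU ν x| ≤ besselM := by
  refine abs_le_of_sq_le_sq ?_ besselM_pos.le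
  rw [besselM_sq]
  nlinarith [le_besselEnergy hν hx, besselEnergy_bound hν hx, sq_nonneg (besselU ν x), Real.exp_pos 4]

/-! ### The slowly varying amplitude of u_ν. -/

/-- The amplitude `z_ν(x) = e^{-ix}(u - i u')`, so that `u = Re (e^{ix} z)`. -/
def besselZ (ν x : ℝ) : ℂ :=
  Complex.exp (-(Complex.I * x)) * (besselU ν x - Complex.I * besselDU ν x)

/-- The derivative of `besselZ`. -/
def besselDZ (ν x : ℝ) : ℂ :=
  -Complex.I * Complex.exp (-(Complex.I * x)) * (((ν ^ 2 - 1 / 4) / x ^ 2 * besselU ν x : ℝ) : ℂ)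

/-- The second derivative of `besselZ`. -/
def besselDDZ (ν x : ℝ) : ℂ :=
  -Complex.I * Complex.exp (-(Complex.I * x)) *
    (((-2 * (ν ^ 2 - 1 / 4) / x ^ 3 * besselU ν x + (ν ^ 2 - 1 / 4) / x ^ 2 * besselDU ν x : ℝ) : ℂ) -
      Complex.I * (((ν ^ 2 - 1 / 4) / x ^ 2 * besselU ν x : ℝ) : ℂ))

theorem hasDerivAt_cexp_neg_I (x : ℝ) :
    HasDerivAt (fun x : ℝ => Complex.exp (-(Complex.I * x)))
      (-Complex.I * Complex.exp (-(Complex.I * x))) x := by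
  have h : HasDerivAt (fun x : ℝ => -(Complex.I * (x : ℂ))) (-(Complex.I * 1)) x :=
    ((hasDerivAt_id x).ofReal_comp.const_mul Complex.I).neg
  refine h.cexp.congr_deriv ?_
  ring

/-- If u'' + u were zero, the amplitude would be constant. Hence only the term with the potential
(ν² - 1/4)/x² survives. -/
theorem hasDerivAt_besselZ {ν x : ℝ} (hν : 0 ≤ ν) (hx : 0 < x) :
    HasDerivAt (besselZ ν) (besselDZ ν x) x := by
  have h := (hasDerivAt_cexp_neg_I x).mul ((hasDerivAt_besselU hν hx).ofReal_comp.sub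
    ((hasDerivAt_besselDU hν hx).ofReal_comp.const_mul Complex.I))
  refine h.congr_deriv ?_
  rw [besselDZ, Pi.sub_apply]
  push_cast
  linear_combination (Complex.exp (-(Complex.I * x)) * besselDU ν x) * Complex.I_sq

theorem hasDerivAt_besselDZ {ν x : ℝ} (hν : 0 ≤ ν) (hx : 0 < x) :
    HasDerivAt (besselDZ ν) (besselDDZ ν x) x := by
  have h := ((hasDerivAt_cexp_neg_I x).const_mul (-Complex.I)).mul
    ((hasDerivAt_potential ν hx).mul (hasDerivAt_besselU hν hx)).ofReal_comp
  refine h.congr_deriv ?_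
  rw [besselDDZ]
  simp only [Pi.mul_apply]
  push_cast
  ring

theorem norm_cexp_neg_I (x : ℝ) : ‖Complex.exp (-(Complex.I * x))‖ = 1 := by
  rw [show -(Complex.I * x) = ((-x : ℝ) : ℂ) * Complex.I by push_cast; ring,
    Complex.norm_exp_ofReal_mul_I]

theorem norm_besselZ_le {ν x : ℝ} (hν : 0 ≤ ν) (hx : 4 * (1 + ν) ≤ x) :
    ‖besselZ ν x‖ ≤ 2 * besselM := by
  rw [besselZ, norm_mul, norm_cexp_neg_I, one_mul]
  refine (norm_sub_le _ _).trans ?_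
  rw [norm_mul, Complex.norm_I, one_mul, Complex.norm_real, Complex.norm_real]
  have h1 := abs_besselU_le hν hx
  have h2 := abs_besselDU_le hν hx
  rw [← Real.norm_eq_abs] at h1 h2
  linarith

theorem abs_sq_sub_quarter_le {ν : ℝ} (hν : 0 ≤ ν) : |ν ^ 2 - 1 / 4| ≤ (1 + ν) ^ 2 := by
  rw [abs_le]; constructor <;> nlinarith

theorem norm_besselDZ_le {ν x : ℝ} (hν : 0 ≤ ν) (hx : 4 * (1 + ν) ≤ x) :
    ‖besselDZ ν x‖ ≤ besselM * ((1 + ν) ^ 2 / x ^ 2) := by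
  have hx0 : 0 < x := by linarith
  rw [besselDZ, norm_mul, norm_mul, norm_neg, Complex.norm_I, norm_cexp_neg_I, one_mul, one_mul,
    Complex.norm_real, Real.norm_eq_abs, abs_mul, abs_div, abs_of_pos (by positivity : 0 < x ^ 2), mul_comm]
  have := besselM_pos
  gcongr
  · exact abs_besselU_le hν hx
  · exact abs_sq_sub_quarter_le hν

/-- A second derivative gains no further decay, because the first derivative contains e^{-ix} u and
u itself oscillates. All terms therefore have the order (1+ν)²/x² already present in the first
derivative. -/
theorem norm_besselDDZ_le {ν x : ℝ} (hν : 0 ≤ ν) (hx : 4 * (1 + ν) ≤ x) :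
    ‖besselDDZ ν x‖ ≤ 3 * besselM * ((1 + ν) ^ 2 / x ^ 2) := by
  have hx0 : 0 < x := by linarith
  have hM := besselM_pos
  have hq := abs_sq_sub_quarter_le hν
  have h1 := abs_besselU_le hν hx
  have h2 := abs_besselDU_le hν hx
  have hV : |(ν ^ 2 - 1 / 4) / x ^ 2| ≤ (1 + ν) ^ 2 / x ^ 2 := by
    rw [abs_div, abs_of_pos (by positivity : 0 < x ^ 2)]
    gcongr
  have hV' : |-2 * (ν ^ 2 - 1 / 4) / x ^ 3| ≤ (1 + ν) ^ 2 / x ^ 2 := by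
    have e : -2 * (ν ^ 2 - 1 / 4) / x ^ 3 = (ν ^ 2 - 1 / 4) / x ^ 2 * (-2 / x) := by field_simp
    rw [e, abs_mul]
    have : |(-2 : ℝ) / x| ≤ 1 := by
      rw [abs_div, abs_neg, abs_of_pos hx0, div_le_one hx0, abs_two]; linarith
    calc _ ≤ (1 + ν) ^ 2 / x ^ 2 * 1 := by gcongr
      _ = _ := mul_one _
  have b1 : |-2 * (ν ^ 2 - 1 / 4) / x ^ 3 * besselU ν x| ≤ (1 + ν) ^ 2 / x ^ 2 * besselM := by
    rw [abs_mul]; gcongr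
  have b2 : |(ν ^ 2 - 1 / 4) / x ^ 2 * besselDU ν x| ≤ (1 + ν) ^ 2 / x ^ 2 * besselM := by
    rw [abs_mul]; gcongr
  have b3 : |(ν ^ 2 - 1 / 4) / x ^ 2 * besselU ν x| ≤ (1 + ν) ^ 2 / x ^ 2 * besselM := by
    rw [abs_mul]; gcongr
  rw [besselDDZ, norm_mul, norm_mul, norm_neg, Complex.norm_I, norm_cexp_neg_I, one_mul, one_mul]
  refine (norm_sub_le _ _).trans ?_
  rw [norm_mul, Complex.norm_I, one_mul, Complex.norm_real, Complex.norm_real, Real.norm_eq_abs,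
    Real.norm_eq_abs]
  have := (abs_add_le (-2 * (ν ^ 2 - 1 / 4) / x ^ 3 * besselU ν x)
    ((ν ^ 2 - 1 / 4) / x ^ 2 * besselDU ν x))
  linarith

open scoped ComplexConjugate in
theorem besselU_eq_besselZ (ν x : ℝ) :
    (besselU ν x : ℂ) = (1 / 2) * (Complex.exp (Complex.I * x) * besselZ ν x +
      Complex.exp (-(Complex.I * x)) * conj (besselZ ν x)) := by
  have h1 : Complex.exp (Complex.I * x) * Complex.exp (-(Complex.I * x)) = 1 := by
    rw [← Complex.exp_add]; simp
  have h2 : conj (Complex.exp (-(Complex.I * x))) = Complex.exp (Complex.I * x) := by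
    rw [← Complex.exp_conj]; simp
  rw [besselZ, map_mul, map_sub, map_mul, h2, Complex.conj_I, Complex.conj_ofReal, Complex.conj_ofReal]
  linear_combination (-besselU ν x : ℂ) * h1

/-! ### Oscillatory integrals: derivative tests and van der Corput's lemma. -/

/-- The amplitude produced by one integration by parts in an oscillatory integral. -/
def oscAmp (φ' φ'' : ℝ → ℝ) (g g' : ℝ → ℂ) (x : ℝ) : ℂ :=
  (g' x / φ' x - g x * φ'' x / (φ' x : ℂ) ^ 2) / Complex.I

theorem norm_cexp_I_mul (x : ℝ) : ‖Complex.exp (Complex.I * x)‖ = 1 := by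
  rw [mul_comm, Complex.norm_exp_ofReal_mul_I]

theorem osc_integral_by_parts {a b : ℝ} (hab : a ≤ b) {φ φ' φ'' : ℝ → ℝ} {g g' : ℝ → ℂ}
    (h1 : ∀ x ∈ Icc a b, HasDerivAt φ (φ' x) x) (h2 : ∀ x ∈ Icc a b, HasDerivAt φ' (φ'' x) x)
    (hg : ∀ x ∈ Icc a b, HasDerivAt g (g' x) x) (h0 : ∀ x ∈ Icc a b, φ' x ≠ 0)
    (hc : ContinuousOn φ'' (Icc a b)) (hcg : ContinuousOn g' (Icc a b)) :
    ContinuousOn (oscAmp φ' φ'' g g') (Icc a b) ∧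
    ∫ x in a..b, Complex.exp (Complex.I * φ x) * g x =
      Complex.exp (Complex.I * φ b) * (g b / (Complex.I * φ' b)) -
        Complex.exp (Complex.I * φ a) * (g a / (Complex.I * φ' a)) -
        ∫ x in a..b, Complex.exp (Complex.I * φ x) * oscAmp φ' φ'' g g' x := by
  have c1 : ContinuousOn φ (Icc a b) := fun x hx => (h1 x hx).continuousAt.continuousWithinAt
  have c2 : ContinuousOn φ' (Icc a b) := fun x hx => (h2 x hx).continuousAt.continuousWithinAt
  have c3 : ContinuousOn g (Icc a b) := fun x hx => (hg x hx).continuousAt.continuousWithinAt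
  have o : ∀ {f : ℝ → ℝ}, ContinuousOn f (Icc a b) → ContinuousOn (fun x => (f x : ℂ)) (Icc a b) :=
    fun hf => Complex.continuous_ofReal.comp_continuousOn hf
  have h0' : ∀ x ∈ Icc a b, (φ' x : ℂ) ≠ 0 := fun x hx => Complex.ofReal_ne_zero.mpr (h0 x hx)
  have hamp : ContinuousOn (oscAmp φ' φ'' g g') (Icc a b) :=
    ((hcg.div (o c2) h0').sub ((c3.mul (o hc)).div ((o c2).pow 2)
      fun x hx => pow_ne_zero 2 (h0' x hx))).div_const _
  refine ⟨hamp, ?_⟩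
  have cE : ContinuousOn (fun x => Complex.exp (Complex.I * φ x)) (Icc a b) :=
    Complex.continuous_exp.comp_continuousOn (continuousOn_const.mul (o c1))
  have hu : uIcc a b = Icc a b := uIcc_of_le hab
  have i1 : IntervalIntegrable (fun x => Complex.exp (Complex.I * φ x) * g x) volume a b :=
    (hu ▸ cE.mul c3).intervalIntegrable
  have i2 : IntervalIntegrable (fun x => Complex.exp (Complex.I * φ x) * oscAmp φ' φ'' g g' x) volume a b :=
    (hu ▸ cE.mul hamp).intervalIntegrable
  have hF : ∀ x ∈ uIcc a b, HasDerivAt (fun x => Complex.exp (Complex.I * φ x) * (g x / (Complex.I * φ' x)))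
      (Complex.exp (Complex.I * φ x) * g x + Complex.exp (Complex.I * φ x) * oscAmp φ' φ'' g g' x) x := by
    intro x hx
    rw [hu] at hx
    have d1 := ((h1 x hx).ofReal_comp.const_mul Complex.I).cexp
    have d2 := (h2 x hx).ofReal_comp.const_mul Complex.I
    have n := h0' x hx
    have d3 := (hg x hx).div d2 (mul_ne_zero Complex.I_ne_zero n)
    refine (d1.mul d3).congr_deriv ?_
    have hI := Complex.I_ne_zero
    simp only [oscAmp, Pi.div_apply]
    field_simp
  have := intervalIntegral.integral_eq_sub_of_hasDerivAt hF (i1.add i2)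
  rw [intervalIntegral.integral_add i1 i2] at this
  linear_combination this

theorem norm_oscAmp_le {φ' φ'' : ℝ → ℝ} {g g' : ℝ → ℂ} {x δ G1 : ℝ} (hδ : 0 < δ) (h : δ ≤ |φ' x|)
    (hG1 : ‖g' x‖ ≤ G1) :
    ‖oscAmp φ' φ'' g g' x‖ ≤ G1 / δ + ‖g x‖ * (|φ'' x| / φ' x ^ 2) := by
  rw [oscAmp, norm_div, Complex.norm_I, div_one]
  refine (norm_sub_le _ _).trans ?_
  rw [norm_div, norm_div, norm_mul, norm_pow, Complex.norm_real, Complex.norm_real, Real.norm_eq_abs,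
    Real.norm_eq_abs, sq_abs, mul_div_assoc]
  gcongr
  exact (norm_nonneg _).trans hG1

/-- The first derivative test for oscillatory integrals. -/
theorem osc_integral_first {a b : ℝ} (hab : a ≤ b) {φ φ' φ'' : ℝ → ℝ} {g g' : ℝ → ℂ}
    (h1 : ∀ x ∈ Icc a b, HasDerivAt φ (φ' x) x) (h2 : ∀ x ∈ Icc a b, HasDerivAt φ' (φ'' x) x)
    (hg : ∀ x ∈ Icc a b, HasDerivAt g (g' x) x) {δ G0 G1 P : ℝ} (hδ : 0 < δ)
    (h0 : ∀ x ∈ Icc a b, δ ≤ |φ' x|)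
    (hc : ContinuousOn φ'' (Icc a b)) (hcg : ContinuousOn g' (Icc a b))
    (hG0 : ∀ x ∈ Icc a b, ‖g x‖ ≤ G0) (hG1 : ∀ x ∈ Icc a b, ‖g' x‖ ≤ G1)
    (hP : ∫ x in a..b, |φ'' x| / φ' x ^ 2 ≤ P) :
    ‖∫ x in a..b, Complex.exp (Complex.I * φ x) * g x‖ ≤ 2 * G0 / δ + (b - a) * G1 / δ + G0 * P := by
  have hne : ∀ x ∈ Icc a b, φ' x ≠ 0 := fun x hx h => by
    have := h0 x hx; rw [h, abs_zero] at this; linarith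
  obtain ⟨-, e⟩ := osc_integral_by_parts hab h1 h2 hg hne hc hcg
  have c2 : ContinuousOn φ' (Icc a b) := fun x hx => (h2 x hx).continuousAt.continuousWithinAt
  have hG0n : 0 ≤ G0 := (norm_nonneg _).trans (hG0 a (left_mem_Icc.mpr hab))
  have hbd : ∀ x ∈ Icc a b, ‖Complex.exp (Complex.I * φ x) * (g x / (Complex.I * φ' x))‖ ≤ G0 / δ := by
    intro x hx
    rw [norm_mul, norm_cexp_I_mul, one_mul, norm_div, norm_mul, Complex.norm_I, one_mul,
      Complex.norm_real, Real.norm_eq_abs]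
    exact div_le_div₀ hG0n (hG0 x hx) hδ (h0 x hx)
  have ci : ContinuousOn (fun x => |φ'' x| / φ' x ^ 2) (Icc a b) :=
    hc.abs.div (c2.pow 2) fun x hx => pow_ne_zero 2 (hne x hx)
  have ii : IntervalIntegrable (fun x => |φ'' x| / φ' x ^ 2) volume a b :=
    ((uIcc_of_le hab).symm ▸ ci).intervalIntegrable
  have hlast : ‖∫ x in a..b, Complex.exp (Complex.I * φ x) * oscAmp φ' φ'' g g' x‖ ≤
      (b - a) * G1 / δ + G0 * P := by
    refine (intervalIntegral.norm_integral_le_of_norm_le hab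
      (g := fun x => G1 / δ + G0 * (|φ'' x| / φ' x ^ 2)) (.of_forall fun x hx => ?_)
      (intervalIntegrable_const.add (ii.const_mul _))).trans ?_
    · have hx' := Ioc_subset_Icc_self hx
      rw [norm_mul, norm_cexp_I_mul, one_mul]
      refine (norm_oscAmp_le hδ (h0 x hx') (hG1 x hx')).trans ?_
      gcongr
      exact hG0 x hx'
    · rw [intervalIntegral.integral_add intervalIntegrable_const (ii.const_mul _),
        intervalIntegral.integral_const, intervalIntegral.integral_const_mul, smul_eq_mul]
      rw [mul_div_assoc]
      gcongr
  rw [e]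
  refine (norm_sub_le _ _).trans ?_
  have t := norm_sub_le (Complex.exp (Complex.I * φ b) * (g b / (Complex.I * φ' b)))
    (Complex.exp (Complex.I * φ a) * (g a / (Complex.I * φ' a)))
  have hb := hbd b (right_mem_Icc.mpr hab)
  have ha := hbd a (left_mem_Icc.mpr hab)
  have e2 : 2 * G0 / δ = G0 / δ + G0 / δ := by ring
  linarith

/-- The first derivative test for a monotone derivative. -/
theorem osc_integral_first_monotone {a b : ℝ} (hab : a ≤ b) {φ φ' φ'' : ℝ → ℝ} {g g' : ℝ → ℂ}
    (h1 : ∀ x ∈ Icc a b, HasDerivAt φ (φ' x) x) (h2 : ∀ x ∈ Icc a b, HasDerivAt φ' (φ'' x) x)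
    (hg : ∀ x ∈ Icc a b, HasDerivAt g (g' x) x) {δ G0 G1 : ℝ} (hδ : 0 < δ)
    (h0 : (∀ x ∈ Icc a b, δ ≤ φ' x) ∨ (∀ x ∈ Icc a b, φ' x ≤ -δ)) (hpos : ∀ x ∈ Icc a b, 0 ≤ φ'' x)
    (hc : ContinuousOn φ'' (Icc a b)) (hcg : ContinuousOn g' (Icc a b))
    (hG0 : ∀ x ∈ Icc a b, ‖g x‖ ≤ G0) (hG1 : ∀ x ∈ Icc a b, ‖g' x‖ ≤ G1) :
    ‖∫ x in a..b, Complex.exp (Complex.I * φ x) * g x‖ ≤ (3 * G0 + (b - a) * G1) / δ := by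
  have h0' : ∀ x ∈ Icc a b, δ ≤ |φ' x| := by
    rcases h0 with h | h
    · exact fun x hx => (h x hx).trans (le_abs_self _)
    · exact fun x hx => by have := h x hx; have := neg_le_abs (φ' x); linarith
  have hne : ∀ x ∈ Icc a b, φ' x ≠ 0 := fun x hx h => by
    have := h0' x hx; rw [h, abs_zero] at this; linarith
  have c2 : ContinuousOn φ' (Icc a b) := fun x hx => (h2 x hx).continuousAt.continuousWithinAt
  have hu : uIcc a b = Icc a b := uIcc_of_le hab
  have hP : ∫ x in a..b, |φ'' x| / φ' x ^ 2 ≤ 1 / δ := by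
    have e : ∫ x in a..b, |φ'' x| / φ' x ^ 2 = -(φ' b)⁻¹ - -(φ' a)⁻¹ := by
      refine intervalIntegral.integral_eq_sub_of_hasDerivAt (f := fun x => -(φ' x)⁻¹) (fun x hx => ?_) ?_
      · rw [hu] at hx
        refine ((h2 x hx).inv (hne x hx)).neg.congr_deriv ?_
        rw [abs_of_nonneg (hpos x hx)]; ring
      · exact (hu ▸ (hc.abs.div (c2.pow 2) fun x hx => pow_ne_zero 2 (hne x hx))).intervalIntegrable
    rw [e]
    have ma := left_mem_Icc.mpr hab
    have mb := right_mem_Icc.mpr hab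
    rcases h0 with h | h
    · have p1 : 0 < (φ' b)⁻¹ := inv_pos.mpr (hδ.trans_le (h b mb))
      have p2 : (φ' a)⁻¹ ≤ 1 / δ := by rw [one_div]; exact inv_anti₀ hδ (h a ma)
      linarith
    · have p1 : (φ' a)⁻¹ < 0 := inv_lt_zero.mpr (by linarith [h a ma])
      have p2 : (-(φ' b))⁻¹ ≤ 1 / δ := by rw [one_div]; exact inv_anti₀ hδ (by linarith [h b mb])
      rw [inv_neg] at p2
      linarith
  refine (osc_integral_first hab h1 h2 hg hδ h0' hc hcg hG0 hG1 hP).trans (le_of_eq ?_)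
  field_simp
  ring

/-- Since φ' increases with slope at least lam, c is its zero if there is one, and otherwise the
endpoint where |φ'| is smallest. Away from c the derivative grows at least linearly. -/
theorem exists_center {a b lam : ℝ} (hab : a ≤ b) {φ' φ'' : ℝ → ℝ}
    (h2 : ∀ x ∈ Icc a b, HasDerivAt φ' (φ'' x) x) (hlow : ∀ x ∈ Icc a b, lam ≤ φ'' x) :
    ∃ c ∈ Icc a b, ∀ x ∈ Icc a b, (c < x → lam * (x - c) ≤ φ' x) ∧ (x < c → φ' x ≤ -(lam * (c - x))) := by
  have c2 : ContinuousOn φ' (Icc a b) := fun x hx => (h2 x hx).continuousAt.continuousWithinAt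
  have hmono : ∀ x ∈ Icc a b, ∀ y ∈ Icc a b, x ≤ y → lam * (y - x) ≤ φ' y - φ' x := by
    refine (convex_Icc a b).mul_sub_le_image_sub_of_le_deriv c2
      (fun x hx => (h2 x (interior_subset hx)).differentiableAt.differentiableWithinAt) fun x hx => ?_
    rw [(h2 x (interior_subset hx)).deriv]
    exact hlow x (interior_subset hx)
  have ma := left_mem_Icc.mpr hab
  have mb := right_mem_Icc.mpr hab
  rcases le_or_gt 0 (φ' a) with h | h
  · refine ⟨a, ma, fun x hx => ⟨fun hcx => ?_, fun hxc => absurd hx.1 (not_le.mpr hxc)⟩⟩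
    linarith [hmono a ma x hx hcx.le]
  rcases le_or_gt (φ' b) 0 with h' | h'
  · refine ⟨b, mb, fun x hx => ⟨fun hcx => absurd hx.2 (not_le.mpr hcx), fun hxc => ?_⟩⟩
    linarith [hmono x hx b mb hxc.le]
  obtain ⟨c, hc, hc0⟩ := intermediate_value_Icc hab c2 (show (0 : ℝ) ∈ Icc (φ' a) (φ' b) from ⟨h.le, h'.le⟩)
  refine ⟨c, hc, fun x hx => ⟨fun hcx => ?_, fun hxc => ?_⟩⟩
  · linarith [hmono c hc x hx hcx.le]
  · linarith [hmono x hx c hc hxc.le]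

theorem van_der_corput_pos {a b lam : ℝ} (hab : a ≤ b) {φ φ' φ'' : ℝ → ℝ} {g g' : ℝ → ℂ}
    (h1 : ∀ x ∈ Icc a b, HasDerivAt φ (φ' x) x) (h2 : ∀ x ∈ Icc a b, HasDerivAt φ' (φ'' x) x)
    (hg : ∀ x ∈ Icc a b, HasDerivAt g (g' x) x) {G0 G1 : ℝ} (hlam : 0 < lam)
    (hlow : ∀ x ∈ Icc a b, lam ≤ φ'' x) (hc : ContinuousOn φ'' (Icc a b))
    (hcg : ContinuousOn g' (Icc a b))
    (hG0 : ∀ x ∈ Icc a b, ‖g x‖ ≤ G0) (hG1 : ∀ x ∈ Icc a b, ‖g' x‖ ≤ G1) :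
    ‖∫ x in a..b, Complex.exp (Complex.I * φ x) * g x‖ ≤ (8 * G0 + 2 * (b - a) * G1) / √lam := by
  obtain ⟨c, hcm, hcc⟩ := exists_center hab h2 hlow
  have hs : 0 < √lam := Real.sqrt_pos.mpr hlam
  have hss : √lam * √lam = lam := Real.mul_self_sqrt hlam.le
  -- The radius lam^{-1/2} balances the trivial bound 2 G0 η near c against the first derivative
  -- test outside, where |φ'| ≥ lam η = √lam. The factor 8 is 3 + 2 + 3.
  obtain ⟨η, hη⟩ : ∃ η, η = 1 / √lam := ⟨_, rfl⟩
  have hη0 : 0 < η := by rw [hη]; positivity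
  have hlη : lam * η = √lam := by rw [hη, mul_one_div, div_eq_iff hs.ne', hss]
  have ma := left_mem_Icc.mpr hab
  have hG0n : 0 ≤ G0 := (norm_nonneg _).trans (hG0 a ma)
  have hG1n : 0 ≤ G1 := (norm_nonneg _).trans (hG1 a ma)
  have c1 : ContinuousOn φ (Icc a b) := fun x hx => (h1 x hx).continuousAt.continuousWithinAt
  have c3 : ContinuousOn g (Icc a b) := fun x hx => (hg x hx).continuousAt.continuousWithinAt
  have cF : ContinuousOn (fun x => Complex.exp (Complex.I * φ x) * g x) (Icc a b) :=
    (Complex.continuous_exp.comp_continuousOn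
      (continuousOn_const.mul (Complex.continuous_ofReal.comp_continuousOn c1))).mul c3
  have ii : ∀ {u v : ℝ}, u ∈ Icc a b → v ∈ Icc a b →
      IntervalIntegrable (fun x => Complex.exp (Complex.I * φ x) * g x) volume u v := fun hu hv =>
    (cF.mono (uIcc_subset_Icc hu hv)).intervalIntegrable
  set u := max a (c - η) with hu
  set v := min b (c + η) with hv
  have hau : a ≤ u := le_max_left _ _
  have huc : u ≤ c := max_le hcm.1 (by linarith)
  have hcv : c ≤ v := le_min hcm.2 (by linarith)
  have hvb : v ≤ b := min_le_left _ _
  have um : u ∈ Icc a b := ⟨hau, huc.trans hcm.2⟩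
  have vm : v ∈ Icc a b := ⟨hcm.1.trans hcv, hvb⟩
  have mb := right_mem_Icc.mpr hab
  have left : ‖∫ x in a..u, Complex.exp (Complex.I * φ x) * g x‖ ≤ (3 * G0 + (b - a) * G1) / √lam := by
    rcases eq_or_lt_of_le hau with h | h
    · rw [← h, intervalIntegral.integral_same, norm_zero]
      have : 0 ≤ b - a := by linarith
      positivity
    have hue : u = c - η := by
      rcases max_choice a (c - η) with h' | h'
      · rw [hu, h'] at h; exact absurd h (lt_irrefl _)
      · rw [hu, h']
    have hsub : Icc a u ⊆ Icc a b := Icc_subset_Icc_right um.2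
    refine (osc_integral_first_monotone hau (fun x hx => h1 x (hsub hx)) (fun x hx => h2 x (hsub hx))
      (fun x hx => hg x (hsub hx)) hs (Or.inr fun x hx => ?_)
      (fun x hx => hlam.le.trans (hlow x (hsub hx))) (hc.mono hsub) (hcg.mono hsub)
      (fun x hx => hG0 x (hsub hx)) (fun x hx => hG1 x (hsub hx))).trans ?_
    · have hxc : x ≤ c - η := hue ▸ hx.2
      have := (hcc x (hsub hx)).2 (by linarith)
      nlinarith
    · gcongr
      exact um.2
  have right : ‖∫ x in v..b, Complex.exp (Complex.I * φ x) * g x‖ ≤ (3 * G0 + (b - a) * G1) / √lam := by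
    rcases eq_or_lt_of_le hvb with h | h
    · rw [h, intervalIntegral.integral_same, norm_zero]
      have : 0 ≤ b - a := by linarith
      positivity
    have hve : v = c + η := by
      rcases min_choice b (c + η) with h' | h'
      · rw [hv, h'] at h; exact absurd h (lt_irrefl _)
      · rw [hv, h']
    have hsub : Icc v b ⊆ Icc a b := Icc_subset_Icc_left vm.1
    refine (osc_integral_first_monotone hvb (fun x hx => h1 x (hsub hx)) (fun x hx => h2 x (hsub hx))
      (fun x hx => hg x (hsub hx)) hs (Or.inl fun x hx => ?_)
      (fun x hx => hlam.le.trans (hlow x (hsub hx))) (hc.mono hsub) (hcg.mono hsub)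
      (fun x hx => hG0 x (hsub hx)) (fun x hx => hG1 x (hsub hx))).trans ?_
    · have hxc : c + η ≤ x := hve ▸ hx.1
      have := (hcc x (hsub hx)).1 (by linarith)
      nlinarith
    · gcongr
      exact vm.1
  have mid : ‖∫ x in u..v, Complex.exp (Complex.I * φ x) * g x‖ ≤ 2 * G0 / √lam := by
    have huv : u ≤ v := huc.trans hcv
    refine (intervalIntegral.norm_integral_le_of_norm_le_const (C := G0) fun x hx => ?_).trans ?_
    · rw [uIoc_of_le huv] at hx
      rw [norm_mul, norm_cexp_I_mul, one_mul]
      exact hG0 x ⟨hau.trans hx.1.le, hx.2.trans hvb⟩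
    · rw [abs_of_nonneg (by linarith)]
      have e1 : c - η ≤ u := le_max_right _ _
      have e2 : v ≤ c + η := min_le_right _ _
      have : 2 * G0 / √lam = G0 * (2 * η) := by rw [hη]; ring
      rw [this]
      gcongr
      linarith
  rw [← intervalIntegral.integral_add_adjacent_intervals (ii ma um) (ii um mb),
    ← intervalIntegral.integral_add_adjacent_intervals (ii um vm) (ii vm mb)]
  refine (norm_add_le _ _).trans ((add_le_add left ((norm_add_le _ _).trans (add_le_add mid right))).trans
    (le_of_eq ?_))
  ring

open scoped ComplexConjugate in
/-- The van der Corput lemma for the second derivative, with an amplitude. -/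
theorem van_der_corput {a b lam : ℝ} (hab : a ≤ b) {φ φ' φ'' : ℝ → ℝ} {g g' : ℝ → ℂ}
    (h1 : ∀ x ∈ Icc a b, HasDerivAt φ (φ' x) x) (h2 : ∀ x ∈ Icc a b, HasDerivAt φ' (φ'' x) x)
    (hg : ∀ x ∈ Icc a b, HasDerivAt g (g' x) x) {G0 G1 : ℝ} (hlam : 0 < lam)
    (hlow : (∀ x ∈ Icc a b, lam ≤ φ'' x) ∨ (∀ x ∈ Icc a b, φ'' x ≤ -lam))
    (hc : ContinuousOn φ'' (Icc a b)) (hcg : ContinuousOn g' (Icc a b))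
    (hG0 : ∀ x ∈ Icc a b, ‖g x‖ ≤ G0) (hG1 : ∀ x ∈ Icc a b, ‖g' x‖ ≤ G1) :
    ‖∫ x in a..b, Complex.exp (Complex.I * φ x) * g x‖ ≤ (8 * G0 + 2 * (b - a) * G1) / √lam := by
  rcases hlow with hlow | hlow
  · exact van_der_corput_pos hab h1 h2 hg hlam hlow hc hcg hG0 hG1
  -- Complex conjugation changes the sign of the phase and preserves the modulus, so a negative
  -- second derivative reduces to a positive one.
  have key := van_der_corput_pos (φ := fun x => -φ x) (φ' := fun x => -φ' x) (φ'' := fun x => -φ'' x)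
    (g := fun x => conj (g x)) (g' := fun x => conj (g' x)) hab (fun x hx => (h1 x hx).neg)
    (fun x hx => (h2 x hx).neg) (fun x hx => (hg x hx).star) hlam
    (fun x hx => by have := hlow x hx; linarith) hc.neg (Complex.continuous_conj.comp_continuousOn hcg)
    (fun x hx => by rw [RCLike.norm_conj]; exact hG0 x hx)
    (fun x hx => by rw [RCLike.norm_conj]; exact hG1 x hx)
  refine le_trans (le_of_eq ?_) key
  rw [← RCLike.norm_conj, intervalIntegral.integral_of_le hab, intervalIntegral.integral_of_le hab,
    ← integral_conj]
  congr 2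
  ext x
  rw [map_mul, ← Complex.exp_conj]
  simp

/-- The derivative of `oscAmp`. -/
def oscAmpDeriv (φ' φ'' φ''' : ℝ → ℝ) (g g' g'' : ℝ → ℂ) (x : ℝ) : ℂ :=
  (g'' x / φ' x - 2 * (g' x * φ'' x / (φ' x : ℂ) ^ 2) - g x * φ''' x / (φ' x : ℂ) ^ 2 +
    2 * (g x * (φ'' x : ℂ) ^ 2 / (φ' x : ℂ) ^ 3)) / Complex.I

theorem hasDerivAt_oscAmp {φ' φ'' φ''' : ℝ → ℝ} {g g' g'' : ℝ → ℂ} {x : ℝ}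
    (h2 : HasDerivAt φ' (φ'' x) x) (h3 : HasDerivAt φ'' (φ''' x) x)
    (hg : HasDerivAt g (g' x) x) (hg' : HasDerivAt g' (g'' x) x) (h0 : φ' x ≠ 0) :
    HasDerivAt (oscAmp φ' φ'' g g') (oscAmpDeriv φ' φ'' φ''' g g' g'' x) x := by
  have n : (φ' x : ℂ) ≠ 0 := Complex.ofReal_ne_zero.mpr h0
  have d2 := h2.ofReal_comp
  have d3 := h3.ofReal_comp
  have := ((hg'.div d2 n).sub ((hg.mul d3).div (d2.fun_pow 2) (pow_ne_zero 2 n))).div_const Complex.I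
  refine this.congr_deriv ?_
  rw [oscAmpDeriv]
  have hI := Complex.I_ne_zero
  simp only [Pi.mul_apply]
  push_cast
  field_simp
  ring

/-- Two integrations by parts in an oscillatory integral with compactly supported amplitude. -/
theorem osc_integral_second {a b : ℝ} (hab : a ≤ b) {φ φ' φ'' φ''' : ℝ → ℝ} {g g' g'' : ℝ → ℂ}
    (h1 : ∀ x ∈ Icc a b, HasDerivAt φ (φ' x) x) (h2 : ∀ x ∈ Icc a b, HasDerivAt φ' (φ'' x) x)
    (h3 : ∀ x ∈ Icc a b, HasDerivAt φ'' (φ''' x) x)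
    (hg : ∀ x ∈ Icc a b, HasDerivAt g (g' x) x) (hg' : ∀ x ∈ Icc a b, HasDerivAt g' (g'' x) x)
    (hc : ContinuousOn φ''' (Icc a b)) (hcg : ContinuousOn g'' (Icc a b))
    (hga : g a = 0) (hgb : g b = 0) (hga' : g' a = 0) (hgb' : g' b = 0)
    {δ κ G0 G1 G2 : ℝ} (hδ : 0 < δ) (h0 : ∀ x ∈ Icc a b, δ ≤ |φ' x|)
    (hk2 : ∀ x ∈ Icc a b, |φ'' x| ≤ κ * δ) (hk3 : ∀ x ∈ Icc a b, |φ''' x| ≤ κ * δ)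
    (hG0 : ∀ x ∈ Icc a b, ‖g x‖ ≤ G0) (hG1 : ∀ x ∈ Icc a b, ‖g' x‖ ≤ G1)
    (hG2 : ∀ x ∈ Icc a b, ‖g'' x‖ ≤ G2) :
    ‖∫ x in a..b, Complex.exp (Complex.I * φ x) * g x‖ ≤
      (b - a) * ((G2 + 3 * κ * G1 + (κ + 3 * κ ^ 2) * G0) / δ ^ 2) := by
  have hne : ∀ x ∈ Icc a b, φ' x ≠ 0 := fun x hx h => by
    have := h0 x hx; rw [h, abs_zero] at this; linarith
  have ma := left_mem_Icc.mpr hab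
  have hG0n : 0 ≤ G0 := (norm_nonneg _).trans (hG0 a ma)
  have hG1n : 0 ≤ G1 := (norm_nonneg _).trans (hG1 a ma)
  have hG2n : 0 ≤ G2 := (norm_nonneg _).trans (hG2 a ma)
  have hκ : 0 ≤ κ := by
    have := (abs_nonneg _).trans (hk2 a ma)
    exact nonneg_of_mul_nonneg_left this hδ
  have c2 : ContinuousOn φ' (Icc a b) := fun x hx => (h2 x hx).continuousAt.continuousWithinAt
  have c3 : ContinuousOn φ'' (Icc a b) := fun x hx => (h3 x hx).continuousAt.continuousWithinAt
  have cg : ContinuousOn g (Icc a b) := fun x hx => (hg x hx).continuousAt.continuousWithinAt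
  have cg' : ContinuousOn g' (Icc a b) := fun x hx => (hg' x hx).continuousAt.continuousWithinAt
  have o : ∀ {f : ℝ → ℝ}, ContinuousOn f (Icc a b) → ContinuousOn (fun x => (f x : ℂ)) (Icc a b) :=
    fun hf => Complex.continuous_ofReal.comp_continuousOn hf
  have n : ∀ k : ℕ, ∀ x ∈ Icc a b, (φ' x : ℂ) ^ k ≠ 0 := fun k x hx =>
    pow_ne_zero k (Complex.ofReal_ne_zero.mpr (hne x hx))
  have cD : ContinuousOn (oscAmpDeriv φ' φ'' φ''' g g' g'') (Icc a b) :=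
    ((((hcg.div (o c2) fun x hx => Complex.ofReal_ne_zero.mpr (hne x hx)).sub
      (continuousOn_const.mul ((cg'.mul (o c3)).div ((o c2).pow 2) (n 2)))).sub
      ((cg.mul (o hc)).div ((o c2).pow 2) (n 2))).add
      (continuousOn_const.mul ((cg.mul ((o c3).pow 2)).div ((o c2).pow 3) (n 3)))).div_const _
  obtain ⟨-, e1⟩ := osc_integral_by_parts hab h1 h2 hg hne c3 cg'
  have hd : ∀ x ∈ Icc a b, HasDerivAt (oscAmp φ' φ'' g g') (oscAmpDeriv φ' φ'' φ''' g g' g'' x) x :=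
    fun x hx => hasDerivAt_oscAmp (h2 x hx) (h3 x hx) (hg x hx) (hg' x hx) (hne x hx)
  obtain ⟨-, e2⟩ := osc_integral_by_parts hab h1 h2 hd hne c3 cD
  have za : oscAmp φ' φ'' g g' a = 0 := by simp [oscAmp, hga, hga']
  have zb : oscAmp φ' φ'' g g' b = 0 := by simp [oscAmp, hgb, hgb']
  -- All boundary terms vanish, because g and g' vanish at both endpoints and the amplitude after
  -- one integration by parts is linear in them.
  rw [e1, e2, hga, hgb, za, zb]
  simp only [zero_div, mul_zero, sub_zero, zero_sub, neg_neg]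
  refine (intervalIntegral.norm_integral_le_of_norm_le_const
    (C := (G2 + 3 * κ * G1 + (κ + 3 * κ ^ 2) * G0) / δ ^ 2) fun x hx => ?_).trans
      (le_of_eq (by rw [abs_of_nonneg (by linarith), mul_comm]))
  rw [uIoc_of_le hab] at hx
  have hx' := Ioc_subset_Icc_self hx
  have p := h0 x hx'
  have p0 : 0 < |φ' x| := hδ.trans_le p
  have q2 : |φ'' x| / φ' x ^ 2 ≤ κ / δ := by
    rw [← sq_abs (φ' x)]
    calc |φ'' x| / |φ' x| ^ 2 ≤ κ * δ / δ ^ 2 := by gcongr; exact hk2 x hx'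
      _ = κ / δ := by field_simp
  have q3 : |φ''' x| / φ' x ^ 2 ≤ κ / δ := by
    rw [← sq_abs (φ' x)]
    calc |φ''' x| / |φ' x| ^ 2 ≤ κ * δ / δ ^ 2 := by gcongr; exact hk3 x hx'
      _ = κ / δ := by field_simp
  have q4 : |φ'' x| ^ 2 / |φ' x| ^ 3 ≤ κ ^ 2 / δ := by
    calc |φ'' x| ^ 2 / |φ' x| ^ 3 ≤ (κ * δ) ^ 2 / δ ^ 3 := by gcongr; exact hk2 x hx'
      _ = κ ^ 2 / δ := by field_simp
  have b0 := hG0 x hx'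
  have b1 := hG1 x hx'
  have b2 := hG2 x hx'
  have A1 : ‖oscAmp φ' φ'' g g' x‖ ≤ G1 / δ + G0 * (κ / δ) := by
    refine (norm_oscAmp_le hδ p b1).trans ?_
    gcongr
  have A2 : ‖oscAmpDeriv φ' φ'' φ''' g g' g'' x‖ ≤
      G2 / δ + 2 * (G1 * (κ / δ)) + G0 * (κ / δ) + 2 * (G0 * (κ ^ 2 / δ)) := by
    rw [oscAmpDeriv, norm_div, Complex.norm_I, div_one]
    refine (norm_add_le _ _).trans (add_le_add ((norm_sub_le _ _).trans (add_le_add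
      ((norm_sub_le _ _).trans (add_le_add ?_ ?_)) ?_)) ?_)
    · rw [norm_div, Complex.norm_real, Real.norm_eq_abs]
      gcongr
    · rw [norm_mul, norm_div, norm_mul, norm_pow, Complex.norm_real, Complex.norm_real,
        Real.norm_eq_abs, Real.norm_eq_abs, sq_abs, mul_div_assoc, RCLike.norm_two]
      gcongr
    · rw [norm_div, norm_mul, norm_pow, Complex.norm_real, Complex.norm_real,
        Real.norm_eq_abs, Real.norm_eq_abs, sq_abs, mul_div_assoc]
      gcongr
    · rw [norm_mul, norm_div, norm_mul, norm_pow, norm_pow, Complex.norm_real, Complex.norm_real,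
        Real.norm_eq_abs, Real.norm_eq_abs, mul_div_assoc, RCLike.norm_two]
      gcongr
  rw [norm_mul, norm_cexp_I_mul, one_mul]
  refine (norm_oscAmp_le hδ p A2).trans ?_
  calc _ ≤ (G2 / δ + 2 * (G1 * (κ / δ)) + G0 * (κ / δ) + 2 * (G0 * (κ ^ 2 / δ))) / δ +
        (G1 / δ + G0 * (κ / δ)) * (κ / δ) := by gcongr
    _ = _ := by field_simp; ring

/-! ### The phase, the cutoff and the TT* kernel. -/

/-- The quantitative form of admissibility that enters the oscillatory integral estimates. -/
structure PhaseData (A lam : ℝ) (ϖ w1 w2 w3 : ℝ → ℝ) : Prop where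
  d1 : ∀ ρ ∈ Ioo (1 / 2 : ℝ) 2, HasDerivAt ϖ (w1 ρ) ρ
  d2 : ∀ ρ ∈ Ioo (1 / 2 : ℝ) 2, HasDerivAt w1 (w2 ρ) ρ
  d3 : ∀ ρ ∈ Ioo (1 / 2 : ℝ) 2, HasDerivAt w2 (w3 ρ) ρ
  cont3 : ContinuousOn w3 (Ioo (1 / 2) 2)
  low1 : ∀ ρ ∈ Ioo (1 / 2 : ℝ) 2, A⁻¹ ≤ |w1 ρ|
  up1 : ∀ ρ ∈ Ioo (1 / 2 : ℝ) 2, |w1 ρ| ≤ A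
  low2 : (∀ ρ ∈ Ioo (1 / 2 : ℝ) 2, lam ≤ w2 ρ) ∨ (∀ ρ ∈ Ioo (1 / 2 : ℝ) 2, w2 ρ ≤ -lam)
  up2 : ∀ ρ ∈ Ioo (1 / 2 : ℝ) 2, |w2 ρ| ≤ A
  up3 : ∀ ρ ∈ Ioo (1 / 2 : ℝ) 2, |w3 ρ| ≤ A

theorem PhaseData.neg {A lam : ℝ} {ϖ w1 w2 w3 : ℝ → ℝ} (h : PhaseData A lam ϖ w1 w2 w3) :
    PhaseData A lam (fun ρ => -ϖ ρ) (fun ρ => -w1 ρ) (fun ρ => -w2 ρ) (fun ρ => -w3 ρ) where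
  d1 ρ hρ := (h.d1 ρ hρ).neg
  d2 ρ hρ := (h.d2 ρ hρ).neg
  d3 ρ hρ := (h.d3 ρ hρ).neg
  cont3 := h.cont3.neg
  low1 ρ hρ := by rw [abs_neg]; exact h.low1 ρ hρ
  up1 ρ hρ := by rw [abs_neg]; exact h.up1 ρ hρ
  low2 := h.low2.symm.imp (fun g ρ hρ => by linarith [g ρ hρ]) (fun g ρ hρ => by linarith [g ρ hρ])
  up2 ρ hρ := by rw [abs_neg]; exact h.up2 ρ hρ
  up3 ρ hρ := by rw [abs_neg]; exact h.up3 ρ hρ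

theorem PhaseData.dist_le {A lam : ℝ} {ϖ w1 w2 w3 : ℝ → ℝ} (h : PhaseData A lam ϖ w1 w2 w3) :
    ∀ x ∈ Ioo (1 / 2 : ℝ) 2, ∀ y ∈ Ioo (1 / 2 : ℝ) 2, A⁻¹ * |x - y| ≤ |ϖ x - ϖ y| := by
  have key : ∀ x ∈ Ioo (1 / 2 : ℝ) 2, ∀ y ∈ Ioo (1 / 2 : ℝ) 2, x < y → A⁻¹ * |x - y| ≤ |ϖ x - ϖ y| := by
    intro x hx y hy hxy
    have hsub : Icc x y ⊆ Ioo (1 / 2 : ℝ) 2 := fun u hu => ⟨hx.1.trans_le hu.1, hu.2.trans_lt hy.2⟩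
    obtain ⟨c, hc, e⟩ := exists_hasDerivAt_eq_slope ϖ w1 hxy
      (fun u hu => (h.d1 u (hsub hu)).continuousAt.continuousWithinAt)
      (fun u hu => h.d1 u (hsub (Ioo_subset_Icc_self hu)))
    have hl := h.low1 c (hsub (Ioo_subset_Icc_self hc))
    have hyx : 0 < y - x := by linarith
    rw [e, abs_div, abs_of_pos hyx, le_div_iff₀ hyx] at hl
    rw [abs_sub_comm x y, abs_of_pos hyx, abs_sub_comm]
    exact hl
  intro x hx y hy
  rcases lt_trichotomy x y with hxy | hxy | hxy
  · exact key x hx y hy hxy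
  · subst hxy; simp
  · rw [abs_sub_comm, abs_sub_comm (ϖ x)]; exact key y hy x hx hxy

theorem hasDerivAt_iteratedDeriv {ϖ : ℝ → ℝ} (h : ContDiffOn ℝ 4 ϖ (Ioo (1 / 2) 2)) {k : ℕ} (hk : k < 4)
    {ρ : ℝ} (hρ : ρ ∈ Ioo (1 / 2 : ℝ) 2) :
    HasDerivAt (iteratedDeriv k ϖ) (iteratedDeriv (k + 1) ϖ ρ) ρ := by
  have hw := ((h.differentiableOn_iteratedDerivWithin (m := k) (by exact_mod_cast hk)
    isOpen_Ioo.uniqueDiffOn) ρ hρ).differentiableAt (isOpen_Ioo.mem_nhds hρ)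
  have : DifferentiableAt ℝ (iteratedDeriv k ϖ) ρ := by
    refine hw.congr_of_eventuallyEq ?_
    filter_upwards [isOpen_Ioo.mem_nhds hρ] with x hx
    exact (iteratedDerivWithin_of_isOpen isOpen_Ioo hx).symm
  rw [iteratedDeriv_succ]
  exact this.hasDerivAt

theorem IsAdmissiblePhase.phaseData {A lam : ℝ} {ϖ : ℝ → ℝ} (h : IsAdmissiblePhase A lam ϖ)
    (hlam : 0 < lam) :
    PhaseData A lam ϖ (deriv ϖ) (iteratedDeriv 2 ϖ) (iteratedDeriv 3 ϖ) where
  d1 ρ hρ := by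
    have := hasDerivAt_iteratedDeriv h.contDiffOn (k := 0) (by norm_num) hρ
    rwa [iteratedDeriv_zero, zero_add, iteratedDeriv_one] at this
  d2 ρ hρ := by
    have := hasDerivAt_iteratedDeriv h.contDiffOn (k := 1) (by norm_num) hρ
    rwa [iteratedDeriv_one] at this
  d3 ρ hρ := hasDerivAt_iteratedDeriv h.contDiffOn (k := 2) (by norm_num) hρ
  cont3 ρ hρ := (hasDerivAt_iteratedDeriv h.contDiffOn (k := 3) (by norm_num)
    hρ).continuousAt.continuousWithinAt
  low1 := h.deriv_lower
  up1 := h.deriv_upper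
  low2 := by
    have hc : ContinuousOn (iteratedDeriv 2 ϖ) (Ioo (1 / 2) 2) := fun ρ hρ =>
      (hasDerivAt_iteratedDeriv h.contDiffOn (k := 2) (by norm_num) hρ).continuousAt.continuousWithinAt
    -- A continuous second derivative with |ϖ''| ≥ lam > 0 has one sign on the whole interval, as
    -- van der Corput's lemma requires.
    have hne : ∀ ρ ∈ Ioo (1 / 2 : ℝ) 2, iteratedDeriv 2 ϖ ρ ≠ 0 := fun ρ hρ h0 => by
      have := h.deriv_two_lower ρ hρ
      rw [h0, abs_zero] at this; linarith
    by_cases hex : ∃ x ∈ Ioo (1 / 2 : ℝ) 2, iteratedDeriv 2 ϖ x < 0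
    · right
      intro y hy
      obtain ⟨x, hx, hx0⟩ := hex
      have hy0 : iteratedDeriv 2 ϖ y < 0 := by
        by_contra hcon
        obtain ⟨c, hcm, hc0⟩ := isPreconnected_Ioo.intermediate_value hx hy hc
          (show (0 : ℝ) ∈ Icc _ _ from ⟨hx0.le, not_lt.mp hcon⟩)
        exact hne c hcm hc0
      have := h.deriv_two_lower y hy
      rw [abs_of_neg hy0] at this
      linarith
    · left
      push Not at hex
      intro y hy
      have := h.deriv_two_lower y hy
      rwa [abs_of_nonneg (hex y hy)] at this
  up2 := h.deriv_two_upper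
  up3 ρ hρ := (le_add_of_nonneg_right (abs_nonneg _)).trans (h.deriv_three_four ρ hρ)

/-- A smooth cutoff living on a compact subinterval of the band. -/
structure CutoffData (a b b0 : ℝ) (B B' B'' : ℝ → ℂ) : Prop where
  lt_a : 1 / 2 < a
  hab : a ≤ b
  b_lt : b < 2
  d1 : ∀ x, HasDerivAt B (B' x) x
  d2 : ∀ x, HasDerivAt B' (B'' x) x
  cont : Continuous B''
  bound : ∀ x, ‖B x‖ ≤ b0
  bound1 : ∀ x, ‖B' x‖ ≤ b0
  bound2 : ∀ x, ‖B'' x‖ ≤ b0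
  za : B a = 0
  zb : B b = 0
  za' : B' a = 0
  zb' : B' b = 0

theorem CutoffData.sub {a b b0 : ℝ} {B B' B'' : ℝ → ℂ} (h : CutoffData a b b0 B B' B'') :
    Icc a b ⊆ Ioo (1 / 2 : ℝ) 2 := fun _ hx => ⟨h.lt_a.trans_le hx.1, hx.2.trans_lt h.b_lt⟩

open scoped ComplexConjugate in
/-- The amplitude of the `TT*` kernel. -/
def ttAmp (ν s s' : ℝ) (B : ℝ → ℂ) (ρ : ℝ) : ℂ :=
  besselZ ν (s * ρ) * conj (besselZ ν (s' * ρ)) * B ρ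

-- For R ≥ 8L² the arguments sx exceed 4(1+ν). A first derivative costs s (1+ν)²/(sx)², of order
-- (1+ν)²/R and hence at most a multiple of L³/L² = L. A second derivative costs s² (1+ν)²/(sx)², of
-- order (1+ν)² ≤ L³. This is where the two conditions on L come from.
open scoped ComplexConjugate in
theorem ttAmp_bounds {a b b0 : ℝ} {B B' B'' : ℝ → ℂ} (hB : CutoffData a b b0 B B' B'')
    {ν L R s s' : ℝ} (hν : 0 ≤ ν) (hL1 : 1 ≤ L) (hL2 : 1 + ν ≤ L ^ 2) (hL3 : (1 + ν) ^ 2 ≤ L ^ 3)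
    (hR : 8 * L ^ 2 ≤ R) (hs : s ∈ Ico R (2 * R)) (hs' : s' ∈ Ico R (2 * R)) :
    ∃ g' g'' : ℝ → ℂ, (∀ x ∈ Icc a b, HasDerivAt (ttAmp ν s s' B) (g' x) x) ∧
      (∀ x ∈ Icc a b, HasDerivAt g' (g'' x) x) ∧ ContinuousOn g'' (Icc a b) ∧
      g' a = 0 ∧ g' b = 0 ∧
      (∀ x ∈ Icc a b, ‖ttAmp ν s s' B x‖ ≤ 144 * besselM ^ 2 * b0) ∧
      (∀ x ∈ Icc a b, ‖g' x‖ ≤ 144 * besselM ^ 2 * b0 * L) ∧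
      (∀ x ∈ Icc a b, ‖g'' x‖ ≤ 144 * besselM ^ 2 * b0 * L ^ 3) := by
  have hM := besselM_pos
  have hb0 : 0 ≤ b0 := (norm_nonneg _).trans (hB.bound 0)
  have hR0 : 0 < R := by nlinarith
  have hd : ∀ {s x : ℝ}, s ∈ Ico R (2 * R) → x ∈ Icc a b → 4 * (1 + ν) ≤ s * x := by
    intro s x hs hx
    have h1 := hs.1
    have h2 := (hB.sub hx).1
    nlinarith
  have hD : ∀ {s x : ℝ}, s ∈ Ico R (2 * R) → x ∈ Icc a b → s * (besselM * ((1 + ν) ^ 2 / (s * x) ^ 2)) ≤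
      4 * besselM * L ∧ s ^ 2 * (3 * besselM * ((1 + ν) ^ 2 / (s * x) ^ 2)) ≤ 12 * besselM * L ^ 3 := by
    intro s x hs hx
    have h1 := hs.1
    have h2 := (hB.sub hx).1
    have hs0 : 0 < s := hR0.trans_le h1
    have hx0 : 0 < x := by linarith
    have hx2 : 1 / 4 ≤ x ^ 2 := by nlinarith
    constructor
    · rw [show s * (besselM * ((1 + ν) ^ 2 / (s * x) ^ 2)) = besselM * ((1 + ν) ^ 2 / (s * x ^ 2)) by
        field_simp, mul_right_comm 4, mul_comm (4 * L)]
      gcongr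
      rw [div_le_iff₀ (by positivity)]
      have h3 : 2 * L ^ 2 ≤ s * x ^ 2 := by nlinarith
      nlinarith [mul_le_mul_of_nonneg_left h3 (by linarith : (0 : ℝ) ≤ 4 * L), pow_pos (by linarith : 0 < L) 3]
    · rw [show s ^ 2 * (3 * besselM * ((1 + ν) ^ 2 / (s * x) ^ 2)) = 3 * besselM * ((1 + ν) ^ 2 / x ^ 2) by
        field_simp, show 12 * besselM * L ^ 3 = 3 * besselM * (4 * L ^ 3) by ring]
      gcongr
      rw [div_le_iff₀ (by positivity)]
      nlinarith [pow_pos (by linarith : 0 < L) 3]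
  have hz : ∀ {s x : ℝ}, s ∈ Ico R (2 * R) → x ∈ Icc a b →
      HasDerivAt (fun x => besselZ ν (s * x)) (s * besselDZ ν (s * x)) x ∧
      HasDerivAt (fun x => (s : ℂ) * besselDZ ν (s * x)) ((s : ℂ) ^ 2 * besselDDZ ν (s * x)) x ∧
      ‖besselZ ν (s * x)‖ ≤ 2 * besselM ∧ ‖(s : ℂ) * besselDZ ν (s * x)‖ ≤ 4 * besselM * L ∧
      ‖(s : ℂ) ^ 2 * besselDDZ ν (s * x)‖ ≤ 12 * besselM * L ^ 3 := by
    intro s x hs hx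
    have h4 := hd hs hx
    have hs0 : 0 < s := hR0.trans_le hs.1
    have hsx : 0 < s * x := by linarith
    have hm : HasDerivAt (fun x => s * x) s x := by simpa using (hasDerivAt_id x).const_mul s
    refine ⟨?_, ?_, norm_besselZ_le hν h4, ?_, ?_⟩
    · exact ((hasDerivAt_besselZ hν hsx).scomp x hm).congr_deriv (by simp)
    · exact (((hasDerivAt_besselDZ hν hsx).scomp x hm).const_mul (s : ℂ)).congr_deriv (by simp; ring)
    · rw [norm_mul, Complex.norm_real, Real.norm_eq_abs, abs_of_pos hs0]
      exact (mul_le_mul_of_nonneg_left (norm_besselDZ_le hν h4) hs0.le).trans (hD hs hx).1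
    · rw [norm_mul, norm_pow, Complex.norm_real, Real.norm_eq_abs, abs_of_pos hs0]
      exact (mul_le_mul_of_nonneg_left (norm_besselDDZ_le hν h4) (by positivity)).trans (hD hs hx).2
  let Z : ℝ → ℝ → ℂ := fun s x => besselZ ν (s * x)
  let Z' : ℝ → ℝ → ℂ := fun s x => s * besselDZ ν (s * x)
  let Z'' : ℝ → ℝ → ℂ := fun s x => (s : ℂ) ^ 2 * besselDDZ ν (s * x)
  refine ⟨fun x => (Z' s x * conj (Z s' x) + Z s x * conj (Z' s' x)) * B x + Z s x * conj (Z s' x) * B' x,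
    fun x => ((Z'' s x * conj (Z s' x) + Z' s x * conj (Z' s' x)) +
      (Z' s x * conj (Z' s' x) + Z s x * conj (Z'' s' x))) * B x +
      (Z' s x * conj (Z s' x) + Z s x * conj (Z' s' x)) * B' x +
      ((Z' s x * conj (Z s' x) + Z s x * conj (Z' s' x)) * B' x + Z s x * conj (Z s' x) * B'' x),
    ?_, ?_, ?_, ?_, ?_, ?_, ?_, ?_⟩
  · intro x hx
    exact (((hz hs hx).1.mul (hz hs' hx).1.star).mul (hB.d1 x))
  · intro x hx
    have e1 := (hz hs hx).1
    have e2 := (hz hs' hx).1.star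
    have f1 := (hz hs hx).2.1
    have f2 := (hz hs' hx).2.1.star
    exact ((((f1.mul e2).add (e1.mul f2)).mul (hB.d1 x)).add ((e1.mul e2).mul (hB.d2 x)))
  · have cZ : ∀ {s}, s ∈ Ico R (2 * R) → ContinuousOn (Z s) (Icc a b) := fun hs x hx =>
      (hz hs hx).1.continuousAt.continuousWithinAt
    have cZ' : ∀ {s}, s ∈ Ico R (2 * R) → ContinuousOn (Z' s) (Icc a b) := fun hs x hx =>
      (hz hs hx).2.1.continuousAt.continuousWithinAt
    have cZ'' : ∀ {s}, s ∈ Ico R (2 * R) → ContinuousOn (Z'' s) (Icc a b) := by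
      intro s hs x hx
      have hsx : 0 < s * x := by linarith [hd hs hx]
      have h1 : ContinuousAt (besselDDZ ν) (s * x) := by
        have u1 := (hasDerivAt_besselU hν hsx).continuousAt
        have u2 := (hasDerivAt_besselDU hν hsx).continuousAt
        have c3 : ContinuousAt (fun y : ℝ => -2 * (ν ^ 2 - 1 / 4) / y ^ 3) (s * x) :=
          continuousAt_const.div (continuousAt_id.pow 3) (by positivity)
        have c2 : ContinuousAt (fun y : ℝ => (ν ^ 2 - 1 / 4) / y ^ 2) (s * x) :=
          continuousAt_const.div (continuousAt_id.pow 2) (by positivity)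
        have o : ∀ {f : ℝ → ℝ}, ContinuousAt f (s * x) → ContinuousAt (fun y => (f y : ℂ)) (s * x) :=
          fun hf => Complex.continuous_ofReal.continuousAt.comp hf
        exact (continuousAt_const.mul (hasDerivAt_cexp_neg_I (s * x)).continuousAt).mul
          ((o ((c3.mul u1).add (c2.mul u2))).sub (continuousAt_const.mul (o (c2.mul u1))))
      have h2 : ContinuousAt (fun x => s * x) x := by fun_prop
      exact (continuousAt_const.mul (ContinuousAt.comp (f := fun x => s * x) h1 h2)).continuousWithinAt
    have st : ∀ {f : ℝ → ℂ}, ContinuousOn f (Icc a b) → ContinuousOn (fun x => conj (f x)) (Icc a b) :=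
      fun hf => Complex.continuous_conj.comp_continuousOn hf
    have cB : ContinuousOn B (Icc a b) := fun x _ => (hB.d1 x).continuousAt.continuousWithinAt
    have cB' : ContinuousOn B' (Icc a b) := fun x _ => (hB.d2 x).continuousAt.continuousWithinAt
    have cB'' := hB.cont.continuousOn (s := Icc a b)
    exact ((((((cZ'' hs).mul (st (cZ hs'))).add ((cZ' hs).mul (st (cZ' hs')))).add
      (((cZ' hs).mul (st (cZ' hs'))).add ((cZ hs).mul (st (cZ'' hs'))))).mul cB).add
      ((((cZ' hs).mul (st (cZ hs'))).add ((cZ hs).mul (st (cZ' hs')))).mul cB')).add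
      (((((cZ' hs).mul (st (cZ hs'))).add ((cZ hs).mul (st (cZ' hs')))).mul cB').add
      (((cZ hs).mul (st (cZ hs'))).mul cB''))
  · simp [hB.za, hB.za']
  · simp [hB.zb, hB.zb']
  · intro x hx
    rw [ttAmp, norm_mul, norm_mul, RCLike.norm_conj]
    calc _ ≤ (2 * besselM) * (2 * besselM) * b0 := by
          gcongr
          · exact (hz hs hx).2.2.1
          · exact (hz hs' hx).2.2.1
          · exact hB.bound x
      _ ≤ _ := by nlinarith [mul_nonneg (sq_nonneg besselM) hb0]
  · intro x hx
    obtain ⟨-, -, p0, p1, -⟩ := hz hs hx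
    obtain ⟨-, -, q0, q1, -⟩ := hz hs' hx
    have t1 : ‖Z' s x * conj (Z s' x)‖ ≤ 4 * besselM * L * (2 * besselM) := by
      rw [norm_mul, RCLike.norm_conj]; gcongr
    have t2 : ‖Z s x * conj (Z' s' x)‖ ≤ 2 * besselM * (4 * besselM * L) := by
      rw [norm_mul, RCLike.norm_conj]; gcongr
    have t3 : ‖Z s x * conj (Z s' x)‖ ≤ 2 * besselM * (2 * besselM) := by
      rw [norm_mul, RCLike.norm_conj]; gcongr
    have b1 := hB.bound x
    have b2 := hB.bound1 x
    calc _ ≤ (4 * besselM * L * (2 * besselM) + 2 * besselM * (4 * besselM * L)) * b0 +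
          2 * besselM * (2 * besselM) * b0 := by
          refine (norm_add_le _ _).trans (add_le_add ?_ ?_)
          · rw [norm_mul]
            refine mul_le_mul ((norm_add_le _ _).trans (add_le_add t1 t2)) b1 (norm_nonneg _) (by positivity)
          · rw [norm_mul]
            exact mul_le_mul t3 b2 (norm_nonneg _) (by positivity)
      _ = besselM ^ 2 * b0 * (16 * L + 4) := by ring
      _ ≤ besselM ^ 2 * b0 * (144 * L) := by gcongr; linarith
      _ = _ := by ring
  · intro x hx
    obtain ⟨-, -, p0, p1, p2⟩ := hz hs hx
    obtain ⟨-, -, q0, q1, q2⟩ := hz hs' hx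
    have t0 : ‖Z'' s x * conj (Z s' x)‖ ≤ 12 * besselM * L ^ 3 * (2 * besselM) := by
      rw [norm_mul, RCLike.norm_conj]; gcongr
    have t0' : ‖Z s x * conj (Z'' s' x)‖ ≤ 2 * besselM * (12 * besselM * L ^ 3) := by
      rw [norm_mul, RCLike.norm_conj]; gcongr
    have tm : ‖Z' s x * conj (Z' s' x)‖ ≤ 4 * besselM * L * (4 * besselM * L) := by
      rw [norm_mul, RCLike.norm_conj]; gcongr
    have t1 : ‖Z' s x * conj (Z s' x)‖ ≤ 4 * besselM * L * (2 * besselM) := by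
      rw [norm_mul, RCLike.norm_conj]; gcongr
    have t2 : ‖Z s x * conj (Z' s' x)‖ ≤ 2 * besselM * (4 * besselM * L) := by
      rw [norm_mul, RCLike.norm_conj]; gcongr
    have t3 : ‖Z s x * conj (Z s' x)‖ ≤ 2 * besselM * (2 * besselM) := by
      rw [norm_mul, RCLike.norm_conj]; gcongr
    have b1 := hB.bound x
    have b2 := hB.bound1 x
    have b3 := hB.bound2 x
    have c1 := (norm_add_le _ _).trans (add_le_add t1 t2)
    calc _ ≤ (12 * besselM * L ^ 3 * (2 * besselM) + 4 * besselM * L * (4 * besselM * L) +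
          (4 * besselM * L * (4 * besselM * L) + 2 * besselM * (12 * besselM * L ^ 3))) * b0 +
          (4 * besselM * L * (2 * besselM) + 2 * besselM * (4 * besselM * L)) * b0 +
          ((4 * besselM * L * (2 * besselM) + 2 * besselM * (4 * besselM * L)) * b0 +
            2 * besselM * (2 * besselM) * b0) := by
          refine (norm_add_le _ _).trans (add_le_add ((norm_add_le _ _).trans (add_le_add ?_ ?_))
            ((norm_add_le _ _).trans (add_le_add ?_ ?_)))
          · rw [norm_mul]
            exact mul_le_mul ((norm_add_le _ _).trans (add_le_add ((norm_add_le _ _).trans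
              (add_le_add t0 tm)) ((norm_add_le _ _).trans (add_le_add tm t0')))) b1 (norm_nonneg _)
              (by positivity)
          · rw [norm_mul]; exact mul_le_mul c1 b2 (norm_nonneg _) (by positivity)
          · rw [norm_mul]; exact mul_le_mul c1 b2 (norm_nonneg _) (by positivity)
          · rw [norm_mul]; exact mul_le_mul t3 b3 (norm_nonneg _) (by positivity)
      _ = besselM ^ 2 * b0 * (48 * L ^ 3 + 32 * L ^ 2 + 32 * L + 4) := by ring
      _ ≤ besselM ^ 2 * b0 * (144 * L ^ 3) := by
          gcongr
          nlinarith [mul_nonneg (sub_nonneg.mpr hL1) (sq_nonneg L)]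
      _ = _ := by ring

/-- The constant in the dispersive bound for the `TT*` kernel. -/
def kernelConst (A lam b0 L : ℝ) : ℝ := 126 * A ^ 6 * (144 * besselM ^ 2 * b0) * L / √lam

/-- The second derivative of the phase is -τϖ'', so van der Corput's lemma applies whatever the
radii are. For |τ| ≥ 2AR the linear term cannot cancel τϖ', and two integrations by parts apply. The
far bound has the form D T^{3/2}/τ² with T = 2AR, which agrees with D/√|τ| at |τ| = T. -/
theorem ttKernel_bound {A lam : ℝ} {ϖ w1 w2 w3 : ℝ → ℝ} (hA : 1 ≤ A) (hlam : 0 < lam) (hlamA : lam ≤ A)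
    (hϖ : PhaseData A lam ϖ w1 w2 w3) {a b b0 : ℝ} {B B' B'' : ℝ → ℂ} (hB : CutoffData a b b0 B B' B'')
    {ν L R s s' : ℝ} (hν : 0 ≤ ν) (hL1 : 1 ≤ L) (hL2 : 1 + ν ≤ L ^ 2) (hL3 : (1 + ν) ^ 2 ≤ L ^ 3)
    (hR : 8 * L ^ 2 ≤ R) (hs : s ∈ Ico R (2 * R)) (hs' : s' ∈ Ico R (2 * R)) {τ : ℝ} (hτ : τ ≠ 0) :
    ‖∫ x in a..b, Complex.exp (Complex.I * ((-τ * ϖ x + (s - s') * x : ℝ) : ℂ)) * ttAmp ν s s' B x‖ ≤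
      kernelConst A lam b0 L / √|τ| ∧
    (2 * A * R ≤ |τ| →
      ‖∫ x in a..b, Complex.exp (Complex.I * ((-τ * ϖ x + (s - s') * x : ℝ) : ℂ)) * ttAmp ν s s' B x‖ ≤
        kernelConst A lam b0 L * (2 * A * R) * √(2 * A * R) / τ ^ 2) := by
  obtain ⟨g', g'', hg, hg', hcg, hga', hgb', G0, G1, G2⟩ := ttAmp_bounds hB hν hL1 hL2 hL3 hR hs hs'
  have hb0 : 0 ≤ b0 := (norm_nonneg _).trans (hB.bound 0)
  have hQ0 : 0 ≤ 144 * besselM ^ 2 * b0 := by positivity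
  rw [kernelConst]
  obtain ⟨Q, hQ⟩ : ∃ Q, Q = 144 * besselM ^ 2 * b0 := ⟨_, rfl⟩
  rw [← hQ] at G0 G1 G2 hQ0 ⊢
  have hsub := hB.sub
  have hba : b - a ≤ 3 / 2 := by linarith [hB.lt_a, hB.b_lt]
  have hba0 : 0 ≤ b - a := by linarith [hB.hab]
  have hτ0 : 0 < |τ| := abs_pos.mpr hτ
  have hA6 : 1 ≤ A ^ 6 := one_le_pow₀ hA
  have d1 : ∀ x ∈ Icc a b, HasDerivAt (fun x => -τ * ϖ x + (s - s') * x) (-τ * w1 x + (s - s')) x := by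
    intro x hx
    exact (((hϖ.d1 x (hsub hx)).const_mul (-τ)).add
      ((hasDerivAt_id x).const_mul (s - s'))).congr_deriv (by simp)
  have d2 : ∀ x ∈ Icc a b, HasDerivAt (fun x => -τ * w1 x + (s - s')) (-τ * w2 x) x := fun x hx =>
    ((hϖ.d2 x (hsub hx)).const_mul (-τ)).add_const _
  have d3 : ∀ x ∈ Icc a b, HasDerivAt (fun x => -τ * w2 x) (-τ * w3 x) x := fun x hx =>
    (hϖ.d3 x (hsub hx)).const_mul (-τ)
  have cg' : ContinuousOn g' (Icc a b) := fun x hx => (hg' x hx).continuousAt.continuousWithinAt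
  have c2 : ContinuousOn (fun x => -τ * w2 x) (Icc a b) := fun x hx =>
    (d3 x hx).continuousAt.continuousWithinAt
  have hLL : L ≤ L ^ 3 := le_self_pow₀ hL1 (by norm_num)
  constructor
  · have hlow : (∀ x ∈ Icc a b, lam * |τ| ≤ -τ * w2 x) ∨ (∀ x ∈ Icc a b, -τ * w2 x ≤ -(lam * |τ|)) := by
      rcases hϖ.low2 with h | h <;> rcases lt_or_gt_of_ne hτ with h0 | h0
      · left; intro x hx; rw [abs_of_neg h0]; nlinarith [h x (hsub hx)]
      · right; intro x hx; rw [abs_of_pos h0]; nlinarith [h x (hsub hx)]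
      · right; intro x hx; rw [abs_of_neg h0]; nlinarith [h x (hsub hx)]
      · left; intro x hx; rw [abs_of_pos h0]; nlinarith [h x (hsub hx)]
    refine (van_der_corput hB.hab d1 d2 hg (by positivity) hlow c2 cg' G0 G1).trans ?_
    rw [Real.sqrt_mul hlam.le, div_div]
    gcongr
    have : 2 * (b - a) * (Q * L) ≤ 3 * (Q * L) := by
      apply mul_le_mul_of_nonneg_right (by linarith) (by positivity)
    have h2 : Q ≤ Q * L := le_mul_of_one_le_right hQ0 hL1
    have h3 : Q * L ≤ A ^ 6 * (Q * L) := le_mul_of_one_le_left (by positivity) hA6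
    nlinarith
  · intro hbig
    have hR0 : 0 < R := by nlinarith
    have hA0 : 0 < A := by linarith
    -- Two radii of the same shell differ by at most R, which is at most half of the lower bound
    -- |τ|/A for |τϖ'|.
    have h0 : ∀ x ∈ Icc a b, |τ| / (2 * A) ≤ |-τ * w1 x + (s - s')| := by
      intro x hx
      have e1 : |τ| / A ≤ |τ * w1 x| := by
        rw [abs_mul, div_eq_mul_inv]; gcongr; exact hϖ.low1 x (hsub hx)
      have e2 : |s - s'| ≤ R := by
        rw [abs_le]; constructor <;> linarith [hs.1, hs.2, hs'.1, hs'.2]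
      have e3 : |τ * w1 x| - |s - s'| ≤ |-τ * w1 x + (s - s')| := by
        rw [show -τ * w1 x + (s - s') = -(τ * w1 x - (s - s')) by ring, abs_neg]
        exact abs_sub_abs_le_abs_sub _ _
      have e4 : R ≤ |τ| / (2 * A) := by rw [le_div_iff₀ (by positivity)]; linarith
      have e5 : |τ| / A = 2 * (|τ| / (2 * A)) := by field_simp
      linarith
    have hk : ∀ {w : ℝ → ℝ} {x : ℝ}, |w x| ≤ A → |-τ * w x| ≤ 2 * A ^ 2 * (|τ| / (2 * A)) := by
      intro w x hw
      rw [abs_mul, abs_neg, show 2 * A ^ 2 * (|τ| / (2 * A)) = |τ| * A by field_simp]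
      gcongr
    refine (osc_integral_second hB.hab d1 d2 d3 hg hg' (continuousOn_const.mul (hϖ.cont3.mono hsub)) hcg
      (by simp [ttAmp, hB.za]) (by simp [ttAmp, hB.zb]) hga' hgb' (by positivity) h0
      (fun x hx => hk (hϖ.up2 x (hsub hx))) (fun x hx => hk (hϖ.up3 x (hsub hx))) G0 G1 G2).trans ?_
    have hQL : 0 ≤ Q * L := by positivity
    have hA2 : 1 ≤ A ^ 2 := one_le_pow₀ hA
    have hA4 : A ^ 2 ≤ A ^ 4 := pow_le_pow_right₀ hA (by norm_num)
    calc _ ≤ 3 / 2 * ((Q * L ^ 3 + 3 * (2 * A ^ 2) * (Q * L ^ 3) +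
          (2 * A ^ 2 + 3 * (2 * A ^ 2) ^ 2) * (Q * L ^ 3)) / (|τ| / (2 * A)) ^ 2) := by
          have : Q ≤ Q * L ^ 3 := le_mul_of_one_le_right hQ0 (hL1.trans hLL)
          gcongr
      _ = 6 * A ^ 2 * (1 + 8 * A ^ 2 + 12 * A ^ 4) * (Q * L) * L ^ 2 / τ ^ 2 := by
          rw [div_pow, sq_abs]; field_simp; ring
      -- The factor L³ from the second derivative of the amplitude becomes L R because L² ≤ R, so
      -- the far bound has the same power of L as the near one.
      _ ≤ 6 * A ^ 2 * (21 * A ^ 4) * (Q * L) * R / τ ^ 2 := by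
          gcongr
          · nlinarith
          · nlinarith
      _ = 126 * A ^ 6 * Q * L * R / τ ^ 2 := by ring
      _ ≤ _ := by
          refine div_le_div_of_nonneg_right ?_ (sq_nonneg _)
          obtain ⟨W, hW⟩ : ∃ W, W = 126 * A ^ 6 * Q * L := ⟨_, rfl⟩
          have hW0 : 0 ≤ W := by rw [hW]; positivity
          rw [← hW]
          have hl : 0 < √lam := Real.sqrt_pos.mpr hlam
          have h1 : √lam ≤ √(2 * A * R) := by
            apply Real.sqrt_le_sqrt
            nlinarith
          have h2 : R ≤ 2 * A * R := by nlinarith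
          rw [div_mul_eq_mul_div, div_mul_eq_mul_div, le_div_iff₀ hl]
          gcongr

/-! ### The Hardy–Littlewood–Sobolev inequality for the kernel |t|^{-1/2}. -/

theorem lintegral_comp_abs_real {F : ℝ → ℝ≥0∞} :
    ∫⁻ x, F |x| = 2 * ∫⁻ x in Ioi 0, F x := by
  have h1 : ∫⁻ x in Ioi 0, F |x| = ∫⁻ x in Ioi 0, F x :=
    setLIntegral_congr_fun measurableSet_Ioi fun x hx => by
      rw [abs_of_pos (mem_Ioi.mp hx)]
  have h2 : ∫⁻ x in Iic 0, F |x| = ∫⁻ x in Ioi 0, F x := by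
    rw [setLIntegral_congr Iio_ae_eq_Iic.symm, ← h1, ← lintegral_indicator measurableSet_Iio,
      ← lintegral_indicator measurableSet_Ioi, ← lintegral_neg_eq_self]
    refine lintegral_congr fun x => ?_
    simp only [indicator, mem_Iio, mem_Ioi, Left.neg_neg_iff, abs_neg]
  rw [← lintegral_add_compl _ (measurableSet_Ioi (a := (0 : ℝ))), compl_Ioi, h1, h2, two_mul]

theorem lintegral_inv_sqrt_abs_le {δ : ℝ} (hδ : 0 < δ) :
    ∫⁻ u : ℝ, (if |u| < δ then ENNReal.ofReal (1 / √|u|) else 0) ≤ ENNReal.ofReal (4 * √δ) := by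
  rw [lintegral_comp_abs_real (F := fun u => if u < δ then ENNReal.ofReal (1 / √u) else 0)]
  have h1 : ∫⁻ u in Ioi (0 : ℝ), (if u < δ then ENNReal.ofReal (1 / √u) else 0) ≤
      ∫⁻ u in Ioc 0 δ, ENNReal.ofReal (u ^ (-(1 / 2) : ℝ)) := by
    rw [← lintegral_indicator measurableSet_Ioi, ← lintegral_indicator measurableSet_Ioc]
    refine lintegral_mono fun u => ?_
    simp only [indicator, mem_Ioi, mem_Ioc]
    by_cases h0 : 0 < u
    · by_cases h1 : u < δ
      · simp only [h0, h1, h1.le, if_true, and_self]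
        rw [Real.rpow_neg h0.le, Real.sqrt_eq_rpow, one_div]
      · simp [h1]
    · simp [h0]
  have hi : IntegrableOn (fun u : ℝ => u ^ (-(1 / 2) : ℝ)) (Ioc 0 δ) :=
    (intervalIntegrable_iff_integrableOn_Ioc_of_le hδ.le).mp
      (intervalIntegral.intervalIntegrable_rpow' (by norm_num))
  have h2 : ∫⁻ u in Ioc 0 δ, ENNReal.ofReal (u ^ (-(1 / 2) : ℝ)) = ENNReal.ofReal (2 * √δ) := by
    rw [← ofReal_integral_eq_lintegral_ofReal hi ((ae_restrict_iff' measurableSet_Ioc).mpr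
      (.of_forall fun u hu => Real.rpow_nonneg hu.1.le _)), ← intervalIntegral.integral_of_le hδ.le,
      integral_rpow (Or.inl (by norm_num)), Real.sqrt_eq_rpow]
    congr 1
    rw [Real.zero_rpow (by norm_num)]
    norm_num
    ring
  calc _ ≤ 2 * ENNReal.ofReal (2 * √δ) := by gcongr; exact h1.trans h2.le
    _ = ENNReal.ofReal (4 * √δ) := by
      rw [show (2 : ℝ≥0∞) = ENNReal.ofReal 2 by simp, ← ENNReal.ofReal_mul (by norm_num)]
      congr 1; ring

theorem lintegral_inv_sq_abs_le {δ : ℝ} (hδ : 0 < δ) :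
    ∫⁻ u : ℝ, (if δ ≤ |u| then ENNReal.ofReal (1 / |u| ^ 2) else 0) ≤ ENNReal.ofReal (2 / δ) := by
  rw [lintegral_comp_abs_real (F := fun u => if δ ≤ u then ENNReal.ofReal (1 / u ^ 2) else 0)]
  have h1 : ∫⁻ u in Ioi (0 : ℝ), (if δ ≤ u then ENNReal.ofReal (1 / u ^ 2) else 0) ≤
      ∫⁻ u in Ioi δ, ENNReal.ofReal (u ^ (-2 : ℝ)) := by
    rw [setLIntegral_congr (Ioi_ae_eq_Ici (a := δ)), ← lintegral_indicator measurableSet_Ioi,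
      ← lintegral_indicator measurableSet_Ici]
    refine lintegral_mono fun u => ?_
    simp only [indicator, mem_Ioi, mem_Ici]
    by_cases h1 : δ ≤ u
    · have h0 : 0 < u := hδ.trans_le h1
      simp only [h0, h1, if_true]
      rw [Real.rpow_neg h0.le, one_div]; norm_num
    · simp [h1]
  have h2 : ∫⁻ u in Ioi δ, ENNReal.ofReal (u ^ (-2 : ℝ)) = ENNReal.ofReal (1 / δ) := by
    rw [← ofReal_integral_eq_lintegral_ofReal (integrableOn_Ioi_rpow_of_lt (by norm_num) hδ)
      ((ae_restrict_iff' measurableSet_Ioi).mpr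
      (.of_forall fun u hu => Real.rpow_nonneg (hδ.le.trans (le_of_lt hu)) _)),
      integral_Ioi_rpow_of_lt (by norm_num) hδ]
    congr 1
    norm_num
    rw [Real.rpow_neg_one]
  calc _ ≤ 2 * ENNReal.ofReal (1 / δ) := by gcongr; exact h1.trans h2.le
    _ = ENNReal.ofReal (2 / δ) := by
      rw [show (2 : ℝ≥0∞) = ENNReal.ofReal 2 by simp, ← ENNReal.ofReal_mul (by norm_num)]
      congr 1; ring

/-- After scaling y by c this is x³z ≤ x⁴ + z⁴. It is applied with y = |t-s|^{-1/2}, since y⁴ =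
|t-s|^{-2} is integrable at infinity. -/
theorem young_cube {x y c : ℝ} (hx : 0 ≤ x) (hy : 0 ≤ y) (hc : 0 < c) :
    x ^ 3 * y ≤ c * x ^ 4 + c⁻¹ ^ 3 * y ^ 4 := by
  obtain ⟨z, hz⟩ : ∃ z, z = c⁻¹ * y := ⟨_, rfl⟩
  have hy' : y = c * z := by rw [hz]; field_simp
  have hz0 : 0 ≤ z := by rw [hz]; positivity
  rw [hy', show c * x ^ 4 + c⁻¹ ^ 3 * (c * z) ^ 4 = c * (x ^ 4 + z ^ 4) by field_simp,
    show x ^ 3 * (c * z) = c * (x ^ 3 * z) by ring]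
  gcongr
  rcases le_total x z with h | h
  · calc x ^ 3 * z ≤ z ^ 3 * z := by gcongr
      _ ≤ _ := by nlinarith [pow_nonneg hx 4]
  · calc x ^ 3 * z ≤ x ^ 3 * x := by gcongr
      _ ≤ _ := by nlinarith [pow_nonneg hz0 4]

/-- The inner integral in the Hardy–Littlewood–Sobolev inequality for the kernel `|t|^{-1/2}`. -/
theorem hls_inner {μ : Measure ℝ} [SFinite μ] (hμ : μ ≤ volume) {φ : ℝ → ℝ} (hφ : Measurable φ)
    (hφ0 : ∀ t, 0 ≤ φ t) {N : ℝ} (hN0 : 0 < N) (hN : ∫⁻ t, ENNReal.ofReal (φ t ^ 4) ∂μ ≤ ENNReal.ofReal N)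
    {x : ℝ} (hx : 0 < x) (t : ℝ) :
    ∫⁻ s, (if φ s ≤ x then ENNReal.ofReal (φ s ^ 3 * (1 / √|t - s|)) else 0) ∂μ ≤
      ENNReal.ofReal (7 * x * √N) := by
  -- For |t-s| < δ the bound φ ≤ x is used and gives 4x³√δ. Beyond δ Young's inequality gives
  -- 2/(c³δ) + cN. With δ = N/x⁴ and c = x/√N the three contributions are 4, 2 and 1 times x√N.
  obtain ⟨δ, hδe⟩ : ∃ δ, δ = N / x ^ 4 := ⟨_, rfl⟩
  obtain ⟨c, hce⟩ : ∃ c, c = x / √N := ⟨_, rfl⟩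
  have hsN : 0 < √N := Real.sqrt_pos.mpr hN0
  have hNN : √N ^ 2 = N := Real.sq_sqrt hN0.le
  have hδ : 0 < δ := by rw [hδe]; positivity
  have hc : 0 < c := by rw [hce]; positivity
  have hpt : ∀ s, (if φ s ≤ x then ENNReal.ofReal (φ s ^ 3 * (1 / √|t - s|)) else 0) ≤
      (ENNReal.ofReal (x ^ 3) * (if |t - s| < δ then ENNReal.ofReal (1 / √|t - s|) else 0) +
        ENNReal.ofReal (c⁻¹ ^ 3) * (if δ ≤ |t - s| then ENNReal.ofReal (1 / |t - s| ^ 2) else 0)) +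
        ENNReal.ofReal c * ENNReal.ofReal (φ s ^ 4) := by
    intro s
    split_ifs with h1 h2 h3 h3
    · exact absurd h3 (not_le.mpr h2)
    · rw [mul_zero, add_zero, ENNReal.ofReal_mul (by have := hφ0 s; positivity)]
      refine le_add_right ?_
      gcongr
      exact hφ0 s
    · rw [mul_zero, zero_add, ← ENNReal.ofReal_mul (by positivity), ← ENNReal.ofReal_mul hc.le,
        ← ENNReal.ofReal_add (by positivity) (by have := hφ0 s; positivity)]
      refine ENNReal.ofReal_le_ofReal ?_
      have h := young_cube (hφ0 s) (y := 1 / √|t - s|) (by positivity) hc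
      rw [show (1 / √|t - s|) ^ 4 = 1 / |t - s| ^ 2 by
        rw [div_pow, one_pow, show √|t - s| ^ 4 = (√|t - s| ^ 2) ^ 2 by ring,
          Real.sq_sqrt (abs_nonneg _)]] at h
      linarith
    · exact absurd (not_lt.mp h2) h3
    · simp
    · simp
    · simp
    · simp
  have m1 : Measurable fun s : ℝ => (if |t - s| < δ then ENNReal.ofReal (1 / √|t - s|) else 0) :=
    Measurable.ite (measurableSet_lt (by fun_prop) (by fun_prop)) (by fun_prop) measurable_const
  have m2 : Measurable fun s : ℝ => (if δ ≤ |t - s| then ENNReal.ofReal (1 / |t - s| ^ 2) else 0) :=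
    Measurable.ite (measurableSet_le (by fun_prop) (by fun_prop)) (by fun_prop) measurable_const
  have i1 : ∫⁻ s, (if |t - s| < δ then ENNReal.ofReal (1 / √|t - s|) else 0) ∂μ ≤
      ENNReal.ofReal (4 * √δ) := by
    refine (lintegral_mono' hμ le_rfl).trans ?_
    rw [lintegral_sub_left_eq_self (fun u : ℝ => if |u| < δ then ENNReal.ofReal (1 / √|u|) else 0) t]
    exact lintegral_inv_sqrt_abs_le hδ
  have i2 : ∫⁻ s, (if δ ≤ |t - s| then ENNReal.ofReal (1 / |t - s| ^ 2) else 0) ∂μ ≤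
      ENNReal.ofReal (2 / δ) := by
    refine (lintegral_mono' hμ le_rfl).trans ?_
    rw [lintegral_sub_left_eq_self
      (fun u : ℝ => if δ ≤ |u| then ENNReal.ofReal (1 / |u| ^ 2) else 0) t]
    exact lintegral_inv_sq_abs_le hδ
  refine (lintegral_mono hpt).trans ?_
  rw [lintegral_add_right _ (by fun_prop), lintegral_add_right _ (m2.const_mul _),
    lintegral_const_mul _ m1, lintegral_const_mul _ m2, lintegral_const_mul _ (by fun_prop)]
  calc _ ≤ ENNReal.ofReal (x ^ 3) * ENNReal.ofReal (4 * √δ) +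
        ENNReal.ofReal (c⁻¹ ^ 3) * ENNReal.ofReal (2 / δ) + ENNReal.ofReal c * ENNReal.ofReal N := by gcongr
    _ = ENNReal.ofReal (x ^ 3 * (4 * √δ) + c⁻¹ ^ 3 * (2 / δ) + c * N) := by
        have h3 : (0 : ℝ) ≤ c⁻¹ ^ 3 := by positivity
        rw [← ENNReal.ofReal_mul (by positivity), ← ENNReal.ofReal_mul h3, ← ENNReal.ofReal_mul hc.le,
          ← ENNReal.ofReal_add (by positivity) (by positivity),
          ← ENNReal.ofReal_add (by positivity) (by positivity)]
    _ = _ := by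
        congr 1
        have hsδ : √δ = √N / x ^ 2 := by
          rw [hδe, Real.sqrt_div hN0.le, show x ^ 4 = (x ^ 2) ^ 2 by ring, Real.sqrt_sq (by positivity)]
        rw [hsδ, hδe, hce]
        obtain ⟨m, hm⟩ : ∃ m, m = √N := ⟨_, rfl⟩
        rw [← hm] at hsN hNN ⊢
        rw [← hNN]
        field_simp
        ring

/-- The part of the Hardy–Littlewood–Sobolev form where the second factor is the smaller one. -/
def hlsForm (φ : ℝ → ℝ) (t s : ℝ) : ℝ≥0∞ :=
  ENNReal.ofReal (φ t ^ 3) * (if φ s ≤ φ t then ENNReal.ofReal (φ s ^ 3 * (1 / √|t - s|)) else 0)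

theorem measurable_hlsForm {φ : ℝ → ℝ} (hφ : Measurable φ) :
    Measurable (Function.uncurry (hlsForm φ)) :=
  Measurable.mul (by fun_prop) (Measurable.ite (measurableSet_le (by fun_prop) (by fun_prop))
      (by fun_prop) measurable_const)

/-- The kernel is symmetric, so for each pair (t, s) the larger value of φ can be taken as the outer
one. The inner integral then has φ(s) ≤ φ(t), as `hls_inner` requires. -/
theorem le_hlsForm_add {φ : ℝ → ℝ} (hφ0 : ∀ t, 0 ≤ φ t) (t s : ℝ) :
    ENNReal.ofReal (φ t ^ 3) * ENNReal.ofReal (φ s ^ 3) * ENNReal.ofReal (1 / √|t - s|) ≤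
      hlsForm φ t s + hlsForm φ s t := by
  have e : ∀ u v : ℝ, ENNReal.ofReal (φ u ^ 3) * ENNReal.ofReal (φ v ^ 3) *
      ENNReal.ofReal (1 / √|u - v|) =
      ENNReal.ofReal (φ u ^ 3) * ENNReal.ofReal (φ v ^ 3 * (1 / √|u - v|)) := by
    intro u v
    rw [ENNReal.ofReal_mul (pow_nonneg (hφ0 v) 3), mul_assoc]
  rcases le_total (φ s) (φ t) with h | h
  · rw [hlsForm, if_pos h, e t s]; exact le_self_add
  · rw [hlsForm.eq_1 φ s t, if_pos h, abs_sub_comm t s, mul_comm (ENNReal.ofReal (φ t ^ 3)), e s t]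
    exact le_add_self

/-- The Hardy–Littlewood–Sobolev inequality for the kernel `|t|^{-1/2}` in the self-dual form. -/
theorem hls_quarter {μ : Measure ℝ} [SFinite μ] (hμ : μ ≤ volume) {φ : ℝ → ℝ} (hφ : Measurable φ)
    (hφ0 : ∀ t, 0 ≤ φ t) {N : ℝ} (hN0 : 0 < N) (hN : ∫⁻ t, ENNReal.ofReal (φ t ^ 4) ∂μ ≤ ENNReal.ofReal N) :
    ∫⁻ t, ∫⁻ s, ENNReal.ofReal (φ t ^ 3) * ENNReal.ofReal (φ s ^ 3) * ENNReal.ofReal (1 / √|t - s|) ∂μ ∂μ ≤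
      ENNReal.ofReal (14 * N * √N) := by
  have hHm := measurable_hlsForm hφ
  have hH : ∫⁻ t, ∫⁻ s, hlsForm φ t s ∂μ ∂μ ≤ ENNReal.ofReal (7 * N * √N) := by
    calc ∫⁻ t, ∫⁻ s, hlsForm φ t s ∂μ ∂μ ≤ ∫⁻ t, ENNReal.ofReal (7 * √N) * ENNReal.ofReal (φ t ^ 4) ∂μ := by
          refine lintegral_mono fun t => ?_
          simp only [hlsForm]
          rcases (hφ0 t).eq_or_lt with h | h
          · rw [← h]; simp
          rw [lintegral_const_mul _ (Measurable.ite (measurableSet_le (by fun_prop) (by fun_prop))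
            (by fun_prop) measurable_const)]
          refine (mul_le_mul_right (hls_inner hμ hφ hφ0 hN0 hN h t) _).trans (le_of_eq ?_)
          rw [← ENNReal.ofReal_mul (by positivity), ← ENNReal.ofReal_mul (by positivity)]
          congr 1; ring
      _ ≤ ENNReal.ofReal (7 * √N) * ENNReal.ofReal N := by
          rw [lintegral_const_mul _ (by fun_prop)]; gcongr
      _ = _ := by
          rw [← ENNReal.ofReal_mul (by positivity)]
          congr 1; ring
  have hswap : ∫⁻ t, ∫⁻ s, hlsForm φ s t ∂μ ∂μ = ∫⁻ t, ∫⁻ s, hlsForm φ t s ∂μ ∂μ :=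
    (lintegral_lintegral_swap hHm.aemeasurable).symm
  calc _ ≤ ∫⁻ t, ∫⁻ s, (hlsForm φ t s + hlsForm φ s t) ∂μ ∂μ :=
        lintegral_mono fun t => lintegral_mono fun s => le_hlsForm_add hφ0 t s
    _ = ∫⁻ t, ((∫⁻ s, hlsForm φ t s ∂μ) + ∫⁻ s, hlsForm φ s t ∂μ) ∂μ :=
        lintegral_congr fun t => lintegral_add_left (hHm.comp (measurable_prodMk_left (x := t))) _
    _ = (∫⁻ t, ∫⁻ s, hlsForm φ t s ∂μ ∂μ) + ∫⁻ t, ∫⁻ s, hlsForm φ s t ∂μ ∂μ :=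
        lintegral_add_left hHm.lintegral_prod_right' _
    _ ≤ ENNReal.ofReal (7 * N * √N) + ENNReal.ofReal (7 * N * √N) := by rw [hswap]; gcongr
    _ = _ := by
        rw [← ENNReal.ofReal_add (by positivity) (by positivity)]
        congr 1; ring

theorem lintegral_mul_sq_le {α : Type*} [MeasurableSpace α] {μ : Measure α} {u v : α → ℝ≥0∞}
    (hu : AEMeasurable u μ) (hv : AEMeasurable v μ) :
    (∫⁻ x, u x * v x ∂μ) ^ 2 ≤ (∫⁻ x, u x ^ 2 ∂μ) * ∫⁻ x, v x ^ 2 ∂μ := by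
  have h := ENNReal.lintegral_mul_le_Lp_mul_Lq μ (p := 2) (q := 2)
    (Real.holderConjugate_iff.mpr ⟨by norm_num, by norm_num⟩) hu hv
  simp only [Pi.mul_apply, ENNReal.rpow_two] at h
  calc _ ≤ ((∫⁻ x, u x ^ 2 ∂μ) ^ (1 / 2 : ℝ) * (∫⁻ x, v x ^ 2 ∂μ) ^ (1 / 2 : ℝ)) ^ 2 := by gcongr
    _ = _ := by
      rw [mul_pow, ← ENNReal.rpow_two, ← ENNReal.rpow_two, ← ENNReal.rpow_mul, ← ENNReal.rpow_mul]
      norm_num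

/-- Monotone convergence over bounded time windows. On such a window bounded functions have finite
norms, so a power of the norm can be cancelled in the duality arguments. -/
theorem lintegral_le_of_forall_Icc {g : ℝ → ℝ≥0∞} {C : ℝ≥0∞}
    (h : ∀ n : ℕ, ∫⁻ t in Icc (-(n : ℝ)) n, g t ≤ C) : ∫⁻ t, g t ≤ C := by
  have hU : (⋃ n : ℕ, Icc (-(n : ℝ)) n) = univ := by
    refine eq_univ_of_forall fun x => ?_
    obtain ⟨n, hn⟩ := exists_nat_ge |x|
    exact mem_iUnion.mpr ⟨n, abs_le.mp hn⟩
  rw [← setLIntegral_univ, ← hU, setLIntegral_iUnion_of_directed]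
  · exact iSup_le h
  · exact directed_of_isDirected_le fun n m hnm => Icc_subset_Icc (by simpa using hnm) (by simpa using hnm)

/-! ### Dispersive families: bounds in L² and L⁴ of time. -/

open scoped ComplexConjugate in
/-- A family of functions on the band whose Gram kernel decays. -/
structure DispersiveFamily (a : ℝ → ℝ → ℂ) (M D T : ℝ) : Prop where
  meas : Measurable (Function.uncurry a)
  bound : ∀ t ρ, ‖a t ρ‖ ≤ M
  D_pos : 0 < D
  T_pos : 0 < T
  decay : ∀ t t', t ≠ t' → ‖∫ ρ, a t ρ * conj (a t' ρ) ∂band‖ ≤ D / √|t - t'|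
  far : ∀ t t', T ≤ |t - t'| → ‖∫ ρ, a t ρ * conj (a t' ρ) ∂band‖ ≤ D * T * √T / |t - t'| ^ 2

namespace DispersiveFamily

variable {a : ℝ → ℝ → ℂ} {M D T : ℝ}

theorem measurable_apply (h : DispersiveFamily a M D T) {f : ℝ → ℂ} (hf : Measurable f) :
    Measurable fun t => ∫ ρ, a t ρ * f ρ ∂band := by
  have h1 : Measurable (Function.uncurry fun t ρ => a t ρ * f ρ) := h.meas.mul (hf.comp measurable_snd)
  exact h1.stronglyMeasurable.integral_prod_right.measurable

theorem apply_bounded (h : DispersiveFamily a M D T) {f : ℝ → ℂ}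
    (hf2 : ∫⁻ ρ, ‖f ρ‖ₑ ^ 2 ∂band ≠ ⊤) : ∃ W : ℝ, 0 ≤ W ∧ ∀ t, ‖∫ ρ, a t ρ * f ρ ∂band‖ ≤ W := by
  have hM : 0 ≤ M := (norm_nonneg _).trans (h.bound 0 0)
  have h1 := lintegral_enorm_lt_top_of_sq hf2
  refine ⟨(ENNReal.ofReal M * ∫⁻ ρ, ‖f ρ‖ₑ ∂band).toReal, ENNReal.toReal_nonneg, fun t => ?_⟩
  rw [← toReal_enorm]
  refine ENNReal.toReal_mono (ENNReal.mul_ne_top (by simp) h1) ?_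
  refine (enorm_integral_le_lintegral_enorm _).trans ?_
  rw [← lintegral_const_mul' _ _ (by simp)]
  refine lintegral_mono fun ρ => ?_
  rw [enorm_mul]
  gcongr
  rw [← ofReal_norm]
  exact ENNReal.ofReal_le_ofReal (h.bound t ρ)

-- Fubini moves the operator onto g. Cauchy–Schwarz in ρ then separates f from the adjoint applied
-- to g, whose squared norm is expanded through the TT* kernel.
open scoped ComplexConjugate in
theorem duality (h : DispersiveFamily a M D T) {f : ℝ → ℂ} (hf : Measurable f)
    (hf2 : ∫⁻ ρ, ‖f ρ‖ₑ ^ 2 ∂band ≠ ⊤) {S : Measure ℝ} [IsFiniteMeasure S] {g : ℝ → ℂ} (hg : Measurable g)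
    {G : ℝ} (hgb : ∀ t, ‖g t‖ ≤ G) {k : ℝ → ℝ → ℝ≥0∞}
    (hk : ∀ᵐ t ∂S, ∀ᵐ t' ∂S, ‖∫ ρ, a t ρ * conj (a t' ρ) ∂band‖ₑ ≤ k t t') :
    ‖∫ t, (∫ ρ, a t ρ * f ρ ∂band) * g t ∂S‖ₑ ^ 2 ≤
      (∫⁻ ρ, ‖f ρ‖ₑ ^ 2 ∂band) * ∫⁻ t, ∫⁻ t', ‖g t‖ₑ * ‖g t'‖ₑ * k t t' ∂S ∂S := by
  have hM : 0 ≤ M := (norm_nonneg _).trans (h.bound 0 0)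
  have hG : 0 ≤ G := (norm_nonneg _).trans (hgb 0)
  have f1 := lintegral_enorm_lt_top_of_sq hf2
  have hfi : Integrable f band := ⟨hf.aestronglyMeasurable, f1.lt_top⟩
  have hagm : Measurable fun p : ℝ × ℝ => a p.1 p.2 * g p.1 := h.meas.mul (hg.comp measurable_fst)
  have hint : Integrable (fun p : ℝ × ℝ => a p.1 p.2 * f p.2 * g p.1) (S.prod band) := by
    have h2 : Integrable (fun p : ℝ × ℝ => (1 : ℂ) * f p.2) (S.prod band) :=
      (integrable_const (1 : ℂ)).mul_prod hfi
    refine (h2.bdd_mul (c := M * G) hagm.aestronglyMeasurable (.of_forall fun p => ?_)).congr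
      (.of_forall fun p => by simp only; ring)
    rw [norm_mul]
    exact mul_le_mul (h.bound _ _) (hgb _) (norm_nonneg _) hM
  have e : ∫ t, (∫ ρ, a t ρ * f ρ ∂band) * g t ∂S = ∫ ρ, f ρ * ∫ t, a t ρ * g t ∂S ∂band := by
    have := integral_integral_swap (f := fun t ρ => a t ρ * f ρ * g t) hint
    simp only [← integral_mul_const, ← integral_const_mul]
    rw [this]
    congr 1; ext ρ; congr 1; ext t; ring
  have hmA : Measurable fun ρ => ∫ t, a t ρ * g t ∂S := by
    have h1 : Measurable (Function.uncurry fun ρ t => a t ρ * g t) := hagm.comp measurable_swap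
    exact h1.stronglyMeasurable.integral_prod_right.measurable
  have ha' : Measurable (Function.uncurry fun ρ t => a t ρ) := h.meas.comp measurable_swap
  rw [e]
  calc _ ≤ (∫⁻ ρ, ‖f ρ‖ₑ * ‖∫ t, a t ρ * g t ∂S‖ₑ ∂band) ^ 2 := by
        gcongr
        refine (enorm_integral_le_lintegral_enorm _).trans (le_of_eq ?_)
        simp only [enorm_mul]
    _ ≤ (∫⁻ ρ, ‖f ρ‖ₑ ^ 2 ∂band) * ∫⁻ ρ, ‖∫ t, a t ρ * g t ∂S‖ₑ ^ 2 ∂band :=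
        lintegral_mul_sq_le hf.enorm.aemeasurable hmA.enorm.aemeasurable
    _ ≤ _ := by
        refine mul_le_mul_right (lintegral_sq_le_of_kernel ha' hg ?_ hk) _
        refine ne_top_of_le_ne_top (b := ∫⁻ _, (ENNReal.ofReal (M * G) * S univ) ^ 2 ∂band) ?_ ?_
        · rw [lintegral_const]
          exact ENNReal.mul_ne_top (ENNReal.pow_ne_top (ENNReal.mul_ne_top (by simp) (by simp))) (by simp)
        · refine lintegral_mono fun ρ => ?_
          dsimp only
          gcongr
          rw [← lintegral_const]
          refine lintegral_mono fun t => ?_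
          rw [← ofReal_norm, norm_mul]
          exact ENNReal.ofReal_le_ofReal (mul_le_mul (h.bound _ _) (hgb _) (norm_nonneg _) hM)

theorem ae_ne {S : Measure ℝ} (hS : S ≤ volume) (t : ℝ) : ∀ᵐ t' ∂S, t ≠ t' := by
  have h : ∀ᵐ t' : ℝ, t ≠ t' := by
    rw [ae_iff]; simp
  exact ae_mono hS h

-- The test function that makes duality an identity: m = 0 for the L² norm and m = 2 for the L⁴
-- norm.
open scoped ComplexConjugate in
theorem self_dual {F : ℝ → ℂ} (hF : Measurable F) {W : ℝ} (hFb : ∀ t, ‖F t‖ ≤ W) {S : Measure ℝ}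
    [IsFiniteMeasure S] (m : ℕ) :
    ‖∫ t, F t * (conj (F t) * (‖F t‖ : ℂ) ^ m) ∂S‖ₑ = ∫⁻ t, ‖F t‖ₑ ^ (m + 2) ∂S := by
  have e : ∀ t, F t * (conj (F t) * (‖F t‖ : ℂ) ^ m) = ((‖F t‖ ^ (m + 2) : ℝ) : ℂ) := by
    intro t
    rw [← mul_assoc, Complex.mul_conj, Complex.normSq_eq_norm_sq]
    push_cast; ring
  have hi : Integrable (fun t => ‖F t‖ ^ (m + 2)) S := by
    refine Integrable.of_bound (by fun_prop) (W ^ (m + 2)) (.of_forall fun t => ?_)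
    rw [Real.norm_eq_abs, abs_of_nonneg (by positivity)]
    gcongr; exact hFb t
  simp only [e]
  rw [integral_complex_ofReal, enorm_complex_ofReal, abs_of_nonneg (integral_nonneg fun t => by positivity),
    ofReal_integral_eq_lintegral_ofReal hi (.of_forall fun t => by positivity)]
  refine lintegral_congr fun t => ?_
  rw [ENNReal.ofReal_pow (norm_nonneg _), ofReal_norm]

theorem lintegral_pow_ne_top {F : ℝ → ℂ} {W : ℝ} (hFb : ∀ t, ‖F t‖ ≤ W) {S : Measure ℝ}
    [IsFiniteMeasure S] (m : ℕ) : ∫⁻ t, ‖F t‖ₑ ^ m ∂S ≠ ⊤ := by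
  refine ne_top_of_le_ne_top (b := ∫⁻ _, ENNReal.ofReal W ^ m ∂S) ?_ (lintegral_mono fun t => ?_)
  · rw [lintegral_const]
    exact ENNReal.mul_ne_top (ENNReal.pow_ne_top (by simp)) (by simp)
  · dsimp only
    gcongr
    rw [← ofReal_norm]
    exact ENNReal.ofReal_le_ofReal (hFb t)

open scoped ComplexConjugate in
/-- The `L²_t` bound of a dispersive family. -/
theorem lintegral_sq_le (h : DispersiveFamily a M D T) {f : ℝ → ℂ} (hf : Measurable f)
    (hf2 : ∫⁻ ρ, ‖f ρ‖ₑ ^ 2 ∂band ≠ ⊤) :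
    ∫⁻ t, ‖∫ ρ, a t ρ * f ρ ∂band‖ₑ ^ 2 ≤ ENNReal.ofReal (6 * D * √T) * ∫⁻ ρ, ‖f ρ‖ₑ ^ 2 ∂band := by
  refine lintegral_le_of_forall_Icc fun n => ?_
  have hD := h.D_pos
  have hT := h.T_pos
  obtain ⟨S, hS⟩ : ∃ S : Measure ℝ, S = volume.restrict (Icc (-(n : ℝ)) n) := ⟨_, rfl⟩
  have hSf : IsFiniteMeasure S := ⟨by rw [hS]; simp⟩
  have hSv : S ≤ volume := by rw [hS]; exact Measure.restrict_le_self
  rw [← hS]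
  obtain ⟨W, hW0, hW⟩ := h.apply_bounded hf2
  have hFm := h.measurable_apply hf
  obtain ⟨F, hF⟩ : ∃ F : ℝ → ℂ, F = fun t => ∫ ρ, a t ρ * f ρ ∂band := ⟨_, rfl⟩
  rw [← hF] at hFm
  have hW' : ∀ t, ‖F t‖ ≤ W := fun t => by rw [hF]; exact hW t
  -- The convolution majorant is D|u|^{-1/2} below T and D T^{3/2} u^{-2} above, with total mass at
  -- most 4D√T + 2D√T.
  obtain ⟨k0, hk0⟩ : ∃ k0 : ℝ → ℝ≥0∞, k0 = fun u =>
      ENNReal.ofReal D * (if |u| < T then ENNReal.ofReal (1 / √|u|) else 0) +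
      ENNReal.ofReal (D * T * √T) * (if T ≤ |u| then ENNReal.ofReal (1 / |u| ^ 2) else 0) := ⟨_, rfl⟩
  have m1 : Measurable fun s : ℝ => (if |s| < T then ENNReal.ofReal (1 / √|s|) else 0) :=
    Measurable.ite (measurableSet_lt (by fun_prop) (by fun_prop)) (by fun_prop) measurable_const
  have m2 : Measurable fun s : ℝ => (if T ≤ |s| then ENNReal.ofReal (1 / |s| ^ 2) else 0) :=
    Measurable.ite (measurableSet_le (by fun_prop) (by fun_prop)) (by fun_prop) measurable_const
  have hk0m : Measurable k0 := by rw [hk0]; exact (m1.const_mul _).add (m2.const_mul _)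
  have hk0i : ∫⁻ u, k0 u ≤ ENNReal.ofReal (6 * D * √T) := by
    rw [hk0, lintegral_add_right _ (m2.const_mul _), lintegral_const_mul _ m1, lintegral_const_mul _ m2]
    calc _ ≤ ENNReal.ofReal D * ENNReal.ofReal (4 * √T) +
          ENNReal.ofReal (D * T * √T) * ENNReal.ofReal (2 / T) := by
          gcongr
          · exact lintegral_inv_sqrt_abs_le hT
          · exact lintegral_inv_sq_abs_le hT
      _ = _ := by
          rw [← ENNReal.ofReal_mul hD.le, ← ENNReal.ofReal_mul (by positivity),
            ← ENNReal.ofReal_add (by positivity) (by positivity)]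
          congr 1; field_simp; ring
  have hkk : ∀ᵐ t ∂S, ∀ᵐ t' ∂S, ‖∫ ρ, a t ρ * conj (a t' ρ) ∂band‖ₑ ≤ k0 (t - t') := by
    refine .of_forall fun t => (ae_ne hSv t).mono fun t' ht => ?_
    rw [hk0, ← ofReal_norm]
    dsimp only
    by_cases hb : |t - t'| < T
    · rw [if_pos hb, ← ENNReal.ofReal_mul hD.le]
      refine le_add_right (ENNReal.ofReal_le_ofReal ((h.decay t t' ht).trans (le_of_eq ?_)))
      ring
    · rw [if_neg hb, if_pos (not_lt.mp hb), mul_zero, zero_add, ← ENNReal.ofReal_mul (by positivity)]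
      refine ENNReal.ofReal_le_ofReal ((h.far t t' (not_lt.mp hb)).trans (le_of_eq ?_))
      ring
  have hd := h.duality hf hf2 (S := S) (g := fun t => conj (F t) * (‖F t‖ : ℂ) ^ 0) (G := W)
    (by fun_prop) (fun t => by simpa using hW' t) hkk
  have hsd := self_dual hFm hW' (S := S) 0
  have hN := lintegral_pow_ne_top hW' (S := S) 2
  have heq : ∀ t, ∫ ρ, a t ρ * f ρ ∂band = F t := fun t => by rw [hF]
  simp only [heq] at hd ⊢
  rw [hsd] at hd
  simp only [pow_zero, mul_one, RCLike.enorm_conj, zero_add] at hd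
  have hsch := schur_test (μ := S) hFm.enorm (k := fun t t' => k0 (t - t'))
    (hk0m.comp (measurable_fst.sub measurable_snd)) (fun x y => by
      rw [hk0]; simp only [abs_sub_comm]) (B := ENNReal.ofReal (6 * D * √T)) fun x => by
      refine (lintegral_mono' hSv le_rfl).trans ?_
      rw [lintegral_sub_left_eq_self k0 x]
      exact hk0i
  have hle := hd.trans (mul_le_mul_right hsch _)
  obtain ⟨N, hNe⟩ : ∃ N, N = ∫⁻ t, ‖F t‖ₑ ^ 2 ∂S := ⟨_, rfl⟩
  rw [← hNe] at hle hN ⊢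
  -- Duality has produced N² ≤ E·B·N, where E is the norm of f and B the Schur constant. A finite
  -- nonzero N cancels.
  rcases eq_or_ne N 0 with h0 | h0
  · rw [h0]; exact zero_le
  · rw [sq, ← mul_assoc] at hle
    rw [mul_comm]
    exact (ENNReal.mul_le_mul_iff_left h0 hN).mp hle

open scoped ComplexConjugate in
/-- The `L⁴_t` bound of a dispersive family. -/
theorem lintegral_four_le (h : DispersiveFamily a M D T) {f : ℝ → ℂ} (hf : Measurable f)
    (hf2 : ∫⁻ ρ, ‖f ρ‖ₑ ^ 2 ∂band ≠ ⊤) :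
    ∫⁻ t, ‖∫ ρ, a t ρ * f ρ ∂band‖ₑ ^ 4 ≤
      ENNReal.ofReal (196 * D ^ 2) * (∫⁻ ρ, ‖f ρ‖ₑ ^ 2 ∂band) ^ 2 := by
  refine lintegral_le_of_forall_Icc fun n => ?_
  have hD := h.D_pos
  obtain ⟨S, hS⟩ : ∃ S : Measure ℝ, S = volume.restrict (Icc (-(n : ℝ)) n) := ⟨_, rfl⟩
  have hSf : IsFiniteMeasure S := ⟨by rw [hS]; simp⟩
  have hSv : S ≤ volume := by rw [hS]; exact Measure.restrict_le_self
  rw [← hS]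
  obtain ⟨W, hW0, hW⟩ := h.apply_bounded hf2
  have hFm := h.measurable_apply hf
  obtain ⟨F, hF⟩ : ∃ F : ℝ → ℂ, F = fun t => ∫ ρ, a t ρ * f ρ ∂band := ⟨_, rfl⟩
  rw [← hF] at hFm
  have hW' : ∀ t, ‖F t‖ ≤ W := fun t => by rw [hF]; exact hW t
  have hkk : ∀ᵐ t ∂S, ∀ᵐ t' ∂S, ‖∫ ρ, a t ρ * conj (a t' ρ) ∂band‖ₑ ≤
      ENNReal.ofReal D * ENNReal.ofReal (1 / √|t - t'|) := by
    refine .of_forall fun t => (ae_ne hSv t).mono fun t' ht => ?_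
    rw [← ofReal_norm, ← ENNReal.ofReal_mul hD.le]
    exact ENNReal.ofReal_le_ofReal ((h.decay t t' ht).trans (le_of_eq (by ring)))
  have hd := h.duality hf hf2 (S := S) (g := fun t => conj (F t) * (‖F t‖ : ℂ) ^ 2) (G := W ^ 3)
    (by fun_prop) (fun t => by
      rw [norm_mul, RCLike.norm_conj, norm_pow, Complex.norm_real, norm_norm, ← pow_succ']
      gcongr; exact hW' t) hkk
  have hsd := self_dual hFm hW' (S := S) 2
  have hN := lintegral_pow_ne_top hW' (S := S) 4
  have heq : ∀ t, ∫ ρ, a t ρ * f ρ ∂band = F t := fun t => by rw [hF]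
  simp only [heq] at hd ⊢
  rw [hsd] at hd
  have hg : ∀ t, ‖conj (F t) * (‖F t‖ : ℂ) ^ 2‖ₑ = ENNReal.ofReal (‖F t‖ ^ 3) := by
    intro t
    rw [← ofReal_norm, norm_mul, RCLike.norm_conj, norm_pow, Complex.norm_real, norm_norm, ← pow_succ']
  simp only [hg] at hd
  have hcomm : ∀ t t', ENNReal.ofReal (‖F t‖ ^ 3) * ENNReal.ofReal (‖F t'‖ ^ 3) *
      (ENNReal.ofReal D * ENNReal.ofReal (1 / √|t - t'|)) = ENNReal.ofReal D *
      (ENNReal.ofReal (‖F t‖ ^ 3) * ENNReal.ofReal (‖F t'‖ ^ 3) * ENNReal.ofReal (1 / √|t - t'|)) := by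
    intro t t'; ring
  simp only [hcomm] at hd
  simp only [lintegral_const_mul' _ _ ENNReal.ofReal_ne_top] at hd
  obtain ⟨N, hNe⟩ : ∃ N, N = (∫⁻ t, ‖F t‖ₑ ^ 4 ∂S).toReal := ⟨_, rfl⟩
  have hNN : ∫⁻ t, ‖F t‖ₑ ^ 4 ∂S = ENNReal.ofReal N := by rw [hNe, ENNReal.ofReal_toReal hN]
  have hN0 : 0 ≤ N := by rw [hNe]; exact ENNReal.toReal_nonneg
  rw [hNN] at hd ⊢
  rcases hN0.eq_or_lt with h0 | h0
  · rw [← h0]; simp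
  have hls := hls_quarter hSv (φ := fun t => ‖F t‖) (by fun_prop) (fun t => norm_nonneg _) h0 (by
    rw [← hNN]
    refine le_of_eq (lintegral_congr fun t => ?_)
    rw [ENNReal.ofReal_pow (norm_nonneg _), ofReal_norm])
  have hle := hd.trans (mul_le_mul_right (mul_le_mul_right hls _) _)
  obtain ⟨E, hE⟩ : ∃ E, E = (∫⁻ ρ, ‖f ρ‖ₑ ^ 2 ∂band).toReal := ⟨_, rfl⟩
  have hEE : ∫⁻ ρ, ‖f ρ‖ₑ ^ 2 ∂band = ENNReal.ofReal E := by rw [hE, ENNReal.ofReal_toReal hf2]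
  have hE0 : 0 ≤ E := by rw [hE]; exact ENNReal.toReal_nonneg
  rw [hEE] at hle ⊢
  rw [← ENNReal.ofReal_pow hN0, ← ENNReal.ofReal_mul hD.le, ← ENNReal.ofReal_mul hE0,
    ENNReal.ofReal_le_ofReal_iff (by positivity)] at hle
  rw [← ENNReal.ofReal_pow hE0, ← ENNReal.ofReal_mul (by positivity)]
  refine ENNReal.ofReal_le_ofReal ?_
  obtain ⟨m, hm⟩ : ∃ m, m = √N := ⟨_, rfl⟩
  have hm0 : 0 < m := by rw [hm]; exact Real.sqrt_pos.mpr h0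
  have hmm : N = m ^ 2 := by rw [hm, Real.sq_sqrt hN0]
  rw [← hm, hmm] at hle
  -- With N = m², duality and the Hardy–Littlewood–Sobolev inequality read m⁴ ≤ 14 D E m³. Squaring
  -- the result gives 196 = 14².
  have h3 : m ≤ 14 * D * E := by
    have : m ^ 3 * m ≤ m ^ 3 * (14 * D * E) := by linarith
    exact le_of_mul_le_mul_left this (by positivity)
  rw [hmm]
  calc m ^ 2 ≤ (14 * D * E) ^ 2 := by gcongr
    _ = _ := by ring

end DispersiveFamily

/-! ### Half waves sampled at a measurable radius. -/

open scoped ComplexConjugate in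
/-- A cutoff function supported in a compact subinterval of the band. -/
structure BandCutoff (a b b0 : ℝ) (β : ℝ → ℂ) : Prop where
  meas : Measurable β
  zero : ∀ ρ, ρ ∉ Icc a b → β ρ = 0
  b0_pos : 0 < b0
  bound : ∀ ρ, ‖β ρ‖ ≤ b0
  cut : ∃ B' B'' : ℝ → ℂ, CutoffData a b b0 (fun ρ => β ρ * conj (β ρ)) B' B''

open scoped ComplexConjugate in
theorem BandCutoff.conj {a b b0 : ℝ} {β : ℝ → ℂ} (h : BandCutoff a b b0 β) :
    BandCutoff a b b0 fun ρ => conj (β ρ) where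
  meas := Complex.continuous_conj.measurable.comp h.meas
  zero ρ hρ := by rw [h.zero ρ hρ, map_zero]
  b0_pos := h.b0_pos
  bound ρ := by rw [RCLike.norm_conj]; exact h.bound ρ
  cut := by
    obtain ⟨B', B'', hB⟩ := h.cut
    refine ⟨B', B'', ?_⟩
    simpa only [Complex.conj_conj, mul_comm] using hB

-- The support of β is compact in the open band, so a slightly larger closed interval still lies
-- inside the band. The margin makes |β|² and its derivative vanish at the endpoints.
open scoped ComplexConjugate in
theorem exists_bandCutoff {β : ℝ → ℂ} (hβ : ContDiff ℝ ∞ β) (hβc : HasCompactSupport β)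
    (hβs : tsupport β ⊆ Ioo (1 / 2) 2) : ∃ a b b0 : ℝ, BandCutoff a b b0 β := by
  obtain ⟨a, b, ha, hab, hb, hsub⟩ : ∃ a b : ℝ, 1 / 2 < a ∧ a ≤ b ∧ b < 2 ∧ tsupport β ⊆ Ioo a b := by
    rcases (tsupport β).eq_empty_or_nonempty with h0 | hne
    · exact ⟨1, 1, by norm_num, le_rfl, by norm_num, by rw [h0]; exact empty_subset _⟩
    · obtain ⟨m, hm, hmin⟩ := (show IsCompact (tsupport β) from hβc).exists_isLeast hne
      obtain ⟨M, hM, hmax⟩ := (show IsCompact (tsupport β) from hβc).exists_isGreatest hne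
      have h1 := hβs hm
      have h2 := hβs hM
      have h3 := hmin hM
      refine ⟨(1 / 2 + m) / 2, (M + 2) / 2, by linarith [h1.1], by linarith [h1.1, h1.2, h2.2], by linarith [h2.2], ?_⟩
      intro x hx
      exact ⟨by linarith [hmin hx, h1.1], by linarith [hmax hx, h2.2]⟩
  have hz : ∀ x, x ∉ Ioo a b → x ∉ tsupport β := fun x hx h => hx (hsub h)
  let B : ℝ → ℂ := fun ρ => β ρ * conj (β ρ)
  have hBs : tsupport B ⊆ tsupport β := tsupport_mul_subset_left
  have hB : ContDiff ℝ ∞ B := hβ.mul (Complex.conjCLE.contDiff.comp hβ)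
  have hBc : HasCompactSupport B := hβc.mul_right
  have hB1 : ContDiff ℝ ∞ (deriv B) := ((contDiff_infty_iff_deriv).mp hB).2
  have hB2 : ContDiff ℝ ∞ (deriv (deriv B)) := ((contDiff_infty_iff_deriv).mp hB1).2
  obtain ⟨c, hc⟩ := hβc.exists_bound_of_continuous hβ.continuous
  obtain ⟨c0, hc0⟩ := hBc.exists_bound_of_continuous hB.continuous
  obtain ⟨c1, hc1⟩ := hBc.deriv.exists_bound_of_continuous hB1.continuous
  obtain ⟨c2, hc2⟩ := hBc.deriv.deriv.exists_bound_of_continuous hB2.continuous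
  have p0 := (norm_nonneg _).trans (hc 0)
  have p1 := (norm_nonneg _).trans (hc0 0)
  have p2 := (norm_nonneg _).trans (hc1 0)
  have p3 := (norm_nonneg _).trans (hc2 0)
  have hs1 : tsupport (deriv B) ⊆ tsupport β :=
    (closure_minimal support_deriv_subset (isClosed_tsupport _)).trans hBs
  refine ⟨a, b, 1 + c + c0 + c1 + c2, hβ.continuous.measurable, fun ρ hρ => ?_, by positivity,
    fun ρ => (hc ρ).trans (by linarith), deriv B, deriv (deriv B), ?_⟩
  · exact image_eq_zero_of_notMem_tsupport (hz ρ fun h => hρ (Ioo_subset_Icc_self h))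
  · have na : a ∉ tsupport β := hz a (by simp)
    have nb : b ∉ tsupport β := hz b (by simp)
    exact
      { lt_a := ha
        hab := hab
        b_lt := hb
        d1 := fun x => (hB.differentiable (by simp)).differentiableAt.hasDerivAt
        d2 := fun x => (hB1.differentiable (by simp)).differentiableAt.hasDerivAt
        cont := hB2.continuous
        bound := fun x => (hc0 x).trans (by linarith)
        bound1 := fun x => (hc1 x).trans (by linarith)
        bound2 := fun x => (hc2 x).trans (by linarith)
        za := image_eq_zero_of_notMem_tsupport (f := B) fun h => na (hBs h)
        zb := image_eq_zero_of_notMem_tsupport (f := B) fun h => nb (hBs h)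
        za' := image_eq_zero_of_notMem_tsupport fun h => na (hs1 h)
        zb' := image_eq_zero_of_notMem_tsupport fun h => nb (hs1 h) }

theorem measurable_besselZ {ν : ℝ} (hν : 0 ≤ ν) : Measurable (besselZ ν) := by
  have h1 := measurable_besselU hν
  have h2 := measurable_besselDU hν
  unfold besselZ
  fun_prop

/-- The outgoing half of the wave, sampled at the time-dependent radius `σ t`. -/
def halfWave (ν : ℝ) (ϖ : ℝ → ℝ) (β : ℝ → ℂ) (σ : ℝ → ℝ) (t ρ : ℝ) : ℂ :=
  Complex.exp (-(Complex.I * t * ϖ ρ)) *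
    (Complex.exp (Complex.I * ((σ t * ρ : ℝ) : ℂ)) * besselZ ν (σ t * ρ) * β ρ)

open scoped ComplexConjugate in
theorem halfWave_mul_conj (ν : ℝ) (ϖ : ℝ → ℝ) (β : ℝ → ℂ) (σ : ℝ → ℝ) (t t' ρ : ℝ) :
    halfWave ν ϖ β σ t ρ * conj (halfWave ν ϖ β σ t' ρ) =
      Complex.exp (Complex.I * ((-(t - t') * ϖ ρ + (σ t - σ t') * ρ : ℝ) : ℂ)) *
        ttAmp ν (σ t) (σ t') (fun ρ => β ρ * conj (β ρ)) ρ := by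
  have e : Complex.exp (Complex.I * ((-(t - t') * ϖ ρ + (σ t - σ t') * ρ : ℝ) : ℂ)) =
      Complex.exp (-(Complex.I * t * ϖ ρ)) * Complex.exp (Complex.I * ((σ t * ρ : ℝ) : ℂ)) *
      (Complex.exp (Complex.I * t' * ϖ ρ) * conj (Complex.exp (Complex.I * ((σ t' * ρ : ℝ) : ℂ)))) := by
    rw [← Complex.exp_conj, ← Complex.exp_add, ← Complex.exp_add, ← Complex.exp_add]
    congr 1
    rw [map_mul, Complex.conj_I, Complex.conj_ofReal]
    push_cast; ring
  rw [e, halfWave, halfWave, ttAmp, map_mul, map_mul, map_mul, conj_cexp_neg_I_mul]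
  ring

theorem BandCutoff.four_mul_le {a b b0 : ℝ} {β : ℝ → ℂ} (hβ : BandCutoff a b b0 β) {ν L R r ρ : ℝ}
    (hν : 0 ≤ ν) (hL2 : 1 + ν ≤ L ^ 2) (hR : 8 * L ^ 2 ≤ R) (hr : r ∈ Ico R (2 * R)) (hρ : ρ ∈ Icc a b) :
    4 * (1 + ν) ≤ r * ρ := by
  obtain ⟨B', B'', hB⟩ := hβ.cut
  have h1 := hr.1
  have h2 := (hB.sub hρ).1
  nlinarith

-- The kernel bounds are uniform over all pairs of radii of the shell, so the radius may depend
-- measurably on time. This linearizes the supremum over r.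
open scoped ComplexConjugate in
theorem dispersiveFamily_halfWave {A lam : ℝ} {ϖ w1 w2 w3 : ℝ → ℝ} (hA : 1 ≤ A) (hlam : 0 < lam)
    (hlamA : lam ≤ A) (hϖm : Measurable ϖ) (hϖ : PhaseData A lam ϖ w1 w2 w3) {a b b0 : ℝ} {β : ℝ → ℂ}
    (hβ : BandCutoff a b b0 β) {ν L R : ℝ} (hν : 0 ≤ ν) (hL1 : 1 ≤ L) (hL2 : 1 + ν ≤ L ^ 2)
    (hL3 : (1 + ν) ^ 2 ≤ L ^ 3) (hR : 8 * L ^ 2 ≤ R) {σ : ℝ → ℝ} (hσm : Measurable σ)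
    (hσ : ∀ t, σ t ∈ Ico R (2 * R)) :
    DispersiveFamily (halfWave ν ϖ β σ) (2 * besselM * b0) (kernelConst A lam b0 L) (2 * A * R) := by
  have hM := besselM_pos
  have hb0 := hβ.b0_pos
  have hR0 : 0 < R := by nlinarith
  have hA0 : 0 < A := by linarith
  obtain ⟨B', B'', hB⟩ := hβ.cut
  have hker : ∀ t t', ∫ ρ, halfWave ν ϖ β σ t ρ * conj (halfWave ν ϖ β σ t' ρ) ∂band =
      ∫ x in a..b, Complex.exp (Complex.I * ((-(t - t') * ϖ x + (σ t - σ t') * x : ℝ) : ℂ)) *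
        ttAmp ν (σ t) (σ t') (fun ρ => β ρ * conj (β ρ)) x := by
    intro t t'
    simp only [halfWave_mul_conj]
    rw [intervalIntegral.integral_of_le hB.hab, ← integral_Icc_eq_integral_Ioc, band]
    refine setIntegral_eq_of_subset_of_forall_sdiff_eq_zero measurableSet_Ioo hB.sub fun x hx => ?_
    rw [ttAmp, hβ.zero x hx.2]
    simp
  refine ⟨?_, ?_, ?_, by positivity, ?_, ?_⟩
  · have hz := measurable_besselZ hν
    have hb := hβ.meas
    unfold Function.uncurry halfWave
    fun_prop
  · intro t ρ
    by_cases hρ : ρ ∈ Icc a b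
    · rw [halfWave, norm_mul, norm_mul, norm_mul, norm_cexp_I_mul, one_mul,
        ← toReal_enorm, enorm_cexp_neg_I_mul, ENNReal.toReal_one, one_mul]
      exact mul_le_mul (norm_besselZ_le hν (hβ.four_mul_le hν hL2 hR (hσ t) hρ)) (hβ.bound ρ) (norm_nonneg _)
        (by positivity)
    · rw [halfWave, hβ.zero ρ hρ, mul_zero, mul_zero, norm_zero]; positivity
  · have := Real.sqrt_pos.mpr hlam
    rw [kernelConst]; positivity
  · intro t t' ht
    rw [hker]
    exact (ttKernel_bound hA hlam hlamA hϖ hB hν hL1 hL2 hL3 hR (hσ t) (hσ t') (sub_ne_zero.mpr ht)).1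
  · intro t t' ht
    rw [hker, sq_abs]
    refine (ttKernel_bound hA hlam hlamA hϖ hB hν hL1 hL2 hL3 hR (hσ t) (hσ t') ?_).2 ht
    intro h0
    rw [h0, abs_zero] at ht
    nlinarith

/-- The operator `f ↦ ∫ e^{-itϖ(ρ)} √(rρ) J_ν(rρ) β(ρ) f(ρ) dρ`. -/
def bandOp (ν : ℝ) (ϖ : ℝ → ℝ) (β f : ℝ → ℂ) (t r : ℝ) : ℂ :=
  ∫ ρ, Complex.exp (-(Complex.I * t * ϖ ρ)) * ((besselU ν (r * ρ) : ℂ) * β ρ * f ρ) ∂band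

-- Since u_ν is the real part of e^{ix}z, the operator is the mean of an outgoing and an incoming
-- wave. The incoming one is the complex conjugate of an outgoing wave with phase -ϖ, cutoff conj β
-- and data conj f, so one family of estimates covers both.
open scoped ComplexConjugate in
theorem bandOp_eq_halfWave {A lam : ℝ} {ϖ w1 w2 w3 : ℝ → ℝ} (hA : 1 ≤ A) (hlam : 0 < lam)
    (hlamA : lam ≤ A) (hϖm : Measurable ϖ) (hϖ : PhaseData A lam ϖ w1 w2 w3) {a b b0 : ℝ} {β : ℝ → ℂ}
    (hβ : BandCutoff a b b0 β) {ν L R : ℝ} (hν : 0 ≤ ν) (hL1 : 1 ≤ L) (hL2 : 1 + ν ≤ L ^ 2)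
    (hL3 : (1 + ν) ^ 2 ≤ L ^ 3) (hR : 8 * L ^ 2 ≤ R) {σ : ℝ → ℝ} (hσm : Measurable σ)
    (hσ : ∀ t, σ t ∈ Ico R (2 * R)) {f : ℝ → ℂ} (hf : Measurable f)
    (hf2 : ∫⁻ ρ, ‖f ρ‖ₑ ^ 2 ∂band ≠ ⊤) (t : ℝ) :
    bandOp ν ϖ β f t (σ t) = (1 / 2) * ((∫ ρ, halfWave ν ϖ β σ t ρ * f ρ ∂band) +
      conj (∫ ρ, halfWave ν (fun ρ => -ϖ ρ) (fun ρ => conj (β ρ)) σ t ρ * conj (f ρ) ∂band)) := by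
  have h1 := dispersiveFamily_halfWave hA hlam hlamA hϖm hϖ hβ hν hL1 hL2 hL3 hR hσm hσ
  have hϖn : Measurable fun ρ => -ϖ ρ := hϖm.neg
  have h2 := dispersiveFamily_halfWave hA hlam hlamA hϖn hϖ.neg hβ.conj hν hL1 hL2 hL3 hR hσm hσ
  have f1 := lintegral_enorm_lt_top_of_sq hf2
  have hfi : Integrable f band := ⟨hf.aestronglyMeasurable, f1.lt_top⟩
  have hfi' : Integrable (fun ρ => conj (f ρ)) band := Complex.conjCLE.integrable_comp_iff.mpr hfi
  have i1 : Integrable (fun ρ => halfWave ν ϖ β σ t ρ * f ρ) band :=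
    hfi.bdd_mul (h1.meas.comp (measurable_prodMk_left (x := t))).aestronglyMeasurable
      (.of_forall fun ρ => h1.bound t ρ)
  have i2 : Integrable (fun ρ => halfWave ν (fun ρ => -ϖ ρ) (fun ρ => conj (β ρ)) σ t ρ * conj (f ρ)) band :=
    hfi'.bdd_mul (h2.meas.comp (measurable_prodMk_left (x := t))).aestronglyMeasurable
      (.of_forall fun ρ => h2.bound t ρ)
  have i3 : Integrable (fun ρ => conj (halfWave ν (fun ρ => -ϖ ρ) (fun ρ => conj (β ρ)) σ t ρ *
      conj (f ρ))) band := Complex.conjCLE.integrable_comp_iff.mpr i2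
  rw [← integral_conj, ← integral_add i1 i3, ← integral_const_mul]
  refine integral_congr_ae (.of_forall fun ρ => ?_)
  simp only [halfWave]
  rw [besselU_eq_besselZ, map_mul, map_mul, map_mul, map_mul, Complex.conj_conj, Complex.conj_conj,
    conj_cexp_neg_I_mul, ← Complex.exp_conj, map_mul, Complex.conj_I, Complex.conj_ofReal]
  rw [show Complex.I * t * ((-ϖ ρ : ℝ) : ℂ) = -(Complex.I * t * ϖ ρ) by push_cast; ring, neg_mul]
  ring

theorem half_add_sq (x y : ℝ≥0∞) : (2⁻¹ * (x + y)) ^ 2 ≤ 2⁻¹ * (x ^ 2 + y ^ 2) := by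
  have h := ENNReal.rpow_arith_mean_le_arith_mean2_rpow 2⁻¹ 2⁻¹ x y ENNReal.inv_two_add_inv_two
    (p := 2) (by norm_num)
  simp only [ENNReal.rpow_two] at h
  rwa [← mul_add, ← mul_add] at h

theorem half_add_four (x y : ℝ≥0∞) : (2⁻¹ * (x + y)) ^ 4 ≤ 2⁻¹ * (x ^ 4 + y ^ 4) := by
  calc (2⁻¹ * (x + y)) ^ 4 = ((2⁻¹ * (x + y)) ^ 2) ^ 2 := by ring
    _ ≤ (2⁻¹ * (x ^ 2 + y ^ 2)) ^ 2 := by gcongr; exact half_add_sq x y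
    _ ≤ 2⁻¹ * ((x ^ 2) ^ 2 + (y ^ 2) ^ 2) := half_add_sq _ _
    _ = _ := by ring

open scoped ComplexConjugate in
theorem bandOp_sampled_bounds {A lam : ℝ} {ϖ w1 w2 w3 : ℝ → ℝ} (hA : 1 ≤ A) (hlam : 0 < lam)
    (hlamA : lam ≤ A) (hϖm : Measurable ϖ) (hϖ : PhaseData A lam ϖ w1 w2 w3) {a b b0 : ℝ} {β : ℝ → ℂ}
    (hβ : BandCutoff a b b0 β) {ν L R : ℝ} (hν : 0 ≤ ν) (hL1 : 1 ≤ L) (hL2 : 1 + ν ≤ L ^ 2)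
    (hL3 : (1 + ν) ^ 2 ≤ L ^ 3) (hR : 8 * L ^ 2 ≤ R) {σ : ℝ → ℝ} (hσm : Measurable σ)
    (hσ : ∀ t, σ t ∈ Ico R (2 * R)) {f : ℝ → ℂ} (hf : Measurable f)
    (hf2 : ∫⁻ ρ, ‖f ρ‖ₑ ^ 2 ∂band ≠ ⊤) :
    (∫⁻ t, ‖bandOp ν ϖ β f t (σ t)‖ₑ ^ 2 ≤
      ENNReal.ofReal (6 * kernelConst A lam b0 L * √(2 * A * R)) * ∫⁻ ρ, ‖f ρ‖ₑ ^ 2 ∂band) ∧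
    ∫⁻ t, ‖bandOp ν ϖ β f t (σ t)‖ₑ ^ 4 ≤
      ENNReal.ofReal (196 * kernelConst A lam b0 L ^ 2) * (∫⁻ ρ, ‖f ρ‖ₑ ^ 2 ∂band) ^ 2 := by
  have h1 := dispersiveFamily_halfWave hA hlam hlamA hϖm hϖ hβ hν hL1 hL2 hL3 hR hσm hσ
  have hϖn : Measurable fun ρ => -ϖ ρ := hϖm.neg
  have h2 := dispersiveFamily_halfWave hA hlam hlamA hϖn hϖ.neg hβ.conj hν hL1 hL2 hL3 hR hσm hσ
  have hcf : Measurable fun ρ => conj (f ρ) := Complex.continuous_conj.measurable.comp hf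
  have hcf2 : ∫⁻ ρ, ‖conj (f ρ)‖ₑ ^ 2 ∂band = ∫⁻ ρ, ‖f ρ‖ₑ ^ 2 ∂band := by
    simp only [RCLike.enorm_conj]
  have m1 := (h1.measurable_apply hf).enorm
  have m2 := (h2.measurable_apply hcf).enorm
  have hle : ∀ t, ‖bandOp ν ϖ β f t (σ t)‖ₑ ≤ 2⁻¹ * (‖∫ ρ, halfWave ν ϖ β σ t ρ * f ρ ∂band‖ₑ +
      ‖∫ ρ, halfWave ν (fun ρ => -ϖ ρ) (fun ρ => conj (β ρ)) σ t ρ * conj (f ρ) ∂band‖ₑ) := by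
    intro t
    rw [bandOp_eq_halfWave hA hlam hlamA hϖm hϖ hβ hν hL1 hL2 hL3 hR hσm hσ hf hf2 t, enorm_mul]
    have : ‖(1 / 2 : ℂ)‖ₑ = 2⁻¹ := by
      rw [← ofReal_norm, show ‖(1 / 2 : ℂ)‖ = (2 : ℝ)⁻¹ by norm_num, ENNReal.ofReal_inv_of_pos two_pos]
      simp
    rw [this]
    gcongr
    refine (enorm_add_le _ _).trans ?_
    rw [RCLike.enorm_conj]
  have key : ∀ (m : ℕ) (K : ℝ≥0∞), (∀ x y : ℝ≥0∞, (2⁻¹ * (x + y)) ^ m ≤ 2⁻¹ * (x ^ m + y ^ m)) →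
      (∫⁻ t, ‖∫ ρ, halfWave ν ϖ β σ t ρ * f ρ ∂band‖ₑ ^ m ≤ K) →
      (∫⁻ t, ‖∫ ρ, halfWave ν (fun ρ => -ϖ ρ) (fun ρ => conj (β ρ)) σ t ρ * conj (f ρ) ∂band‖ₑ ^ m ≤ K) →
      ∫⁻ t, ‖bandOp ν ϖ β f t (σ t)‖ₑ ^ m ≤ K := by
    intro m K hm k1 k2
    refine (lintegral_mono fun t => (pow_le_pow_left' (hle t) m).trans (hm _ _)).trans ?_
    rw [lintegral_const_mul' _ _ (by simp), lintegral_add_left (m1.pow_const m)]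
    calc _ ≤ 2⁻¹ * (K + K) := by gcongr
      _ = K := by rw [← two_mul, ← mul_assoc, ENNReal.inv_mul_cancel (by simp) (by simp), one_mul]
  constructor
  · refine key 2 _ half_add_sq (h1.lintegral_sq_le hf hf2) ?_
    rw [← hcf2]
    exact h2.lintegral_sq_le hcf (by rwa [hcf2])
  · refine key 4 _ half_add_four (h1.lintegral_four_le hf hf2) ?_
    rw [← hcf2]
    exact h2.lintegral_four_le hcf (by rwa [hcf2])

/-- A supremum over countably many parameters is realized, up to monotone convergence, by
measurable selections. -/
theorem lintegral_iSup_pow_le {X : Set ℝ} {Φ : ℝ → ℝ → ℝ≥0∞} (hΦ : Measurable (Function.uncurry Φ))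
    {m : ℕ} {C : ℝ≥0∞}
    (h : ∀ σ : ℝ → ℝ, Measurable σ → (∀ t, σ t ∈ X) → ∫⁻ t, Φ t (σ t) ^ m ≤ C) (x : ℕ → ℝ)
    (hx : ∀ i, x i ∈ X) : ∫⁻ t, (⨆ i, Φ t (x i)) ^ m ≤ C := by
  -- The maximum over finitely many radii is attained at a measurable choice of radius, built by
  -- comparing one more radius at each step.
  have hsel : ∀ n : ℕ, ∃ σ : ℝ → ℝ, Measurable σ ∧ (∀ t, σ t ∈ X) ∧
      ∀ t, Φ t (σ t) = partialSups (fun i => Φ t (x i)) n := by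
    intro n
    induction n with
    | zero => exact ⟨fun _ => x 0, measurable_const, fun _ => hx 0, fun t => by simp⟩
    | succ n ih =>
      obtain ⟨σ, hσ, hX, he⟩ := ih
      have m1 : Measurable fun t => Φ t (σ t) := hΦ.comp (measurable_id.prodMk hσ)
      have m2 : Measurable fun t => Φ t (x (n + 1)) := hΦ.comp (measurable_id.prodMk measurable_const)
      refine ⟨fun t => if Φ t (σ t) ≤ Φ t (x (n + 1)) then x (n + 1) else σ t,
        Measurable.ite (measurableSet_le m1 m2) measurable_const hσ, fun t => ?_, fun t => ?_⟩
      · dsimp only; split_ifs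
        · exact hx _
        · exact hX t
      · dsimp only
        rw [partialSups_add_one, ← he t]
        split_ifs with hc
        · exact (sup_eq_right.mpr hc).symm
        · exact (sup_eq_left.mpr (not_le.mp hc).le).symm
  have hm : ∀ n, Measurable fun t => partialSups (fun i => Φ t (x i)) n := by
    intro n
    obtain ⟨σ, hσ, hX, he⟩ := hsel n
    simp only [← he]
    exact hΦ.comp (measurable_id.prodMk hσ)
  have hlim := lintegral_tendsto_of_tendsto_of_monotone (μ := (volume : Measure ℝ))
    (f := fun n t => (partialSups (fun i => Φ t (x i)) n) ^ m) (F := fun t => (⨆ i, Φ t (x i)) ^ m)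
    (fun n => ((hm n).pow_const m).aemeasurable)
    (.of_forall fun t n k hnk => pow_le_pow_left' ((partialSups (fun i => Φ t (x i))).monotone hnk) m)
    (.of_forall fun t => by
      refine ((ENNReal.continuous_pow m).tendsto _).comp ?_
      rw [← iSup_partialSups_eq]
      exact tendsto_atTop_iSup (partialSups _).monotone)
  refine le_of_tendsto' hlim fun n => ?_
  obtain ⟨σ, hσ, hX, he⟩ := hsel n
  simp only [← he]
  exact h σ hσ hX

/-- A dense sequence of radii in `[R, 2R)`. -/
theorem exists_radii {R : ℝ} (hR : 0 < R) : ∃ x : ℕ → ℝ, (∀ i, x i ∈ Ico R (2 * R)) ∧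
    ∀ (g : ℝ → ℝ≥0∞), ContinuousOn g (Ico R (2 * R)) → ∀ r ∈ Ico R (2 * R), g r ≤ ⨆ i, g (x i) := by
  have : Nonempty (Ico R (2 * R)) := ⟨⟨R, le_rfl, by linarith⟩⟩
  refine ⟨fun i => TopologicalSpace.denseSeq (Ico R (2 * R)) i, fun i => Subtype.coe_prop _, ?_⟩
  intro g hg r hr
  have hgr := continuousOn_iff_continuous_domRestrict.mp hg
  have hcl : IsClosed {y : Ico R (2 * R) | (Ico R (2 * R)).domRestrict g y ≤
      ⨆ i, g (TopologicalSpace.denseSeq (Ico R (2 * R)) i)} := isClosed_le hgr continuous_const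
  have hd := TopologicalSpace.denseRange_denseSeq (Ico R (2 * R))
  have hsub : range (TopologicalSpace.denseSeq (Ico R (2 * R))) ⊆ {y : Ico R (2 * R) |
      (Ico R (2 * R)).domRestrict g y ≤ ⨆ i, g (TopologicalSpace.denseSeq (Ico R (2 * R)) i)} := by
    rintro _ ⟨i, rfl⟩
    exact le_iSup (fun i => g (TopologicalSpace.denseSeq (Ico R (2 * R)) i)) i
  have := closure_minimal hsub hcl
  rw [hd.closure_range] at this
  exact this (mem_univ ⟨r, hr⟩)

theorem measurable_bandOp {ν : ℝ} (hν : 0 ≤ ν) {ϖ : ℝ → ℝ} (hϖ : Measurable ϖ) {β f : ℝ → ℂ}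
    (hβ : Measurable β) (hf : Measurable f) : Measurable (Function.uncurry (bandOp ν ϖ β f)) := by
  have hu := measurable_besselU hν
  have h : Measurable (Function.uncurry fun (p : ℝ × ℝ) (ρ : ℝ) =>
      Complex.exp (-(Complex.I * p.1 * ϖ ρ)) * ((besselU ν (p.2 * ρ) : ℂ) * β ρ * f ρ)) := by
    unfold Function.uncurry
    fun_prop
  exact h.stronglyMeasurable.integral_prod_right.measurable

theorem continuousOn_bandOp {ν : ℝ} (hν : 0 ≤ ν) {ϖ : ℝ → ℝ} (hϖ : Measurable ϖ) {a b b0 : ℝ} {β f : ℝ → ℂ}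
    (hβ : BandCutoff a b b0 β) (hf : Measurable f) (hf2 : ∫⁻ ρ, ‖f ρ‖ₑ ^ 2 ∂band ≠ ⊤) {R : ℝ} (hR : 0 < R)
    (t : ℝ) : ContinuousOn (bandOp ν ϖ β f t) (Ico R (2 * R)) := by
  have hu := measurable_besselU hν
  have hβm := hβ.meas
  have hfi : Integrable f band := ⟨hf.aestronglyMeasurable, (lintegral_enorm_lt_top_of_sq hf2).lt_top⟩
  unfold bandOp
  refine continuousOn_of_dominated (bound := fun ρ => 6 * Real.exp (4 * R) * b0 * ‖f ρ‖) (fun r hr => ?_)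
    (fun r hr => ae_band fun ρ hρ => ?_) (hfi.norm.const_mul _) (ae_band fun ρ hρ => ?_)
  · exact Measurable.aestronglyMeasurable (by fun_prop)
  · have hr0 : 0 < r := hR.trans_le hr.1
    have hρ0 : 0 < ρ := by linarith [hρ.1]
    rw [norm_mul, norm_mul, norm_mul, ← toReal_enorm, enorm_cexp_neg_I_mul, ENNReal.toReal_one, one_mul,
      Complex.norm_real, Real.norm_eq_abs]
    gcongr
    · refine (abs_besselU_le_exp hν (by positivity)).trans ?_
      have h3 : r * ρ ≤ 4 * R := by nlinarith [hr.2, hρ.2]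
      gcongr
    · exact hβ.bound ρ
  · have hρ0 : 0 < ρ := by linarith [hρ.1]
    have h1 : ContinuousOn (fun r => besselU ν (r * ρ)) (Ico R (2 * R)) :=
      (continuousOn_besselU hν).comp (by fun_prop) fun r hr => mul_pos (hR.trans_le hr.1) hρ0
    have h2 := Complex.continuous_ofReal.comp_continuousOn h1
    exact continuousOn_const.mul ((h2.mul continuousOn_const).mul continuousOn_const)

/-- The maximal function over the dense set of radii controls all radii, and satisfies the
`L²_t` and `L⁴_t` bounds in the dispersive regime. -/
theorem exists_maximal_dispersive {A lam : ℝ} {ϖ w1 w2 w3 : ℝ → ℝ} (hA : 1 ≤ A) (hlam : 0 < lam)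
    (hlamA : lam ≤ A) (hϖm : Measurable ϖ) (hϖ : PhaseData A lam ϖ w1 w2 w3) {a b b0 : ℝ} {β : ℝ → ℂ}
    (hβ : BandCutoff a b b0 β) {ν L R : ℝ} (hν : 0 ≤ ν) (hL1 : 1 ≤ L) (hL2 : 1 + ν ≤ L ^ 2)
    (hL3 : (1 + ν) ^ 2 ≤ L ^ 3) (hR : 8 * L ^ 2 ≤ R) {f : ℝ → ℂ} (hf : Measurable f)
    (hf2 : ∫⁻ ρ, ‖f ρ‖ₑ ^ 2 ∂band ≠ ⊤) :
    ∃ Y : ℝ → ℝ≥0∞, Measurable Y ∧ (∀ t, ∀ r ∈ Ico R (2 * R), ‖bandOp ν ϖ β f t r‖ₑ ≤ Y t) ∧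
      (∫⁻ t, Y t ^ 2 ≤
        ENNReal.ofReal (6 * kernelConst A lam b0 L * √(2 * A * R)) * ∫⁻ ρ, ‖f ρ‖ₑ ^ 2 ∂band) ∧
      ∫⁻ t, Y t ^ 4 ≤
        ENNReal.ofReal (196 * kernelConst A lam b0 L ^ 2) * (∫⁻ ρ, ‖f ρ‖ₑ ^ 2 ∂band) ^ 2 := by
  have hR0 : 0 < R := by nlinarith
  obtain ⟨x, hx, hsup⟩ := exists_radii hR0
  have hm := measurable_bandOp hν hϖm hβ.meas hf
  have hme : Measurable (Function.uncurry fun t r => ‖bandOp ν ϖ β f t r‖ₑ) := hm.enorm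
  obtain ⟨Φ, hΦ⟩ : ∃ Φ : ℝ → ℝ → ℝ≥0∞, Φ = fun t r => ‖bandOp ν ϖ β f t r‖ₑ := ⟨_, rfl⟩
  have hΦe : ∀ t r, ‖bandOp ν ϖ β f t r‖ₑ = Φ t r := fun t r => by rw [hΦ]
  rw [← hΦ] at hme
  have hb := fun (σ : ℝ → ℝ) (hσ : Measurable σ) (hX : ∀ t, σ t ∈ Ico R (2 * R)) =>
    bandOp_sampled_bounds hA hlam hlamA hϖm hϖ hβ hν hL1 hL2 hL3 hR hσ hX hf hf2
  simp only [hΦe] at hb ⊢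
  refine ⟨fun t => ⨆ i, Φ t (x i), Measurable.iSup fun i => hme.comp (measurable_id.prodMk measurable_const),
    fun t r hr => hsup (Φ t) ?_ r hr, ?_, ?_⟩
  · rw [hΦ]
    exact continuous_enorm.comp_continuousOn (continuousOn_bandOp hν hϖm hβ hf hf2 hR0 t)
  · exact lintegral_iSup_pow_le hme (fun σ hσ hX => (hb σ hσ hX).1) x hx
  · exact lintegral_iSup_pow_le hme (fun σ hσ hX => (hb σ hσ hX).2) x hx

/-! ### Bounds valid for every R ≥ 1/A: Plancherel, pointwise and Sobolev. -/

/-- The space-time `L²` bound on a dyadic shell, by Plancherel in time and Fubini. -/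
theorem shell_lintegral_sq_le {A : ℝ} (hA : 0 < A) {ϖ : ℝ → ℝ} (hϖ : Measurable ϖ)
    (hmono : ∀ x ∈ Ioo (1 / 2 : ℝ) 2, ∀ y ∈ Ioo (1 / 2 : ℝ) 2, A⁻¹ * |x - y| ≤ |ϖ x - ϖ y|)
    {w : ℝ → ℝ} (hw : Measurable w) {g : ℝ → ℂ} (hg : Measurable g) {R W : ℝ}
    (hW : ∀ ρ ∈ Ioo (1 / 2 : ℝ) 2, ∫⁻ r in Ico R (2 * R), ENNReal.ofReal (w (r * ρ) ^ 2) ≤ ENNReal.ofReal W) :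
    ∫⁻ t : ℝ, ∫⁻ r in Ico R (2 * R),
        ‖∫ ρ, Complex.exp (-(Complex.I * t * ϖ ρ)) * ((w (r * ρ) : ℂ) * g ρ) ∂band‖ₑ ^ 2 ≤
      ENNReal.ofReal (2 * Real.pi * A) * (ENNReal.ofReal W * ∫⁻ ρ, ‖g ρ‖ₑ ^ 2 ∂band) := by
  have hm : Measurable (Function.uncurry fun (p : ℝ × ℝ) (ρ : ℝ) =>
      Complex.exp (-(Complex.I * p.1 * ϖ ρ)) * ((w (p.2 * ρ) : ℂ) * g ρ)) := by
    unfold Function.uncurry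
    fun_prop
  have hG : Measurable fun p : ℝ × ℝ =>
      ‖∫ ρ, Complex.exp (-(Complex.I * p.1 * ϖ ρ)) * ((w (p.2 * ρ) : ℂ) * g ρ) ∂band‖ₑ ^ 2 :=
    (hm.stronglyMeasurable.integral_prod_right.measurable).enorm.pow_const 2
  have hpi : 0 < 2 * Real.pi * A := by positivity
  rw [lintegral_lintegral_swap (f := fun (t r : ℝ) =>
      ‖∫ ρ, Complex.exp (-(Complex.I * t * ϖ ρ)) * ((w (r * ρ) : ℂ) * g ρ) ∂band‖ₑ ^ 2) hG.aemeasurable]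
  have hpl : ∀ r : ℝ, ∫⁻ t : ℝ,
      ‖∫ ρ, Complex.exp (-(Complex.I * t * ϖ ρ)) * ((w (r * ρ) : ℂ) * g ρ) ∂band‖ₑ ^ 2 ≤
      ENNReal.ofReal (2 * Real.pi * A) * ∫⁻ ρ, ENNReal.ofReal (w (r * ρ) ^ 2) * ‖g ρ‖ₑ ^ 2 ∂band := by
    intro r
    have e : ∫⁻ ρ, ‖(w (r * ρ) : ℂ) * g ρ‖ₑ ^ 2 ∂band =
        ∫⁻ ρ, ENNReal.ofReal (w (r * ρ) ^ 2) * ‖g ρ‖ₑ ^ 2 ∂band := by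
      refine lintegral_congr fun ρ => ?_
      rw [enorm_mul, mul_pow, enorm_complex_ofReal, ← ENNReal.ofReal_pow (abs_nonneg _), sq_abs]
    rw [← e]
    -- At radii where the right side is infinite nothing has to be proved, since 2πA > 0. Elsewhere
    -- Plancherel applies.
    by_cases hfin : ∫⁻ ρ, ‖(w (r * ρ) : ℂ) * g ρ‖ₑ ^ 2 ∂band = ⊤
    · rw [hfin, ENNReal.mul_top (by simpa using hpi)]
      exact le_top
    · exact time_plancherel hA hϖ hmono (by fun_prop) hfin
  calc _ ≤ ∫⁻ r in Ico R (2 * R), ENNReal.ofReal (2 * Real.pi * A) *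
        ∫⁻ ρ, ENNReal.ofReal (w (r * ρ) ^ 2) * ‖g ρ‖ₑ ^ 2 ∂band := lintegral_mono fun r => hpl r
    _ = ENNReal.ofReal (2 * Real.pi * A) *
        ∫⁻ ρ, (∫⁻ r in Ico R (2 * R), ENNReal.ofReal (w (r * ρ) ^ 2) * ‖g ρ‖ₑ ^ 2) ∂band := by
        rw [lintegral_const_mul' _ _ ENNReal.ofReal_ne_top]
        congr 1
        refine lintegral_lintegral_swap (μ := volume.restrict (Ico R (2 * R))) (ν := band) (f := fun (r ρ : ℝ) =>
          ENNReal.ofReal (w (r * ρ) ^ 2) * ‖g ρ‖ₑ ^ 2) (Measurable.aemeasurable ?_)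
        unfold Function.uncurry
        fun_prop
    _ ≤ _ := by
        rw [← lintegral_const_mul' (ENNReal.ofReal W) _ ENNReal.ofReal_ne_top]
        refine mul_le_mul_right (lintegral_mono_ae (ae_band fun ρ hρ => ?_)) _
        rw [lintegral_mul_const _ (by fun_prop)]
        exact mul_le_mul_left (hW ρ hρ) _

theorem lintegral_cutoff_sq_le {a b b0 : ℝ} {β : ℝ → ℂ} (hβ : BandCutoff a b b0 β) {f : ℝ → ℂ} :
    ∫⁻ ρ, ‖β ρ * f ρ‖ₑ ^ 2 ∂band ≤ ENNReal.ofReal (b0 ^ 2) * ∫⁻ ρ, ‖f ρ‖ₑ ^ 2 ∂band := by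
  rw [← lintegral_const_mul' _ _ ENNReal.ofReal_ne_top]
  refine lintegral_mono fun ρ => ?_
  rw [enorm_mul, mul_pow, ENNReal.ofReal_pow hβ.b0_pos.le]
  gcongr
  rw [← ofReal_norm]
  exact ENNReal.ofReal_le_ofReal (hβ.bound ρ)

theorem shell_besselU {ν R : ℝ} (hν : 0 ≤ ν) (hR : 0 < R) {ρ : ℝ} (hρ : ρ ∈ Ioo (1 / 2 : ℝ) 2) :
    ∫⁻ r in Ico R (2 * R), ENNReal.ofReal (besselU ν (r * ρ) ^ 2) ≤ ENNReal.ofReal (5 * Real.exp 4 * R) := by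
  refine le_trans ?_ (lintegral_besselU_sq hν (a := ρ) (by linarith [hρ.1]) hR)
  simp only [mul_comm ρ]
  exact lintegral_mono_set fun r hr => ⟨hR.trans_le hr.1, hr.2.le⟩

/-- On the shell rρ > R/4, so c = R/4 is allowed in the average of u'². The resulting 72/R² is at
most 72A² because R ≥ 1/A. The lower bound on R keeps the argument away from the singular point x =
0. -/
theorem shell_besselDU {A ν R : ℝ} (hA : 1 ≤ A) (hν : 0 ≤ ν) (hR : A⁻¹ ≤ R) {ρ : ℝ}
    (hρ : ρ ∈ Ioo (1 / 2 : ℝ) 2) :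
    ∫⁻ r in Ico R (2 * R), ENNReal.ofReal (besselDU ν (r * ρ) ^ 2) ≤
      ENNReal.ofReal (75 * A ^ 2 * (5 * Real.exp 4 * R)) := by
  have hA0 : 0 < A⁻¹ := by positivity
  have hR0 : 0 < R := hA0.trans_le hR
  have hAR : 1 ≤ A * R := by
    calc 1 = A * A⁻¹ := by field_simp
      _ ≤ A * R := by gcongr
  have hρ0 : 0 < ρ := by linarith [hρ.1]
  refine le_trans ?_ ((lintegral_besselDU_sq hν (a := ρ) hρ0 hR0
    (c := R / 4) (by positivity)).trans (ENNReal.ofReal_le_ofReal ?_))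
  · simp only [mul_comm ρ]
    refine lintegral_mono_set fun r hr => ⟨?_, hr.2.le⟩
    refine lt_of_lt_of_le ?_ hr.1
    rw [div_lt_iff₀ hρ0]
    nlinarith [hρ.1]
  · gcongr
    have h2 : 1 ≤ (A * R) ^ 2 := one_le_pow₀ hAR
    have : 9 / 2 / (R / 4) ^ 2 = 72 / R ^ 2 := by field_simp; norm_num
    rw [this]
    have h3 : 72 / R ^ 2 ≤ 72 * A ^ 2 := by
      rw [div_le_iff₀ (by positivity)]
      nlinarith
    nlinarith [one_le_pow₀ (n := 2) hA]

/-- The space-time `L²` bound for `bandOp`. -/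
theorem bandOp_shell_sq_le {A lam : ℝ} {ϖ w1 w2 w3 : ℝ → ℝ} (hA : 1 ≤ A) (hϖm : Measurable ϖ)
    (hϖ : PhaseData A lam ϖ w1 w2 w3) {a b b0 : ℝ} {β : ℝ → ℂ}
    (hβ : BandCutoff a b b0 β) {ν R : ℝ} (hν : 0 ≤ ν) (hR : 0 < R) {f : ℝ → ℂ} (hf : Measurable f) :
    ∫⁻ t, ∫⁻ r in Ico R (2 * R), ‖bandOp ν ϖ β f t r‖ₑ ^ 2 ≤
      ENNReal.ofReal (10 * Real.pi * A * Real.exp 4 * b0 ^ 2 * R) * ∫⁻ ρ, ‖f ρ‖ₑ ^ 2 ∂band := by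
  have h := shell_lintegral_sq_le (by linarith : 0 < A) hϖm hϖ.dist_le (measurable_besselU hν)
    (g := fun ρ => β ρ * f ρ) (hβ.meas.mul hf) fun ρ hρ => shell_besselU hν hR hρ
  simp only [bandOp, mul_assoc (Complex.ofReal _)]
  refine h.trans ((mul_le_mul_right (mul_le_mul_right (lintegral_cutoff_sq_le hβ) _) _).trans (le_of_eq ?_))
  have hA0 : 0 < A := by linarith
  rw [← mul_assoc, ← mul_assoc, ← ENNReal.ofReal_mul (by positivity), ← ENNReal.ofReal_mul (by positivity)]
  congr 2; ring

/-- The fixed-time `L²` bound for `bandOp`. -/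
theorem bandOp_fixed_time {ϖ : ℝ → ℝ} (hϖm : Measurable ϖ) {a b b0 : ℝ} {β : ℝ → ℂ}
    (hβ : BandCutoff a b b0 β) {ν R : ℝ} (hν : 0 ≤ ν) (hR : 0 < R) {f : ℝ → ℂ} (hf : Measurable f)
    (hf2 : ∫⁻ ρ, ‖f ρ‖ₑ ^ 2 ∂band ≠ ⊤) (t : ℝ) :
    ∫⁻ r in Ico R (2 * R), ‖bandOp ν ϖ β f t r‖ₑ ^ 2 ≤
      ENNReal.ofReal (20 * Real.exp 4 * b0 ^ 2) * ∫⁻ ρ, ‖f ρ‖ₑ ^ 2 ∂band := by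
  have e : ∫⁻ ρ, ‖Complex.exp (-(Complex.I * t * ϖ ρ)) * (β ρ * f ρ)‖ₑ ^ 2 ∂band =
      ∫⁻ ρ, ‖β ρ * f ρ‖ₑ ^ 2 ∂band := by
    refine lintegral_congr fun ρ => ?_
    rw [enorm_mul, enorm_cexp_neg_I_mul, one_mul]
  have hle := lintegral_cutoff_sq_le hβ (f := f)
  have hβm := hβ.meas
  have h := hankel_bound hν hR (f := fun ρ => Complex.exp (-(Complex.I * t * ϖ ρ)) * (β ρ * f ρ))
    (by fun_prop) (by rw [e]; exact ne_top_of_le_ne_top (ENNReal.mul_ne_top (by simp) hf2) hle)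
  rw [e] at h
  have e2 : ∀ r ρ : ℝ, (besselU ν (r * ρ) : ℂ) * (Complex.exp (-(Complex.I * t * ϖ ρ)) * (β ρ * f ρ)) =
      Complex.exp (-(Complex.I * t * ϖ ρ)) * ((besselU ν (r * ρ) : ℂ) * β ρ * f ρ) := fun r ρ => by ring
  simp only [e2] at h
  refine h.trans ((mul_le_mul_right hle _).trans (le_of_eq ?_))
  rw [← mul_assoc, ← ENNReal.ofReal_mul (by positivity)]

/-- The pointwise bound for `bandOp`. -/
theorem bandOp_pointwise {ϖ : ℝ → ℝ} {a b b0 : ℝ} {β : ℝ → ℂ}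
    (hβ : BandCutoff a b b0 β) {ν r : ℝ} (hν : 0 ≤ ν) (hr : 0 < r) {f : ℝ → ℂ} (hf : Measurable f) (t : ℝ) :
    ‖bandOp ν ϖ β f t r‖ₑ ^ 2 ≤ ENNReal.ofReal (5 * Real.exp 4 * b0 ^ 2) * ∫⁻ ρ, ‖f ρ‖ₑ ^ 2 ∂band := by
  have hu := measurable_besselU hν
  calc _ ≤ (∫⁻ ρ, ‖(besselU ν (r * ρ) : ℂ)‖ₑ * ‖β ρ * f ρ‖ₑ ∂band) ^ 2 := by
        gcongr
        refine (enorm_integral_le_lintegral_enorm _).trans (le_of_eq (lintegral_congr fun ρ => ?_))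
        rw [enorm_mul, enorm_cexp_neg_I_mul, one_mul, mul_assoc, enorm_mul]
    _ ≤ (∫⁻ ρ, ‖(besselU ν (r * ρ) : ℂ)‖ₑ ^ 2 ∂band) * ∫⁻ ρ, ‖β ρ * f ρ‖ₑ ^ 2 ∂band :=
        lintegral_mul_sq_le (Measurable.aemeasurable (by fun_prop)) (hβ.meas.mul hf).enorm.aemeasurable
    _ ≤ ENNReal.ofReal (5 * Real.exp 4) * (ENNReal.ofReal (b0 ^ 2) * ∫⁻ ρ, ‖f ρ‖ₑ ^ 2 ∂band) := by
        gcongr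
        -- Here the average is over the frequency: as ρ runs through the band, rρ is r times a
        -- variable in (0, 2], so X = 1 and the bound is uniform in r.
        · have h := lintegral_besselU_sq hν hr (X := 1) one_pos
          rw [mul_one, mul_one] at h
          refine le_trans ?_ h
          rw [band]
          calc _ = ∫⁻ ρ in Ioo (1 / 2) 2, ENNReal.ofReal (besselU ν (r * ρ) ^ 2) := by
                refine lintegral_congr fun ρ => ?_
                rw [enorm_complex_ofReal, ← ENNReal.ofReal_pow (abs_nonneg _), sq_abs]
            _ ≤ _ := lintegral_mono_set (s := Ioo (1 / 2) 2) (t := Ioc 0 2) fun ρ hρ =>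
                ⟨by linarith [hρ.1], hρ.2.le⟩
        · exact lintegral_cutoff_sq_le hβ
    _ = _ := by rw [← mul_assoc, ← ENNReal.ofReal_mul (by positivity)]

/-- The radial derivative of `bandOp`. -/
def bandOpDeriv (ν : ℝ) (ϖ : ℝ → ℝ) (β f : ℝ → ℂ) (t r : ℝ) : ℂ :=
  ∫ ρ, Complex.exp (-(Complex.I * t * ϖ ρ)) * ((besselDU ν (r * ρ) : ℂ) * (ρ * (β ρ * f ρ))) ∂band

theorem bandOpDeriv_shell_sq_le {A lam : ℝ} {ϖ w1 w2 w3 : ℝ → ℝ} (hA : 1 ≤ A) (hϖm : Measurable ϖ)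
    (hϖ : PhaseData A lam ϖ w1 w2 w3) {a b b0 : ℝ} {β : ℝ → ℂ}
    (hβ : BandCutoff a b b0 β) {ν R : ℝ} (hν : 0 ≤ ν) (hR : A⁻¹ ≤ R) {f : ℝ → ℂ} (hf : Measurable f) :
    ∫⁻ t, ∫⁻ r in Ico R (2 * R), ‖bandOpDeriv ν ϖ β f t r‖ₑ ^ 2 ≤
      ENNReal.ofReal (3000 * Real.pi * A ^ 3 * Real.exp 4 * b0 ^ 2 * R) * ∫⁻ ρ, ‖f ρ‖ₑ ^ 2 ∂band := by
  have hβm := hβ.meas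
  have hA0 : 0 < A := by linarith
  have hR0 : 0 < R := (by positivity : 0 < A⁻¹).trans_le hR
  have h := shell_lintegral_sq_le (by linarith : 0 < A) hϖm hϖ.dist_le (measurable_besselDU hν)
    (g := fun ρ => ρ * (β ρ * f ρ)) (by fun_prop) fun ρ hρ => shell_besselDU hA hν hR hρ
  have hle : ∫⁻ ρ, ‖(ρ : ℂ) * (β ρ * f ρ)‖ₑ ^ 2 ∂band ≤
      ENNReal.ofReal 4 * (ENNReal.ofReal (b0 ^ 2) * ∫⁻ ρ, ‖f ρ‖ₑ ^ 2 ∂band) := by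
    refine le_trans ?_ (mul_le_mul_right (lintegral_cutoff_sq_le hβ) _)
    rw [← lintegral_const_mul' _ _ ENNReal.ofReal_ne_top]
    refine lintegral_mono_ae (ae_band fun ρ hρ => ?_)
    rw [enorm_mul, mul_pow, enorm_complex_ofReal, ← ENNReal.ofReal_pow (abs_nonneg _), sq_abs]
    gcongr
    nlinarith [hρ.1, hρ.2]
  refine h.trans ((mul_le_mul_right (mul_le_mul_right hle _) _).trans (le_of_eq ?_))
  rw [← mul_assoc, ← mul_assoc, ← mul_assoc, ← ENNReal.ofReal_mul (by positivity),
    ← ENNReal.ofReal_mul (by positivity), ← ENNReal.ofReal_mul (by positivity)]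
  congr 2; ring

/-- The fundamental theorem of calculus for `bandOp` in the radial variable. -/
theorem bandOp_sub_le {ν : ℝ} (hν : 0 ≤ ν) {ϖ : ℝ → ℝ} (hϖm : Measurable ϖ) {a b b0 : ℝ} {β f : ℝ → ℂ}
    (hβ : BandCutoff a b b0 β) (hf : Measurable f) (hf2 : ∫⁻ ρ, ‖f ρ‖ₑ ^ 2 ∂band ≠ ⊤) {s r : ℝ} (hs : 0 < s)
    (hsr : s ≤ r) (t : ℝ) :
    ‖bandOp ν ϖ β f t r - bandOp ν ϖ β f t s‖ₑ ≤ ∫⁻ y in Icc s r, ‖bandOpDeriv ν ϖ β f t y‖ₑ := by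
  have hu := measurable_besselU hν
  have hdu := measurable_besselDU hν
  have hβm := hβ.meas
  have hfi : Integrable f band := ⟨hf.aestronglyMeasurable, (lintegral_enorm_lt_top_of_sq hf2).lt_top⟩
  have hb0 := hβ.b0_pos
  have hcU : ContinuousOn (besselU ν) (Icc (s / 2) (2 * r)) :=
    (continuousOn_besselU hν).mono fun x hx => lt_of_lt_of_le (by positivity) hx.1
  have hcD : ContinuousOn (besselDU ν) (Icc (s / 2) (2 * r)) :=
    (continuousOn_besselDU hν).mono fun x hx => lt_of_lt_of_le (by positivity) hx.1
  obtain ⟨CU, hCU⟩ := isCompact_Icc.exists_bound_of_continuousOn hcU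
  obtain ⟨CD, hCD⟩ := isCompact_Icc.exists_bound_of_continuousOn hcD
  have hmem : ∀ y ∈ Icc s r, ∀ ρ ∈ Ioo (1 / 2 : ℝ) 2, y * ρ ∈ Icc (s / 2) (2 * r) := by
    intro y hy ρ hρ
    constructor <;> nlinarith [hy.1, hy.2, hρ.1, hρ.2]
  have hint : ∀ y ∈ Icc s r, Integrable (fun ρ => Complex.exp (-(Complex.I * t * ϖ ρ)) *
      ((besselU ν (y * ρ) : ℂ) * β ρ * f ρ)) band := by
    intro y hy
    refine (hfi.bdd_mul (c := CU * b0) (f := fun ρ => Complex.exp (-(Complex.I * t * ϖ ρ)) *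
      ((besselU ν (y * ρ) : ℂ) * β ρ)) (Measurable.aestronglyMeasurable (by fun_prop))
      (ae_band fun ρ hρ => ?_)).congr (.of_forall fun ρ => by simp only; ring)
    have h1 := hCU _ (hmem y hy ρ hρ)
    rw [norm_mul, norm_mul, ← toReal_enorm, enorm_cexp_neg_I_mul, ENNReal.toReal_one, one_mul,
      Complex.norm_real]
    exact mul_le_mul h1 (hβ.bound ρ) (norm_nonneg _) ((norm_nonneg _).trans h1)
  have hftc : ∀ ρ ∈ Ioo (1 / 2 : ℝ) 2, ((besselU ν (r * ρ) - besselU ν (s * ρ) : ℝ) : ℂ) =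
      ∫ y in Icc s r, ((ρ * besselDU ν (y * ρ) : ℝ) : ℂ) := by
    intro ρ hρ
    have hρ0 : 0 < ρ := by linarith [hρ.1]
    rw [integral_complex_ofReal, integral_Icc_eq_integral_Ioc, ← intervalIntegral.integral_of_le hsr]
    congr 1
    refine (intervalIntegral.integral_eq_sub_of_hasDerivAt (f := fun y => besselU ν (y * ρ)) (fun y hy => ?_) ?_).symm
    · rw [uIcc_of_le hsr] at hy
      have := (hasDerivAt_besselU hν (mul_pos (hs.trans_le hy.1) hρ0)).scomp y
        (by simpa using (hasDerivAt_id y).mul_const ρ)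
      exact this.congr_deriv (by simp)
    · refine ContinuousOn.intervalIntegrable ?_
      rw [uIcc_of_le hsr]
      exact continuousOn_const.mul ((continuousOn_besselDU hν).comp (by fun_prop) fun y hy =>
        mul_pos (hs.trans_le hy.1) hρ0)
  have hfub : Integrable (fun p : ℝ × ℝ => Complex.exp (-(Complex.I * t * ϖ p.1)) *
      ((besselDU ν (p.2 * p.1) : ℂ) * (p.1 * (β p.1 * f p.1)))) (band.prod (volume.restrict (Icc s r))) := by
    have h2 : Integrable (fun p : ℝ × ℝ => f p.1 * (1 : ℂ)) (band.prod (volume.restrict (Icc s r))) :=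
      hfi.mul_prod (integrable_const (1 : ℂ))
    refine (h2.bdd_mul (c := CD * (2 * b0)) (f := fun p : ℝ × ℝ => Complex.exp (-(Complex.I * t * ϖ p.1)) *
      ((besselDU ν (p.2 * p.1) : ℂ) * (p.1 * β p.1))) (Measurable.aestronglyMeasurable (by fun_prop)) ?_).congr
      (.of_forall fun p => by simp only; ring)
    rw [band, Measure.prod_restrict]
    refine (ae_restrict_iff' (measurableSet_Ioo.prod measurableSet_Icc)).mpr (.of_forall fun p hp => ?_)
    have h1 := hCD _ (hmem p.2 hp.2 p.1 hp.1)
    rw [norm_mul, norm_mul, norm_mul, ← toReal_enorm, enorm_cexp_neg_I_mul, ENNReal.toReal_one, one_mul,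
      Complex.norm_real, Complex.norm_real]
    have h3 : ‖p.1‖ ≤ 2 := by
      rw [Real.norm_eq_abs, abs_le]; constructor <;> linarith [hp.1.1, hp.1.2]
    exact mul_le_mul h1 (mul_le_mul h3 (hβ.bound _) (norm_nonneg _) (by norm_num)) (by positivity)
      ((norm_nonneg _).trans h1)
  have e : bandOp ν ϖ β f t r - bandOp ν ϖ β f t s = ∫ y in Icc s r, bandOpDeriv ν ϖ β f t y := by
    simp only [bandOp, bandOpDeriv]
    rw [← integral_integral_swap (f := fun (ρ y : ℝ) => Complex.exp (-(Complex.I * t * ϖ ρ)) *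
      ((besselDU ν (y * ρ) : ℂ) * (ρ * (β ρ * f ρ)))) hfub,
      ← integral_sub (hint r (right_mem_Icc.mpr hsr)) (hint s (left_mem_Icc.mpr hsr))]
    refine integral_congr_ae (ae_band fun ρ hρ => ?_)
    have h1 := hftc ρ hρ
    calc _ = Complex.exp (-(Complex.I * t * ϖ ρ)) * (β ρ * f ρ) *
          ((besselU ν (r * ρ) - besselU ν (s * ρ) : ℝ) : ℂ) := by push_cast; ring
      _ = _ := by
          rw [h1, ← integral_const_mul]
          refine integral_congr_ae (.of_forall fun y => ?_)
          simp only
          push_cast; ring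
  rw [e]
  exact enorm_integral_le_lintegral_enorm _

theorem ENNReal.add_sq_le' (x y : ℝ≥0∞) : (x + y) ^ 2 ≤ 2 * (x ^ 2 + y ^ 2) := by
  have h := half_add_sq x y
  rw [mul_pow] at h
  calc (x + y) ^ 2 = 4 * (2⁻¹ ^ 2 * (x + y) ^ 2) := by
        rw [← mul_assoc, show (4 : ℝ≥0∞) = 2 ^ 2 by norm_num, ← mul_pow,
          ENNReal.mul_inv_cancel (by simp) (by simp), one_pow, one_mul]
    _ ≤ 4 * (2⁻¹ * (x ^ 2 + y ^ 2)) := by gcongr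
    _ = 2 * (x ^ 2 + y ^ 2) := by
        rw [← mul_assoc, show (4 : ℝ≥0∞) = 2 * 2 by norm_num, mul_assoc 2 2,
          ENNReal.mul_inv_cancel (by simp) (by simp), mul_one]

theorem setLIntegral_sq_le {S : Set ℝ} {D : ℝ → ℝ≥0∞} (hD : Measurable D) :
    (∫⁻ y in S, D y) ^ 2 ≤ volume S * ∫⁻ y in S, D y ^ 2 := by
  have h := lintegral_mul_sq_le (μ := volume.restrict S) (u := fun _ => 1) (v := D)
    measurable_const.aemeasurable hD.aemeasurable
  simpa using h

/-- A one-dimensional Sobolev inequality on a shell. -/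
theorem sobolev_shell {R m : ℝ} (hm : 0 < m) (hmR : 2 * m ≤ R) {G : ℝ → ℂ} {D : ℝ → ℝ≥0∞}
    (hD : Measurable D)
    (hGD : ∀ s r, R ≤ s → s ≤ r → ‖G r - G s‖ₑ ≤ ∫⁻ y in Icc s r, D y) {r : ℝ} (hr : r ∈ Ico R (2 * R)) :
    ‖G r‖ₑ ^ 2 ≤ ENNReal.ofReal (2 / m) * (∫⁻ s in Ico R (2 * R), ‖G s‖ₑ ^ 2) +
      ENNReal.ofReal (2 * m) * ∫⁻ s in Ico R (2 * R), D s ^ 2 := by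
  -- An interval of length m containing r is taken on whichever side stays inside the shell, which
  -- is possible because R ≥ 2m.
  obtain ⟨u, v, hru, hrv, huv, huR, hvR⟩ : ∃ u v : ℝ, u ≤ r ∧ r ≤ v ∧ v = u + m ∧ R ≤ u ∧ v < 2 * R := by
    by_cases h : r < 2 * R - m
    · exact ⟨r, r + m, le_rfl, by linarith, rfl, hr.1, by linarith⟩
    · push Not at h
      exact ⟨r - m, r, by linarith, le_rfl, by ring, by linarith, hr.2⟩
  have hsub : Icc u v ⊆ Ico R (2 * R) := fun x hx => ⟨huR.trans hx.1, hx.2.trans_lt hvR⟩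
  have hvol : volume (Icc u v) = ENNReal.ofReal m := by rw [Real.volume_Icc, huv]; congr 1; ring
  obtain ⟨P, hP⟩ : ∃ P, P = ∫⁻ s in Ico R (2 * R), D s ^ 2 := ⟨_, rfl⟩
  have hPle : (∫⁻ y in Icc u v, D y) ^ 2 ≤ ENNReal.ofReal m * P := by
    refine (setLIntegral_sq_le hD).trans ?_
    rw [hvol, hP]
    gcongr
  have hpt : ∀ s ∈ Icc u v, ‖G r‖ₑ ^ 2 ≤ 2 * ‖G s‖ₑ ^ 2 + 2 * (ENNReal.ofReal m * P) := by
    intro s hs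
    have hd : ‖G r - G s‖ₑ ≤ ∫⁻ y in Icc u v, D y := by
      rcases le_total s r with h | h
      · exact (hGD s r (huR.trans hs.1) h).trans (lintegral_mono_set (Icc_subset_Icc hs.1 hrv))
      · rw [← enorm_neg, neg_sub]
        exact (hGD r s hr.1 h).trans (lintegral_mono_set (Icc_subset_Icc hru hs.2))
    calc ‖G r‖ₑ ^ 2 = ‖G s + (G r - G s)‖ₑ ^ 2 := by rw [add_sub_cancel]
      _ ≤ (‖G s‖ₑ + ‖G r - G s‖ₑ) ^ 2 := by gcongr; exact enorm_add_le _ _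
      _ ≤ 2 * (‖G s‖ₑ ^ 2 + ‖G r - G s‖ₑ ^ 2) := ENNReal.add_sq_le' _ _
      _ ≤ 2 * (‖G s‖ₑ ^ 2 + ENNReal.ofReal m * P) := by
          gcongr
          exact (pow_le_pow_left' hd 2).trans hPle
      _ = _ := by ring
  have hint : ENNReal.ofReal m * ‖G r‖ₑ ^ 2 ≤
      2 * (∫⁻ s in Ico R (2 * R), ‖G s‖ₑ ^ 2) + ENNReal.ofReal m * (2 * (ENNReal.ofReal m * P)) := by
    calc ENNReal.ofReal m * ‖G r‖ₑ ^ 2 = ∫⁻ _ in Icc u v, ‖G r‖ₑ ^ 2 := by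
          rw [setLIntegral_const, hvol, mul_comm]
      _ ≤ ∫⁻ s in Icc u v, (2 * ‖G s‖ₑ ^ 2 + 2 * (ENNReal.ofReal m * P)) :=
          setLIntegral_mono' measurableSet_Icc hpt
      _ = 2 * (∫⁻ s in Icc u v, ‖G s‖ₑ ^ 2) + ENNReal.ofReal m * (2 * (ENNReal.ofReal m * P)) := by
          rw [lintegral_add_right _ measurable_const, setLIntegral_const, hvol,
            lintegral_const_mul' _ _ (by simp), mul_comm (ENNReal.ofReal m) (2 * _)]
      _ ≤ _ := by gcongr
  have hinv : ENNReal.ofReal (1 / m) * ENNReal.ofReal m = 1 := by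
    rw [← ENNReal.ofReal_mul (by positivity), one_div_mul_cancel hm.ne', ENNReal.ofReal_one]
  calc ‖G r‖ₑ ^ 2 = ENNReal.ofReal (1 / m) * (ENNReal.ofReal m * ‖G r‖ₑ ^ 2) := by
        rw [← mul_assoc, hinv, one_mul]
    _ ≤ ENNReal.ofReal (1 / m) * (2 * (∫⁻ s in Ico R (2 * R), ‖G s‖ₑ ^ 2) +
        ENNReal.ofReal m * (2 * (ENNReal.ofReal m * P))) := by gcongr
    _ = (ENNReal.ofReal (1 / m) * 2) * (∫⁻ s in Ico R (2 * R), ‖G s‖ₑ ^ 2) +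
        (ENNReal.ofReal (1 / m) * ENNReal.ofReal m) * (2 * ENNReal.ofReal m) * P := by ring
    _ = _ := by
        rw [hinv, one_mul, show (2 : ℝ≥0∞) = ENNReal.ofReal 2 by simp,
          ← ENNReal.ofReal_mul (by positivity), ← ENNReal.ofReal_mul (by positivity), hP]
        congr 3; ring

theorem ENNReal.iSup_sq_le {ι : Type*} {a : ι → ℝ≥0∞} {K : ℝ≥0∞} (h : ∀ i, a i ^ 2 ≤ K) :
    (⨆ i, a i) ^ 2 ≤ K := by
  rw [← ENNReal.rpow_two, ← ENNReal.le_rpow_inv_iff two_pos]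
  refine iSup_le fun i => ?_
  rw [ENNReal.le_rpow_inv_iff two_pos, ENNReal.rpow_two]
  exact h i

theorem measurable_bandOpDeriv {ν : ℝ} (hν : 0 ≤ ν) {ϖ : ℝ → ℝ} (hϖ : Measurable ϖ) {β f : ℝ → ℂ}
    (hβ : Measurable β) (hf : Measurable f) : Measurable (Function.uncurry (bandOpDeriv ν ϖ β f)) := by
  have hu := measurable_besselDU hν
  have h : Measurable (Function.uncurry fun (p : ℝ × ℝ) (ρ : ℝ) =>
      Complex.exp (-(Complex.I * p.1 * ϖ ρ)) * ((besselDU ν (p.2 * ρ) : ℂ) * (ρ * (β ρ * f ρ)))) := by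
    unfold Function.uncurry
    fun_prop
  exact h.stronglyMeasurable.integral_prod_right.measurable

/-- The maximal function bounds that hold for all radii `R ≥ A⁻¹`. -/
theorem exists_maximal_sobolev {A lam : ℝ} {ϖ w1 w2 w3 : ℝ → ℝ} (hA : 1 ≤ A)
    (hϖm : Measurable ϖ) (hϖ : PhaseData A lam ϖ w1 w2 w3) {a b b0 : ℝ} {β : ℝ → ℂ}
    (hβ : BandCutoff a b b0 β) {ν R : ℝ} (hν : 0 ≤ ν) (hR : A⁻¹ ≤ R) {f : ℝ → ℂ} (hf : Measurable f)
    (hf2 : ∫⁻ ρ, ‖f ρ‖ₑ ^ 2 ∂band ≠ ⊤) :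
    ∃ Y : ℝ → ℝ≥0∞, Measurable Y ∧ (∀ t, ∀ r ∈ Ico R (2 * R), ‖bandOp ν ϖ β f t r‖ₑ ≤ Y t) ∧
      (∫⁻ t, Y t ^ 2 ≤
        ENNReal.ofReal (20000 * Real.pi * A ^ 3 * Real.exp 4 * b0 ^ 2 * R) * ∫⁻ ρ, ‖f ρ‖ₑ ^ 2 ∂band) ∧
      ∀ t, Y t ^ 2 ≤ ENNReal.ofReal (5 * Real.exp 4 * b0 ^ 2) * ∫⁻ ρ, ‖f ρ‖ₑ ^ 2 ∂band := by
  have hA0 : 0 < A := by linarith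
  have hR0 : 0 < R := (by positivity : 0 < A⁻¹).trans_le hR
  obtain ⟨x, hx, hsup⟩ := exists_radii hR0
  have hm := measurable_bandOp hν hϖm hβ.meas hf
  obtain ⟨Φ, hΦ⟩ : ∃ Φ : ℝ → ℝ → ℝ≥0∞, Φ = fun t r => ‖bandOp ν ϖ β f t r‖ₑ := ⟨_, rfl⟩
  obtain ⟨Ψ, hΨ⟩ : ∃ Ψ : ℝ → ℝ → ℝ≥0∞, Ψ = fun t r => ‖bandOpDeriv ν ϖ β f t r‖ₑ := ⟨_, rfl⟩
  have hΦe : ∀ t r, ‖bandOp ν ϖ β f t r‖ₑ = Φ t r := fun t r => by rw [hΦ]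
  have hΨe : ∀ t r, ‖bandOpDeriv ν ϖ β f t r‖ₑ = Ψ t r := fun t r => by rw [hΨ]
  have hme : Measurable (Function.uncurry Φ) := by rw [hΦ]; exact hm.enorm
  have hdm : Measurable (Function.uncurry Ψ) := by
    rw [hΨ]; exact (measurable_bandOpDeriv hν hϖm hβ.meas hf).enorm
  have hQ : Measurable fun t => ∫⁻ s in Ico R (2 * R), Φ t s ^ 2 := (hme.pow_const 2).lintegral_prod_right'
  -- The averaging length m = 1/(2A) is independent of R and satisfies 2m ≤ R. A fixed length
  -- suffices because the operator and its radial derivative have space-time norms of the same order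
  -- in R.
  have hsob : ∀ t, ∀ r ∈ Ico R (2 * R), Φ t r ^ 2 ≤
      ENNReal.ofReal (2 / (A⁻¹ / 2)) * (∫⁻ s in Ico R (2 * R), Φ t s ^ 2) +
      ENNReal.ofReal (2 * (A⁻¹ / 2)) * ∫⁻ s in Ico R (2 * R), Ψ t s ^ 2 := by
    intro t r hr
    have := sobolev_shell (R := R) (m := A⁻¹ / 2) (D := Ψ t) (by positivity) (by linarith)
      (hdm.comp (measurable_prodMk_left (x := t))) (G := bandOp ν ϖ β f t)
      (fun s r hs hsr => by
        have h1 := bandOp_sub_le hν hϖm hβ hf hf2 (hR0.trans_le hs) hsr t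
        simpa only [hΨe] using h1) hr
    simpa only [hΦe] using this
  have hcont : ∀ t, ContinuousOn (Φ t) (Ico R (2 * R)) := fun t => by
    rw [hΦ]; exact continuous_enorm.comp_continuousOn (continuousOn_bandOp hν hϖm hβ hf hf2 hR0 t)
  have hb1 := bandOp_shell_sq_le hA hϖm hϖ hβ hν hR0 hf
  have hb2 := bandOpDeriv_shell_sq_le hA hϖm hϖ hβ hν hR hf
  have hb3 := fun t i => bandOp_pointwise hβ (ϖ := ϖ) hν (hR0.trans_le (hx i).1) hf t
  simp only [hΦe, hΨe] at hb1 hb2 hb3 ⊢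
  obtain ⟨E, hE⟩ : ∃ E, E = ∫⁻ ρ, ‖f ρ‖ₑ ^ 2 ∂band := ⟨_, rfl⟩
  rw [← hE] at hb1 hb2 hb3 ⊢
  refine ⟨fun t => ⨆ i, Φ t (x i), Measurable.iSup fun i => hme.comp (measurable_id.prodMk measurable_const),
    fun t r hr => hsup (Φ t) (hcont t) r hr, ?_, fun t => ENNReal.iSup_sq_le (hb3 t)⟩
  refine (lintegral_mono fun t => ENNReal.iSup_sq_le fun i => hsob t (x i) (hx i)).trans ?_
  rw [lintegral_add_left (hQ.const_mul _), lintegral_const_mul' _ _ ENNReal.ofReal_ne_top,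
    lintegral_const_mul' _ _ ENNReal.ofReal_ne_top]
  refine (add_le_add (mul_le_mul_right hb1 _) (mul_le_mul_right hb2 _)).trans ?_
  rw [← mul_assoc, ← mul_assoc, ← ENNReal.ofReal_mul (by positivity), ← ENNReal.ofReal_mul (by positivity),
    ← add_mul, ← ENNReal.ofReal_add (by positivity) (by positivity)]
  refine mul_le_mul_left (ENNReal.ofReal_le_ofReal ?_) _
  have e1 : 2 / (A⁻¹ / 2) = 4 * A := by field_simp; norm_num
  have e2 : 2 * (A⁻¹ / 2) ≤ 1 := by
    have := inv_le_one_of_one_le₀ hA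
    linarith
  rw [e1]
  obtain ⟨c, hc⟩ : ∃ c, c = Real.pi * Real.exp 4 * b0 ^ 2 * R := ⟨_, rfl⟩
  have hc0 : 0 ≤ c := by rw [hc]; positivity
  calc _ = 40 * (c * A ^ 2) + 2 * (A⁻¹ / 2) * (3000 * A ^ 3 * c) := by rw [hc]; ring
    _ ≤ 40 * (c * A ^ 3) + 1 * (3000 * A ^ 3 * c) := by
        gcongr
        norm_num
    _ ≤ 20000 * (c * A ^ 3) := by nlinarith [mul_nonneg hc0 (pow_nonneg hA0.le 3)]
    _ = _ := by rw [hc]; ring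

/-! ### Merging the regimes R ≥ 8L² and R < 8L². -/

/-- The maximal function bounds in all regimes. -/
theorem exists_maximal {A : ℝ} (hA : 1 ≤ A) {a b b0 : ℝ} {β : ℝ → ℂ} (hβ : BandCutoff a b b0 β) :
    ∃ K : ℝ, 0 < K ∧ ∀ {lam : ℝ} {ϖ w1 w2 w3 : ℝ → ℝ}, 0 < lam → lam ≤ A → Measurable ϖ →
      PhaseData A lam ϖ w1 w2 w3 → ∀ {ν L R : ℝ}, 0 ≤ ν → 1 ≤ L → 1 + ν ≤ L ^ 2 → (1 + ν) ^ 2 ≤ L ^ 3 →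
      A⁻¹ ≤ R → ∀ {f : ℝ → ℂ}, Measurable f → ∫⁻ ρ, ‖f ρ‖ₑ ^ 2 ∂band ≠ ⊤ →
      ∃ Y : ℝ → ℝ≥0∞, Measurable Y ∧ (∀ t, ∀ r ∈ Ico R (2 * R), ‖bandOp ν ϖ β f t r‖ₑ ≤ Y t) ∧
      (∫⁻ t, Y t ^ 2 ≤ ENNReal.ofReal (K * (L / √lam * √R)) * ∫⁻ ρ, ‖f ρ‖ₑ ^ 2 ∂band) ∧
      ∫⁻ t, Y t ^ 4 ≤ ENNReal.ofReal (K * (L / √lam) ^ 2) * (∫⁻ ρ, ‖f ρ‖ₑ ^ 2 ∂band) ^ 2 := by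
  have hA0 : 0 < A := by linarith
  have hb0 := hβ.b0_pos
  have hM := besselM_pos
  obtain ⟨κ, hκ⟩ : ∃ κ, κ = 126 * A ^ 6 * (144 * besselM ^ 2 * b0) := ⟨_, rfl⟩
  obtain ⟨c, hc⟩ : ∃ c, c = 20000 * Real.pi * A ^ 3 * Real.exp 4 * b0 ^ 2 := ⟨_, rfl⟩
  obtain ⟨d, hd⟩ : ∃ d, d = 5 * Real.exp 4 * b0 ^ 2 := ⟨_, rfl⟩
  have hκ0 : 0 < κ := by rw [hκ]; positivity
  have hc0 : 0 < c := by rw [hc]; positivity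
  have hd0 : 0 < d := by rw [hd]; positivity
  have hsA : 0 < √A := Real.sqrt_pos.mpr hA0
  refine ⟨6 * κ * √(2 * A) + 196 * κ ^ 2 + 3 * c * √A + 8 * d * c * A, by positivity, ?_⟩
  intro lam ϖ w1 w2 w3 hlam hlamA hϖm hϖ ν L R hν hL1 hL2 hL3 hR f hf hf2
  have hR0 : 0 < R := (by positivity : 0 < A⁻¹).trans_le hR
  have hsl : 0 < √lam := Real.sqrt_pos.mpr hlam
  have hL0 : 0 < L := by linarith
  -- Above 8L² dispersion applies. Below it the bound of size R is good enough: √R ≤ 3L turns R =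
  -- √R·√R into a multiple of L√R, and the factor lam^{-1/2} costs only √A since lam ≤ A.
  by_cases hbig : 8 * L ^ 2 ≤ R
  · obtain ⟨Y, hY, hsup, h2, h4⟩ := exists_maximal_dispersive hA hlam hlamA hϖm hϖ hβ hν hL1 hL2 hL3 hbig hf hf2
    refine ⟨Y, hY, hsup, h2.trans ?_, h4.trans ?_⟩
    · refine mul_le_mul_left (ENNReal.ofReal_le_ofReal ?_) _
      rw [kernelConst, ← hκ, Real.sqrt_mul (by positivity)]
      calc 6 * (κ * L / √lam) * (√(2 * A) * √R) = (6 * κ * √(2 * A)) * (L / √lam * √R) := by ring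
        _ ≤ _ := by
          gcongr
          have : 0 ≤ 196 * κ ^ 2 + 3 * c * √A + 8 * d * c * A := by positivity
          linarith
    · refine mul_le_mul_left (ENNReal.ofReal_le_ofReal ?_) _
      rw [kernelConst, ← hκ]
      calc 196 * (κ * L / √lam) ^ 2 = (196 * κ ^ 2) * (L / √lam) ^ 2 := by ring
        _ ≤ _ := by
          gcongr
          have : 0 ≤ 6 * κ * √(2 * A) + 3 * c * √A + 8 * d * c * A := by positivity
          linarith
  · push Not at hbig
    obtain ⟨Y, hY, hsup, h2, h4⟩ := exists_maximal_sobolev hA hϖm hϖ hβ hν hR hf hf2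
    rw [← hc] at h2
    rw [← hd] at h4
    have hll : √lam ≤ √A := Real.sqrt_le_sqrt hlamA
    have hRL : √R ≤ 3 * L := by
      rw [Real.sqrt_le_left (by positivity)]
      nlinarith
    refine ⟨Y, hY, hsup, h2.trans ?_, ?_⟩
    · refine mul_le_mul_left (ENNReal.ofReal_le_ofReal ?_) _
      calc c * R = c * (√R * √R) := by rw [Real.mul_self_sqrt hR0.le]
        _ ≤ c * (3 * L * √R) := by gcongr
        _ ≤ c * (3 * L * √R) * (√A / √lam) :=
            le_mul_of_one_le_right (by positivity) ((one_le_div hsl).mpr hll)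
        _ = (3 * c * √A) * (L / √lam * √R) := by ring
        _ ≤ _ := by
          gcongr
          have : 0 ≤ 6 * κ * √(2 * A) + 196 * κ ^ 2 + 8 * d * c * A := by positivity
          linarith
    · obtain ⟨E, hE⟩ : ∃ E, E = ∫⁻ ρ, ‖f ρ‖ₑ ^ 2 ∂band := ⟨_, rfl⟩
      rw [← hE] at h2 h4 hf2 ⊢
      -- Two of the four powers of Y are absorbed by the pointwise bound. The remaining L² bound is
      -- proportional to R < 8L².
      calc ∫⁻ t, Y t ^ 4 ≤ ∫⁻ t, (ENNReal.ofReal d * E) * Y t ^ 2 := by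
            refine lintegral_mono fun t => ?_
            rw [show Y t ^ 4 = Y t ^ 2 * Y t ^ 2 by ring]
            exact mul_le_mul_left (h4 t) _
        _ = (ENNReal.ofReal d * E) * ∫⁻ t, Y t ^ 2 :=
            lintegral_const_mul' _ _ (ENNReal.mul_ne_top (by simp) hf2)
        _ ≤ (ENNReal.ofReal d * E) * (ENNReal.ofReal (c * R) * E) := by gcongr
        _ = ENNReal.ofReal (d * (c * R)) * E ^ 2 := by
            rw [ENNReal.ofReal_mul hd0.le]; ring
        _ ≤ _ := by
          refine mul_le_mul_left (ENNReal.ofReal_le_ofReal ?_) _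
          rw [div_pow, Real.sq_sqrt hlam.le]
          calc d * (c * R) ≤ d * (c * (8 * L ^ 2)) := by gcongr
            _ ≤ d * (c * (8 * L ^ 2)) * (A / lam) :=
                le_mul_of_one_le_right (by positivity) ((one_le_div hlam).mpr hlamA)
            _ = (8 * d * c * A) * (L ^ 2 / lam) := by ring
            _ ≤ _ := by
              gcongr
              have : 0 ≤ 6 * κ * √(2 * A) + 196 * κ ^ 2 + 3 * c * √A := by positivity
              linarith

/-! ### Interpolation of the mixed norm. -/

/-- Interpolation between an `L²` bound and an `L^∞` bound for `X`, and `L²`, `L⁴` bounds for `Y`. -/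
theorem lintegral_rpow_mul_rpow_le {X Y : ℝ → ℝ≥0∞} (hX : Measurable X) (hY : Measurable Y) {c d r : ℝ≥0∞}
    (hr0 : r ≠ 0) (hr : r ≠ ⊤) (hXc : ∀ t, X t ≤ c) (hX2 : ∫⁻ t, X t ^ 2 ≤ c ^ 2 * r)
    (hY2 : ∫⁻ t, Y t ^ 2 ≤ d ^ 2 * r ^ (1 / 2 : ℝ)) (hY4 : ∫⁻ t, Y t ^ 4 ≤ d ^ 4) {α γ : ℝ} (hα : 0 ≤ α)
    (hγ : 0 ≤ γ) (hγ4 : γ ≤ 4) (hαγ : 2 ≤ α + γ) :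
    ∫⁻ t, X t ^ α * Y t ^ γ ≤ c ^ α * d ^ γ * r ^ (1 - γ / 4) := by
  -- For γ ≤ 2 the surplus power of X is bounded by c, and Hölder interpolates between X² and Y².
  -- For γ ≥ 2 all of X is bounded by c, and Hölder interpolates between Y² and Y⁴. Both give
  -- r^{1-γ/4}.
  rcases le_total γ 2 with h | h
  · have e1 : ∀ t, X t ^ α * Y t ^ γ ≤ c ^ (α - (2 - γ)) *
        ((X t ^ 2) ^ (1 - γ / 2) * (Y t ^ 2) ^ (γ / 2)) := by
      intro t
      rw [← ENNReal.rpow_two, ← ENNReal.rpow_two, ← ENNReal.rpow_mul, ← ENNReal.rpow_mul,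
        show 2 * (1 - γ / 2) = 2 - γ by ring, show 2 * (γ / 2) = γ by ring, ← mul_assoc]
      gcongr
      calc X t ^ α = X t ^ (α - (2 - γ)) * X t ^ (2 - γ) := by
            rw [← ENNReal.rpow_add_of_nonneg _ _ (by linarith) (by linarith)]
            congr 1; ring
        _ ≤ _ := by
            gcongr
            · linarith
            · exact hXc t
    calc _ ≤ ∫⁻ t, c ^ (α - (2 - γ)) * ((X t ^ 2) ^ (1 - γ / 2) * (Y t ^ 2) ^ (γ / 2)) := lintegral_mono e1
      _ = c ^ (α - (2 - γ)) * ∫⁻ t, (X t ^ 2) ^ (1 - γ / 2) * (Y t ^ 2) ^ (γ / 2) :=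
          lintegral_const_mul _ (by fun_prop)
      _ ≤ c ^ (α - (2 - γ)) * ((c ^ 2 * r) ^ (1 - γ / 2) * (d ^ 2 * r ^ (1 / 2 : ℝ)) ^ (γ / 2)) := by
          gcongr
          refine (ENNReal.lintegral_mul_norm_pow_le (by fun_prop) (by fun_prop) (by linarith) (by linarith)
            (by ring)).trans ?_
          gcongr
          linarith
      _ = _ := by
          rw [ENNReal.mul_rpow_of_nonneg _ _ (by linarith : 0 ≤ 1 - γ / 2),
            ENNReal.mul_rpow_of_nonneg _ _ (by linarith : 0 ≤ γ / 2), ← ENNReal.rpow_two, ← ENNReal.rpow_two,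
            ← ENNReal.rpow_mul, ← ENNReal.rpow_mul, ← ENNReal.rpow_mul]
          have e2 : c ^ α = c ^ (α - (2 - γ)) * c ^ (2 * (1 - γ / 2)) := by
            rw [← ENNReal.rpow_add_of_nonneg _ _ (by linarith) (by linarith)]
            congr 1; ring
          have e3 : r ^ (1 - γ / 4) = r ^ (1 - γ / 2) * r ^ (1 / 2 * (γ / 2)) := by
            rw [← ENNReal.rpow_add _ _ hr0 hr]
            congr 1; ring
          rw [e2, e3, show 2 * (γ / 2) = γ by ring]
          ring
  · have e1 : ∀ t, X t ^ α * Y t ^ γ ≤ c ^ α * ((Y t ^ 2) ^ (2 - γ / 2) * (Y t ^ 4) ^ (γ / 2 - 1)) := by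
      intro t
      rw [← ENNReal.rpow_two, ← ENNReal.rpow_natCast (Y t) 4, ← ENNReal.rpow_mul, ← ENNReal.rpow_mul,
        ← ENNReal.rpow_add_of_nonneg _ _ (by linarith) (by push_cast; linarith)]
      refine mul_le_mul' (ENNReal.rpow_le_rpow (hXc t) hα) (le_of_eq ?_)
      congr 1; push_cast; ring
    calc _ ≤ ∫⁻ t, c ^ α * ((Y t ^ 2) ^ (2 - γ / 2) * (Y t ^ 4) ^ (γ / 2 - 1)) := lintegral_mono e1
      _ = c ^ α * ∫⁻ t, (Y t ^ 2) ^ (2 - γ / 2) * (Y t ^ 4) ^ (γ / 2 - 1) :=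
          lintegral_const_mul _ (by fun_prop)
      _ ≤ c ^ α * ((d ^ 2 * r ^ (1 / 2 : ℝ)) ^ (2 - γ / 2) * (d ^ 4) ^ (γ / 2 - 1)) := by
          gcongr
          refine (ENNReal.lintegral_mul_norm_pow_le (by fun_prop) (by fun_prop) (by linarith) (by linarith)
            (by ring)).trans ?_
          gcongr
          · linarith
          · linarith
      _ = _ := by
          rw [ENNReal.mul_rpow_of_nonneg _ _ (by linarith : 0 ≤ 2 - γ / 2), ← ENNReal.rpow_two,
            ← ENNReal.rpow_natCast d 4, ← ENNReal.rpow_mul, ← ENNReal.rpow_mul, ← ENNReal.rpow_mul]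
          have e2 : d ^ γ = d ^ (2 * (2 - γ / 2)) * d ^ (((4 : ℕ) : ℝ) * (γ / 2 - 1)) := by
            rw [← ENNReal.rpow_add_of_nonneg _ _ (by linarith) (by push_cast; linarith)]
            congr 1; push_cast; ring
          rw [e2, show 1 / 2 * (2 - γ / 2) = 1 - γ / 4 by ring]
          ring

/-- `L^p` interpolation between `L²` and `L^∞`, with `1/∞ = 0`. -/
theorem eLpNorm_le_two_top {α : Type*} [MeasurableSpace α] {μ : Measure α} {F : α → ℂ}
    (hF : AEMeasurable F μ) {p : ℝ≥0∞} (hp : 2 ≤ p)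
    {y : ℝ≥0∞} (hy : ∀ᵐ x ∂μ, ‖F x‖ₑ ≤ y) :
    eLpNorm F p μ ≤ eLpNorm F 2 μ ^ (1 - 2 * gap p) * y ^ (2 * gap p) := by
  rcases eq_or_ne p ⊤ with rfl | hpt
  · have hg : gap ⊤ = 1 / 2 := by simp [gap]
    rw [hg, show (1 - 2 * (1 / 2) : ℝ) = 0 by norm_num, show (2 * (1 / 2) : ℝ) = 1 by norm_num,
      ENNReal.rpow_zero, ENNReal.rpow_one, one_mul, eLpNorm_exponent_top]
    exact eLpNormEssSup_le_of_ae_enorm_bound hy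
  have hp0 : p ≠ 0 := fun h => by simp [h] at hp
  have hpr : 2 ≤ p.toReal := by
    have := ENNReal.toReal_mono hpt hp
    simpa using this
  have hg : 2 * gap p = 1 - 2 / p.toReal := by
    rw [gap, ENNReal.toReal_inv]; ring
  rw [hg, eLpNorm_eq_lintegral_rpow_enorm_toReal hp0 hpt,
    eLpNorm_eq_lintegral_rpow_enorm_toReal (by norm_num) (by norm_num)]
  simp only [ENNReal.toReal_ofNat]
  have hpt2 : ∫⁻ x, ‖F x‖ₑ ^ p.toReal ∂μ ≤ (∫⁻ x, ‖F x‖ₑ ^ (2 : ℝ) ∂μ) * y ^ (p.toReal - 2) := by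
    rw [← lintegral_mul_const'' _ (by fun_prop)]
    refine lintegral_mono_ae (hy.mono fun x hx => ?_)
    calc ‖F x‖ₑ ^ p.toReal = ‖F x‖ₑ ^ (2 : ℝ) * ‖F x‖ₑ ^ (p.toReal - 2) := by
          rw [← ENNReal.rpow_add_of_nonneg _ _ (by norm_num) (by linarith)]
          congr 1; ring
      _ ≤ _ := by
          gcongr
  calc _ ≤ ((∫⁻ x, ‖F x‖ₑ ^ (2 : ℝ) ∂μ) * y ^ (p.toReal - 2)) ^ (1 / p.toReal) := by gcongr
    _ = _ := by
      have hpp : p.toReal ≠ 0 := by linarith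
      rw [ENNReal.mul_rpow_of_nonneg _ _ (by positivity), ← ENNReal.rpow_mul, ← ENNReal.rpow_mul]
      congr 2
      · field_simp
        ring
      · field_simp

theorem gap_nonneg {p : ℝ≥0∞} (hp : 2 ≤ p) : 0 ≤ gap p := by
  have h1 : p⁻¹ ≤ 2⁻¹ := ENNReal.inv_le_inv.mpr hp
  have h2 := ENNReal.toReal_mono (by simp) h1
  rw [ENNReal.toReal_inv 2] at h2
  simp only [ENNReal.toReal_ofNat] at h2
  rw [gap]; linarith

theorem gap_le_half (p : ℝ≥0∞) : gap p ≤ 1 / 2 := by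
  rw [gap]; linarith [ENNReal.toReal_nonneg (a := p⁻¹)]

/-- The mixed norm is controlled by the fixed-time `L²` norms and the maximal function. -/
theorem mixedNorm_le {n : ℕ} {p q : ℝ≥0∞} (hp : 2 ≤ p) (hq : 2 ≤ q) (hpq : gap p ≤ 2 * q⁻¹.toReal)
    {F : ℝ → ℝ → ℂ} (hF : Measurable (Function.uncurry F)) {Y : ℝ → ℝ≥0∞} (hY : Measurable Y) {c d r : ℝ≥0∞}
    (hr0 : r ≠ 0) (hr : r ≠ ⊤)
    (hXc : ∀ t, ∫⁻ x, ‖F t x‖ₑ ^ 2 ∂(radialMeasure n) ≤ c ^ 2)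
    (hX2 : ∫⁻ t, ∫⁻ x, ‖F t x‖ₑ ^ 2 ∂(radialMeasure n) ≤ c ^ 2 * r)
    (hsup : ∀ t x, ‖F t x‖ₑ ≤ Y t)
    (hY2 : ∫⁻ t, Y t ^ 2 ≤ d ^ 2 * r ^ (1 / 2 : ℝ)) (hY4 : ∫⁻ t, Y t ^ 4 ≤ d ^ 4) :
    mixedNorm n q p F ≤ c ^ (1 - 2 * gap p) * d ^ (2 * gap p) * r ^ (q⁻¹.toReal - gap p / 2) := by
  have hg0 := gap_nonneg hp
  have hg1 := gap_le_half p
  obtain ⟨X, hXdef⟩ : ∃ X : ℝ → ℝ≥0∞, X = fun t => eLpNorm (F t) 2 (radialMeasure n) := ⟨_, rfl⟩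
  have hSF : SFinite (radialMeasure n) := by
    unfold radialMeasure halfLine; infer_instance
  have hXsq : ∀ t, X t ^ 2 = ∫⁻ x, ‖F t x‖ₑ ^ 2 ∂(radialMeasure n) := by
    intro t
    rw [hXdef]
    dsimp only
    rw [eLpNorm_eq_lintegral_rpow_enorm_toReal (by norm_num) (by norm_num), ← ENNReal.rpow_two,
      ← ENNReal.rpow_mul]
    simp
  have hXr : ∀ t, X t = (∫⁻ x, ‖F t x‖ₑ ^ 2 ∂(radialMeasure n)) ^ (1 / 2 : ℝ) := by
    intro t
    rw [← hXsq, ← ENNReal.rpow_two, ← ENNReal.rpow_mul]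
    norm_num
  have hXm : Measurable X := by
    have : X = fun t => (∫⁻ x, ‖F t x‖ₑ ^ 2 ∂(radialMeasure n)) ^ (1 / 2 : ℝ) := funext hXr
    rw [this]
    exact (Measurable.lintegral_prod_right' (hF.enorm.pow_const 2)).pow_const _
  have hXle : ∀ t, X t ≤ c := by
    intro t
    have := hXc t
    rw [← hXsq] at this
    exact (ENNReal.pow_le_pow_left_iff two_ne_zero).mp this
  have hpt : ∀ t, eLpNorm (F t) p (radialMeasure n) ≤ X t ^ (1 - 2 * gap p) * Y t ^ (2 * gap p) := by
    intro t
    rw [hXdef]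
    exact eLpNorm_le_two_top (hF.comp (measurable_prodMk_left (x := t))).aemeasurable hp
      (.of_forall fun x => hsup t x)
  rw [mixedNorm]
  -- For q = ∞ the hypothesis forces g = 0, that is p = 2, and only the fixed-time L² bound remains.
  rcases eq_or_ne q ⊤ with rfl | hqt
  · have hg : gap p = 0 := by
      simp only [ENNReal.inv_top, ENNReal.toReal_zero, mul_zero] at hpq
      linarith
    rw [hg] at hpt ⊢
    simp only [mul_zero, sub_zero, ENNReal.rpow_one, ENNReal.rpow_zero, mul_one] at hpt ⊢
    rw [eLpNorm_exponent_top]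
    simp only [ENNReal.inv_top, ENNReal.toReal_zero, zero_div, sub_zero, ENNReal.rpow_zero, mul_one]
    refine eLpNormEssSup_le_of_ae_enorm_bound (.of_forall fun t => ?_)
    rw [enorm_eq_self]
    exact (hpt t).trans (hXle t)
  have hq0 : q ≠ 0 := fun h => by simp [h] at hq
  have hqr : 2 ≤ q.toReal := by
    have := ENNReal.toReal_mono hqt hq
    simpa using this
  have hqi : q⁻¹.toReal = 1 / q.toReal := by rw [ENNReal.toReal_inv, one_div]
  rw [hqi] at hpq ⊢
  have hqp : 0 < q.toReal := by linarith
  rw [eLpNorm_eq_lintegral_rpow_enorm_toReal hq0 hqt]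
  simp only [enorm_eq_self]
  -- The only use of 2/q ≥ 1/2 - 1/p for finite q: the power 2gq of Y must not exceed 4, the largest
  -- exponent for which Y is controlled.
  have hγ4 : 2 * gap p * q.toReal ≤ 4 := by
    calc 2 * gap p * q.toReal ≤ 2 * (2 * (1 / q.toReal)) * q.toReal := by gcongr
      _ = 4 := by field_simp; norm_num
  calc (∫⁻ t, eLpNorm (F t) p (radialMeasure n) ^ q.toReal) ^ (1 / q.toReal)
      ≤ (∫⁻ t, X t ^ ((1 - 2 * gap p) * q.toReal) * Y t ^ (2 * gap p * q.toReal)) ^ (1 / q.toReal) := by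
        gcongr with t
        rw [ENNReal.rpow_mul, ENNReal.rpow_mul, ← ENNReal.mul_rpow_of_nonneg _ _ hqp.le]
        exact ENNReal.rpow_le_rpow (hpt t) hqp.le
    _ ≤ (c ^ ((1 - 2 * gap p) * q.toReal) * d ^ (2 * gap p * q.toReal) *
          r ^ (1 - 2 * gap p * q.toReal / 4)) ^ (1 / q.toReal) := by
        refine ENNReal.rpow_le_rpow (lintegral_rpow_mul_rpow_le hXm hY hr0 hr hXle ?_ hY2 hY4
          (mul_nonneg (by linarith) hqp.le) (by positivity) hγ4 (by nlinarith)) (by positivity)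
        simp only [hXsq]
        exact hX2
    _ = _ := by
        have h1 : (0 : ℝ) ≤ 1 / q.toReal := by positivity
        rw [ENNReal.mul_rpow_of_nonneg _ _ h1, ENNReal.mul_rpow_of_nonneg _ _ h1, ← ENNReal.rpow_mul,
          ← ENNReal.rpow_mul, ← ENNReal.rpow_mul]
        congr 2
        · congr 1; field_simp
        · congr 1; field_simp
        · field_simp
          ring

/-! ### The upper bound for the localized operator. -/

theorem measurable_indicator_of_phaseData {A lam : ℝ} {ϖ w1 w2 w3 : ℝ → ℝ} (h : PhaseData A lam ϖ w1 w2 w3) :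
    Measurable ((Ioo (1 / 2 : ℝ) 2).indicator ϖ) := by
  have hc : ContinuousOn ϖ (Ioo (1 / 2) 2) := fun ρ hρ => (h.d1 ρ hρ).continuousAt.continuousWithinAt
  rw [← piecewise_eq_indicator]
  exact hc.measurable_piecewise continuousOn_const measurableSet_Ioo

/-- Outside the band the phase is arbitrary, possibly not measurable, but β vanishes there. The
extension by zero can therefore replace it. -/
theorem PhaseData.indicator {A lam : ℝ} {ϖ w1 w2 w3 : ℝ → ℝ} (h : PhaseData A lam ϖ w1 w2 w3) :
    PhaseData A lam ((Ioo (1 / 2 : ℝ) 2).indicator ϖ) w1 w2 w3 :=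
  { h with
    d1 := fun ρ hρ => (h.d1 ρ hρ).congr_of_eventuallyEq (by
      filter_upwards [isOpen_Ioo.mem_nhds hρ] with x hx
      exact indicator_of_mem hx ϖ) }

/-- The localized operator in terms of `bandOp`. -/
theorem localizedOp_eq {n : ℕ} {β : ℝ → ℂ} (hβs : ∀ ρ, ρ ∉ Ioo (1 / 2 : ℝ) 2 → β ρ = 0) {ϖ ϖ' : ℝ → ℝ}
    (hϖ : ∀ ρ ∈ Ioo (1 / 2 : ℝ) 2, ϖ ρ = ϖ' ρ) {h h' : ℝ → ℂ} (hh : h =ᵐ[halfLine] h') {ν R : ℝ} (hR : 0 < R)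
    (t r : ℝ) :
    localizedOp n β ϖ ν R h t r = (Ico R (2 * R)).indicator (fun r =>
      ((r ^ (-(((n : ℝ) - 1) / 2)) : ℝ) : ℂ) *
        bandOp ν ϖ' β (fun ρ => (((√ρ)⁻¹ : ℝ) : ℂ) * h' ρ) t r) r := by
  rw [localizedOp]
  by_cases hr : r ∈ Ico R (2 * R)
  swap
  · rw [indicator_of_notMem hr, indicator_of_notMem hr]
  rw [indicator_of_mem hr, indicator_of_mem hr]
  have hr0 : 0 < r := hR.trans_le hr.1
  have e1 : ((r ^ (-(((n : ℝ) - 2) / 2)) : ℝ) : ℂ) = ((r ^ (-(((n : ℝ) - 1) / 2)) : ℝ) : ℂ) * (√r : ℝ) := by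
    rw [← Complex.ofReal_mul, Real.sqrt_eq_rpow, ← Real.rpow_add hr0]
    congr 2; ring
  rw [e1, mul_assoc]
  congr 1
  rw [bandOp, ← integral_const_mul, band]
  have hsub : Ioo (1 / 2 : ℝ) 2 ⊆ Ioi 0 := fun x hx => lt_trans (by norm_num) hx.1
  have h0 : ∫ ρ, (√r : ℝ) * (Complex.exp (-(Complex.I * t * ϖ ρ)) * (besselJ ν (r * ρ) : ℂ) * β ρ * h ρ) ∂halfLine =
      ∫ ρ in Ioo (1 / 2 : ℝ) 2, (√r : ℝ) *
        (Complex.exp (-(Complex.I * t * ϖ ρ)) * (besselJ ν (r * ρ) : ℂ) * β ρ * h ρ) := by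
    rw [halfLine]
    refine setIntegral_eq_of_subset_of_forall_sdiff_eq_zero measurableSet_Ioi hsub fun x hx => ?_
    rw [hβs x hx.2]; simp
  rw [h0]
  have hhb : ∀ᵐ ρ ∂(volume.restrict (Ioo (1 / 2 : ℝ) 2)), h ρ = h' ρ :=
    ae_mono (Measure.restrict_mono hsub le_rfl) hh
  refine integral_congr_ae ?_
  filter_upwards [hhb, ae_restrict_mem measurableSet_Ioo] with ρ h1 h2
  have hρ0 : 0 < ρ := hsub h2
  have hr1 : (√r : ℂ) ≠ 0 := by exact_mod_cast (Real.sqrt_pos.mpr hr0).ne'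
  have hr2 : (√ρ : ℂ) ≠ 0 := by exact_mod_cast (Real.sqrt_pos.mpr hρ0).ne'
  rw [besselJ_eq_besselU (mul_pos hr0 hρ0), h1, hϖ ρ h2, Real.sqrt_mul hr0.le]
  push_cast
  field_simp

theorem measurable_localizedOp {n : ℕ} {β : ℝ → ℂ} (hβm : Measurable β)
    (hβs : ∀ ρ, ρ ∉ Ioo (1 / 2 : ℝ) 2 → β ρ = 0) {ϖ ϖ' : ℝ → ℝ}
    (hϖ : ∀ ρ ∈ Ioo (1 / 2 : ℝ) 2, ϖ ρ = ϖ' ρ) (hϖm : Measurable ϖ') {h h' : ℝ → ℂ} (hh : h =ᵐ[halfLine] h')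
    (hhm : Measurable h') {ν R : ℝ} (hν : 0 ≤ ν) (hR : 0 < R) :
    Measurable (Function.uncurry (localizedOp n β ϖ ν R h)) := by
  have e : Function.uncurry (localizedOp n β ϖ ν R h) = (univ ×ˢ Ico R (2 * R)).indicator (fun p : ℝ × ℝ =>
      ((p.2 ^ (-(((n : ℝ) - 1) / 2)) : ℝ) : ℂ) *
        Function.uncurry (bandOp ν ϖ' β (fun ρ => (((√ρ)⁻¹ : ℝ) : ℂ) * h' ρ)) p) := by
    funext p
    obtain ⟨t, r⟩ := p
    simp only [Function.uncurry_apply_pair]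
    rw [localizedOp_eq hβs hϖ hh hR]
    by_cases hr : r ∈ Ico R (2 * R)
    · rw [indicator_of_mem hr, indicator_of_mem (show (t, r) ∈ univ ×ˢ Ico R (2 * R) from ⟨trivial, hr⟩)]
      simp only [Function.uncurry_apply_pair]
    · rw [indicator_of_notMem hr, indicator_of_notMem (fun hc => hr hc.2)]
  rw [e]
  refine Measurable.indicator (Measurable.mul (by fun_prop) (measurable_bandOp hν hϖm hβm (by fun_prop)))
    (MeasurableSet.univ.prod measurableSet_Ico)

/-- The fixed-time `L²(r^{n-1}dr)` norm of the localized operator. -/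
theorem lintegral_localizedOp_sq {n : ℕ} {β : ℝ → ℂ} (hβm : Measurable β)
    (hβs : ∀ ρ, ρ ∉ Ioo (1 / 2 : ℝ) 2 → β ρ = 0) {ϖ ϖ' : ℝ → ℝ}
    (hϖ : ∀ ρ ∈ Ioo (1 / 2 : ℝ) 2, ϖ ρ = ϖ' ρ) (hϖm : Measurable ϖ') {h h' : ℝ → ℂ} (hh : h =ᵐ[halfLine] h')
    (hhm : Measurable h') {ν R : ℝ} (hν : 0 ≤ ν) (hR : 0 < R) (t : ℝ) :
    ∫⁻ x, ‖localizedOp n β ϖ ν R h t x‖ₑ ^ 2 ∂(radialMeasure n) =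
      ∫⁻ r in Ico R (2 * R), ‖bandOp ν ϖ' β (fun ρ => (((√ρ)⁻¹ : ℝ) : ℂ) * h' ρ) t r‖ₑ ^ 2 := by
  have hm := (measurable_localizedOp (n := n) hβm hβs hϖ hϖm hh hhm hν hR).comp (measurable_prodMk_left (x := t))
  have hm2 : Measurable fun x => ‖localizedOp n β ϖ ν R h t x‖ₑ ^ 2 := hm.enorm.pow_const 2
  rw [radialMeasure, lintegral_withDensity_eq_lintegral_mul _ (by fun_prop) hm2, halfLine,
    ← lintegral_indicator measurableSet_Ioi, ← lintegral_indicator measurableSet_Ico]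
  refine lintegral_congr fun r => ?_
  by_cases hr : r ∈ Ico R (2 * R)
  · have hr0 : 0 < r := hR.trans_le hr.1
    rw [indicator_of_mem hr, indicator_of_mem (mem_Ioi.mpr hr0), Pi.mul_apply,
      localizedOp_eq hβs hϖ hh hR, indicator_of_mem hr, enorm_mul, mul_pow, enorm_complex_ofReal,
      abs_of_pos (Real.rpow_pos_of_pos hr0 _), ← ENNReal.ofReal_pow (by positivity), ← mul_assoc,
      ← ENNReal.ofReal_mul (by positivity), ← Real.rpow_natCast, ← Real.rpow_mul hr0.le, ← Real.rpow_add hr0,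
      show (n : ℝ) - 1 + -(((n : ℝ) - 1) / 2) * ((2 : ℕ) : ℝ) = 0 by push_cast; ring, Real.rpow_zero,
      ENNReal.ofReal_one, one_mul]
  · rw [indicator_of_notMem hr]
    by_cases h0 : r ∈ Ioi (0 : ℝ)
    · rw [indicator_of_mem h0, Pi.mul_apply, localizedOp_eq hβs hϖ hh hR, indicator_of_notMem hr]
      simp
    · rw [indicator_of_notMem h0]

/-- The weight 1/ρ created by the normalization of the Bessel function is at most 2 on the band. -/
theorem lintegral_weighted_sq_le {h h' : ℝ → ℂ} (hh : h =ᵐ[halfLine] h') :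
    ∫⁻ ρ, ‖(((√ρ)⁻¹ : ℝ) : ℂ) * h' ρ‖ₑ ^ 2 ∂band ≤ 2 * eLpNorm h 2 halfLine ^ 2 := by
  have hsub : Ioo (1 / 2 : ℝ) 2 ⊆ Ioi 0 := fun x hx => lt_trans (by norm_num) hx.1
  have e : eLpNorm h 2 halfLine ^ 2 = ∫⁻ ρ, ‖h' ρ‖ₑ ^ 2 ∂halfLine := by
    rw [eLpNorm_congr_ae hh, eLpNorm_eq_lintegral_rpow_enorm_toReal (by norm_num) (by norm_num),
      ← ENNReal.rpow_two, ← ENNReal.rpow_mul]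
    simp
  rw [e]
  calc _ ≤ ∫⁻ ρ, 2 * ‖h' ρ‖ₑ ^ 2 ∂band := by
        refine lintegral_mono_ae (ae_band fun ρ hρ => ?_)
        have hρ0 : 0 < ρ := hsub hρ
        rw [enorm_mul, mul_pow, enorm_complex_ofReal, ← ENNReal.ofReal_pow (abs_nonneg _), sq_abs, inv_pow,
          Real.sq_sqrt hρ0.le, show (2 : ℝ≥0∞) = ENNReal.ofReal 2 by simp]
        gcongr
        rw [inv_le_comm₀ hρ0 two_pos]
        linarith [hρ.1]
    _ = 2 * ∫⁻ ρ, ‖h' ρ‖ₑ ^ 2 ∂band := lintegral_const_mul' _ _ (by simp)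
    _ ≤ _ := by
        gcongr
        exact Measure.restrict_mono hsub le_rfl

/-- The three factors are the parameters c, d and r = R of `mixedNorm_le`. The factor R^{-(n-1)/2}
is the supremum over the shell of the weight r^{-(n-1)/2}, and it enters only Y. For X this weight
cancels the measure r^{n-1} dr. -/
theorem mixedNorm_localizedOp_le_aux {n : ℕ} (hn : 1 ≤ n) {p q : ℝ≥0∞} (hp : 2 ≤ p) (hq : 2 ≤ q)
    (hpq : gap p ≤ 2 * q⁻¹.toReal) {β : ℝ → ℂ} {a b b0 : ℝ} (hβ : BandCutoff a b b0 β)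
    (hβs : ∀ ρ, ρ ∉ Ioo (1 / 2 : ℝ) 2 → β ρ = 0) {A K : ℝ} (hA : 1 ≤ A) (hK : 1 ≤ K)
    {lam ν L R : ℝ} {ϖ w1 w2 w3 : ℝ → ℝ} (hlam : 0 < lam) (hϖ : PhaseData A lam ϖ w1 w2 w3) (hν : 0 ≤ ν)
    (hL : 0 < L) (hR : 0 < R) {h : ℝ → ℂ} (hh : MemLp h 2 halfLine)
    (hmax : ∀ {f : ℝ → ℂ}, Measurable f → ∫⁻ ρ, ‖f ρ‖ₑ ^ 2 ∂band ≠ ⊤ →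
      ∃ Y : ℝ → ℝ≥0∞, Measurable Y ∧
        (∀ t, ∀ r ∈ Ico R (2 * R), ‖bandOp ν ((Ioo (1 / 2 : ℝ) 2).indicator ϖ) β f t r‖ₑ ≤ Y t) ∧
        (∫⁻ t, Y t ^ 2 ≤ ENNReal.ofReal (K * (L / √lam * √R)) * ∫⁻ ρ, ‖f ρ‖ₑ ^ 2 ∂band) ∧
        ∫⁻ t, Y t ^ 4 ≤ ENNReal.ofReal (K * (L / √lam) ^ 2) * (∫⁻ ρ, ‖f ρ‖ₑ ^ 2 ∂band) ^ 2) :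
    mixedNorm n q p (localizedOp n β ϖ ν R h) ≤
      (ENNReal.ofReal √(40 * Real.pi * A * Real.exp 4 * b0 ^ 2) * eLpNorm h 2 halfLine) ^ (1 - 2 * gap p) *
      (ENNReal.ofReal √(2 * K * (L / √lam) * R ^ (-((n : ℝ) - 1))) * eLpNorm h 2 halfLine) ^ (2 * gap p) *
      ENNReal.ofReal R ^ (q⁻¹.toReal - gap p / 2) := by
  obtain ⟨h', hm', hh'⟩ : ∃ h' : ℝ → ℂ, Measurable h' ∧ h =ᵐ[halfLine] h' :=
    ⟨hh.1.mk h, hh.1.stronglyMeasurable_mk.measurable, hh.1.ae_eq_mk⟩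
  obtain ⟨ϖ', hϖ'⟩ : ∃ ϖ' : ℝ → ℝ, ϖ' = (Ioo (1 / 2 : ℝ) 2).indicator ϖ := ⟨_, rfl⟩
  have hϖm : Measurable ϖ' := by rw [hϖ']; exact measurable_indicator_of_phaseData hϖ
  have hϖd : PhaseData A lam ϖ' w1 w2 w3 := by rw [hϖ']; exact hϖ.indicator
  have hϖe : ∀ ρ ∈ Ioo (1 / 2 : ℝ) 2, ϖ ρ = ϖ' ρ := fun ρ hρ => by rw [hϖ', indicator_of_mem hρ]
  rw [← hϖ'] at hmax
  obtain ⟨f, hfe⟩ : ∃ f : ℝ → ℂ, f = fun ρ => (((√ρ)⁻¹ : ℝ) : ℂ) * h' ρ := ⟨_, rfl⟩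
  have hfm : Measurable f := by rw [hfe]; fun_prop
  obtain ⟨H, hH⟩ : ∃ H, H = eLpNorm h 2 halfLine := ⟨_, rfl⟩
  have hHt : H ≠ ⊤ := by rw [hH]; exact hh.2.ne
  have hfE : ∫⁻ ρ, ‖f ρ‖ₑ ^ 2 ∂band ≤ 2 * H ^ 2 := by
    rw [hfe, hH]; exact lintegral_weighted_sq_le hh'
  have hft : ∫⁻ ρ, ‖f ρ‖ₑ ^ 2 ∂band ≠ ⊤ :=
    ne_top_of_le_ne_top (ENNReal.mul_ne_top (by simp) (ENNReal.pow_ne_top hHt)) hfE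
  obtain ⟨Y, hY, hsup, hY2, hY4⟩ := hmax hfm hft
  have hb0 := hβ.b0_pos
  have hA0 : 0 < A := by linarith
  have hsl : 0 < √lam := Real.sqrt_pos.mpr hlam
  have hLl : 0 < L / √lam := by positivity
  have hloc := fun t => lintegral_localizedOp_sq (n := n) hβ.meas hβs hϖe hϖm hh' hm' hν hR t
  rw [← hfe] at hloc
  rw [← hH]
  obtain ⟨w, hw⟩ : ∃ w, w = R ^ (-(((n : ℝ) - 1) / 2)) := ⟨_, rfl⟩
  have hw0 : 0 < w := by rw [hw]; exact Real.rpow_pos_of_pos hR _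
  have hww : w ^ 2 = R ^ (-((n : ℝ) - 1)) := by
    rw [hw, ← Real.rpow_natCast, ← Real.rpow_mul hR.le]
    congr 1; push_cast; ring
  rw [← hww]
  have hrs : ENNReal.ofReal R ^ (1 / 2 : ℝ) = ENNReal.ofReal √R := by
    rw [ENNReal.ofReal_rpow_of_pos hR, Real.sqrt_eq_rpow]
  have hc2 : (ENNReal.ofReal √(40 * Real.pi * A * Real.exp 4 * b0 ^ 2) * H) ^ 2 =
      ENNReal.ofReal (40 * Real.pi * A * Real.exp 4 * b0 ^ 2) * H ^ 2 := by
    rw [mul_pow, ← ENNReal.ofReal_pow (Real.sqrt_nonneg _), Real.sq_sqrt (by positivity)]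
  have hd2 : (ENNReal.ofReal √(2 * K * (L / √lam) * w ^ 2) * H) ^ 2 =
      ENNReal.ofReal (2 * K * (L / √lam) * w ^ 2) * H ^ 2 := by
    rw [mul_pow, ← ENNReal.ofReal_pow (Real.sqrt_nonneg _), Real.sq_sqrt (by positivity)]
  refine mixedNorm_le hp hq hpq (measurable_localizedOp hβ.meas hβs hϖe hϖm hh' hm' hν hR)
    (Y := fun t => ENNReal.ofReal w * Y t) (hY.const_mul _) (by simpa using hR) ENNReal.ofReal_ne_top
    (fun t => ?_) ?_ (fun t r => ?_) ?_ ?_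
  · rw [hloc, hc2]
    calc _ ≤ ENNReal.ofReal (20 * Real.exp 4 * b0 ^ 2) * (2 * H ^ 2) :=
          (bandOp_fixed_time hϖm hβ hν hR hfm hft t).trans (mul_le_mul_right hfE _)
      _ = ENNReal.ofReal (40 * Real.exp 4 * b0 ^ 2) * H ^ 2 := by
          rw [show (2 : ℝ≥0∞) = ENNReal.ofReal 2 by simp, ← mul_assoc, ← ENNReal.ofReal_mul (by positivity)]
          congr 2; ring
      _ ≤ _ := by
          refine mul_le_mul_left (ENNReal.ofReal_le_ofReal ?_) _
          have : 1 ≤ Real.pi * A := by nlinarith [Real.pi_gt_three]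
          calc 40 * Real.exp 4 * b0 ^ 2 ≤ 40 * Real.exp 4 * b0 ^ 2 * (Real.pi * A) :=
                le_mul_of_one_le_right (by positivity) this
            _ = _ := by ring
  · simp only [hloc]
    rw [hc2]
    calc _ ≤ ENNReal.ofReal (10 * Real.pi * A * Real.exp 4 * b0 ^ 2 * R) * (2 * H ^ 2) :=
          (bandOp_shell_sq_le hA hϖm hϖd hβ hν hR hfm).trans (mul_le_mul_right hfE _)
      _ = ENNReal.ofReal (20 * Real.pi * A * Real.exp 4 * b0 ^ 2) * H ^ 2 * ENNReal.ofReal R := by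
          rw [show (2 : ℝ≥0∞) = ENNReal.ofReal 2 by simp, mul_right_comm _ (H ^ 2), ← mul_assoc,
            ← ENNReal.ofReal_mul (by positivity), ← ENNReal.ofReal_mul (by positivity)]
          congr 2; ring
      _ ≤ _ := by
          refine mul_le_mul_left (mul_le_mul_left (ENNReal.ofReal_le_ofReal ?_) _) _
          have : 0 ≤ Real.pi * A * Real.exp 4 * b0 ^ 2 := by positivity
          linarith
  · rw [localizedOp_eq hβs hϖe hh' hR, ← hfe]
    by_cases hr : r ∈ Ico R (2 * R)
    · rw [indicator_of_mem hr, enorm_mul, enorm_complex_ofReal]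
      refine mul_le_mul' (ENNReal.ofReal_le_ofReal ?_) (hsup t r hr)
      rw [abs_of_pos (Real.rpow_pos_of_pos (hR.trans_le hr.1) _), hw]
      refine Real.rpow_le_rpow_of_nonpos hR hr.1 ?_
      have : (1 : ℝ) ≤ n := by exact_mod_cast hn
      linarith
    · rw [indicator_of_notMem hr, enorm_zero]; exact zero_le
  · rw [hd2, hrs]
    simp only [mul_pow]
    rw [lintegral_const_mul _ (hY.pow_const 2), ← ENNReal.ofReal_pow hw0.le]
    calc _ ≤ ENNReal.ofReal (w ^ 2) * (ENNReal.ofReal (K * (L / √lam * √R)) * (2 * H ^ 2)) := by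
          gcongr
          exact hY2.trans (mul_le_mul_right hfE _)
      _ = _ := by
          rw [show (2 : ℝ≥0∞) = ENNReal.ofReal 2 by simp, mul_right_comm _ (H ^ 2), ← mul_assoc, ← mul_assoc,
            ← ENNReal.ofReal_mul (by positivity), ← ENNReal.ofReal_mul (by positivity),
            ← ENNReal.ofReal_mul (by positivity)]
          congr 2; ring
  · rw [show (ENNReal.ofReal √(2 * K * (L / √lam) * w ^ 2) * H) ^ 4 =
      ((ENNReal.ofReal √(2 * K * (L / √lam) * w ^ 2) * H) ^ 2) ^ 2 by ring, hd2]
    simp only [mul_pow]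
    rw [lintegral_const_mul _ (hY.pow_const 4), ← ENNReal.ofReal_pow hw0.le, ← ENNReal.ofReal_pow (by positivity)]
    calc _ ≤ ENNReal.ofReal (w ^ 4) * (ENNReal.ofReal (K * (L / √lam) ^ 2) * (2 * H ^ 2) ^ 2) := by
          gcongr
          exact hY4.trans (mul_le_mul_right (pow_le_pow_left' hfE 2) _)
      _ = ENNReal.ofReal (w ^ 4 * (K * (L / √lam) ^ 2) * 4) * (H ^ 2) ^ 2 := by
          rw [ENNReal.ofReal_mul (q := 4) (by positivity), ENNReal.ofReal_mul (p := w ^ 4) (by positivity),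
            show ENNReal.ofReal 4 = 4 by simp]
          ring
      _ ≤ _ := by
          refine mul_le_mul_left (ENNReal.ofReal_le_ofReal ?_) _
          calc w ^ 4 * (K * (L / √lam) ^ 2) * 4 = K * (4 * w ^ 4 * (L / √lam) ^ 2) := by ring
            _ ≤ K ^ 2 * (4 * w ^ 4 * (L / √lam) ^ 2) := by
                gcongr
                exact le_self_pow₀ hK two_ne_zero
            _ = _ := by ring

/-- The Strichartz-type estimate for the localized operator. -/
theorem exists_mixedNorm_localizedOp_le {n : ℕ} (hn : 1 ≤ n) {p q : ℝ≥0∞} (hp : 2 ≤ p) (hq : 2 ≤ q)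
    (hpq : gap p ≤ 2 * q⁻¹.toReal) {β : ℝ → ℂ} (hβ : ContDiff ℝ ∞ β) (hβc : HasCompactSupport β)
    (hβs : tsupport β ⊆ Ioo (1 / 2) 2) {A : ℝ} (hA : 1 ≤ A) :
    ∃ C : ℝ, 0 < C ∧ ∀ (lam ν R : ℝ) (ϖ : ℝ → ℝ) (h : ℝ → ℂ),
        0 < lam → lam ≤ A → 0 ≤ ν → A⁻¹ ≤ R → IsAdmissiblePhase A lam ϖ →
        MemLp h 2 halfLine →
        mixedNorm n q p (localizedOp n β ϖ ν R h) ≤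
          ENNReal.ofReal (C * lam ^ (-(1 / 2) * gap p) * (1 + ν) ^ (4 / 5 * gap p) *
            R ^ expR n p q) * eLpNorm h 2 halfLine := by
  obtain ⟨a, b, b0, hB⟩ := exists_bandCutoff hβ hβc hβs
  have hβ0 : ∀ ρ, ρ ∉ Ioo (1 / 2 : ℝ) 2 → β ρ = 0 := fun ρ hρ =>
    image_eq_zero_of_notMem_tsupport fun hc => hρ (hβs hc)
  obtain ⟨K, hK0, hK⟩ := exists_maximal hA hB
  have hb0 := hB.b0_pos
  have hA0 : 0 < A := by linarith
  have hg0 := gap_nonneg hp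
  have hg1 := gap_le_half p
  obtain ⟨c, hc⟩ : ∃ c, c = √(40 * Real.pi * A * Real.exp 4 * b0 ^ 2) := ⟨_, rfl⟩
  have hc0 : 0 < c := by rw [hc]; exact Real.sqrt_pos.mpr (by positivity)
  refine ⟨c ^ (1 - 2 * gap p) * (2 * (K + 1)) ^ gap p, by positivity, ?_⟩
  intro lam ν R ϖ h hlam hlamA hν hR hϖ hh
  have hR0 : 0 < R := (by positivity : 0 < A⁻¹).trans_le hR
  have hsl : 0 < √lam := Real.sqrt_pos.mpr hlam
  have hν1 : 1 ≤ 1 + ν := by linarith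
  -- The estimates require L ≥ 1, L² ≥ 1+ν and L³ ≥ (1+ν)². The exponent 4/5 satisfies the last two
  -- because 8/5 ≥ 1 and 12/5 ≥ 2.
  obtain ⟨L, hL⟩ : ∃ L, L = (1 + ν) ^ (4 / 5 : ℝ) := ⟨_, rfl⟩
  have hL1 : 1 ≤ L := by rw [hL]; exact Real.one_le_rpow hν1 (by norm_num)
  have hL0 : 0 < L := by linarith
  have hL2 : 1 + ν ≤ L ^ 2 := by
    rw [hL, ← Real.rpow_natCast, ← Real.rpow_mul (by linarith)]
    calc 1 + ν = (1 + ν) ^ (1 : ℝ) := (Real.rpow_one _).symm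
      _ ≤ _ := Real.rpow_le_rpow_of_exponent_le hν1 (by norm_num)
  have hL3 : (1 + ν) ^ 2 ≤ L ^ 3 := by
    rw [hL, ← Real.rpow_natCast, ← Real.rpow_natCast, ← Real.rpow_mul (by linarith)]
    exact Real.rpow_le_rpow_of_exponent_le hν1 (by norm_num)
  have hpd := hϖ.phaseData hlam
  refine (mixedNorm_localizedOp_le_aux hn hp hq hpq hB hβ0 hA (K := K + 1) (by linarith) hlam hpd hν hL0 hR0 hh
    fun {f} hf hf2 => ?_).trans ?_
  · obtain ⟨Y, hY, h1, h2, h3⟩ := hK hlam hlamA (measurable_indicator_of_phaseData hpd) hpd.indicator hν hL1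
      hL2 hL3 hR hf hf2
    refine ⟨Y, hY, h1, h2.trans ?_, h3.trans ?_⟩
    · refine mul_le_mul_left (ENNReal.ofReal_le_ofReal ?_) _
      gcongr; linarith
    · refine mul_le_mul_left (ENNReal.ofReal_le_ofReal ?_) _
      gcongr; linarith
  rw [← hc]
  obtain ⟨H, hH⟩ : ∃ H, H = eLpNorm h 2 halfLine := ⟨_, rfl⟩
  rw [← hH]
  have hd0 : 0 < 2 * (K + 1) * (L / √lam) * R ^ (-((n : ℝ) - 1)) := by positivity
  rw [ENNReal.mul_rpow_of_nonneg _ _ (by linarith : 0 ≤ 1 - 2 * gap p),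
    ENNReal.mul_rpow_of_nonneg _ _ (by linarith : 0 ≤ 2 * gap p), ENNReal.ofReal_rpow_of_pos hc0,
    ENNReal.ofReal_rpow_of_pos (Real.sqrt_pos.mpr hd0), ENNReal.ofReal_rpow_of_pos hR0]
  have hHH : H ^ (1 - 2 * gap p) * H ^ (2 * gap p) = H := by
    rw [← ENNReal.rpow_add_of_nonneg _ _ (by linarith) (by linarith)]
    simp
  have hmul : ∀ x y z : ℝ≥0∞, x * H ^ (1 - 2 * gap p) * (y * H ^ (2 * gap p)) * z = x * y * z * H := by
    intro x y z
    calc _ = x * y * z * (H ^ (1 - 2 * gap p) * H ^ (2 * gap p)) := by ring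
      _ = _ := by rw [hHH]
  rw [hmul, ← ENNReal.ofReal_mul (by positivity), ← ENNReal.ofReal_mul (by positivity)]
  refine mul_le_mul_left (ENNReal.ofReal_le_ofReal (le_of_eq ?_)) _
  have e1 : √(2 * (K + 1) * (L / √lam) * R ^ (-((n : ℝ) - 1))) ^ (2 * gap p) =
      (2 * (K + 1)) ^ gap p * ((1 + ν) ^ (4 / 5 * gap p) * lam ^ (-(1 / 2) * gap p)) *
        R ^ (-((n : ℝ) - 1) * gap p) := by
    rw [Real.sqrt_eq_rpow, ← Real.rpow_mul hd0.le, show 1 / 2 * (2 * gap p) = gap p by ring,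
      Real.mul_rpow (by positivity) (by positivity), Real.mul_rpow (by positivity) (by positivity),
      Real.div_rpow hL0.le hsl.le, hL, ← Real.rpow_mul (by linarith), ← Real.rpow_mul hR0.le,
      Real.sqrt_eq_rpow, ← Real.rpow_mul hlam.le, neg_mul (1 / 2), Real.rpow_neg hlam.le, div_eq_mul_inv]
  -- The weight contributes -(n-1)g to the exponent and the interpolation contributes 1/q - g/2.
  -- Together they give 1/q - (2n-1)g/2.
  have e2 : R ^ expR n p q = R ^ (-((n : ℝ) - 1) * gap p) * R ^ (q⁻¹.toReal - gap p / 2) := by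
    rw [← Real.rpow_add hR0, expR]
    congr 1; ring
  rw [e1, e2]
  ring

/-! ### Sharpness: wave packets near the light cone. -/

/-- The modulus of `besselZ` stays away from zero. -/
theorem exists_le_norm_besselZ {ν : ℝ} (hν : 0 ≤ ν) :
    ∃ m X : ℝ, 0 < m ∧ 0 < X ∧ ∀ x, X ≤ x → m ≤ ‖besselZ ν x‖ := by
  obtain ⟨x0, hx0, hu0⟩ := exists_besselU_ne_zero hν
  obtain ⟨κ, hκ⟩ : ∃ κ, κ = |ν ^ 2 - 1 / 4| := ⟨_, rfl⟩
  have hκ0 : 0 ≤ κ := by rw [hκ]; positivity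
  -- E = u² + u'² is |z|², and E' = 2V u u' with V = (ν² - 1/4)/x², so |E'| ≤ κE/x². Hence E
  -- e^{-κ/x} is nondecreasing, and a single point with u nonzero bounds it from below for all
  -- larger x.
  let E : ℝ → ℝ := fun x => besselU ν x ^ 2 + besselDU ν x ^ 2
  have hE0 : ∀ x, 0 ≤ E x := fun x => by positivity
  have hd : ∀ x, 0 < x → HasDerivAt (fun x => E x * Real.exp (-(κ / x)))
      ((2 * ((ν ^ 2 - 1 / 4) / x ^ 2) * besselU ν x * besselDU ν x + κ / x ^ 2 * E x) *
        Real.exp (-(κ / x))) x := by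
    intro x hx
    have h1 := ((hasDerivAt_besselU hν hx).pow 2).add ((hasDerivAt_besselDU hν hx).pow 2)
    have h2 : HasDerivAt (fun x => -(κ / x)) (κ / x ^ 2) x := by
      refine ((hasDerivAt_inv hx.ne').const_mul κ).neg.congr_deriv ?_
      field_simp
    refine (h1.mul h2.exp).congr_deriv ?_
    simp only [E, Pi.add_apply, Pi.pow_apply]
    ring
  have hmono : MonotoneOn (fun x => E x * Real.exp (-(κ / x))) (Ioi 0) := by
    refine monotoneOn_of_deriv_nonneg (convex_Ioi 0)
      (fun x hx => (hd x hx).continuousAt.continuousWithinAt)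
      (fun x hx => (hd x (by simpa using hx)).differentiableAt.differentiableWithinAt) fun x hx => ?_
    rw [interior_Ioi] at hx
    have hx0 : 0 < x := hx
    rw [(hd x hx).deriv]
    refine mul_nonneg ?_ (Real.exp_pos _).le
    have h1 : |2 * ((ν ^ 2 - 1 / 4) / x ^ 2) * besselU ν x * besselDU ν x| ≤ κ / x ^ 2 * E x := by
      rw [show 2 * ((ν ^ 2 - 1 / 4) / x ^ 2) * besselU ν x * besselDU ν x =
        (ν ^ 2 - 1 / 4) * (2 * besselU ν x * besselDU ν x / x ^ 2) by ring, abs_mul, ← hκ,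
        show κ / x ^ 2 * E x = κ * (E x / x ^ 2) by ring, abs_div, abs_of_pos (pow_pos hx0 2)]
      gcongr
      simp only [E]
      rw [abs_le]
      constructor
      · nlinarith [sq_nonneg (besselU ν x + besselDU ν x)]
      · nlinarith [sq_nonneg (besselU ν x - besselDU ν x)]
    linarith [neg_le_of_abs_le h1]
  have hc : 0 < E x0 * Real.exp (-(κ / x0)) := by
    have : 0 < besselU ν x0 ^ 2 := by positivity
    have : 0 < E x0 := by simp only [E]; positivity
    positivity
  have hnorm : ∀ x, ‖besselZ ν x‖ ^ 2 = E x := by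
    intro x
    rw [besselZ, norm_mul, norm_cexp_neg_I, one_mul, ← Complex.normSq_eq_norm_sq, Complex.normSq_apply]
    simp [E]
    ring
  refine ⟨√(E x0 * Real.exp (-(κ / x0))), x0, Real.sqrt_pos.mpr hc, hx0, fun x hx => ?_⟩
  have hxp : 0 < x := hx0.trans_le hx
  refine Real.sqrt_le_iff.mpr ⟨norm_nonneg _, ?_⟩
  rw [hnorm]
  calc _ ≤ E x * Real.exp (-(κ / x)) := hmono hx0 hxp hx
    _ ≤ E x * 1 := by
        refine mul_le_mul_of_nonneg_left (Real.exp_le_one_iff.mpr ?_) (hE0 x)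
        have : 0 ≤ κ / x := by positivity
        linarith
    _ = E x := mul_one _

theorem norm_cexp_I_sub_le (x y : ℝ) :
    ‖Complex.exp (Complex.I * x) - Complex.exp (Complex.I * y)‖ ≤ |x - y| := by
  have e : Complex.exp (Complex.I * x) - Complex.exp (Complex.I * y) =
      Complex.exp (Complex.I * y) * (Complex.exp (Complex.I * ((x - y : ℝ) : ℂ)) - 1) := by
    rw [mul_sub, ← Complex.exp_add, mul_one]
    congr 2; push_cast; ring
  rw [e, norm_mul, norm_cexp_I_mul, one_mul]
  exact Real.norm_exp_I_mul_ofReal_sub_one_le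

/-- The first-order Taylor estimate for the phase. -/
theorem PhaseData.taylor {A lam : ℝ} {ϖ w1 w2 w3 : ℝ → ℝ} (h : PhaseData A lam ϖ w1 w2 w3) (hA : 0 ≤ A)
    {ρ0 η : ℝ} (hη : 0 ≤ η) (hsub : Icc (ρ0 - η) (ρ0 + η) ⊆ Ioo (1 / 2) 2) {ρ : ℝ}
    (hρ : ρ ∈ Icc (ρ0 - η) (ρ0 + η)) : |ϖ ρ - ϖ ρ0 - w1 ρ0 * (ρ - ρ0)| ≤ A * η ^ 2 := by
  have h0 : ρ0 ∈ Icc (ρ0 - η) (ρ0 + η) := ⟨by linarith, by linarith⟩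
  have hdist : ∀ x ∈ Icc (ρ0 - η) (ρ0 + η), |x - ρ0| ≤ η := fun x hx =>
    abs_le.mpr ⟨by linarith [hx.1], by linarith [hx.2]⟩
  have h1 : ∀ x ∈ Icc (ρ0 - η) (ρ0 + η), ‖w1 x - w1 ρ0‖ ≤ A * η := by
    intro x hx
    have := (convex_Icc (ρ0 - η) (ρ0 + η)).norm_image_sub_le_of_norm_hasDerivWithin_le (C := A)
      (fun y hy => (h.d2 y (hsub hy)).hasDerivWithinAt) (fun y hy => h.up2 y (hsub hy)) h0 hx
    refine this.trans ?_
    gcongr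
    exact hdist x hx
  have h2 := (convex_Icc (ρ0 - η) (ρ0 + η)).norm_image_sub_le_of_norm_hasDerivWithin_le (C := A * η)
      (f := fun x => ϖ x - w1 ρ0 * x) (f' := fun x => w1 x - w1 ρ0)
      (fun y hy => ((h.d1 y (hsub hy)).sub (((hasDerivAt_id y).const_mul (w1 ρ0)).congr_deriv
        (mul_one _))).hasDerivWithinAt) h1 h0 hρ
  calc _ = ‖ϖ ρ - w1 ρ0 * ρ - (ϖ ρ0 - w1 ρ0 * ρ0)‖ := by rw [Real.norm_eq_abs]; congr 1; ring
    _ ≤ A * η * ‖ρ - ρ0‖ := h2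
    _ ≤ A * η * η := by gcongr; exact hdist ρ hρ
    _ = _ := by ring

theorem norm_besselZ_sub_le {ν y : ℝ} (hν : 0 ≤ ν) (hy : 4 * (1 + ν) ≤ y) {x x' : ℝ} (hx : y ≤ x) (hx' : y ≤ x') :
    ‖besselZ ν x - besselZ ν x'‖ ≤ besselM * ((1 + ν) ^ 2 / y ^ 2) * |x - x'| := by
  have hM := besselM_pos
  have hy0 : 0 < y := by linarith
  refine (convex_Ici y).norm_image_sub_le_of_norm_hasDerivWithin_le (f := besselZ ν)
    (fun u hu => (hasDerivAt_besselZ hν (hy0.trans_le hu)).hasDerivWithinAt) (fun u hu => ?_) hx' hx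
  have hu' : y ≤ u := hu
  refine (norm_besselDZ_le hν (hy.trans hu')).trans ?_
  gcongr

/-- The resonant half of the wave is coherent near the light cone. -/
theorem coherent_half {A lam : ℝ} {ϖ w1 w2 w3 : ℝ → ℝ} (hA : 1 ≤ A) (hϖ : PhaseData A lam ϖ w1 w2 w3)
    {ν : ℝ} (hν : 0 ≤ ν) {ρ0 η : ℝ} (hη : 0 < η) (hsub : Icc (ρ0 - η) (ρ0 + η) ⊆ Ioo (1 / 2) 2)
    {m t r : ℝ} (hr : 8 * (1 + ν) ≤ r) (hmz : m ≤ ‖besselZ ν (r * ρ0)‖)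
    (hphase : 2 * besselM * (|t| * (A * η ^ 2) + |r - t * w1 ρ0| * η) ≤ m / 4)
    (hamp : 4 * besselM * (1 + ν) ^ 2 * η / r ≤ m / 4) :
    η * m ≤ ‖∫ ρ in (ρ0 - η)..(ρ0 + η),
      Complex.exp (Complex.I * ((-t * ϖ ρ + r * ρ : ℝ) : ℂ)) * besselZ ν (r * ρ)‖ := by
  have hM := besselM_pos
  have hr0 : 0 < r := by linarith
  have hle : ρ0 - η ≤ ρ0 + η := by linarith
  have h0 : ρ0 ∈ Icc (ρ0 - η) (ρ0 + η) := ⟨by linarith, by linarith⟩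
  have hlow : ∀ ρ ∈ Icc (ρ0 - η) (ρ0 + η), r / 2 ≤ r * ρ := fun ρ hρ => by
    nlinarith [(hsub hρ).1]
  have hdist : ∀ x ∈ Icc (ρ0 - η) (ρ0 + η), |x - ρ0| ≤ η := fun x hx =>
    abs_le.mpr ⟨by linarith [hx.1], by linarith [hx.2]⟩
  have cF : ContinuousOn (fun ρ => Complex.exp (Complex.I * ((-t * ϖ ρ + r * ρ : ℝ) : ℂ)) *
      besselZ ν (r * ρ)) (Icc (ρ0 - η) (ρ0 + η)) := by
    intro ρ hρ
    have h1 := (hϖ.d1 ρ (hsub hρ)).continuousAt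
    have h2 : ContinuousAt (fun ρ => r * ρ) ρ := by fun_prop
    have h3 : ContinuousAt (fun ρ => besselZ ν (r * ρ)) ρ :=
      ContinuousAt.comp (f := fun ρ => r * ρ) (g := besselZ ν)
        (hasDerivAt_besselZ hν (by linarith [hlow ρ hρ])).continuousAt h2
    have h4 : ContinuousAt (fun ρ => Complex.exp (Complex.I * ((-t * ϖ ρ + r * ρ : ℝ) : ℂ))) ρ := by
      fun_prop
    exact (h4.mul h3).continuousWithinAt
  -- The integrand is compared with its value c at the centre. The variation of the phase and that
  -- of the amplitude each cost at most m/4, so the integral over length 2η keeps at least 2η(m -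
  -- m/2).
  obtain ⟨c, hc⟩ : ∃ c, c = Complex.exp (Complex.I * ((-t * ϖ ρ0 + r * ρ0 : ℝ) : ℂ)) * besselZ ν (r * ρ0) := ⟨_, rfl⟩
  have hcn : m ≤ ‖c‖ := by rw [hc, norm_mul, norm_cexp_I_mul, one_mul]; exact hmz
  have hpt : ∀ ρ ∈ Icc (ρ0 - η) (ρ0 + η), ‖Complex.exp (Complex.I * ((-t * ϖ ρ + r * ρ : ℝ) : ℂ)) *
      besselZ ν (r * ρ) - c‖ ≤ m / 2 := by
    intro ρ hρ
    have e : Complex.exp (Complex.I * ((-t * ϖ ρ + r * ρ : ℝ) : ℂ)) * besselZ ν (r * ρ) - c =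
        (Complex.exp (Complex.I * ((-t * ϖ ρ + r * ρ : ℝ) : ℂ)) -
          Complex.exp (Complex.I * ((-t * ϖ ρ0 + r * ρ0 : ℝ) : ℂ))) * besselZ ν (r * ρ) +
        Complex.exp (Complex.I * ((-t * ϖ ρ0 + r * ρ0 : ℝ) : ℂ)) * (besselZ ν (r * ρ) - besselZ ν (r * ρ0)) := by
      rw [hc]; ring
    rw [e]
    have b1 : ‖besselZ ν (r * ρ)‖ ≤ 2 * besselM := norm_besselZ_le hν (by linarith [hlow ρ hρ])
    have b2 : |(-t * ϖ ρ + r * ρ) - (-t * ϖ ρ0 + r * ρ0)| ≤ |t| * (A * η ^ 2) + |r - t * w1 ρ0| * η := by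
      rw [show (-t * ϖ ρ + r * ρ) - (-t * ϖ ρ0 + r * ρ0) =
        -(t * (ϖ ρ - ϖ ρ0 - w1 ρ0 * (ρ - ρ0))) + (r - t * w1 ρ0) * (ρ - ρ0) by ring]
      refine (abs_add_le _ _).trans ?_
      rw [abs_neg, abs_mul, abs_mul]
      gcongr
      · exact hϖ.taylor (by linarith) hη.le hsub hρ
      · exact hdist ρ hρ
    have b3 := norm_besselZ_sub_le hν (y := r / 2) (by linarith) (hlow ρ hρ) (hlow ρ0 h0)
    have b4 : besselM * ((1 + ν) ^ 2 / (r / 2) ^ 2) * |r * ρ - r * ρ0| ≤ 4 * besselM * (1 + ν) ^ 2 * η / r := by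
      rw [← mul_sub, abs_mul, abs_of_pos hr0]
      calc _ ≤ besselM * ((1 + ν) ^ 2 / (r / 2) ^ 2) * (r * η) := by gcongr; exact hdist ρ hρ
        _ = _ := by field_simp; ring
    calc _ ≤ (|t| * (A * η ^ 2) + |r - t * w1 ρ0| * η) * (2 * besselM) +
          1 * (4 * besselM * (1 + ν) ^ 2 * η / r) := by
          refine (norm_add_le _ _).trans ?_
          rw [norm_mul, norm_mul, norm_cexp_I_mul]
          gcongr
          · exact (norm_cexp_I_sub_le _ _).trans b2
          · exact b3.trans b4
      _ ≤ m / 2 := by linarith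
  have hint : IntervalIntegrable (fun ρ => Complex.exp (Complex.I * ((-t * ϖ ρ + r * ρ : ℝ) : ℂ)) *
      besselZ ν (r * ρ)) volume (ρ0 - η) (ρ0 + η) :=
    ContinuousOn.intervalIntegrable (by rw [uIcc_of_le hle]; exact cF)
  have hdiff := intervalIntegral.norm_integral_le_of_norm_le_const (a := ρ0 - η) (b := ρ0 + η)
    (f := fun ρ => Complex.exp (Complex.I * ((-t * ϖ ρ + r * ρ : ℝ) : ℂ)) * besselZ ν (r * ρ) - c) (C := m / 2)
    (fun ρ hρ => hpt ρ (by rw [uIoc_of_le hle] at hρ; exact Ioc_subset_Icc_self hρ))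
  rw [intervalIntegral.integral_sub hint intervalIntegrable_const, intervalIntegral.integral_const,
    show ρ0 + η - (ρ0 - η) = 2 * η by ring, abs_of_pos (by positivity : 0 < 2 * η)] at hdiff
  have h3 := norm_sub_norm_le (((2 * η : ℝ) : ℝ) • c) (∫ ρ in (ρ0 - η)..(ρ0 + η),
      Complex.exp (Complex.I * ((-t * ϖ ρ + r * ρ : ℝ) : ℂ)) * besselZ ν (r * ρ))
  rw [norm_sub_rev, norm_smul, Real.norm_eq_abs, abs_of_pos (by positivity : 0 < 2 * η)] at h3
  nlinarith

open scoped ComplexConjugate in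
/-- The non-resonant half of the wave is small. -/
theorem incoherent_half {A lam : ℝ} {ϖ w1 w2 w3 : ℝ → ℝ} (hA : 1 ≤ A) (hϖ : PhaseData A lam ϖ w1 w2 w3)
    {ν : ℝ} (hν : 0 ≤ ν) {ρ0 η : ℝ} (hη : 0 < η) (hη1 : η ≤ 1) (hsub : Icc (ρ0 - η) (ρ0 + η) ⊆ Ioo (1 / 2) 2)
    {t r : ℝ} (hr : 8 * (1 + ν) ≤ r) (hsign : ∀ ρ ∈ Ioo (1 / 2 : ℝ) 2, 0 ≤ t * w1 ρ) (htr : |t| ≤ 2 * A * r) :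
    ‖∫ ρ in (ρ0 - η)..(ρ0 + η),
      Complex.exp (Complex.I * ((-t * ϖ ρ + -r * ρ : ℝ) : ℂ)) * conj (besselZ ν (r * ρ))‖ ≤
      (4 * besselM + 8 * besselM * (1 + ν) ^ 2 + 8 * besselM * A ^ 2) / r := by
  have hM := besselM_pos
  have hr0 : 0 < r := by linarith
  have hle : ρ0 - η ≤ ρ0 + η := by linarith
  have hlow : ∀ ρ ∈ Icc (ρ0 - η) (ρ0 + η), r / 2 ≤ r * ρ := fun ρ hρ => by
    nlinarith [(hsub hρ).1]
  have h1 : ∀ x ∈ Icc (ρ0 - η) (ρ0 + η), HasDerivAt (fun ρ => -t * ϖ ρ + -r * ρ) (-t * w1 x + -r) x := fun x hx =>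
    (((hϖ.d1 x (hsub hx)).const_mul (-t)).add (((hasDerivAt_id x).const_mul (-r)))).congr_deriv (by simp)
  have h2 : ∀ x ∈ Icc (ρ0 - η) (ρ0 + η), HasDerivAt (fun ρ => -t * w1 ρ + -r) (-t * w2 x) x := fun x hx =>
    ((hϖ.d2 x (hsub hx)).const_mul (-t)).add_const _
  have hg : ∀ x ∈ Icc (ρ0 - η) (ρ0 + η), HasDerivAt (fun ρ => conj (besselZ ν (r * ρ)))
      (conj ((r : ℂ) * besselDZ ν (r * x))) x := by
    intro x hx
    have hm : HasDerivAt (fun x => r * x) r x := by simpa using (hasDerivAt_id x).const_mul r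
    have := ((hasDerivAt_besselZ hν (x := r * x) (by linarith [hlow x hx])).scomp x hm).star
    exact this.congr_deriv (by simp)
  -- In the incoming wave tϖ' and r have the same sign and add up, so the phase has no stationary
  -- point and its derivative is at least r.
  have h0 : ∀ x ∈ Icc (ρ0 - η) (ρ0 + η), r ≤ |-t * w1 x + -r| := by
    intro x hx
    have := hsign x (hsub hx)
    rw [show -t * w1 x + -r = -(t * w1 x + r) by ring, abs_neg, abs_of_nonneg (by linarith)]
    linarith
  have c2 : ContinuousOn (fun x => -t * w2 x) (Icc (ρ0 - η) (ρ0 + η)) := fun x hx =>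
    ((hϖ.d3 x (hsub hx)).continuousAt.const_mul (-t)).continuousWithinAt
  have cg : ContinuousOn (fun x => conj ((r : ℂ) * besselDZ ν (r * x))) (Icc (ρ0 - η) (ρ0 + η)) := by
    intro x hx
    have hx2 : ContinuousAt (fun x => r * x) x := by fun_prop
    have := ContinuousAt.comp (f := fun x => r * x) (g := besselDZ ν)
      (hasDerivAt_besselDZ hν (by linarith [hlow x hx])).continuousAt hx2
    exact (Complex.continuous_conj.continuousAt.comp (continuousAt_const.mul this)).continuousWithinAt
  have hP : ∫ x in (ρ0 - η)..(ρ0 + η), |-t * w2 x| / (-t * w1 x + -r) ^ 2 ≤ 4 * A ^ 2 / r := by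
    have hb := intervalIntegral.norm_integral_le_of_norm_le_const (a := ρ0 - η) (b := ρ0 + η)
      (f := fun x => |-t * w2 x| / (-t * w1 x + -r) ^ 2) (C := 2 * A ^ 2 / r) (fun x hx => by
        rw [uIoc_of_le hle] at hx
        have hx' := Ioc_subset_Icc_self hx
        rw [Real.norm_eq_abs, abs_of_nonneg (by positivity), ← sq_abs (-t * w1 x + -r)]
        calc |-t * w2 x| / |-t * w1 x + -r| ^ 2 ≤ (2 * A * r * A) / r ^ 2 := by
              gcongr
              · rw [abs_mul, abs_neg]
                gcongr
                exact hϖ.up2 x (hsub hx')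
              · exact h0 x hx'
          _ = 2 * A ^ 2 / r := by field_simp)
    refine (le_abs_self _).trans (hb.trans ?_)
    rw [show ρ0 + η - (ρ0 - η) = 2 * η by ring, abs_of_pos (by positivity : 0 < 2 * η)]
    calc 2 * A ^ 2 / r * (2 * η) ≤ 2 * A ^ 2 / r * (2 * 1) := by gcongr
      _ = _ := by ring
  refine (osc_integral_first hle h1 h2 hg hr0 h0 c2 cg (G0 := 2 * besselM)
    (G1 := 4 * besselM * (1 + ν) ^ 2 / r) (fun x hx => ?_) (fun x hx => ?_) hP).trans ?_
  · rw [RCLike.norm_conj]; exact norm_besselZ_le hν (by linarith [hlow x hx])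
  · rw [RCLike.norm_conj, norm_mul, Complex.norm_real, Real.norm_eq_abs, abs_of_pos hr0]
    calc r * ‖besselDZ ν (r * x)‖ ≤ r * (besselM * ((1 + ν) ^ 2 / (r / 2) ^ 2)) := by
          gcongr
          refine (norm_besselDZ_le hν (by linarith [hlow x hx])).trans ?_
          gcongr
          exact hlow x hx
      _ = _ := by field_simp; ring
  · rw [show ρ0 + η - (ρ0 - η) = 2 * η by ring]
    have hr1 : 1 ≤ r := by linarith
    calc _ ≤ 2 * (2 * besselM) / r + 2 * 1 * (4 * besselM * (1 + ν) ^ 2 / 1) / r + 2 * besselM * (4 * A ^ 2 / r) := by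
          gcongr
      _ = _ := by ring

open scoped ComplexConjugate in
/-- The wave packet is large near the light cone. -/
theorem le_norm_integral_besselU {A lam : ℝ} {ϖ w1 w2 w3 : ℝ → ℝ} (hA : 1 ≤ A) (hϖ : PhaseData A lam ϖ w1 w2 w3)
    {ν : ℝ} (hν : 0 ≤ ν) {ρ0 η : ℝ} (hη : 0 < η) (hη1 : η ≤ 1) (hsub : Icc (ρ0 - η) (ρ0 + η) ⊆ Ioo (1 / 2) 2)
    {m t r : ℝ} (hr : 8 * (1 + ν) ≤ r) (hmz : m ≤ ‖besselZ ν (r * ρ0)‖)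
    (hphase : 2 * besselM * (|t| * (A * η ^ 2) + |r - t * w1 ρ0| * η) ≤ m / 4)
    (hamp : 4 * besselM * (1 + ν) ^ 2 * η / r ≤ m / 4)
    (hsign : ∀ ρ ∈ Ioo (1 / 2 : ℝ) 2, 0 ≤ t * w1 ρ) (htr : |t| ≤ 2 * A * r)
    (hinc : (4 * besselM + 8 * besselM * (1 + ν) ^ 2 + 8 * besselM * A ^ 2) / r ≤ η * m / 2) :
    η * m / 4 ≤ ‖∫ ρ in (ρ0 - η)..(ρ0 + η),
      Complex.exp (-(Complex.I * t * ϖ ρ)) * (besselU ν (r * ρ) : ℂ)‖ := by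
  have hr0 : 0 < r := by linarith
  have hle : ρ0 - η ≤ ρ0 + η := by linarith
  have hpos : ∀ ρ ∈ Icc (ρ0 - η) (ρ0 + η), 0 < r * ρ := fun ρ hρ => by
    have := (hsub hρ).1
    exact mul_pos hr0 (by linarith)
  have h1 := coherent_half hA hϖ hν hη hsub hr hmz hphase hamp
  have h2 := (incoherent_half hA hϖ hν hη hη1 hsub hr hsign htr).trans hinc
  have cz : ∀ ρ ∈ Icc (ρ0 - η) (ρ0 + η), ContinuousAt (fun ρ => besselZ ν (r * ρ)) ρ := fun ρ hρ =>
    ContinuousAt.comp (f := fun ρ => r * ρ) (g := besselZ ν)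
      (hasDerivAt_besselZ hν (hpos ρ hρ)).continuousAt (by fun_prop)
  have cw : ∀ ρ ∈ Icc (ρ0 - η) (ρ0 + η), ContinuousAt ϖ ρ := fun ρ hρ => (hϖ.d1 ρ (hsub hρ)).continuousAt
  have i1 : IntervalIntegrable (fun ρ => Complex.exp (Complex.I * ((-t * ϖ ρ + r * ρ : ℝ) : ℂ)) *
      besselZ ν (r * ρ)) volume (ρ0 - η) (ρ0 + η) := by
    refine ContinuousOn.intervalIntegrable (fun ρ hρ => ?_)
    rw [uIcc_of_le hle] at hρ
    have := cz ρ hρ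
    have := cw ρ hρ
    exact ContinuousAt.continuousWithinAt (by fun_prop)
  have i2 : IntervalIntegrable (fun ρ => Complex.exp (Complex.I * ((-t * ϖ ρ + -r * ρ : ℝ) : ℂ)) *
      conj (besselZ ν (r * ρ))) volume (ρ0 - η) (ρ0 + η) := by
    refine ContinuousOn.intervalIntegrable (fun ρ hρ => ?_)
    rw [uIcc_of_le hle] at hρ
    have h3 := Complex.continuous_conj.continuousAt.comp (cz ρ hρ)
    have := cw ρ hρ
    exact ContinuousAt.continuousWithinAt (ContinuousAt.mul (by fun_prop) h3)
  have e : ∀ ρ, Complex.exp (-(Complex.I * t * ϖ ρ)) * (besselU ν (r * ρ) : ℂ) =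
      (1 / 2) * (Complex.exp (Complex.I * ((-t * ϖ ρ + r * ρ : ℝ) : ℂ)) * besselZ ν (r * ρ) +
        Complex.exp (Complex.I * ((-t * ϖ ρ + -r * ρ : ℝ) : ℂ)) * conj (besselZ ν (r * ρ))) := by
    intro ρ
    have e1 : Complex.exp (Complex.I * ((-t * ϖ ρ + r * ρ : ℝ) : ℂ)) =
        Complex.exp (-(Complex.I * t * ϖ ρ)) * Complex.exp (Complex.I * ((r * ρ : ℝ) : ℂ)) := by
      rw [← Complex.exp_add]; congr 1; push_cast; ring
    have e2 : Complex.exp (Complex.I * ((-t * ϖ ρ + -r * ρ : ℝ) : ℂ)) =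
        Complex.exp (-(Complex.I * t * ϖ ρ)) * Complex.exp (-(Complex.I * ((r * ρ : ℝ) : ℂ))) := by
      rw [← Complex.exp_add]; congr 1; push_cast; ring
    rw [besselU_eq_besselZ, e1, e2]
    ring
  simp only [e]
  rw [intervalIntegral.integral_const_mul, intervalIntegral.integral_add i1 i2, norm_mul]
  have h3 := norm_sub_le_norm_add (∫ ρ in (ρ0 - η)..(ρ0 + η), Complex.exp (Complex.I * ((-t * ϖ ρ + r * ρ : ℝ) : ℂ)) *
      besselZ ν (r * ρ)) (∫ ρ in (ρ0 - η)..(ρ0 + η), Complex.exp (Complex.I * ((-t * ϖ ρ + -r * ρ : ℝ) : ℂ)) *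
      conj (besselZ ν (r * ρ)))
  have h4 : ‖(1 / 2 : ℂ)‖ = 1 / 2 := by norm_num
  rw [h4]
  linarith

/-- A nonvanishing continuous derivative keeps its sign on the band. With t = s/ϖ'(ρ0) and s ≥ 0
this makes tϖ' nonnegative at every frequency, as `incoherent_half` needs. -/
theorem PhaseData.sign {A lam : ℝ} {ϖ w1 w2 w3 : ℝ → ℝ} (h : PhaseData A lam ϖ w1 w2 w3) (hA : 0 < A)
    {ρ0 ρ : ℝ} (h0 : ρ0 ∈ Ioo (1 / 2 : ℝ) 2) (hρ : ρ ∈ Ioo (1 / 2 : ℝ) 2) : 0 ≤ w1 ρ / w1 ρ0 := by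
  have hne : ∀ x ∈ Ioo (1 / 2 : ℝ) 2, w1 x ≠ 0 := fun x hx hx0 => by
    have h1 := h.low1 x hx
    rw [hx0, abs_zero] at h1
    have : 0 < A⁻¹ := by positivity
    linarith
  by_contra hneg
  push Not at hneg
  have hc : ContinuousOn w1 (Ioo (1 / 2) 2) := fun x hx => (h.d2 x hx).continuousAt.continuousWithinAt
  have hc' : ContinuousOn (fun x => w1 x / w1 ρ0) (Ioo (1 / 2) 2) := hc.div_const _
  have := isPreconnected_Ioo.intermediate_value hρ h0 hc'
  have h1 : (0 : ℝ) ∈ Icc (w1 ρ / w1 ρ0) (w1 ρ0 / w1 ρ0) :=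
    ⟨hneg.le, by rw [div_self (hne ρ0 h0)]; exact zero_le_one⟩
  obtain ⟨x, hx, hx0⟩ := this h1
  exact hne x hx ((div_eq_zero_iff.mp hx0).resolve_right (hne ρ0 h0))

/-- With η = ε/√R, |t| at most of order R and |r - s| ≤ ε√R, both phase errors |t|η² and |r - s|η
are of order ε². They are small once ε is small, uniformly in R. The incoming wave, of size 1/r, is
negligible against η because √R is large. -/
theorem packet_lower {A lam : ℝ} {ϖ w1 w2 w3 : ℝ → ℝ} (hA : 1 ≤ A) (hϖ : PhaseData A lam ϖ w1 w2 w3)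
    {ν : ℝ} (hν : 0 ≤ ν) {ρ0 ε m R W s r : ℝ} (hm : 0 < m) (hε0 : 0 < ε) (hε1 : ε ≤ 1) (hR1 : 1 ≤ R)
    (hsub : Icc (ρ0 - ε / √R) (ρ0 + ε / √R) ⊆ Ioo (1 / 2) 2) (hε2 : 32 * A ^ 2 * besselM * ε ≤ m)
    (hW : W = 4 * besselM + 8 * besselM * (1 + ν) ^ 2 + 8 * besselM * A ^ 2)
    (hW1 : 4 * W ≤ R * m) (hW2 : 2 * W ≤ √R * (ε * m)) (hν8 : 8 * (1 + ν) ≤ R)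
    (hs0 : 0 ≤ s) (hs2 : s ≤ 2 * R) (hrs : |r - s| ≤ ε * √R) (hr1 : R ≤ r)
    (hmz : m ≤ ‖besselZ ν (r * ρ0)‖) :
    ε / √R * m / 4 ≤ ‖∫ ρ in (ρ0 - ε / √R)..(ρ0 + ε / √R),
      Complex.exp (-(Complex.I * (s / w1 ρ0 : ℝ) * ϖ ρ)) * (besselU ν (r * ρ) : ℂ)‖ := by
  have hM := besselM_pos
  have hA0 : 0 < A := by linarith
  have hR0 : 0 < R := by linarith
  have hr0 : 0 < r := by linarith
  have hq1 : 1 ≤ √R := Real.one_le_sqrt.mpr hR1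
  have hRq : √R * √R = R := Real.mul_self_sqrt hR0.le
  obtain ⟨η, hη⟩ : ∃ η, η = ε / √R := ⟨_, rfl⟩
  have hη0 : 0 < η := by rw [hη]; positivity
  have hηq : η * √R = ε := by rw [hη]; field_simp
  have hη1 : η ≤ 1 := by nlinarith
  rw [← hη] at hsub ⊢
  have h0 : ρ0 ∈ Ioo (1 / 2 : ℝ) 2 := hsub ⟨by linarith, by linarith⟩
  have hv0 : 0 < |w1 ρ0| := (by positivity : 0 < A⁻¹).trans_le (hϖ.low1 ρ0 h0)
  have hvne : w1 ρ0 ≠ 0 := abs_pos.mp hv0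
  have ht2 : |s / w1 ρ0| ≤ 2 * A * R := by
    rw [abs_div, abs_of_nonneg hs0, div_eq_mul_inv]
    calc s * |w1 ρ0|⁻¹ ≤ 2 * R * A := by
          gcongr
          exact inv_le_of_inv_le₀ hA0 (hϖ.low1 ρ0 h0)
      _ = _ := by ring
  have hphase : 2 * besselM * (|s / w1 ρ0| * (A * η ^ 2) + |r - s / w1 ρ0 * w1 ρ0| * η) ≤ m / 4 := by
    rw [div_mul_cancel₀ _ hvne]
    have e0 : ε ^ 2 ≤ ε := by nlinarith
    have e1 : |s / w1 ρ0| * (A * η ^ 2) ≤ 2 * A ^ 2 * ε := by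
      calc _ ≤ 2 * A * R * (A * η ^ 2) := by gcongr
        _ = 2 * A ^ 2 * (η * √R) ^ 2 := by linear_combination (-2 * A ^ 2 * η ^ 2) * hRq
        _ ≤ _ := by rw [hηq]; gcongr
    have e2 : |r - s| * η ≤ A ^ 2 * ε := by
      calc _ ≤ ε * √R * η := by gcongr
        _ = 1 * ε ^ 2 := by rw [mul_assoc, mul_comm √R, hηq]; ring
        _ ≤ A ^ 2 * ε := by gcongr; exact one_le_pow₀ hA
    calc _ ≤ 2 * besselM * (2 * A ^ 2 * ε + A ^ 2 * ε) := by gcongr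
      _ ≤ m / 4 := by
          have : 0 < A ^ 2 * besselM * ε := by positivity
          linarith
  have hamp : 4 * besselM * (1 + ν) ^ 2 * η / r ≤ m / 4 := by
    rw [div_le_iff₀ hr0]
    have e2 : 4 * besselM * (1 + ν) ^ 2 * η ≤ W := by
      calc _ ≤ 4 * besselM * (1 + ν) ^ 2 * 1 := by gcongr
        _ ≤ W := by
          rw [hW]
          have : 0 < besselM * (1 + ν) ^ 2 := by positivity
          have : 0 < besselM * A ^ 2 := by positivity
          linarith
    have e3 : R * m ≤ r * m := by gcongr
    linarith
  have hsign : ∀ ρ ∈ Ioo (1 / 2 : ℝ) 2, 0 ≤ s / w1 ρ0 * w1 ρ := by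
    intro ρ hρ
    have := hϖ.sign hA0 h0 hρ
    calc 0 ≤ s * (w1 ρ / w1 ρ0) := by positivity
      _ = _ := by ring
  have hinc : (4 * besselM + 8 * besselM * (1 + ν) ^ 2 + 8 * besselM * A ^ 2) / r ≤ η * m / 2 := by
    rw [← hW, div_le_iff₀ hr0]
    calc W ≤ √R * (ε * m) / 2 := by linarith
      _ = η * m / 2 * (√R * √R) := by rw [← hηq]; ring
      _ ≤ η * m / 2 * r := by rw [hRq]; gcongr
  refine le_norm_integral_besselU hA hϖ hν hη0 hη1 hsub (by linarith) hmz
    hphase hamp hsign (ht2.trans ?_) hinc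
  gcongr

/-- A packet at frequency `ρ0` of width `ε / √R` is large near the light cone. -/
theorem exists_packet_lower {A lam : ℝ} {ϖ w1 w2 w3 : ℝ → ℝ} (hA : 1 ≤ A) (hϖ : PhaseData A lam ϖ w1 w2 w3)
    {ν : ℝ} (hν : 0 ≤ ν) {ρ0 δ : ℝ} (hδ : 0 < δ) (hsub : Icc (ρ0 - δ) (ρ0 + δ) ⊆ Ioo (1 / 2) 2) :
    ∃ m ε R₀ : ℝ, 0 < m ∧ 0 < ε ∧ 1 ≤ R₀ ∧ ∀ R, R₀ ≤ R → ε / √R ≤ δ ∧ 8 * (ε * √R) ≤ R ∧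
      ∀ s r : ℝ, s ∈ Icc (5 / 4 * R) (7 / 4 * R) → |r - s| ≤ ε * √R →
        ε / √R * m / 4 ≤ ‖∫ ρ in (ρ0 - ε / √R)..(ρ0 + ε / √R),
          Complex.exp (-(Complex.I * (s / w1 ρ0 : ℝ) * ϖ ρ)) * (besselU ν (r * ρ) : ℂ)‖ := by
  obtain ⟨m, X, hm, hX, hmX⟩ := exists_le_norm_besselZ hν
  have hM := besselM_pos
  have h0 : ρ0 ∈ Ioo (1 / 2 : ℝ) 2 := hsub ⟨by linarith, by linarith⟩
  obtain ⟨ε, hε0, hε1, hε2⟩ : ∃ ε, 0 < ε ∧ ε ≤ 1 ∧ 32 * A ^ 2 * besselM * ε ≤ m := by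
    refine ⟨min 1 (m / (32 * A ^ 2 * besselM)), by positivity, min_le_left _ _, ?_⟩
    rw [← le_div_iff₀' (by positivity)]
    exact min_le_right _ _
  obtain ⟨W, hW⟩ : ∃ W, W = 4 * besselM + 8 * besselM * (1 + ν) ^ 2 + 8 * besselM * A ^ 2 := ⟨_, rfl⟩
  have hW0 : 0 < W := by rw [hW]; positivity
  -- S exceeds every threshold that √R or R has to pass, and the bound R ≥ S² then gives √R ≥ S.
  obtain ⟨S, hS1, hS2, hS3, hS4, hS5, hS6⟩ : ∃ S, 8 ≤ S ∧ 1 / δ ≤ S ∧ 2 * X ≤ S ∧ 8 * (1 + ν) ≤ S ∧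
      4 * W / m ≤ S ∧ 2 * W / (ε * m) ≤ S := by
    have p1 : 0 < 1 / δ := by positivity
    have p2 : 0 < 4 * W / m := by positivity
    have p3 : 0 < 2 * W / (ε * m) := by positivity
    refine ⟨8 + 1 / δ + 2 * X + 8 * (1 + ν) + 4 * W / m + 2 * W / (ε * m), ?_, ?_, ?_, ?_, ?_, ?_⟩ <;>
      linarith
  refine ⟨m, ε, S ^ 2, hm, hε0, by nlinarith, fun R hR => ?_⟩
  have hSR : S ≤ √R := Real.le_sqrt_of_sq_le hR
  have hq0 : 0 < √R := by linarith
  have hRq : √R * √R = R := Real.mul_self_sqrt (by nlinarith)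
  have hR0 : 0 < R := by rw [← hRq]; positivity
  have hle : √R ≤ R := by nlinarith
  have hηδ : ε / √R ≤ δ := by
    rw [div_le_iff₀ hq0]
    have : 1 / δ ≤ √R := by linarith
    rw [div_le_iff₀' hδ] at this
    linarith
  have h4 : 8 * (ε * √R) ≤ R := by
    have : ε * √R ≤ 1 * √R := by gcongr
    have : 8 * √R ≤ √R * √R := by gcongr; linarith
    linarith
  refine ⟨hηδ, h4, fun s r hs hrs => ?_⟩
  have hr1 : R ≤ r := by linarith [hs.1, (abs_le.mp hrs).1]
  rw [div_le_iff₀ hm] at hS5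
  rw [div_le_iff₀ (by positivity)] at hS6
  have hXr : X ≤ r * ρ0 := by nlinarith [h0.1]
  refine packet_lower hA hϖ hν hm hε0 hε1 (by linarith)
    ((Icc_subset_Icc (by linarith) (by linarith)).trans hsub) hε2 hW (hS5.trans ?_) (hS6.trans ?_)
    (by linarith) (by linarith [hs.1]) (by linarith [hs.2]) hrs hr1 (hmX _ hXr)
  · gcongr; linarith
  · gcongr

/-- Comparison with a constant on a set, applied once in r and once in t. The exponent is read as
zero when p is infinite. -/
theorem ofReal_mul_rpow_le_eLpNorm {α E : Type*} {_ : MeasurableSpace α} {μ : Measure α} [TopologicalSpace E]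
    [ContinuousENorm E] {S : Set α} (hS : MeasurableSet S) {f : α → E} {p : ℝ≥0∞} (hp : p ≠ 0) {κ a : ℝ}
    (hκ : 0 ≤ κ) (ha : 0 < a) (hf : ∀ x ∈ S, ENNReal.ofReal κ ≤ ‖f x‖ₑ) (hμ : ENNReal.ofReal a ≤ μ S) :
    ENNReal.ofReal (κ * a ^ p⁻¹.toReal) ≤ eLpNorm f p μ := by
  have hne : μ S ≠ 0 := fun h0 => by
    rw [h0, nonpos_iff_eq_zero, ENNReal.ofReal_eq_zero] at hμ
    linarith
  have h1 : eLpNorm (S.indicator fun _ => κ) p μ ≤ eLpNorm f p μ := by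
    refine eLpNorm_mono_enorm fun x => ?_
    by_cases hx : x ∈ S
    · rw [indicator_of_mem hx, Real.enorm_eq_ofReal hκ]; exact hf x hx
    · rw [indicator_of_notMem hx, enorm_zero]; exact zero_le
  refine le_trans ?_ h1
  rw [eLpNorm_indicator_const' hS hne hp, Real.enorm_eq_ofReal hκ, ENNReal.ofReal_mul hκ,
    ← ENNReal.ofReal_rpow_of_pos ha, ENNReal.toReal_inv, one_div]
  gcongr

theorem ofReal_le_radialMeasure_Icc {n : ℕ} (hn : 1 ≤ n) {R a b : ℝ} (hR : 0 < R) (ha : R ≤ a) :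
    ENNReal.ofReal (R ^ ((n : ℝ) - 1) * (b - a)) ≤ radialMeasure n (Icc a b) := by
  have hsub : Icc a b ⊆ Ioi 0 := fun x hx => hR.trans_le (ha.trans hx.1)
  have hn' : (0 : ℝ) ≤ (n : ℝ) - 1 := by
    have : (1 : ℝ) ≤ n := by exact_mod_cast hn
    linarith
  rw [radialMeasure, withDensity_apply _ measurableSet_Icc, halfLine,
    Measure.restrict_restrict measurableSet_Icc, inter_eq_self_of_subset_left hsub,
    ENNReal.ofReal_mul (by positivity), ← Real.volume_Icc, ← setLIntegral_const]
  refine setLIntegral_mono' measurableSet_Icc fun x hx => ENNReal.ofReal_le_ofReal ?_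
  exact Real.rpow_le_rpow hR.le (ha.trans hx.1) hn'

/-- A function that is large near the cone `r = v t` has large mixed norm. -/
theorem ofReal_le_mixedNorm {n : ℕ} (hn : 1 ≤ n) {p q : ℝ≥0∞} (hp : p ≠ 0) (hq : q ≠ 0) {F : ℝ → ℝ → ℂ}
    {A v R d κ : ℝ} (hv : v ≠ 0) (hvA : |v| ≤ A) (hR : 0 < R) (hd : 0 < d) (hdR : 4 * d ≤ R) (hκ : 0 ≤ κ)
    (hF : ∀ s r : ℝ, s ∈ Icc (5 / 4 * R) (7 / 4 * R) → |r - s| ≤ d → κ ≤ ‖F (s / v) r‖) :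
    ENNReal.ofReal (κ * (R ^ ((n : ℝ) - 1) * (2 * d)) ^ p⁻¹.toReal * (R / (2 * A)) ^ q⁻¹.toReal) ≤
      mixedNorm n q p F := by
  have hv0 : 0 < |v| := abs_pos.mpr hv
  have hA : 0 < A := hv0.trans_le hvA
  -- The times with tv in [5R/4, 7R/4] have measure R/(2|v|) ≥ R/(2A). For each of them the tube |r
  -- - tv| ≤ d stays in r ≥ R because 4d ≤ R.
  refine ofReal_mul_rpow_le_eLpNorm (S := (fun t => t * v) ⁻¹' Icc (5 / 4 * R) (7 / 4 * R))
    (measurableSet_Icc.preimage (by fun_prop)) hq (by positivity) (by positivity) (fun t ht => ?_) ?_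
  · rw [enorm_eq_self]
    have ht' : t * v ∈ Icc (5 / 4 * R) (7 / 4 * R) := ht
    refine ofReal_mul_rpow_le_eLpNorm (S := Icc (t * v - d) (t * v + d)) measurableSet_Icc hp hκ
      (by positivity) (fun r hr => ?_) ?_
    · have h1 := hF (t * v) r ht' (abs_le.mpr ⟨by linarith [hr.1], by linarith [hr.2]⟩)
      rw [mul_div_cancel_right₀ _ hv] at h1
      rw [← ofReal_norm]
      exact ENNReal.ofReal_le_ofReal h1
    · have := ofReal_le_radialMeasure_Icc hn (b := t * v + d) hR (by linarith [ht'.1] : R ≤ t * v - d)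
      rwa [show t * v + d - (t * v - d) = 2 * d by ring] at this
  · rw [Real.volume_preimage_mul_right hv, Real.volume_Icc, ← ENNReal.ofReal_mul (abs_nonneg _)]
    refine ENNReal.ofReal_le_ofReal ?_
    rw [abs_inv, show 7 / 4 * R - 5 / 4 * R = R / 2 by ring, show R / (2 * A) = A⁻¹ * (R / 2) by field_simp]
    gcongr

/-- The packet of frequencies within `η` of `ρ0` on which the localized operator concentrates. -/
def packet (β : ℝ → ℂ) (ρ0 η : ℝ) : ℝ → ℂ :=
  (Icc (ρ0 - η) (ρ0 + η)).indicator fun ρ => (√ρ : ℂ) / β ρ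

/-- The factor √ρ/β(ρ) undoes both the normalization of the Bessel function and the cutoff, leaving
a pure oscillatory integral over the packet. -/
theorem localizedOp_packet {n : ℕ} {β : ℝ → ℂ} (hβs : ∀ ρ, ρ ∉ Ioo (1 / 2 : ℝ) 2 → β ρ = 0) (ϖ : ℝ → ℝ)
    {ρ0 η : ℝ} (hη : 0 < η) (hsub : Icc (ρ0 - η) (ρ0 + η) ⊆ Ioo (1 / 2) 2)
    (hβ0 : ∀ ρ ∈ Icc (ρ0 - η) (ρ0 + η), β ρ ≠ 0) {ν R t r : ℝ} (hR : 0 < R) (hr : r ∈ Ico R (2 * R)) :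
    localizedOp n β ϖ ν R (packet β ρ0 η) t r = ((r ^ (-(((n : ℝ) - 1) / 2)) : ℝ) : ℂ) *
      ∫ ρ in (ρ0 - η)..(ρ0 + η), Complex.exp (-(Complex.I * t * ϖ ρ)) * (besselU ν (r * ρ) : ℂ) := by
  rw [localizedOp_eq hβs (fun _ _ => rfl) (Filter.EventuallyEq.refl _ _) hR, indicator_of_mem hr]
  congr 1
  rw [bandOp, intervalIntegral.integral_of_le (by linarith), ← integral_Icc_eq_integral_Ioc,
    ← inter_eq_self_of_subset_left hsub, ← Measure.restrict_restrict measurableSet_Icc,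
    ← integral_indicator measurableSet_Icc, ← band]
  refine integral_congr_ae (.of_forall fun ρ => ?_)
  by_cases hρ : ρ ∈ Icc (ρ0 - η) (ρ0 + η)
  · have h1 := hβ0 ρ hρ
    have h2 : (√ρ : ℂ) ≠ 0 := by
      have : 0 < ρ := by linarith [(hsub hρ).1]
      exact_mod_cast (Real.sqrt_pos.mpr this).ne'
    simp only [packet, indicator_of_mem hρ]
    push_cast
    field_simp
  · simp only [packet, indicator_of_notMem hρ, mul_zero]

theorem measurable_packet {β : ℝ → ℂ} (hβ : Measurable β) (ρ0 η : ℝ) : Measurable (packet β ρ0 η) :=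
  Measurable.indicator (by fun_prop) measurableSet_Icc

theorem eLpNorm_packet_le {β : ℝ → ℂ} {ρ0 η b : ℝ} (hb : 0 < b) (hη : 0 < η)
    (hsub : Icc (ρ0 - η) (ρ0 + η) ⊆ Ioo (1 / 2) 2) (hβb : ∀ ρ ∈ Icc (ρ0 - η) (ρ0 + η), b ≤ ‖β ρ‖) :
    eLpNorm (packet β ρ0 η) 2 halfLine ≤ ENNReal.ofReal (2 / b * √(2 * η)) := by
  have h1 : eLpNorm (packet β ρ0 η) 2 halfLine ≤
      eLpNorm ((Icc (ρ0 - η) (ρ0 + η)).indicator fun _ => 2 / b) 2 halfLine := by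
    refine eLpNorm_mono_enorm fun ρ => ?_
    by_cases hρ : ρ ∈ Icc (ρ0 - η) (ρ0 + η)
    · rw [packet, indicator_of_mem hρ, indicator_of_mem hρ, ← ofReal_norm, Real.enorm_eq_ofReal (by positivity)]
      refine ENNReal.ofReal_le_ofReal ?_
      rw [norm_div, Complex.norm_real, Real.norm_eq_abs, abs_of_nonneg (Real.sqrt_nonneg _)]
      gcongr
      · exact Real.sqrt_le_iff.mpr ⟨by norm_num, by linarith [(hsub hρ).2]⟩
      · exact hβb ρ hρ
    · rw [packet, indicator_of_notMem hρ, enorm_zero]; exact zero_le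
  refine h1.trans ((eLpNorm_indicator_const_le _ _).trans ?_)
  rw [Real.enorm_eq_ofReal (by positivity), ENNReal.ofReal_mul (by positivity), Real.sqrt_eq_rpow,
    ← ENNReal.ofReal_rpow_of_pos (by positivity)]
  rw [show 1 / ENNReal.toReal 2 = 1 / 2 by norm_num]
  gcongr
  refine (Measure.restrict_apply_le _ _).trans ?_
  rw [Real.volume_Icc]
  exact ENNReal.ofReal_le_ofReal (by linarith)

theorem eLpNorm_packet_ne_zero {β : ℝ → ℂ} (hβ : Measurable β) {ρ0 η : ℝ} (hη : 0 < η)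
    (hsub : Icc (ρ0 - η) (ρ0 + η) ⊆ Ioo (1 / 2) 2) (hβ0 : ∀ ρ ∈ Icc (ρ0 - η) (ρ0 + η), β ρ ≠ 0) :
    eLpNorm (packet β ρ0 η) 2 halfLine ≠ 0 := by
  rw [Ne, eLpNorm_eq_zero_iff (measurable_packet hβ _ _).aestronglyMeasurable (by norm_num)]
  intro h
  have h1 : halfLine (Icc (ρ0 - η) (ρ0 + η)) = 0 := by
    refine measure_mono_null (fun ρ hρ => ?_) (ae_iff.mp h)
    have h2 : (√ρ : ℂ) ≠ 0 := by
      have : 0 < ρ := by linarith [(hsub hρ).1]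
      exact_mod_cast (Real.sqrt_pos.mpr this).ne'
    simp only [mem_ofPred_eq, packet, indicator_of_mem hρ, Pi.zero_apply]
    exact div_ne_zero h2 (hβ0 ρ hρ)
  have hsub2 : Icc (ρ0 - η) (ρ0 + η) ⊆ Ioi 0 := fun x hx => lt_trans (by norm_num) (hsub hx).1
  rw [halfLine, Measure.restrict_apply measurableSet_Icc, inter_eq_self_of_subset_left hsub2,
    Real.volume_Icc, ENNReal.ofReal_eq_zero] at h1
  linarith

theorem exists_Icc_subset_le_norm {β : ℝ → ℂ} (hβ : Continuous β) (hβs : ∀ ρ, ρ ∉ Ioo (1 / 2 : ℝ) 2 → β ρ = 0)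
    (hβ0 : β ≠ 0) : ∃ ρ0 δ b : ℝ, 0 < δ ∧ 0 < b ∧ Icc (ρ0 - δ) (ρ0 + δ) ⊆ Ioo (1 / 2) 2 ∧
      ∀ ρ ∈ Icc (ρ0 - δ) (ρ0 + δ), b ≤ ‖β ρ‖ := by
  obtain ⟨ρ0, h0⟩ := Function.ne_iff.mp hβ0
  have hmem : ρ0 ∈ Ioo (1 / 2 : ℝ) 2 := by
    by_contra hc
    exact h0 (hβs ρ0 hc)
  have hb : 0 < ‖β ρ0‖ := norm_pos_iff.mpr h0
  have hev : ∀ᶠ ρ in nhds ρ0, ρ ∈ Ioo (1 / 2 : ℝ) 2 ∧ ‖β ρ0‖ / 2 < ‖β ρ‖ :=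
    Filter.Eventually.and (isOpen_Ioo.mem_nhds hmem)
      ((hβ.norm.continuousAt).eventually_const_lt (by linarith : ‖β ρ0‖ / 2 < ‖β ρ0‖))
  obtain ⟨δ, hδ, h⟩ := Metric.nhds_basis_closedBall.eventually_iff.mp hev
  rw [Real.closedBall_eq_Icc] at h
  exact ⟨ρ0, δ, ‖β ρ0‖ / 2, hδ, by positivity, fun ρ hρ => (h hρ).1, fun ρ hρ => (h hρ).2.le⟩

/-- Power counting: the weight gives R^{-(n-1)/2}, the packet R^{-1/2}, the tube R^{(n-1/2)P} and
the time span R^Q. The norm of the datum is R^{-1/4}, and -(n-1)/2 - 1/2 + 1/4 = -(2n-1)/4. -/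
theorem sharp_power_identity {n : ℕ} {P Q A b ε m R : ℝ} (hA : 0 < A) (hb : 0 < b) (hε : 0 < ε)
    (hR : 0 < R) {e : ℝ} (he : e = Q - (2 * (n : ℝ) - 1) / 2 * (1 / 2 - P)) :
    (2 ^ (-(((n : ℝ) - 1) / 2)) * (ε * m / 4) * (2 * ε) ^ P * (2 * A) ^ (-Q) * (b / (2 * √(2 * ε)))) * R ^ e *
      (2 / b * √(2 * (ε / √R))) =
    (2 * R) ^ (-(((n : ℝ) - 1) / 2)) * (ε / √R * m / 4) * (R ^ ((n : ℝ) - 1) * (2 * (ε * √R))) ^ P *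
      (R / (2 * A)) ^ Q := by
  have hq : 0 < √R := Real.sqrt_pos.mpr hR
  have e1 : √(2 * (ε / √R)) = √(2 * ε) * R ^ (-(1 / 4) : ℝ) := by
    rw [← mul_div_assoc, Real.sqrt_div (by positivity), div_eq_mul_inv, Real.sqrt_eq_rpow (√R), Real.sqrt_eq_rpow R,
      ← Real.rpow_mul hR.le, ← Real.rpow_neg hR.le]
    norm_num
  have e2 : (R ^ ((n : ℝ) - 1) * (2 * (ε * √R))) ^ P = (2 * ε) ^ P * R ^ (((n : ℝ) - 1 / 2) * P) := by
    rw [show R ^ ((n : ℝ) - 1) * (2 * (ε * √R)) = 2 * ε * (R ^ ((n : ℝ) - 1) * √R) by ring, Real.sqrt_eq_rpow,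
      ← Real.rpow_add hR, Real.mul_rpow (by positivity) (by positivity), ← Real.rpow_mul hR.le]
    congr 2; ring
  have e3 : (R / (2 * A)) ^ Q = (2 * A) ^ (-Q) * R ^ Q := by
    rw [Real.div_rpow hR.le (by positivity), Real.rpow_neg (by positivity), div_eq_mul_inv, mul_comm]
  have e4 : (2 * R) ^ (-(((n : ℝ) - 1) / 2)) = 2 ^ (-(((n : ℝ) - 1) / 2)) * R ^ (-(((n : ℝ) - 1) / 2)) :=
    Real.mul_rpow (by norm_num) hR.le
  have e5 : ε / √R = ε * R ^ (-(1 / 2) : ℝ) := by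
    rw [Real.sqrt_eq_rpow, Real.rpow_neg hR.le, div_eq_mul_inv]
  have e6 : R ^ e * R ^ (-(1 / 4) : ℝ) = R ^ (-(((n : ℝ) - 1) / 2)) * R ^ (-(1 / 2) : ℝ) *
      R ^ (((n : ℝ) - 1 / 2) * P) * R ^ Q := by
    rw [← Real.rpow_add hR, ← Real.rpow_add hR, ← Real.rpow_add hR, ← Real.rpow_add hR, he]
    congr 1; ring
  have hs : √(2 * ε) ≠ 0 := (Real.sqrt_pos.mpr (by positivity)).ne'
  rw [e1, e2, e3, e4, e5]
  calc _ = 2 ^ (-(((n : ℝ) - 1) / 2)) * (ε * m / 4) * (2 * ε) ^ P * (2 * A) ^ (-Q) * (R ^ e * R ^ (-(1 / 4) : ℝ)) := by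
        field_simp
    _ = _ := by rw [e6]; ring

/-- The power of `R` in the localized estimate is sharp. -/
theorem exists_le_mixedNorm_localizedOp {n : ℕ} (hn : 1 ≤ n) {p q : ℝ≥0∞} (hp : p ≠ 0) (hq : q ≠ 0)
    {β : ℝ → ℂ} (hβ : Continuous β) (hβs : ∀ ρ, ρ ∉ Ioo (1 / 2 : ℝ) 2 → β ρ = 0) (hβ0 : β ≠ 0)
    {A lam ν : ℝ} {ϖ : ℝ → ℝ} (hA : 1 ≤ A) (hlam : 0 < lam) (hν : 0 ≤ ν) (hϖ : IsAdmissiblePhase A lam ϖ) :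
    ∃ c R₀ : ℝ, 0 < c ∧ 0 < R₀ ∧ ∀ R : ℝ, R₀ ≤ R →
      ∃ h : ℝ → ℂ, MemLp h 2 halfLine ∧ eLpNorm h 2 halfLine ≠ 0 ∧
        ENNReal.ofReal (c * R ^ expR n p q) * eLpNorm h 2 halfLine ≤
          mixedNorm n q p (localizedOp n β ϖ ν R h) := by
  obtain ⟨ρ0, δ, b, hδ, hb, hsub, hβb⟩ := exists_Icc_subset_le_norm hβ hβs hβ0
  have hpd := hϖ.phaseData hlam
  obtain ⟨m, ε, R₀, hm, hε, hR₀, hmain⟩ := exists_packet_lower hA hpd hν hδ hsub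
  have hA0 : 0 < A := by linarith
  have h0 : ρ0 ∈ Ioo (1 / 2 : ℝ) 2 := hsub ⟨by linarith, by linarith⟩
  have hv0 : deriv ϖ ρ0 ≠ 0 := abs_pos.mp ((by positivity : 0 < A⁻¹).trans_le (hpd.low1 ρ0 h0))
  have hn' : (0 : ℝ) ≤ (n : ℝ) - 1 := by
    have : (1 : ℝ) ≤ n := by exact_mod_cast hn
    linarith
  refine ⟨2 ^ (-(((n : ℝ) - 1) / 2)) * (ε * m / 4) * (2 * ε) ^ p⁻¹.toReal * (2 * A) ^ (-q⁻¹.toReal) *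
    (b / (2 * √(2 * ε))), R₀, by positivity, by linarith, fun R hR => ?_⟩
  have hR0 : 0 < R := by linarith
  obtain ⟨hηδ, hdR, hlow⟩ := hmain R hR
  have hη : 0 < ε / √R := by positivity
  have hsub' : Icc (ρ0 - ε / √R) (ρ0 + ε / √R) ⊆ Icc (ρ0 - δ) (ρ0 + δ) :=
    Icc_subset_Icc (by linarith) (by linarith)
  have hβb' : ∀ ρ ∈ Icc (ρ0 - ε / √R) (ρ0 + ε / √R), b ≤ ‖β ρ‖ := fun ρ hρ => hβb ρ (hsub' hρ)
  have hβne : ∀ ρ ∈ Icc (ρ0 - ε / √R) (ρ0 + ε / √R), β ρ ≠ 0 := fun ρ hρ =>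
    norm_pos_iff.mp (hb.trans_le (hβb' ρ hρ))
  have hup := eLpNorm_packet_le hb hη (hsub'.trans hsub) hβb'
  refine ⟨packet β ρ0 (ε / √R), ⟨(measurable_packet hβ.measurable _ _).aestronglyMeasurable,
    hup.trans_lt ENNReal.ofReal_lt_top⟩, eLpNorm_packet_ne_zero hβ.measurable hη (hsub'.trans hsub) hβne, ?_⟩
  refine (mul_le_mul_right hup _).trans ?_
  rw [← ENNReal.ofReal_mul (by positivity),
    sharp_power_identity (n := n) hA0 hb hε hR0 (Q := q⁻¹.toReal) (P := p⁻¹.toReal) (by rw [expR, gap])]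
  refine ofReal_le_mixedNorm hn hp hq hv0 (hpd.up1 ρ0 h0) hR0 (by positivity) (by linarith) (by positivity) ?_
  intro s r hs hrs
  have hr := abs_le.mp hrs
  have hε4 : 0 < ε * √R := by positivity
  have hr1 : r ∈ Ico R (2 * R) := ⟨by linarith [hs.1], by linarith [hs.2]⟩
  have hr0 : 0 < r := hR0.trans_le hr1.1
  rw [localizedOp_packet hβs ϖ hη (hsub'.trans hsub) hβne hR0 hr1, norm_mul, Complex.norm_real,
    Real.norm_eq_abs, abs_of_pos (Real.rpow_pos_of_pos hr0 _)]
  refine mul_le_mul (Real.rpow_le_rpow_of_nonpos hr0 hr1.2.le (by linarith)) (hlow s r hs hrs)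
    (by positivity) (by positivity)

end

theorem proposition3p1
    (n : ℕ) (hn : 2 ≤ n) (p q : ℝ≥0∞) (hp : 2 ≤ p) (hq : 2 ≤ q)
    (hpq : gap p ≤ 2 * q⁻¹.toReal)
    (β : ℝ → ℂ) (hβ : ContDiff ℝ ∞ β) (hβc : HasCompactSupport β)
    (hβs : tsupport β ⊆ Ioo (1 / 2) 2) :
    -- the estimate; `A` is the constant implied in all the relations `∼` and `≲`
    (∀ A : ℝ, 1 ≤ A → ∃ C : ℝ, 0 < C ∧
      ∀ (lam ν R : ℝ) (ϖ : ℝ → ℝ) (h : ℝ → ℂ),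
        0 < lam → lam ≤ A → 0 ≤ ν → A⁻¹ ≤ R → IsAdmissiblePhase A lam ϖ →
        MemLp h 2 halfLine →
        mixedNorm n q p (localizedOp n β ϖ ν R h) ≤
          ENNReal.ofReal (C * lam ^ (-(1 / 2) * gap p) * (1 + ν) ^ (4 / 5 * gap p) *
            R ^ expR n p q) * eLpNorm h 2 halfLine) ∧
    -- the power of `R` is sharp, for every fixed order and phase
    (β ≠ 0 → ∀ (A lam ν : ℝ) (ϖ : ℝ → ℝ),
      1 ≤ A → 0 < lam → lam ≤ A → 0 ≤ ν → IsAdmissiblePhase A lam ϖ →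
      ∃ c R₀ : ℝ, 0 < c ∧ 0 < R₀ ∧ ∀ R : ℝ, R₀ ≤ R →
        ∃ h : ℝ → ℂ, MemLp h 2 halfLine ∧ eLpNorm h 2 halfLine ≠ 0 ∧
          ENNReal.ofReal (c * R ^ expR n p q) * eLpNorm h 2 halfLine ≤
            mixedNorm n q p (localizedOp n β ϖ ν R h)) := by
  have hβs' : ∀ ρ, ρ ∉ Ioo (1 / 2 : ℝ) 2 → β ρ = 0 := fun ρ hρ =>
    image_eq_zero_of_notMem_tsupport fun h => hρ (hβs h)
  have hp0 : p ≠ 0 := fun h => by simp [h] at hp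
  have hq0 : q ≠ 0 := fun h => by simp [h] at hq
  exact ⟨fun A hA => exists_mixedNorm_localizedOp_le (by lia) hp hq hpq hβ hβc hβs hA,
    fun hβ0 A lam ν ϖ hA hlam _ hν hϖ =>
      exists_le_mixedNorm_localizedOp (by lia) hp0 hq0 hβ.continuous hβs' hβ0 hA hlam hν hϖ⟩
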